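/- Let $N$ be a smooth $n$-dimensional manifold (Hausdorff, second countable, without boundary), let $(g_t)_{t\in\mathbb R}$ be a smooth family of Riemannian metrics on $N$, and let $M=\mathbb R\times N$ carry the Lorentzian metric $\langle\cdot,\cdot\rangle=-dt^2+g_t$, time-oriented by $\partial_t$. Assume that $M$ is globally hyperbolic and that every slice $\{\tau\}\times N$ is a Cauchy hypersurface. Let $k=(k_0,k_1):\mathbb R\to TM$ be a smooth $2\pi$-periodic curve such that at every point $k_1\pm\partial_xk_0\neq0$, $\langle\partial_xk_0,\partial_xk_0\rangle=-\langle k_1,k_1\rangle\ge0$, $\langle\partial_xk_0,k_1\rangle=0$, and $k_1$ is future-directed, i.e. $dt(k_1)>0$. For a map $y$ into $M$ write $y^0$ for its $\mathbb R$-component. Let $\mathbb H=\{(t,x)\in\mathbb R^2: t\ge0\}$. By a solution $(\Omega,y)$ we mean a connected, relatively open set $\Omega\subseteq\mathbb H$ containing the $x$-axis and a smooth map $y:\Omega\to M$ which is a minimal surface in conformal gauge and satisfies $y(0,x)=k_0(x)$, $\partial_ty(0,x)=k_1(x)$. Here minimal surface in conformal gauge means: $y$ is a wave map with respect to $-dt^2+dx^2$,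 its pulled-back metric is a nonnegative (possibly vanishing) multiple of $-dt^2+dx^2$, and $y$ is a critical point of the area, under compactly supported smooth variations, on the set of points with $t>0$ where the pulled-back metric is Lorentzian. Call $\Omega$ past-closed if with each point $p$ it contains all points of $\mathbb H$ in the causal past of $p$ in $(\mathbb R^2,-dt^2+dx^2)$. Then: 1. There is a solution $(\Omega,y)$ such that $\Omega$ and $y$ are $2\pi$-periodic in $x$ and $\lim_{q\to p,\,q\in\Omega}y^0(q)=+\infty$ for every $p\in\partial\Omega\setminus\{t=0\}$. 2. It is unique: every solution $(\Omega',y')$ with $y'^0\to+\infty$ at every point of $\partial\Omega'\setminus\{t=0\}$ satisfies $\Omega'=\Omega$ and $y'=y$. 3. It is maximal: no solution on a strictly larger set extends $y$; moreover $\Omega$ is past-closed, and every solution on a past-closed set $\Omega'$ satisfies $\Omega'\subseteq\Omega$ and $y'=y|_{\Omega'}$. 4. For every $x_0\in\mathbb R$ there is a smooth $2\pi$-periodic function $f:\mathbb R\to\mathbb R$ such that $y^{-1}(\{x_0\}\times N)=\{(f(x),x): k_0^0(x)\le x_0\}$. In particular, if $x_0\ge\max k_0^0$, then $y^{-1}(\{x_0\}\times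 N)$ is the graph of a smooth $2\pi$-periodic function over the whole $x$-axis. -/

import Mathlib

open scoped Manifold ContDiff Topology
open Set Filter MeasureTheory

noncomputable section

/-- The coordinate space of an `n`-dimensional manifold. -/
abbrev Coord (n : ℕ) : Type := EuclideanSpace ℝ (Fin n)

/-- The model with corners of the spacetime `ℝ × N`, where `dim N = n`. -/
abbrev stModel (n : ℕ) : ModelWithCorners ℝ (ℝ × Coord n) (ModelProd ℝ (Coord n)) :=
  𝓘(ℝ, ℝ).prod (𝓡 n)

/-- The differential at `z` of the inverse of the preferred chart at `q₀`. -/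
def chartInvDeriv {n : ℕ} {N : Type*} [TopologicalSpace N] [ChartedSpace (Coord n) N]
    (q₀ : N) (z : Coord n) :
    Coord n →L[ℝ] TangentSpace (𝓡 n) ((extChartAt (𝓡 n) q₀).symm z) :=
  mfderiv 𝓘(ℝ, Coord n) (𝓡 n) (extChartAt (𝓡 n) q₀).symm z

/-- A smooth one-parameter family `t ↦ g_t` of Riemannian metrics on `N`.  It carries the same
data as the Lorentzian metric `-dt² + g_t` on `ℝ × N`. -/
structure MetricFamily (n : ℕ) (N : Type*) [TopologicalSpace N] [ChartedSpace (Coord n) N] where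
  /-- the inner product `g_t` on the tangent space at `q` -/
  inner : ℝ → (q : N) → TangentSpace (𝓡 n) q →L[ℝ] TangentSpace (𝓡 n) q →L[ℝ] ℝ
  symm : ∀ t q v w, inner t q v w = inner t q w v
  pos : ∀ t q v, v ≠ 0 → 0 < inner t q v v
  /-- the coefficients of `g_t` in charts are jointly smooth in time and space -/
  smooth : ∀ (q₀ : N) (v w : Coord n),
    ContDiffOn ℝ ∞ (fun z : ℝ × Coord n =>
      inner z.1 ((extChartAt (𝓡 n) q₀).symm z.2)
        (chartInvDeriv q₀ z.2 v) (chartInvDeriv q₀ z.2 w))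
      (univ ×ˢ (extChartAt (𝓡 n) q₀).target)

namespace MetricFamily

variable {n : ℕ} {N : Type*} [TopologicalSpace N] [ChartedSpace (Coord n) N]

/-- The component `dt(V)` of a tangent vector of `ℝ × N`. -/
def timePart {p : ℝ × N} (V : TangentSpace (stModel n) p) : ℝ :=
  mfderiv (stModel n) 𝓘(ℝ, ℝ) (Prod.fst : ℝ × N → ℝ) p V

/-- The projection to `TN` of a tangent vector of `ℝ × N`. -/
def spacePart {p : ℝ × N} (V : TangentSpace (stModel n) p) : TangentSpace (𝓡 n) p.2 :=
  mfderiv (stModel n) (𝓡 n) (Prod.snd : ℝ × N → N) p V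

variable (g : MetricFamily n N)

/-- The Lorentzian metric `-dt² + g_t` on `ℝ × N`. -/
def lor (p : ℝ × N) (V W : TangentSpace (stModel n) p) : ℝ :=
  -(timePart V * timePart W) + g.inner p.1 p.2 (spacePart V) (spacePart W)

/-! ### Causality -/

/-- The velocity of a curve in `ℝ × N`. -/
def velocity (c : ℝ → ℝ × N) (s : ℝ) : TangentSpace (stModel n) (c s) :=
  mfderiv 𝓘(ℝ, ℝ) (stModel n) c s (1 : ℝ)

/-- Future-directed causal curves, parametrized by `J`: continuous, and `C¹` with future-directed
causal velocity away from finitely many parameters. -/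
def IsCausalCurveOn (c : ℝ → ℝ × N) (J : Set ℝ) : Prop :=
  ContinuousOn c J ∧ ∃ D : Set ℝ, D.Finite ∧
    ContMDiffOn 𝓘(ℝ, ℝ) (stModel n) 1 c (interior J \ D) ∧
    ∀ s ∈ interior J \ D, g.lor (c s) (velocity c s) (velocity c s) ≤ 0 ∧
      0 < timePart (velocity (n := n) c s)

/-- The causal relation: `q ∈ J⁺(p)`. -/
def CausalLE (p q : ℝ × N) : Prop :=
  p = q ∨ ∃ (a b : ℝ) (c : ℝ → ℝ × N), a < b ∧ g.IsCausalCurveOn c (Icc a b) ∧ c a = p ∧ c b = q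

/-- Global hyperbolicity: causality, and compactness of all causal diamonds. -/
def IsGloballyHyperbolic : Prop :=
  (∀ p q, g.CausalLE p q → g.CausalLE q p → p = q) ∧
  ∀ p q, IsCompact {r | g.CausalLE p r ∧ g.CausalLE r q}

/-- Cauchy hypersurfaces: every causal curve without past or future endpoint meets `S` exactly
once. -/
def IsCauchyHypersurface (S : Set (ℝ × N)) : Prop :=
  ∀ c : ℝ → ℝ × N, g.IsCausalCurveOn c univ →
    (¬ ∃ p, Tendsto c atTop (𝓝 p)) → (¬ ∃ p, Tendsto c atBot (𝓝 p)) → ∃! s, c s ∈ S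

/-! ### Wave maps from the plane with coordinates `(t, x)` and metric `-dt² + dx²` -/

/-- The metric `-dt² + g_t` in the coordinates given by the preferred chart at `q₀`. -/
def coordMetric (q₀ : N) (z V W : ℝ × Coord n) : ℝ :=
  -(V.1 * W.1) + g.inner z.1 ((extChartAt (𝓡 n) q₀).symm z.2)
    (chartInvDeriv q₀ z.2 V.2) (chartInvDeriv q₀ z.2 W.2)

/-- The Christoffel symbols of the Levi-Civita connection in these coordinates, with the upper
index lowered: the value is `⟨Γ(U, V), W⟩`. -/
def christoffel (q₀ : N) (z U V W : ℝ × Coord n) : ℝ :=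
  (fderiv ℝ (fun z' => g.coordMetric q₀ z' V W) z U
    + fderiv ℝ (fun z' => g.coordMetric q₀ z' U W) z V
    - fderiv ℝ (fun z' => g.coordMetric q₀ z' U V) z W) / 2

/-- A map to `ℝ × N` in the coordinates given by the preferred chart at `q₀`. -/
def inCoord (q₀ : N) (y : ℝ × ℝ → ℝ × N) (p : ℝ × ℝ) : ℝ × Coord n :=
  ((y p).1, extChartAt (𝓡 n) q₀ (y p).2)

/-- The wave map equation `∂ₜ²y - ∂ₓ²y + Γ(y)(∂ₜy, ∂ₜy) - Γ(y)(∂ₓy, ∂ₓy) = 0` at `p`, in the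
preferred chart at `y p`; the equation is paired with every vector `W` by the (nondegenerate)
metric. -/
def WaveMapAt (y : ℝ × ℝ → ℝ × N) (p : ℝ × ℝ) : Prop :=
  let Y : ℝ × ℝ → ℝ × Coord n := inCoord (y p).2 y
  let dt : ℝ × ℝ → ℝ × Coord n := fun p' => fderiv ℝ Y p' (1, 0)
  let dx : ℝ × ℝ → ℝ × Coord n := fun p' => fderiv ℝ Y p' (0, 1)
  ∀ W : ℝ × Coord n,
    g.coordMetric (y p).2 (Y p) (fderiv ℝ dt p (1, 0) - fderiv ℝ dx p (0, 1)) W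
      + (g.christoffel (y p).2 (Y p) (dt p) (dt p) W
        - g.christoffel (y p).2 (Y p) (dx p) (dx p) W) = 0

/-! ### Minimal surfaces -/

/-- The coefficient `⟨dy(a), dy(b)⟩` of the pulled-back metric `y^*g` at `p`. -/
def pullback (y : ℝ × ℝ → ℝ × N) (p a b : ℝ × ℝ) : ℝ :=
  g.lor (y p) (mfderiv 𝓘(ℝ, ℝ × ℝ) (stModel n) y p a) (mfderiv 𝓘(ℝ, ℝ × ℝ) (stModel n) y p b)

/-- The determinant of the pulled-back metric in the coordinates `(t, x)`.  The pulled-back metric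
is Lorentzian at `p` iff this is negative. -/
def pullbackDet (y : ℝ × ℝ → ℝ × N) (p : ℝ × ℝ) : ℝ :=
  g.pullback y p (1, 0) (1, 0) * g.pullback y p (0, 1) (0, 1) - g.pullback y p (1, 0) (0, 1) ^ 2

/-- The Lorentzian area of `y` over `K`. -/
def area (y : ℝ × ℝ → ℝ × N) (K : Set (ℝ × ℝ)) : ℝ :=
  ∫ p in K, Real.sqrt (-(g.pullbackDet y p))

/-- `y` is a critical point of the area on the set `U`, with respect to all smooth variations
with compact support in `U`. -/
def IsAreaCriticalOn (y : ℝ × ℝ → ℝ × N) (U : Set (ℝ × ℝ)) : Prop :=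
  ∀ K : Set (ℝ × ℝ), IsCompact K → K ⊆ U → ∀ Y : ℝ → ℝ × ℝ → ℝ × N,
    ContMDiffOn 𝓘(ℝ, ℝ × (ℝ × ℝ)) (stModel n) ∞ (fun q : ℝ × (ℝ × ℝ) => Y q.1 q.2) (univ ×ˢ U) →
    (∀ p ∈ U, Y 0 p = y p) → (∀ s, ∀ p ∈ U \ K, Y s p = y p) →
    HasDerivAt (fun s => g.area (Y s) K) 0 0

/-- The closed upper half plane `{t ≥ 0}` in coordinates `(t, x)`. -/
def upper : Set (ℝ × ℝ) := {p | 0 ≤ p.1}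

/-- Minimal surfaces in conformal gauge on `Ω ⊆ {t ≥ 0}`: maps, smooth up to `{t = 0}`, that are
wave maps, whose pulled-back metric is a nonnegative multiple of `-dt² + dx²`, and that are
critical for the area where the pulled-back metric is Lorentzian. -/
structure IsMinimalSurface (Ω : Set (ℝ × ℝ)) (y : ℝ × ℝ → ℝ × N) : Prop where
  smooth : ContMDiffOn 𝓘(ℝ, ℝ × ℝ) (stModel n) ∞ y Ω
  wave : ∀ p ∈ Ω, 0 < p.1 → g.WaveMapAt y p
  conformal : ∀ p ∈ Ω, 0 < p.1 →
    g.pullback y p (0, 1) (0, 1) = -g.pullback y p (1, 0) (1, 0) ∧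
    0 ≤ g.pullback y p (0, 1) (0, 1) ∧ g.pullback y p (1, 0) (0, 1) = 0
  critical : g.IsAreaCriticalOn y {p | p ∈ Ω ∧ 0 < p.1 ∧ g.pullbackDet y p < 0}

/-! ### The initial value problem -/

/-- The derivative `∂ₓk₀` of the base curve `k₀` of a curve `k = (k₀, k₁)` in the tangent bundle. -/
def baseDeriv (k : ℝ → TangentBundle (stModel n) (ℝ × N)) (x : ℝ) :
    TangentSpace (stModel n) (k x).proj :=
  velocity (fun x' => (k x').proj) x

/-- Admissible initial data `k = (k₀, k₁)`. -/
structure IsInitialData [IsManifold (𝓡 n) ∞ N] (k : ℝ → TangentBundle (stModel n) (ℝ × N)) :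
    Prop where
  smooth : ContMDiff 𝓘(ℝ, ℝ) (stModel n).tangent ∞ k
  periodic : Function.Periodic k (2 * Real.pi)
  add_ne : ∀ x, (k x).snd + baseDeriv k x ≠ 0
  sub_ne : ∀ x, (k x).snd - baseDeriv k x ≠ 0
  norm_eq : ∀ x, g.lor (k x).proj (baseDeriv k x) (baseDeriv k x)
    = -g.lor (k x).proj (k x).snd (k x).snd
  norm_nonneg : ∀ x, 0 ≤ g.lor (k x).proj (baseDeriv k x) (baseDeriv k x)
  perp : ∀ x, g.lor (k x).proj (baseDeriv k x) (k x).snd = 0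
  future : ∀ x, 0 < timePart (k x).snd

/-- `y` is a minimal surface in conformal gauge on `Ω`, a connected relatively open subset of the
closed upper half plane containing the `x`-axis, with `y(0, x) = k₀(x)` and `∂ₜy(0, x) = k₁(x)`. -/
structure IsSolution (k : ℝ → TangentBundle (stModel n) (ℝ × N)) (Ω : Set (ℝ × ℝ))
    (y : ℝ × ℝ → ℝ × N) : Prop where
  isOpen : ∃ O : Set (ℝ × ℝ), IsOpen O ∧ Ω = O ∩ upper
  connected : IsConnected Ω
  axis : ∀ x : ℝ, ((0 : ℝ), x) ∈ Ω
  minimal : g.IsMinimalSurface Ω y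
  initial : ∀ x : ℝ,
    (⟨y (0, x), mfderivWithin 𝓘(ℝ, ℝ × ℝ) (stModel n) y upper (0, x) ((1, 0) : ℝ × ℝ)⟩ :
      TangentBundle (stModel n) (ℝ × N)) = k x

/-- The time component of `y` tends to `+∞` at all points of `∂Ω` off the `x`-axis. -/
def TimeBlowsUp (Ω : Set (ℝ × ℝ)) (y : ℝ × ℝ → ℝ × N) : Prop :=
  ∀ p ∈ frontier Ω, p.1 ≠ 0 → Tendsto (fun q => (y q).1) (𝓝[Ω] p) atTop

/-- With a point, `Ω` contains the part in `{t ≥ 0}` of its causal past in the plane. -/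
def PastClosed (Ω : Set (ℝ × ℝ)) : Prop :=
  ∀ p ∈ Ω, ∀ q ∈ upper, |p.2 - q.2| ≤ p.1 - q.1 → q ∈ Ω

end MetricFamily

end

/-! Write P and Q for the derivatives of y in the null directions (1,1) and (1,-1). The wave map
equation says that P is parallel along Q and Q is parallel along P. In a chart the triple (y, P, Q)
therefore solves a semilinear transport system with speeds 0, 1 and -1. A contraction argument
solves this system for a time that depends only on a compact set containing the data
(`exists_chartWave`), and integration along characteristics gives uniqueness on backward triangles
(`jetEq_of_base`). Local solutions on past-closed sets hence agree wherever they meet, and their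
union is the candidate (`isLocalSolution_max`). All geometric properties are derived from the wave
equation and the data.

Since P is parallel along Q, the product ⟨P,P⟩ is constant along the lines of direction (1,-1), and
it vanishes initially; likewise for Q. So P and Q stay null, which is conformality. The time parts
of k₁ ± ∂ₓk₀ never vanish, and they are positive where the periodic function k₀⁰ is critical, hence
everywhere. The linear estimate |α'| ≤ C α β for the time parts α of P and β of Q preserves
positivity. Causal lines of the plane thus map to future-directed causal curves, and time increases
along them.

The heart is the behaviour at a missing point (`exists_extension`). Suppose that time is bounded on
a vertical segment that ends there. Its image is a causal curve which misses a later Cauchy slice,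
so it converges to some z. In a chart near z a causal curve moves at most a constant times the time
elapsed on it, so the future of a point q high on the segment is trapped in the chart (`trapped`).
Along a line of direction (1,-1), β is the derivative of time, so log α varies by at most a constant
times elapsed time (`log_estimate`), however long the line is. Hence P and Q are controlled by their
values on the two null edges issuing from q (`edge_estimate`), which are compact and lie in the
domain. The jets stay bounded, the existence time is uniform, and the solution extends past the
missing point. Applied to a lowest missing point in the past of a boundary point, this gives blow-up
of time (`timeBlowsUp_max`).

The same estimate read backwards, together with periodicity, bounds α from below along a null ray if
time is bounded on an infinite vertical ray. Then time grows linearly on that null ray, a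
contradiction (`exists_time_gt`). So time is strictly increasing and unbounded on every vertical
line. Its level sets are smooth graphs by the inverse function theorem, and a partition of unity and
a periodization turn them into one function f.

An arbitrary solution need not have a past-closed domain. `IsSolution.pastClosed` shows that blow-up
forces this, by connectedness, and `eq_of_timeBlowsUp` shows that a domain with blow-up cannot be
enlarged. Criticality for the area comes from the first variation: where the induced metric is
conformal and Lorentzian, the variation of area density is that of the energy density, a divergence
by the wave equation. -/

noncomputable section

/-! ### Smoothness of composition operators on spaces of continuous functions -/

section CompositionOperator

variable {D : Type*} [TopologicalSpace D] [CompactSpace D]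
variable {E E' : Type} [NormedAddCommGroup E] [NormedSpace ℝ E]
  [NormedAddCommGroup E'] [NormedSpace ℝ E']

/-- Pointwise application of an operator-valued function, as a bounded bilinear map. -/
def pointwiseApply (D : Type*) [TopologicalSpace D] [CompactSpace D] (E E' : Type)
    [NormedAddCommGroup E] [NormedSpace ℝ E] [NormedAddCommGroup E'] [NormedSpace ℝ E'] :
    C(D, E →L[ℝ] E') →L[ℝ] C(D, E) →L[ℝ] C(D, E') :=
  LinearMap.mkContinuous₂
    (LinearMap.mk₂ ℝ (fun (A : C(D, E →L[ℝ] E')) (h : C(D, E)) =>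
        (⟨fun d => A d (h d), by fun_prop⟩ : C(D, E')))
      (fun _ _ _ => by ext; simp) (fun _ _ _ => by ext; simp)
      (fun _ _ _ => by ext; simp) (fun _ _ _ => by ext; simp)) 1
    (fun A h => by
      rw [one_mul]
      refine (ContinuousMap.norm_le _ (by positivity)).2 fun d => ?_
      exact (A d).le_of_opNorm_le_of_le (A.norm_coe_le_norm d) (h.norm_coe_le_norm d))

lemma norm_pointwiseApply_le (A : C(D, E →L[ℝ] E')) :
    ‖pointwiseApply D E E' A‖ ≤ ‖A‖ := by
  refine ContinuousLinearMap.opNorm_le_bound _ (norm_nonneg A) fun h => ?_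
  refine (ContinuousMap.norm_le _ (by positivity)).2 fun d => ?_
  exact (A d).le_of_opNorm_le_of_le (A.norm_coe_le_norm d) (h.norm_coe_le_norm d)

/-- The mean value inequality at each point d bounds the remainder. The radius on which F' varies by
less than ε around w d can be chosen independently of d, because w ↦ F' ∘ w is continuous for the
uniform norm. -/
lemma hasFDerivAt_postcomp (F : C(E, E')) (F' : C(E, E →L[ℝ] E'))
    (hF : ∀ e, HasFDerivAt F (F' e) e) (w : C(D, E)) :
    HasFDerivAt (fun w : C(D, E) => F.comp w) (pointwiseApply D E E' (F'.comp w)) w := by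
  rw [hasFDerivAt_iff_isLittleO_nhds_zero, Asymptotics.isLittleO_iff]
  intro ε hε
  have hcont : Continuous (fun w : C(D, E) => (F'.comp w : C(D, E →L[ℝ] E'))) :=
    ContinuousMap.continuous_postcomp F'
  obtain ⟨δ, hδ, hδ'⟩ := (Metric.continuous_iff (α := C(D, E)) (β := C(D, E →L[ℝ] E'))).1 hcont w ε hε
  filter_upwards [Metric.ball_mem_nhds (0 : C(D, E)) hδ] with h hh
  refine (ContinuousMap.norm_le _ (by positivity)).2 fun d => ?_
  rw [mem_ball_zero_iff] at hh
  have key := (convex_ball (w d) δ).norm_image_sub_le_of_norm_hasFDerivWithin_le' (f := F)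
    (f' := F') (φ := F' (w d)) (C := ε) (x := w d) (y := w d + h d)
    (fun x _ => (hF x).hasFDerivWithinAt) (fun x hx => ?_) (Metric.mem_ball_self hδ) ?_
  · simp only [add_sub_cancel_left] at key
    refine (key.trans ?_)
    gcongr
    exact h.norm_coe_le_norm d
  -- Translating w by a constant moves its value at d to x, so uniform continuity estimates for F' ∘
  -- w yield a bound for F' on the whole ball around w d.
  · have h1 := hδ' (w + ContinuousMap.const D (x - w d)) (by
      rw [dist_eq_norm, add_sub_cancel_left]
      refine lt_of_le_of_lt ((ContinuousMap.norm_le _ (norm_nonneg (x - w d))).2 fun _ => le_rfl) ?_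
      rwa [← dist_eq_norm])
    have h2 := ContinuousMap.dist_apply_le_dist
      (f := F'.comp (w + ContinuousMap.const D (x - w d))) (g := F'.comp w) d
    rw [dist_eq_norm] at h2
    simp only [ContinuousMap.comp_apply, ContinuousMap.add_apply, ContinuousMap.const_apply,
      add_sub_cancel] at h2
    exact h2.trans h1.le
  · rw [mem_ball_iff_norm, add_sub_cancel_left]
    exact (h.norm_coe_le_norm d).trans_lt hh

/-- Composition with a smooth map is a smooth map between spaces of continuous functions. -/
theorem contDiff_postcomp (F : C(E, E')) (hF : ContDiff ℝ ∞ F) :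
    ContDiff ℝ ∞ (fun w : C(D, E) => F.comp w) := by
  rw [contDiff_infty]
  intro m
  -- The derivative is again a composition operator, with F' in place of F, followed by a bounded
  -- linear map; its target is a space of operators, so the target must vary in the induction.
  induction m generalizing E' with
  | zero => exact contDiff_zero.2 (ContinuousMap.continuous_postcomp F)
  | succ m ih =>
    have hc : Continuous (fderiv ℝ F) := hF.continuous_fderiv (by simp)
    have hd : ∀ w : C(D, E), HasFDerivAt (fun w : C(D, E) => F.comp w)
        (pointwiseApply D E E' ((⟨fderiv ℝ F, hc⟩ : C(E, E →L[ℝ] E')).comp w)) w := fun w =>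
      hasFDerivAt_postcomp F ⟨fderiv ℝ F, hc⟩
        (fun e => (hF.differentiable (by simp) e).hasFDerivAt) w
    refine (contDiff_succ_iff_fderiv (n := (m : WithTop ℕ∞))).2
      ⟨fun w => (hd w).differentiableAt, by simp, ?_⟩
    have : fderiv ℝ (fun w : C(D, E) => F.comp w) = fun w => pointwiseApply D E E'
        ((⟨fderiv ℝ F, hc⟩ : C(E, E →L[ℝ] E')).comp w) := funext fun w => (hd w).fderiv
    rw [this]
    exact (pointwiseApply D E E').contDiff.comp
      (ih ⟨fderiv ℝ F, hc⟩ (hF.fderiv_right (m := ∞) (by simp)))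

end CompositionOperator

/-! ### Semilinear transport systems: the fixed point problem on a triangle -/

section TransportSystem

/-- The unit triangle of dependence over the base `{0} × [-1, 1]`. -/
def unitTriangle : Set (ℝ × ℝ) := {p | 0 ≤ p.1 ∧ p.1 + |p.2| ≤ 1}

lemma isCompact_unitTriangle : IsCompact unitTriangle := by
  refine (isCompact_Icc.prod isCompact_Icc : IsCompact (Icc (0:ℝ) 1 ×ˢ Icc (-1:ℝ) 1)).of_isClosed_subset
    ?_ ?_
  · exact (isClosed_le continuous_const continuous_fst).inter
      (isClosed_le (continuous_fst.add continuous_snd.abs) continuous_const)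
  · rintro ⟨t, x⟩ ⟨h1, h2⟩
    simp only at h1 h2
    have := abs_nonneg x
    exact ⟨⟨h1, by linarith⟩, abs_le.1 (by linarith)⟩

instance : CompactSpace unitTriangle := isCompact_iff_compactSpace.1 isCompact_unitTriangle

/-- The apex of the unit triangle. -/
def triangleApex : unitTriangle := ⟨(1, 0), by simp [unitTriangle]⟩

lemma linePoint_mem {c : ℝ} (hc : |c| ≤ 1) {p : ℝ × ℝ} (hp : p ∈ unitTriangle) {σ : ℝ}
    (h0 : 0 ≤ σ) (h1 : σ ≤ 1) : (σ * p.1, p.2 + c * (p.1 * (1 - σ))) ∈ unitTriangle := by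
  obtain ⟨h2, h3⟩ := hp
  refine ⟨mul_nonneg h0 h2, ?_⟩
  have h4 : |c * (p.1 * (1 - σ))| ≤ p.1 * (1 - σ) := by
    have h5 : 0 ≤ p.1 * (1 - σ) := mul_nonneg h2 (by linarith)
    rw [abs_mul, abs_of_nonneg h5]
    nlinarith
  have := abs_add_le p.2 (c * (p.1 * (1 - σ)))
  simp only
  linarith

/-- The line of slope `c` that ends at `p`. -/
def linePoint (c : Icc (-1 : ℝ) 1) (p : unitTriangle) (σ : ℝ) : unitTriangle :=
  -- Clamping σ to [0,1] makes the point lie in the triangle for every real σ.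
  ⟨((projIcc 0 1 zero_le_one σ : ℝ) * p.1.1,
    p.1.2 + c * (p.1.1 * (1 - (projIcc 0 1 zero_le_one σ : ℝ)))),
    linePoint_mem (abs_le.2 c.2) p.2 (projIcc 0 1 zero_le_one σ).2.1 (projIcc 0 1 zero_le_one σ).2.2⟩

lemma continuous_linePoint (c : Icc (-1 : ℝ) 1) :
    Continuous (fun q : unitTriangle × ℝ => linePoint c q.1 q.2) := by
  unfold linePoint
  have : Continuous (fun q : unitTriangle × ℝ => (projIcc (0:ℝ) 1 zero_le_one q.2 : ℝ)) :=
    continuous_subtype_val.comp (continuous_projIcc.comp continuous_snd)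
  fun_prop

variable {E : Type} [NormedAddCommGroup E] [NormedSpace ℝ E] [CompleteSpace E]

/-- Integration of a function along lines of slope `c`. -/
def lineIntegral (E : Type) [NormedAddCommGroup E] [NormedSpace ℝ E] [CompleteSpace E]
    (c : Icc (-1 : ℝ) 1) : C(unitTriangle, E) →L[ℝ] C(unitTriangle, E) :=
  LinearMap.mkContinuous
    { toFun := fun f => ⟨fun p => p.1.1 • ∫ σ in (0:ℝ)..1, f (linePoint c p σ), by
        refine (continuous_fst.comp continuous_subtype_val).smul ?_
        refine intervalIntegral.continuous_parametric_intervalIntegral_of_continuous' ?_ 0 1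
        exact f.continuous.comp (continuous_linePoint c)⟩
      map_add' := fun f f' => by
        ext p
        have h : ∀ f : C(unitTriangle, E), IntervalIntegrable (fun σ => f (linePoint c p σ))
            volume 0 1 := fun f => (f.continuous.comp ((continuous_linePoint c).comp
              (by fun_prop : Continuous fun σ : ℝ => (p, σ)))).intervalIntegrable 0 1
        simp only [ContinuousMap.add_apply, ContinuousMap.coe_mk]
        rw [intervalIntegral.integral_add (h f) (h f'), smul_add]
      map_smul' := fun r f => by
        ext p
        simp only [ContinuousMap.smul_apply, ContinuousMap.coe_mk, RingHom.id_apply,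
          intervalIntegral.integral_smul]
        rw [smul_comm] } 1
    (fun f => by
      rw [one_mul]
      refine (ContinuousMap.norm_le _ (norm_nonneg f)).2 fun p => ?_
      simp only [LinearMap.coe_mk, AddHom.coe_mk, ContinuousMap.coe_mk]
      rw [norm_smul]
      have h1 : ‖p.1.1‖ ≤ 1 := by
        have := p.2.1
        have := p.2.2
        have := abs_nonneg p.1.2
        rw [Real.norm_eq_abs, abs_le]
        constructor <;> linarith
      have h2 : ‖∫ σ in (0:ℝ)..1, f (linePoint c p σ)‖ ≤ ‖f‖ * |1 - 0| :=
        intervalIntegral.norm_integral_le_of_norm_le_const fun σ _ => f.norm_coe_le_norm _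
      simp only [sub_zero, abs_one, mul_one] at h2
      nlinarith [norm_nonneg (∫ σ in (0:ℝ)..1, f (linePoint c p σ)), norm_nonneg f])

variable {ι : Type} [Fintype ι] (c : ι → Icc (-1 : ℝ) 1) (A : ι → E →L[ℝ] E)

/-- The sum of the integrals along the lines of slopes `c i`, combined by the operators `A i`. -/
def transportIntegral : C(unitTriangle, E) →L[ℝ] C(unitTriangle, E) :=
  ∑ i, ((A i).compLeftContinuous ℝ unitTriangle).comp (lineIntegral E (c i))

lemma transportIntegral_apply (f : C(unitTriangle, E)) (p : unitTriangle) :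
    transportIntegral c A f p
      = ∑ i, A i (p.1.1 • ∫ σ in (0:ℝ)..1, f (linePoint (c i) p σ)) := by
  rw [transportIntegral, sum_apply, ContinuousMap.sum_apply]
  rfl

/-- The transported initial data, rescaled by `q.1` and translated by `q.2`. -/
def transportData (w₀ : C(ℝ, E)) (q : ℝ × ℝ) : C(unitTriangle, E) :=
  ∑ i, (A i).compLeftContinuous ℝ unitTriangle (w₀.comp
    (q.1 • (⟨fun p => p.1.2 + c i * p.1.1, by fun_prop⟩ : C(unitTriangle, ℝ))
      + q.2 • (1 : C(unitTriangle, ℝ))))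

lemma transportData_apply (w₀ : C(ℝ, E)) (q : ℝ × ℝ) (p : unitTriangle) :
    transportData c A w₀ q p = ∑ i, A i (w₀ (q.1 * (p.1.2 + c i * p.1.1) + q.2)) := by
  rw [transportData, ContinuousMap.sum_apply]
  refine Finset.sum_congr rfl fun i _ => ?_
  change A i (w₀ (q.1 * (p.1.2 + c i * p.1.1) + q.2 * 1)) = _
  rw [mul_one]

lemma contDiff_transportData (w₀ : C(ℝ, E)) (h : ContDiff ℝ ∞ w₀) :
    ContDiff ℝ ∞ (transportData c A w₀) := by
  unfold transportData
  refine ContDiff.sum fun i _ => ?_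
  refine ((A i).compLeftContinuous ℝ unitTriangle).contDiff.comp ?_
  refine (contDiff_postcomp (D := unitTriangle) w₀ h).comp ?_
  fun_prop

/-- The fixed point map of the rescaled Duhamel formula. -/
def duhamel (w₀ : C(ℝ, E)) (F : C(E, E)) (q : ℝ × ℝ) (w : C(unitTriangle, E)) :
    C(unitTriangle, E) :=
  transportData c A w₀ q + q.1 • transportIntegral c A (F.comp w)

lemma duhamel_apply (w₀ : C(ℝ, E)) (F : C(E, E)) (q : ℝ × ℝ) (w : C(unitTriangle, E))
    (p : unitTriangle) : duhamel c A w₀ F q w p =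
      ∑ i, A i (w₀ (q.1 * (p.1.2 + c i * p.1.1) + q.2)
        + (q.1 * p.1.1) • ∫ σ in (0:ℝ)..1, F (w (linePoint (c i) p σ))) := by
  simp only [duhamel, ContinuousMap.add_apply, ContinuousMap.smul_apply, transportData_apply,
    transportIntegral_apply, ContinuousMap.comp_apply, map_add, Finset.sum_add_distrib,
    Finset.smul_sum, map_smul, mul_smul]

/-- After rescaling, the triangle below (t, x) becomes the unit triangle and the integral term
acquires the factor t = q.1. Only this term depends on w, so smallness of t suffices whatever the
data are. -/
lemma contractingWith_duhamel (w₀ : C(ℝ, E)) (F : C(E, E)) {L : NNReal} (hF : LipschitzWith L F)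
    (q : ℝ × ℝ) (hq : |q.1| * (‖transportIntegral c A‖ * L) < 1) :
    ContractingWith ⟨|q.1| * (‖transportIntegral c A‖ * L), by positivity⟩
      (duhamel c A w₀ F q) := by
  refine ⟨by exact_mod_cast hq, LipschitzWith.of_dist_le_mul fun w w' => ?_⟩
  rw [dist_eq_norm, duhamel, duhamel, add_sub_add_left_eq_sub, ← smul_sub, ← map_sub, norm_smul]
  rw [Real.norm_eq_abs]
  have h1 : ‖F.comp w - F.comp w'‖ ≤ L * dist w w' := by
    refine (ContinuousMap.norm_le _ (by positivity)).2 fun p => ?_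
    simp only [ContinuousMap.sub_apply, ContinuousMap.comp_apply]
    rw [← dist_eq_norm]
    exact (hF.dist_le_mul _ _).trans (by gcongr; exact ContinuousMap.dist_apply_le_dist p)
  calc _ ≤ |q.1| * (‖transportIntegral c A‖ * (L * dist w w')) := by
        gcongr
        exact ContinuousLinearMap.le_of_opNorm_le_of_le _ le_rfl h1
    _ = |q.1| * (‖transportIntegral c A‖ * L) * dist w w' := by ring

/-- Local existence of smooth solutions, in Duhamel form, of semilinear transport systems with
finitely many speeds `c i`; the time of existence depends on the nonlinearity only. -/
theorem exists_transport_solution (F : E → E) (hF : ContDiff ℝ ∞ F) {L : NNReal}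
    (hL : LipschitzWith L F) :
    ∃ ε > 0, ∀ w₀ : ℝ → E, ContDiff ℝ ∞ w₀ → ∃ w : ℝ × ℝ → E,
      ContDiffOn ℝ ∞ w {p | |p.1| < ε} ∧ ∀ t x : ℝ, |t| < ε →
        w (t, x) = ∑ i, A i (w₀ (x + c i * t)
          + t • ∫ σ in (0:ℝ)..1, F (w (σ * t, x + c i * (t * (1 - σ))))) := by
  set B := ‖transportIntegral c A‖ * L with hB
  have hB0 : 0 ≤ B := by positivity
  refine ⟨1 / (B + 1), by positivity, fun w₀ hw₀ => ?_⟩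
  let F' : C(E, E) := ⟨F, hF.continuous⟩
  let w₀' : C(ℝ, E) := ⟨w₀, hw₀.continuous⟩
  have hsmall : ∀ q : ℝ × ℝ, |q.1| < 1 / (B + 1) → |q.1| * B < 1 := by
    intro q hq
    rw [lt_div_iff₀ (by positivity)] at hq
    nlinarith [abs_nonneg q.1]
  have hcon : ∀ q : ℝ × ℝ, |q.1| < 1 / (B + 1) → ContractingWith ⟨|q.1| * B, by positivity⟩
      (duhamel c A w₀' F' q) := fun q hq =>
    contractingWith_duhamel c A w₀' F' hL q (hsmall q hq)
  have hex : ∀ q : ℝ × ℝ, ∃ w : C(unitTriangle, E), |q.1| < 1 / (B + 1) →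
      duhamel c A w₀' F' q w = w := by
    intro q
    by_cases hq : |q.1| < 1 / (B + 1)
    · exact ⟨_, fun _ => (hcon q hq).fixedPoint_isFixedPt⟩
    · exact ⟨0, fun h => absurd h hq⟩
  choose sol hsol using hex
  have huniq : ∀ (q : ℝ × ℝ) (w : C(unitTriangle, E)), |q.1| < 1 / (B + 1) →
      duhamel c A w₀' F' q w = w → w = sol q := fun q w hq hw =>
    (hcon q hq).fixedPoint_unique' hw (hsol q hq)
  -- Thanks to the rescaling all solutions live in one Banach space and depend on the parameter q =
  -- (t, x). The implicit function theorem applies: the derivative in w is 1 - T, where ‖T‖ is below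
  -- the contraction constant.
  have hsmooth : ∀ q : ℝ × ℝ, |q.1| < 1 / (B + 1) → ContDiffAt ℝ ∞ sol q := by
    intro q hq
    let Φ : (ℝ × ℝ) × C(unitTriangle, E) → C(unitTriangle, E) := fun r =>
      r.2 - duhamel c A w₀' F' r.1 r.2
    have hΦ : ContDiff ℝ ∞ Φ := by
      have h1 : ContDiff ℝ ∞ (fun r : (ℝ × ℝ) × C(unitTriangle, E) =>
          transportData c A w₀' r.1) :=
        (contDiff_transportData c A w₀' hw₀).comp contDiff_fst
      have h2 : ContDiff ℝ ∞ (fun r : (ℝ × ℝ) × C(unitTriangle, E) =>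
          transportIntegral c A (F'.comp r.2)) :=
        (transportIntegral c A).contDiff.comp ((contDiff_postcomp F' hF).comp contDiff_snd)
      have h3 : ContDiff ℝ ∞ (fun r : (ℝ × ℝ) × C(unitTriangle, E) => r.1.1) := by fun_prop
      exact contDiff_snd.sub (h1.add (h3.smul h2))
    have hc : Continuous (fderiv ℝ F) := hF.continuous_fderiv (by simp)
    set T : C(unitTriangle, E) →L[ℝ] C(unitTriangle, E) := q.1 • (transportIntegral c A).comp
      (pointwiseApply unitTriangle E E ((⟨fderiv ℝ F, hc⟩ : C(E, E →L[ℝ] E)).comp (sol q))) with hT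
    have hd : HasFDerivAt (fun w => Φ (q, w))
        (ContinuousLinearMap.id ℝ C(unitTriangle, E) - T) (sol q) := by
      have h1 := (transportIntegral c A).hasFDerivAt.comp _ (hasFDerivAt_postcomp F'
        ⟨fderiv ℝ F, hc⟩ (fun e => (hF.differentiable (by simp) e).hasFDerivAt) (sol q))
      have h2 : HasFDerivAt (fun w => duhamel c A w₀' F' q w) T (sol q) :=
        (h1.const_smul q.1).const_add (transportData c A w₀' q)
      exact (hasFDerivAt_id _).sub h2
    have hd' : fderiv ℝ Φ (q, sol q) ∘L .inr ℝ (ℝ × ℝ) C(unitTriangle, E)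
        = ContinuousLinearMap.id ℝ C(unitTriangle, E) - T := by
      have h1 := ((hΦ.differentiable (by simp) (q, sol q)).hasFDerivAt).comp (sol q)
        (hasFDerivAt_prodMk_right q (sol q))
      exact h1.unique hd
    have hnorm : ‖T‖ < 1 := by
      refine lt_of_le_of_lt ?_ (hsmall q hq)
      rw [hT, norm_smul, Real.norm_eq_abs]
      gcongr
      refine (ContinuousLinearMap.opNorm_comp_le _ _).trans ?_
      rw [hB]
      gcongr
      refine (norm_pointwiseApply_le _).trans ?_
      refine (ContinuousMap.norm_le _ (NNReal.coe_nonneg L)).2 fun d => ?_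
      exact norm_fderiv_le_of_lipschitz ℝ hL
    have hinv : (fderiv ℝ Φ (q, sol q) ∘L .inr ℝ (ℝ × ℝ) C(unitTriangle, E)).IsInvertible := by
      rw [hd']
      have hu : IsUnit (1 - T) := isUnit_one_sub_of_norm_lt_one hnorm
      obtain ⟨u, hu⟩ := hu
      exact ⟨ContinuousLinearEquiv.ofUnit u, by ext1 v; simp [ContinuousLinearEquiv.ofUnit, hu]⟩
    have h0 : Φ (q, sol q) = 0 := sub_eq_zero.2 (hsol q hq).symm
    have hat : ContDiffAt ℝ ∞ Φ (q, sol q) := hΦ.contDiffAt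
    refine (hat.contDiffAt_implicitFunction (by simp) hinv).congr_of_eventuallyEq ?_
    have hop : IsOpen {q : ℝ × ℝ | |q.1| < 1 / (B + 1)} :=
      isOpen_lt continuous_fst.abs continuous_const
    filter_upwards [hop.mem_nhds hq, hat.eventually_apply_implicitFunction (by simp) hinv]
      with r hr hr'
    rw [h0, sub_eq_zero] at hr'
    exact (huniq r _ hr hr'.symm).symm
  -- A solution restricted to a smaller triangle and rescaled solves the problem of that triangle,
  -- so by uniqueness it is given by apex values. Hence the function that assigns to (t, x) the apex
  -- value satisfies the unscaled Duhamel formula.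
  have hself : ∀ (q : ℝ × ℝ) (p : unitTriangle), |q.1| < 1 / (B + 1) →
      sol q p = sol (q.1 * p.1.1, q.1 * p.1.2 + q.2) triangleApex := by
    intro q p hq
    have hmem : ∀ r : unitTriangle, (p.1.1 * r.1.1, p.1.1 * r.1.2 + p.1.2) ∈ unitTriangle := by
      intro r
      have h1 := p.2.1
      have h2 := p.2.2
      have h3 := r.2.1
      have h4 := r.2.2
      refine ⟨mul_nonneg h1 h3, ?_⟩
      have h5 := abs_add_le (p.1.1 * r.1.2) p.1.2
      rw [abs_mul, abs_of_nonneg h1] at h5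
      simp only
      nlinarith
    let φ : C(unitTriangle, unitTriangle) := ⟨fun r => ⟨_, hmem r⟩, by fun_prop⟩
    have h1 : p.1.1 ≤ 1 := by
      have := p.2.2
      have := abs_nonneg p.1.2
      linarith
    have hq' : |q.1 * p.1.1| < 1 / (B + 1) := by
      rw [abs_mul, abs_of_nonneg p.2.1]
      exact lt_of_le_of_lt (mul_le_of_le_one_right (abs_nonneg _) h1) hq
    have h2 : (sol q).comp φ = sol (q.1 * p.1.1, q.1 * p.1.2 + q.2) := by
      refine huniq _ _ hq' ?_
      ext r
      rw [ContinuousMap.comp_apply]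
      conv_rhs => rw [← hsol q hq]
      rw [duhamel_apply, duhamel_apply]
      refine Finset.sum_congr rfl fun i _ => ?_
      have e1 : q.1 * p.1.1 * (r.1.2 + c i * r.1.1) + (q.1 * p.1.2 + q.2)
          = q.1 * ((φ r).1.2 + c i * (φ r).1.1) + q.2 := by
        simp only [φ, ContinuousMap.coe_mk]; ring
      have e2 : q.1 * p.1.1 * r.1.1 = q.1 * (φ r).1.1 := by
        simp only [φ, ContinuousMap.coe_mk]; ring
      have e3 : ∀ σ, φ (linePoint (c i) r σ) = linePoint (c i) (φ r) σ := by
        intro σ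
        apply Subtype.ext
        simp only [φ, ContinuousMap.coe_mk, linePoint]
        ext
        · simp only; ring
        · simp only; ring
      simp only [ContinuousMap.comp_apply, e3]
      rw [e1, e2]
    rw [← h2]
    simp only [ContinuousMap.comp_apply]
    congr 1
    apply Subtype.ext
    simp [φ, triangleApex]
  refine ⟨fun q => sol q triangleApex, ?_, ?_⟩
  · intro q hq
    have hev : ContDiff ℝ ∞ (fun w : C(unitTriangle, E) => w triangleApex) :=
      (ContinuousMap.evalCLM ℝ triangleApex : C(unitTriangle, E) →L[ℝ] E).contDiff
    exact (hev.contDiffAt.comp q (hsmooth q hq)).contDiffWithinAt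
  · intro t x ht
    simp only
    conv_lhs => rw [← hsol (t, x) ht]
    rw [duhamel_apply]
    refine Finset.sum_congr rfl fun i _ => ?_
    congr 2
    · simp only [triangleApex]
      show w₀ _ = _
      congr 1; ring
    · simp only [triangleApex, mul_one]
      congr 1
      refine intervalIntegral.integral_congr fun σ hσ => ?_
      rw [uIcc_of_le zero_le_one] at hσ
      rw [hself (t, x) _ ht]
      simp only [linePoint, projIcc_of_mem zero_le_one hσ]
      show F _ = _
      congr 3
      ext <;> simp only <;> ring

end TransportSystem

set_option maxSynthPendingDepth 3

/-! ### Christoffel symbols and covariant acceleration -/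

section ChristoffelForm

variable {X : Type} [NormedAddCommGroup X] [NormedSpace ℝ X]

/-- The Christoffel symbols, with the upper index lowered, of a field of bilinear forms. -/
def christForm (G : X → X →L[ℝ] X →L[ℝ] ℝ) (z : X) : X →L[ℝ] X →L[ℝ] X →L[ℝ] ℝ :=
  (1 / 2 : ℝ) • (fderiv ℝ G z + (fderiv ℝ G z).flip
    - (ContinuousLinearMap.flipₗᵢ ℝ X X ℝ : (X →L[ℝ] X →L[ℝ] ℝ) →L[ℝ] (X →L[ℝ] X →L[ℝ] ℝ)).comp
      (fderiv ℝ G z).flip)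

lemma christForm_apply (G : X → X →L[ℝ] X →L[ℝ] ℝ) (z U V W : X) :
    christForm G z U V W = (fderiv ℝ G z U V W + fderiv ℝ G z V U W - fderiv ℝ G z W U V) / 2 := by
  have : christForm G z U V W
      = (1 / 2 : ℝ) * (fderiv ℝ G z U V W + fderiv ℝ G z V U W - fderiv ℝ G z W U V) := rfl
  rw [this]; ring

lemma ContDiffOn.christForm {G : X → X →L[ℝ] X →L[ℝ] ℝ} {T : Set X} (hT : IsOpen T)
    (hG : ContDiffOn ℝ ∞ G T) : ContDiffOn ℝ ∞ (christForm G) T := by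
  have h1 : ContDiffOn ℝ ∞ (fderiv ℝ G) T := hG.fderiv_of_isOpen hT (by simp)
  have h2 : ContDiffOn ℝ ∞ (fun z => (fderiv ℝ G z).flip) T :=
    (ContinuousLinearMap.flipₗᵢ ℝ X X (X →L[ℝ] ℝ)).contDiff.comp_contDiffOn h1
  exact ((h1.add h2).sub (contDiffOn_const.clm_comp h2)).const_smul (1 / 2 : ℝ)

/-- The acceleration `∇_d ∂_d Y` of a map, paired with `W`. -/
def acceleration {A : Type} [NormedAddCommGroup A] [NormedSpace ℝ A]
    (G : X → X →L[ℝ] X →L[ℝ] ℝ) (Y : A → X) (p d : A) (W : X) : ℝ :=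
  G (Y p) (fderiv ℝ (fun p' => fderiv ℝ Y p' d) p d) W
    + christForm G (Y p) (fderiv ℝ Y p d) (fderiv ℝ Y p d) W

/-- The acceleration is invariant under changes of coordinates that are isometries. -/
lemma acceleration_comp {A : Type} [NormedAddCommGroup A] [NormedSpace ℝ A]
    {G₀ G₁ : X → X →L[ℝ] X →L[ℝ] ℝ} {φ : X → X} {Y : A → X} {p : A}
    (hY : ContDiffAt ℝ 2 Y p) (hφ : ContDiffAt ℝ 2 φ (Y p))
    (hG₁ : DifferentiableAt ℝ G₁ (φ (Y p)))
    (hG : ∀ᶠ z in 𝓝 (Y p), ∀ V W, G₀ z V W = G₁ (φ z) (fderiv ℝ φ z V) (fderiv ℝ φ z W))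
    (hG₀ : DifferentiableAt ℝ G₀ (Y p)) (hs : ∀ V W, G₁ (φ (Y p)) V W = G₁ (φ (Y p)) W V)
    (d : A) (W : X) :
    acceleration G₁ (φ ∘ Y) p d (fderiv ℝ φ (Y p) W) = acceleration G₀ Y p d W := by
  have hY1 : DifferentiableAt ℝ Y p := hY.differentiableAt (by simp)
  have hφ1 : DifferentiableAt ℝ φ (Y p) := hφ.differentiableAt (by simp)
  have hφ' : DifferentiableAt ℝ (fderiv ℝ φ) (Y p) :=
    (hφ.fderiv_right (m := 1) (by norm_num)).differentiableAt (by simp)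
  have hY' : DifferentiableAt ℝ (fderiv ℝ Y) p :=
    (hY.fderiv_right (m := 1) (by norm_num)).differentiableAt (by simp)
  have hsymm : ∀ U V, fderiv ℝ (fderiv ℝ φ) (Y p) U V = fderiv ℝ (fderiv ℝ φ) (Y p) V U :=
    fun U V => (hφ.isSymmSndFDerivAt (by simp)).eq U V
  have e1 : fderiv ℝ (φ ∘ Y) p d = fderiv ℝ φ (Y p) (fderiv ℝ Y p d) := by
    rw [fderiv_comp p hφ1 hY1]; rfl
  have hYd : HasFDerivAt (fun p' => fderiv ℝ Y p' d) ((fderiv ℝ (fderiv ℝ Y) p).flip d) p := by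
    simpa using hY'.hasFDerivAt.clm_apply (hasFDerivAt_const d p)
  have e2 : fderiv ℝ (fun p' => fderiv ℝ (φ ∘ Y) p' d) p d
      = fderiv ℝ (fderiv ℝ φ) (Y p) (fderiv ℝ Y p d) (fderiv ℝ Y p d)
        + fderiv ℝ φ (Y p) (fderiv ℝ (fun p' => fderiv ℝ Y p' d) p d) := by
    have hev : (fun p' => fderiv ℝ (φ ∘ Y) p' d)
        =ᶠ[𝓝 p] fun p' => fderiv ℝ φ (Y p') (fderiv ℝ Y p' d) := by
      have h1 := (hY.eventually (by simp)).and
        (hY.continuousAt.eventually (hφ.eventually (by simp)))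
      filter_upwards [h1] with p' hp'
      rw [fderiv_comp p' (hp'.2.differentiableAt (by simp)) (hp'.1.differentiableAt (by simp))]
      rfl
    rw [hev.fderiv_eq]
    have h2 : HasFDerivAt (fun p' => fderiv ℝ φ (Y p') (fderiv ℝ Y p' d)) _ p :=
      (hφ'.hasFDerivAt.comp p hY1.hasFDerivAt).clm_apply hYd
    rw [h2.fderiv, hYd.fderiv]
    simp [add_comm]
  -- In the Christoffel combination of the derivatives of φ^*G₁, the terms with second derivatives
  -- of φ reduce to G₁(φ''(d,d), φ'W), exactly the extra term from the second derivative of φ ∘ Y.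
  have e3 : ∀ U V W, fderiv ℝ G₀ (Y p) U V W
      = fderiv ℝ G₁ (φ (Y p)) (fderiv ℝ φ (Y p) U) (fderiv ℝ φ (Y p) V) (fderiv ℝ φ (Y p) W)
        + G₁ (φ (Y p)) (fderiv ℝ (fderiv ℝ φ) (Y p) U V) (fderiv ℝ φ (Y p) W)
        + G₁ (φ (Y p)) (fderiv ℝ φ (Y p) V) (fderiv ℝ (fderiv ℝ φ) (Y p) U W) := by
    intro U V W
    have h1 : HasFDerivAt (fun z => G₀ z V W)
        (((fderiv ℝ G₀ (Y p)).flip V).flip W) (Y p) := by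
      simpa using (hG₀.hasFDerivAt.clm_apply (hasFDerivAt_const V _)).clm_apply
        (hasFDerivAt_const W _)
    have h2 : HasFDerivAt (fun z => fderiv ℝ φ z V) ((fderiv ℝ (fderiv ℝ φ) (Y p)).flip V) (Y p) := by
      simpa using hφ'.hasFDerivAt.clm_apply (hasFDerivAt_const V _)
    have h3 : HasFDerivAt (fun z => fderiv ℝ φ z W) ((fderiv ℝ (fderiv ℝ φ) (Y p)).flip W) (Y p) := by
      simpa using hφ'.hasFDerivAt.clm_apply (hasFDerivAt_const W _)
    have h4 := ((hG₁.hasFDerivAt.comp (Y p) hφ1.hasFDerivAt).clm_apply h2).clm_apply h3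
    have h5 := h1.unique (h4.congr_of_eventuallyEq (hG.mono fun z hz => hz V W))
    have h6 := congrArg (fun T => T U) h5
    simp only [ContinuousLinearMap.flip_apply, add_apply,
      ContinuousLinearMap.comp_apply, Function.comp_apply] at h6
    rw [h6]
    ring
  simp only [acceleration, christForm_apply, Function.comp_apply]
  rw [e1, e2, e3, e3, (hG.self_of_nhds : ∀ V W, _)]
  simp only [map_add, add_apply]
  rw [hs (fderiv ℝ (fderiv ℝ φ) (Y p) W (fderiv ℝ Y p d)), hsymm W]
  ring

end ChristoffelForm

/-! ### Charts of the spacetime and coordinates of tangent vectors -/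

namespace MetricFamily

variable {n : ℕ} {N : Type*} [TopologicalSpace N] [ChartedSpace (Coord n) N]

/-- The set of points of `ℝ × N` covered by the preferred chart at `q₀`. -/
def chartDomain (q₀ : N) : Set (ℝ × N) := {p | p.2 ∈ (extChartAt (𝓡 n) q₀).source}

/-- The range of the coordinates of `ℝ × N` given by the preferred chart at `q₀`. -/
def chartRange (q₀ : N) : Set (ℝ × Coord n) := univ ×ˢ (extChartAt (𝓡 n) q₀).target

/-- The coordinates of `ℝ × N` given by the preferred chart at `q₀`. -/
def stCoord (q₀ : N) (p : ℝ × N) : ℝ × Coord n := (p.1, extChartAt (𝓡 n) q₀ p.2)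

/-- The point of `ℝ × N` with given coordinates. -/
def stPoint (q₀ : N) (z : ℝ × Coord n) : ℝ × N := (z.1, (extChartAt (𝓡 n) q₀).symm z.2)

lemma mem_chartDomain_self (p : ℝ × N) : p ∈ chartDomain (n := n) p.2 :=
  mem_extChartAt_source (I := 𝓡 n) p.2

lemma isOpen_chartDomain (q₀ : N) : IsOpen (chartDomain (n := n) q₀) :=
  (isOpen_extChartAt_source q₀).preimage continuous_snd

lemma isOpen_chartRange (q₀ : N) : IsOpen (chartRange (n := n) q₀) :=
  isOpen_univ.prod (isOpen_extChartAt_target q₀)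

lemma stCoord_mem {q₀ : N} {p : ℝ × N} (hp : p ∈ chartDomain (n := n) q₀) :
    stCoord q₀ p ∈ chartRange (n := n) q₀ :=
  ⟨mem_univ _, (extChartAt (𝓡 n) q₀).map_source hp⟩

lemma stPoint_mem {q₀ : N} {z : ℝ × Coord n} (hz : z ∈ chartRange (n := n) q₀) :
    stPoint q₀ z ∈ chartDomain (n := n) q₀ :=
  (extChartAt (𝓡 n) q₀).map_target hz.2

lemma stPoint_stCoord {q₀ : N} {p : ℝ × N} (hp : p ∈ chartDomain (n := n) q₀) :
    stPoint (n := n) q₀ (stCoord q₀ p) = p :=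
  Prod.ext rfl ((extChartAt (𝓡 n) q₀).left_inv hp)

lemma stCoord_stPoint {q₀ : N} {z : ℝ × Coord n} (hz : z ∈ chartRange (n := n) q₀) :
    stCoord q₀ (stPoint q₀ z) = z :=
  Prod.ext rfl ((extChartAt (𝓡 n) q₀).right_inv hz.2)

lemma continuousOn_stCoord (q₀ : N) : ContinuousOn (stCoord (n := n) q₀) (chartDomain (n := n) q₀) :=
  continuousOn_fst.prodMk ((continuousOn_extChartAt q₀).comp continuousOn_snd fun _ h => h)

lemma continuousOn_stPoint (q₀ : N) : ContinuousOn (stPoint (n := n) q₀) (chartRange (n := n) q₀) :=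
  continuousOn_fst.prodMk ((continuousOn_extChartAt_symm q₀).comp continuousOn_snd fun _ h => h.2)

/-- The coordinates of a tangent vector of `ℝ × N`. -/
def vecCoord (q₀ : N) {p : ℝ × N} (V : TangentSpace (stModel n) p) : ℝ × Coord n :=
  (timePart V, mfderiv (𝓡 n) 𝓘(ℝ, Coord n) (extChartAt (𝓡 n) q₀) p.2 (spacePart V))

section Smooth

variable [IsManifold (𝓡 n) ∞ N]

lemma contMDiffOn_stCoord (q₀ : N) :
    ContMDiffOn (stModel n) 𝓘(ℝ, ℝ × Coord n) ∞ (stCoord (n := n) q₀) (chartDomain (n := n) q₀) := by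
  refine contMDiffOn_fst.prodMk_space ?_
  refine (contMDiffOn_extChartAt (I := 𝓡 n) (n := ∞) (x := q₀)).comp contMDiffOn_snd fun p hp => ?_
  simpa [chartDomain] using hp

lemma contMDiffOn_stPoint (q₀ : N) :
    ContMDiffOn 𝓘(ℝ, ℝ × Coord n) (stModel n) ∞ (stPoint (n := n) q₀) (chartRange (n := n) q₀) := by
  refine ContMDiffOn.prodMk contDiff_fst.contMDiff.contMDiffOn ?_
  exact (contMDiffOn_extChartAt_symm (I := 𝓡 n) (n := ∞) q₀).comp
    contDiff_snd.contMDiff.contMDiffOn fun p hp => hp.2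

lemma chartInvDeriv_mfderiv {q₀ : N} {z : Coord n} (hz : z ∈ (extChartAt (𝓡 n) q₀).target)
    (v : TangentSpace (𝓡 n) ((extChartAt (𝓡 n) q₀).symm z)) :
    chartInvDeriv q₀ z (mfderiv (𝓡 n) 𝓘(ℝ, Coord n) (extChartAt (𝓡 n) q₀) _ v) = v := by
  have : IsManifold (𝓡 n) 1 N := IsManifold.of_le (n := ∞) (by simp)
  have h := mfderivWithin_extChartAt_symm_comp_mfderiv_extChartAt (I := 𝓡 n) hz
  simp only [ModelWithCorners.range_eq_univ, mfderivWithin_univ] at h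
  exact congrArg (fun T => T v) h

lemma mfderiv_chartInvDeriv {q₀ : N} {z : Coord n} (hz : z ∈ (extChartAt (𝓡 n) q₀).target)
    (v : Coord n) :
    mfderiv (𝓡 n) 𝓘(ℝ, Coord n) (extChartAt (𝓡 n) q₀) ((extChartAt (𝓡 n) q₀).symm z)
      (chartInvDeriv q₀ z v) = v := by
  have : IsManifold (𝓡 n) 1 N := IsManifold.of_le (n := ∞) (by simp)
  have h := mfderiv_extChartAt_comp_mfderivWithin_extChartAt_symm (I := 𝓡 n) hz
  simp only [ModelWithCorners.range_eq_univ, mfderivWithin_univ] at h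
  exact congrArg (fun T => T v) h

lemma lor_eq_coordMetric (g : MetricFamily n N) {q₀ : N} {p : ℝ × N}
    (hp : p ∈ chartDomain (n := n) q₀) (V W : TangentSpace (stModel n) p) :
    g.lor p V W = g.coordMetric q₀ (stCoord q₀ p) (vecCoord q₀ V) (vecCoord q₀ W) := by
  obtain ⟨z, hz, rfl⟩ : ∃ z ∈ chartRange (n := n) q₀, p = stPoint q₀ z :=
    ⟨_, stCoord_mem hp, (stPoint_stCoord hp).symm⟩
  rw [stCoord_stPoint hz]
  simp only [lor, coordMetric, vecCoord]
  congr 1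
  have h := fun v => chartInvDeriv_mfderiv (q₀ := q₀) hz.2 v
  exact (congrArg₂ (fun a b => g.inner z.1 _ a b) (h _) (h _)).symm

lemma timePart_eq {p : ℝ × N} (V : TangentSpace (stModel n) p) :
    timePart V = (show ℝ × Coord n from V).1 := by
  simp only [timePart, mfderiv_fst]; rfl

lemma spacePart_eq {p : ℝ × N} (V : TangentSpace (stModel n) p) :
    spacePart V = (show ℝ × Coord n from V).2 := by
  simp only [spacePart, mfderiv_snd]; rfl

lemma vecCoord_injective {q₀ : N} {p : ℝ × N} (hp : p ∈ chartDomain (n := n) q₀) :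
    Function.Injective (vecCoord (n := n) q₀ (p := p)) := by
  have : IsManifold (𝓡 n) 1 N := IsManifold.of_le (n := ∞) (by simp)
  intro V W h
  replace h := Prod.ext_iff.1 h
  have h2 := (isInvertible_mfderiv_extChartAt (I := 𝓡 n) hp).injective h.2
  rw [spacePart_eq, spacePart_eq] at h2
  exact Prod.ext ((timePart_eq V).symm.trans (h.1.trans (timePart_eq W))) h2

/-- The chain rule, taken separately in the two factors of the product. Derivatives within a set are
needed because solutions are only smooth up to the axis. -/
lemma fderivWithin_stCoord_comp {A : Type} [NormedAddCommGroup A] [NormedSpace ℝ A]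
    {q₀ : N} {y : A → ℝ × N} {S : Set A} {p : A}
    (hy : MDifferentiableWithinAt 𝓘(ℝ, A) (stModel n) y S p) (hS : UniqueDiffWithinAt ℝ S p)
    (hp : y p ∈ chartDomain (n := n) q₀) (d : A) :
    fderivWithin ℝ (stCoord (n := n) q₀ ∘ y) S p d
      = vecCoord q₀ (mfderivWithin 𝓘(ℝ, A) (stModel n) y S p d) := by
  have : IsManifold (𝓡 n) 1 N := IsManifold.of_le (n := ∞) (by simp)
  have hS' : UniqueMDiffWithinAt 𝓘(ℝ, A) S p := hS.uniqueMDiffWithinAt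
  have h1 : MDifferentiableAt (stModel n) 𝓘(ℝ, ℝ) (Prod.fst : ℝ × N → ℝ) (y p) :=
    mdifferentiableAt_fst
  have h2 : MDifferentiableAt (stModel n) (𝓡 n) (Prod.snd : ℝ × N → N) (y p) :=
    mdifferentiableAt_snd
  have h3 : MDifferentiableAt (𝓡 n) 𝓘(ℝ, Coord n) (extChartAt (𝓡 n) q₀) (y p).2 :=
    mdifferentiableAt_extChartAt (by simpa [chartDomain] using hp)
  have h4 := h2.comp_mdifferentiableWithinAt p hy
  have h5 : MDifferentiableWithinAt 𝓘(ℝ, A) 𝓘(ℝ, Coord n)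
    (fun p => extChartAt (𝓡 n) q₀ (y p).2) S p := h3.comp_mdifferentiableWithinAt p h4
  have h6 : MDifferentiableWithinAt 𝓘(ℝ, A) 𝓘(ℝ, ℝ) (fun p => (y p).1) S p :=
    h1.comp_mdifferentiableWithinAt p hy
  have e1 : fderivWithin ℝ (stCoord (n := n) q₀ ∘ y) S p d
      = (fderivWithin ℝ (fun p => (y p).1) S p d,
        fderivWithin ℝ (fun p => extChartAt (𝓡 n) q₀ (y p).2) S p d) := by
    have := DifferentiableWithinAt.fderivWithin_prodMk
      h6.differentiableWithinAt h5.differentiableWithinAt hS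
    exact congrArg (fun T => T d) this
  rw [e1, ← mfderivWithin_eq_fderivWithin, ← mfderivWithin_eq_fderivWithin]
  have e2 := mfderiv_comp_mfderivWithin p h1 hy hS'
  have e3 := mfderiv_comp_mfderivWithin p h3 h4 hS'
  have e4 := mfderiv_comp_mfderivWithin p h2 hy hS'
  refine Prod.ext ?_ ?_
  · exact congrArg (fun T => T d) e2
  · refine (congrArg (fun T => T d) e3).trans ?_
    simp only [vecCoord, spacePart]
    exact congrArg (mfderiv (𝓡 n) 𝓘(ℝ, Coord n) (extChartAt (𝓡 n) q₀) (y p).2)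
      (congrArg (fun T => T d) e4)

lemma fderiv_stCoord_comp {A : Type} [NormedAddCommGroup A] [NormedSpace ℝ A]
    {q₀ : N} {y : A → ℝ × N} {p : A} (hy : MDifferentiableAt 𝓘(ℝ, A) (stModel n) y p)
    (hp : y p ∈ chartDomain (n := n) q₀) (d : A) :
    fderiv ℝ (stCoord (n := n) q₀ ∘ y) p d
      = vecCoord q₀ (mfderiv 𝓘(ℝ, A) (stModel n) y p d) := by
  rw [← fderivWithin_univ, fderivWithin_stCoord_comp (mdifferentiableWithinAt_univ.2 hy)
    uniqueDiffWithinAt_univ hp, mfderivWithin_univ]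

end Smooth

/-! ### The metric in coordinates -/

variable (g : MetricFamily n N)

/-- The metric `-dt² + g_t` in coordinates, as a field of bilinear forms. -/
def metricForm (q₀ : N) (z : ℝ × Coord n) :
    (ℝ × Coord n) →L[ℝ] (ℝ × Coord n) →L[ℝ] ℝ :=
  LinearMap.toContinuousLinearMap
    ((LinearMap.toContinuousLinearMap (𝕜 := ℝ) (E := ℝ × Coord n) (F' := ℝ)).toLinearMap ∘ₗ
      LinearMap.mk₂ ℝ (g.coordMetric q₀ z)
        (fun _ _ _ => by simp only [coordMetric, Prod.fst_add, Prod.snd_add, map_add, add_apply]; ring)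
        (fun _ _ _ => by
          simp only [coordMetric, Prod.smul_fst, Prod.smul_snd, map_smul, smul_apply, smul_eq_mul]
          ring)
        (fun _ _ _ => by simp only [coordMetric, Prod.fst_add, Prod.snd_add, map_add]; ring)
        (fun _ _ _ => by
          simp only [coordMetric, Prod.smul_fst, Prod.smul_snd, map_smul, smul_eq_mul]
          ring))

lemma metricForm_apply (q₀ : N) (z V W : ℝ × Coord n) :
    g.metricForm q₀ z V W = g.coordMetric q₀ z V W := rfl

lemma metricForm_symm (q₀ : N) (z V W : ℝ × Coord n) :
    g.metricForm q₀ z V W = g.metricForm q₀ z W V := by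
  simp only [metricForm_apply, coordMetric]
  rw [g.symm, mul_comm]

lemma contDiffOn_metricForm (q₀ : N) : ContDiffOn ℝ ∞ (g.metricForm q₀) (chartRange q₀) := by
  rw [contDiffOn_clm_apply]
  intro V
  rw [contDiffOn_clm_apply]
  intro W
  simp only [metricForm_apply, coordMetric]
  exact contDiffOn_const.add (g.smooth q₀ V.2 W.2)

lemma differentiableAt_metricForm {q₀ : N} {z : ℝ × Coord n} (hz : z ∈ chartRange q₀) :
    DifferentiableAt ℝ (g.metricForm q₀) z :=
  ((g.contDiffOn_metricForm q₀).contDiffAt ((isOpen_chartRange q₀).mem_nhds hz)).differentiableAt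
    (by simp)

lemma fderiv_coordMetric {q₀ : N} {z : ℝ × Coord n} (hz : z ∈ chartRange q₀)
    (U V W : ℝ × Coord n) :
    fderiv ℝ (fun z' => g.coordMetric q₀ z' V W) z U = fderiv ℝ (g.metricForm q₀) z U V W := by
  have h1 : HasFDerivAt (fun z' => g.metricForm q₀ z' V W)
      (((fderiv ℝ (g.metricForm q₀) z).flip V).flip W) z := by
    simpa using ((g.differentiableAt_metricForm hz).hasFDerivAt.clm_apply
      (hasFDerivAt_const V _)).clm_apply (hasFDerivAt_const W _)
  exact congrArg (fun T => T U) h1.fderiv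

lemma christoffel_eq {q₀ : N} {z : ℝ × Coord n} (hz : z ∈ chartRange q₀) (U V W : ℝ × Coord n) :
    g.christoffel q₀ z U V W = christForm (g.metricForm q₀) z U V W := by
  rw [christForm_apply, christoffel, g.fderiv_coordMetric hz, g.fderiv_coordMetric hz,
    g.fderiv_coordMetric hz]

variable [IsManifold (𝓡 n) ∞ N]

/-- Pairing V with its time reflection (-V.1, V.2) gives V.1² plus the Riemannian square of V.2, so
the form has no kernel; dimensions then force invertibility. -/
lemma isInvertible_metricForm {q₀ : N} {z : ℝ × Coord n} (hz : z ∈ chartRange q₀) :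
    (g.metricForm q₀ z).IsInvertible := by
  have hinj : Function.Injective (g.metricForm q₀ z) := by
    rw [injective_iff_map_eq_zero]
    intro V hV
    have h1 : g.metricForm q₀ z V (-V.1, V.2) = 0 := by rw [hV]; rfl
    rw [metricForm_apply, coordMetric] at h1
    simp only at h1
    have h2 : chartInvDeriv q₀ z.2 V.2 = 0 := by
      by_contra h
      have := g.pos z.1 _ _ h
      nlinarith [sq_nonneg V.1]
    have h3 : V.2 = 0 := by
      rw [← mfderiv_chartInvDeriv hz.2 V.2, h2, map_zero]; rfl
    rw [h2] at h1
    have h4 : V.1 = 0 := by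
      simp only [map_zero] at h1
      nlinarith
    exact Prod.ext h4 h3
  have hdim : Module.finrank ℝ (ℝ × Coord n) = Module.finrank ℝ ((ℝ × Coord n) →L[ℝ] ℝ) := by
    rw [← (LinearMap.toContinuousLinearMap (𝕜 := ℝ) (E := ℝ × Coord n) (F' := ℝ)).finrank_eq]
    exact (Subspace.dual_finrank_eq (K := ℝ) (V := ℝ × Coord n)).symm
  exact ⟨(LinearEquiv.ofInjectiveOfFinrankEq (g.metricForm q₀ z).toLinearMap hinj
    hdim).toContinuousLinearEquiv, ContinuousLinearMap.ext fun _ => rfl⟩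

/-- The Christoffel symbols with raised index, as a function of the point and two vectors. -/
def christSharp (q₀ : N) (e : (ℝ × Coord n) × (ℝ × Coord n) × (ℝ × Coord n)) : ℝ × Coord n :=
  (g.metricForm q₀ e.1).inverse (christForm (g.metricForm q₀) e.1 e.2.1 e.2.2)

lemma metricForm_christSharp {q₀ : N} {z : ℝ × Coord n} (hz : z ∈ chartRange q₀)
    (U V W : ℝ × Coord n) :
    g.metricForm q₀ z (g.christSharp q₀ (z, U, V)) W = christForm (g.metricForm q₀) z U V W := by
  rw [christSharp, (g.isInvertible_metricForm hz).self_apply_inverse]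

lemma contDiffOn_christSharp (q₀ : N) :
    ContDiffOn ℝ ∞ (g.christSharp q₀) (chartRange q₀ ×ˢ univ) := by
  have h0 : MapsTo (Prod.fst : (ℝ × Coord n) × (ℝ × Coord n) × (ℝ × Coord n) → _)
      (chartRange (n := n) q₀ ×ˢ univ) (chartRange q₀) := fun e he => he.1
  have h1 : ContDiffOn ℝ ∞ (fun e : (ℝ × Coord n) × (ℝ × Coord n) × (ℝ × Coord n) =>
      (g.metricForm q₀ e.1).inverse) (chartRange q₀ ×ˢ univ) := by
    intro e he
    have h2 : ContDiffWithinAt ℝ ∞ (g.metricForm q₀) (chartRange q₀) e.1 :=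
      g.contDiffOn_metricForm q₀ e.1 he.1
    exact ((g.isInvertible_metricForm he.1).contDiffAt_map_inverse).comp_contDiffWithinAt e
      (h2.comp e contDiffWithinAt_fst h0)
  have h3 := (ContDiffOn.christForm (isOpen_chartRange q₀) (g.contDiffOn_metricForm q₀)).comp
    contDiff_fst.contDiffOn h0
  exact h1.clm_apply ((h3.clm_apply contDiff_snd.fst.contDiffOn).clm_apply
    contDiff_snd.snd.contDiffOn)

end MetricFamily

/-! ### Chart independence and null form of the wave map equation -/

namespace MetricFamily

variable {n : ℕ} {N : Type*} [TopologicalSpace N] [ChartedSpace (Coord n) N]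
variable (g : MetricFamily n N)

lemma inCoord_eq (q₀ : N) (y : ℝ × ℝ → ℝ × N) : inCoord (n := n) q₀ y = stCoord q₀ ∘ y := rfl

lemma christForm_symm {q₀ : N} {z : ℝ × Coord n} (hz : z ∈ chartRange q₀) (U V W : ℝ × Coord n) :
    christForm (g.metricForm q₀) z U V W = christForm (g.metricForm q₀) z V U W := by
  have h : fderiv ℝ (g.metricForm q₀) z W U V = fderiv ℝ (g.metricForm q₀) z W V U := by
    rw [← g.fderiv_coordMetric hz, ← g.fderiv_coordMetric hz]
    congr 2
    funext z'
    rw [← metricForm_apply, metricForm_symm, metricForm_apply]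
  rw [christForm_apply, christForm_apply, h]
  ring

variable [IsManifold (𝓡 n) ∞ N]

lemma contDiffAt_transition {q₀ q₁ : N} {z : ℝ × Coord n} (hz : z ∈ chartRange q₀)
    (hz' : stPoint q₀ z ∈ chartDomain (n := n) q₁) :
    ContDiffAt ℝ ∞ (stCoord (n := n) q₁ ∘ stPoint q₀) z := by
  have h1 := (contMDiffOn_stPoint (n := n) q₀).contMDiffAt ((isOpen_chartRange q₀).mem_nhds hz)
  have h2 := (contMDiffOn_stCoord (n := n) q₁).contMDiffAt ((isOpen_chartDomain q₁).mem_nhds hz')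
  exact contMDiffAt_iff_contDiffAt.1 (h2.comp z h1)

/-- Both sides are the product `lor` of the same two tangent vectors, computed in two charts. -/
lemma metricForm_transition {q₀ q₁ : N} {z : ℝ × Coord n} (hz : z ∈ chartRange q₀)
    (hz' : stPoint q₀ z ∈ chartDomain (n := n) q₁) (V W : ℝ × Coord n) :
    g.metricForm q₀ z V W = g.metricForm q₁ ((stCoord q₁ ∘ stPoint q₀) z)
      (fderiv ℝ (stCoord (n := n) q₁ ∘ stPoint q₀) z V)
      (fderiv ℝ (stCoord (n := n) q₁ ∘ stPoint q₀) z W) := by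
  have h1 : MDifferentiableAt 𝓘(ℝ, ℝ × Coord n) (stModel n) (stPoint (n := n) q₀) z :=
    ((contMDiffOn_stPoint (n := n) q₀).contMDiffAt
      ((isOpen_chartRange q₀).mem_nhds hz)).mdifferentiableAt (by simp)
  have h2 : ∀ V : ℝ × Coord n,
      vecCoord q₀ (mfderiv 𝓘(ℝ, ℝ × Coord n) (stModel n) (stPoint (n := n) q₀) z V) = V := by
    intro V
    refine (fderiv_stCoord_comp h1 (stPoint_mem hz) V).symm.trans ?_
    have : stCoord (n := n) q₀ ∘ stPoint q₀ =ᶠ[𝓝 z] id := by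
      filter_upwards [(isOpen_chartRange (n := n) q₀).mem_nhds hz] with z' hz'
      exact stCoord_stPoint hz'
    rw [this.fderiv_eq, fderiv_id]
    rfl
  have h3 := (g.lor_eq_coordMetric (stPoint_mem hz)
    (mfderiv 𝓘(ℝ, ℝ × Coord n) (stModel n) (stPoint (n := n) q₀) z V)
    (mfderiv 𝓘(ℝ, ℝ × Coord n) (stModel n) (stPoint (n := n) q₀) z W)).symm.trans
    (g.lor_eq_coordMetric hz' _ _)
  refine Eq.trans ?_ (h3.trans ?_)
  · rw [stCoord_stPoint hz, metricForm_apply]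
    exact (congrArg₂ _ (h2 V) (h2 W)).symm
  · exact congrArg₂ _ (fderiv_stCoord_comp h1 hz' V).symm (fderiv_stCoord_comp h1 hz' W).symm

/-- The map pulls a form back to a nondegenerate one, so it is injective, and source and target have
equal dimension. -/
lemma transition_surjective (g : MetricFamily n N) {q₀ q₁ : N} {z : ℝ × Coord n} (hz : z ∈ chartRange q₀)
    (hz' : stPoint q₀ z ∈ chartDomain (n := n) q₁) :
    Function.Surjective (fderiv ℝ (stCoord (n := n) q₁ ∘ stPoint q₀) z) := by
  have hinj : Function.Injective (fderiv ℝ (stCoord (n := n) q₁ ∘ stPoint q₀) z) := by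
    rw [injective_iff_map_eq_zero]
    intro V hV
    apply (g.isInvertible_metricForm hz).injective
    refine ContinuousLinearMap.ext fun W => ?_
    rw [g.metricForm_transition hz hz', hV, map_zero, map_zero]
    rfl
  exact LinearMap.injective_iff_surjective.1 hinj

/-- The wave map equation in the coordinates of the preferred chart at `q₀`, in null form. -/
def ChartWave (q₀ : N) (Y : ℝ × ℝ → ℝ × Coord n) (p : ℝ × ℝ) : Prop :=
  fderiv ℝ (fun p' => fderiv ℝ Y p' (1, 1)) p (1, -1)
    + g.christSharp q₀ (Y p, fderiv ℝ Y p (1, 1), fderiv ℝ Y p (1, -1)) = 0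

lemma fderiv_fderiv_apply {F : Type} [NormedAddCommGroup F] [NormedSpace ℝ F] {Y : ℝ × ℝ → F}
    {p : ℝ × ℝ} (hY : ContDiffAt ℝ 2 Y p) (a b : ℝ × ℝ) :
    fderiv ℝ (fun p' => fderiv ℝ Y p' b) p a = fderiv ℝ (fderiv ℝ Y) p a b := by
  have hY' : DifferentiableAt ℝ (fderiv ℝ Y) p :=
    (hY.fderiv_right (m := 1) (by norm_num)).differentiableAt (by simp)
  have h : HasFDerivAt (fun p' => fderiv ℝ Y p' b) ((fderiv ℝ (fderiv ℝ Y) p).flip b) p := by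
    simpa using hY'.hasFDerivAt.clm_apply (hasFDerivAt_const b p)
  exact congrArg (fun T => T a) h.fderiv

/-- The wave operator factors as (∂ₜ - ∂ₓ)(∂ₜ + ∂ₓ), and by symmetry of Γ the value Γ(∂ₜY + ∂ₓY, ∂ₜY
- ∂ₓY) is the difference of the two quadratic terms. -/
lemma chartWave_iff_acceleration {q₀ : N} {Y : ℝ × ℝ → ℝ × Coord n} {p : ℝ × ℝ}
    (hY : ContDiffAt ℝ 2 Y p) (hp : Y p ∈ chartRange q₀) :
    g.ChartWave q₀ Y p ↔ ∀ W, acceleration (g.metricForm q₀) Y p (1, 0) W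
      = acceleration (g.metricForm q₀) Y p (0, 1) W := by
  have hs : ∀ a b, fderiv ℝ (fderiv ℝ Y) p a b = fderiv ℝ (fderiv ℝ Y) p b a :=
    fun a b => (hY.isSymmSndFDerivAt (by simp)).eq a b
  have e1 : ((1 : ℝ), (1 : ℝ)) = (1, 0) + (0, 1) := by simp
  have e2 : ((1 : ℝ), (-1 : ℝ)) = (1, 0) - (0, 1) := by simp
  have h1 : ∀ W, g.metricForm q₀ (Y p) (fderiv ℝ (fun p' => fderiv ℝ Y p' (1, 1)) p (1, -1)
      + g.christSharp q₀ (Y p, fderiv ℝ Y p (1, 1), fderiv ℝ Y p (1, -1))) W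
      = acceleration (g.metricForm q₀) Y p (1, 0) W
        - acceleration (g.metricForm q₀) Y p (0, 1) W := by
    intro W
    rw [map_add, add_apply, g.metricForm_christSharp hp, acceleration, acceleration,
      fderiv_fderiv_apply hY, fderiv_fderiv_apply hY, fderiv_fderiv_apply hY, e1, e2]
    simp only [map_add, map_sub, add_apply, sub_apply]
    rw [hs (0, 1) (1, 0), g.christForm_symm hp (fderiv ℝ Y p (0, 1)) (fderiv ℝ Y p (1, 0))]
    ring
  constructor
  · intro h W
    have := h1 W
    rw [show _ = _ from h, map_zero] at this
    exact (sub_eq_zero.1 this.symm)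
  · intro h
    apply (g.isInvertible_metricForm hp).injective
    refine ContinuousLinearMap.ext fun W => ?_
    rw [h1, h W, sub_self, map_zero]
    rfl

lemma contDiffWithinAt_inCoord {q₀ : N} {y : ℝ × ℝ → ℝ × N} {S : Set (ℝ × ℝ)} {p : ℝ × ℝ}
    (hy : ContMDiffWithinAt 𝓘(ℝ, ℝ × ℝ) (stModel n) ∞ y S p)
    (hp : y p ∈ chartDomain (n := n) q₀) : ContDiffWithinAt ℝ ∞ (inCoord (n := n) q₀ y) S p :=
  contMDiffWithinAt_iff_contDiffWithinAt.1 (((contMDiffOn_stCoord (n := n) q₀).contMDiffAt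
    ((isOpen_chartDomain q₀).mem_nhds hp)).comp_contMDiffWithinAt p hy)

lemma contDiffAt_inCoord {q₀ : N} {y : ℝ × ℝ → ℝ × N} {p : ℝ × ℝ}
    (hy : ContMDiffAt 𝓘(ℝ, ℝ × ℝ) (stModel n) ∞ y p)
    (hp : y p ∈ chartDomain (n := n) q₀) : ContDiffAt ℝ ∞ (inCoord (n := n) q₀ y) p :=
  contDiffWithinAt_univ.1 (contDiffWithinAt_inCoord (contMDiffWithinAt_univ.2 hy) hp)

/-- The wave map equation does not depend on the chart. -/
theorem waveMapAt_iff_chartWave {q₀ : N} {y : ℝ × ℝ → ℝ × N} {p : ℝ × ℝ}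
    (hy : ContMDiffAt 𝓘(ℝ, ℝ × ℝ) (stModel n) ∞ y p) (hp : y p ∈ chartDomain (n := n) q₀) :
    g.WaveMapAt y p ↔ g.ChartWave q₀ (inCoord q₀ y) p := by
  set q₁ := (y p).2 with hq₁
  have hp₁ : y p ∈ chartDomain (n := n) q₁ := mem_chartDomain_self _
  have hY₀ := contDiffAt_inCoord hy hp
  have hY₁ := contDiffAt_inCoord hy hp₁
  have hz₀ : inCoord q₀ y p ∈ chartRange (n := n) q₀ := stCoord_mem hp
  have hz₁ : inCoord q₁ y p ∈ chartRange (n := n) q₁ := stCoord_mem hp₁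
  have h1 : g.WaveMapAt y p ↔ ∀ W, acceleration (g.metricForm q₁) (inCoord q₁ y) p (1, 0) W
      = acceleration (g.metricForm q₁) (inCoord q₁ y) p (0, 1) W := by
    refine forall_congr' fun W => ?_
    rw [← hq₁, g.christoffel_eq hz₁, g.christoffel_eq hz₁, ← metricForm_apply, map_sub, sub_apply,
      acceleration, acceleration]
    constructor <;> intro h <;> linarith
  rw [h1, g.chartWave_iff_acceleration (hY₀.of_le (mod_cast le_top : ((2 : ℕ∞) : WithTop ℕ∞) ≤ ∞)) hz₀]
  set φ : ℝ × Coord n → ℝ × Coord n := stCoord (n := n) q₁ ∘ stPoint q₀ with hφ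
  have hback : ∀ p', y p' ∈ chartDomain (n := n) q₀ →
      stPoint (n := n) q₀ (inCoord q₀ y p') = y p' := fun p' hp' => stPoint_stCoord hp'
  have hz₀' : stPoint q₀ (inCoord (n := n) q₀ y p) ∈ chartDomain (n := n) q₁ := by
    rw [hback p hp]; exact hp₁
  have hφY : φ (inCoord q₀ y p) = inCoord q₁ y p := congrArg (stCoord (n := n) q₁) (hback p hp)
  have hev : inCoord q₁ y =ᶠ[𝓝 p] φ ∘ inCoord q₀ y := by
    filter_upwards [hy.continuousAt.preimage_mem_nhds ((isOpen_chartDomain q₀).mem_nhds hp)]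
      with p' hp'
    exact (congrArg (stCoord (n := n) q₁) (hback p' hp')).symm
  -- The transition map is an isometry between the coordinate metrics, so accelerations correspond;
  -- since its derivative is onto, testing against all W is the same in both charts.
  have key : ∀ d W, acceleration (g.metricForm q₁) (inCoord q₁ y) p d
      (fderiv ℝ φ (inCoord (n := n) q₀ y p) W) = acceleration (g.metricForm q₀) (inCoord q₀ y) p d W := by
    intro d W
    rw [← acceleration_comp (G₁ := g.metricForm q₁) (φ := φ)
      (hY₀.of_le (mod_cast le_top : ((2 : ℕ∞) : WithTop ℕ∞) ≤ ∞))
      ((contDiffAt_transition hz₀ hz₀').of_le (mod_cast le_top : ((2 : ℕ∞) : WithTop ℕ∞) ≤ ∞))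
      (by rw [hφY]; exact g.differentiableAt_metricForm hz₁) ?_
      (g.differentiableAt_metricForm hz₀) (fun V W => g.metricForm_symm _ _ _ _) d W]
    · have h2 : (fun p' => fderiv ℝ (inCoord q₁ y) p' d)
          =ᶠ[𝓝 p] fun p' => fderiv ℝ (φ ∘ inCoord q₀ y) p' d :=
        hev.fderiv.fun_comp (fun T => T d)
      rw [acceleration, acceleration, h2.fderiv_eq, hev.fderiv_eq, hev.eq_of_nhds]
    · have h3 : ∀ᶠ z in 𝓝 (inCoord q₀ y p), z ∈ chartRange (n := n) q₀ :=
        (isOpen_chartRange q₀).mem_nhds hz₀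
      have h4 : ∀ᶠ z in 𝓝 (inCoord q₀ y p), stPoint q₀ z ∈ chartDomain (n := n) q₁ :=
        ((continuousOn_stPoint q₀).continuousAt ((isOpen_chartRange q₀).mem_nhds
          hz₀)).preimage_mem_nhds ((isOpen_chartDomain q₁).mem_nhds hz₀')
      filter_upwards [h3, h4] with z hz hz' V W
      exact g.metricForm_transition hz hz' V W
  constructor
  · intro h W
    rw [← key, ← key, h]
  · intro h W
    obtain ⟨W', rfl⟩ := g.transition_surjective hz₀ hz₀' W
    rw [key, key, h]

end MetricFamily

/-! ### Integration along lines and uniqueness in a chart -/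

/-- Lines may start on the axis, where no two-sided derivative exists. Reversing the parameter moves
that endpoint to the right, where the standard inequality requires no derivative. -/
lemma norm_sub_le_of_hasDerivAt_Ioc {F : Type} [NormedAddCommGroup F] [NormedSpace ℝ F]
    {f f' : ℝ → F} {a b C : ℝ} (hab : a ≤ b) (hf : ContinuousOn f (Icc a b))
    (hf' : ∀ s ∈ Ioc a b, HasDerivAt f (f' s) s) (hC : ∀ s ∈ Ioc a b, ‖f' s‖ ≤ C) :
    ‖f b - f a‖ ≤ C * (b - a) := by
  have key := norm_image_sub_le_of_norm_deriv_right_le_segment (f := fun s => f (a + b - s))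
    (f' := fun s => -f' (a + b - s)) (a := a) (b := b) (C := C)
    (hf.comp (by fun_prop) fun s hs => ⟨by linarith [hs.2], by linarith [hs.1]⟩)
    (fun s hs => by
      have h1 := (hf' (a + b - s) ⟨by linarith [hs.2], by linarith [hs.1]⟩).scomp s
        ((hasDerivAt_id s).const_sub (a + b))
      simpa [Function.comp_def] using h1.hasDerivWithinAt)
    (fun s hs => by
      rw [norm_neg]
      exact hC _ ⟨by linarith [hs.2], by linarith [hs.1]⟩) b ⟨hab, le_rfl⟩
  simpa [norm_sub_rev] using key

lemma hasDerivAt_comp_line {F : Type} [NormedAddCommGroup F] [NormedSpace ℝ F] {f : ℝ × ℝ → F}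
    {r d : ℝ × ℝ} {s : ℝ} (hf : DifferentiableAt ℝ f (r + s • d)) :
    HasDerivAt (fun s : ℝ => f (r + s • d)) (fderiv ℝ f (r + s • d) d) s := by
  have h1 : HasDerivAt (fun s : ℝ => r + s • d) d s := by
    simpa using ((hasDerivAt_id s).smul_const d).const_add r
  exact hf.hasFDerivAt.comp_hasDerivAt s h1

namespace MetricFamily

/-! ### The geometry of the half plane -/

lemma mem_upper {p : ℝ × ℝ} : p ∈ upper ↔ 0 ≤ p.1 := Iff.rfl

lemma upper_mem_nhds {p : ℝ × ℝ} (hp : 0 < p.1) : upper ∈ 𝓝 p :=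
  mem_of_superset ((isOpen_lt continuous_const continuous_fst).mem_nhds hp) fun q (h : 0 < q.1) =>
    show 0 ≤ q.1 from h.le

lemma isClosed_upper : IsClosed upper := isClosed_le continuous_const continuous_fst

lemma uniqueDiffOn_upper : UniqueDiffOn ℝ upper := by
  refine uniqueDiffOn_convex ?_ ?_
  · exact (convex_Ici (0 : ℝ)).is_linear_preimage (f := (Prod.fst : ℝ × ℝ → ℝ))
      (IsLinearMap.mk (by simp) (by simp))
  · exact ⟨(1, 0), mem_interior_iff_mem_nhds.2 (upper_mem_nhds (by simp))⟩

/-- The part above time `τ` of the causal past of `q` in the plane. -/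
def pastFrom (τ : ℝ) (q : ℝ × ℝ) : Set (ℝ × ℝ) := {r | τ ≤ r.1 ∧ |q.2 - r.2| ≤ q.1 - r.1}

lemma isCompact_pastFrom (τ : ℝ) (q : ℝ × ℝ) : IsCompact (pastFrom τ q) := by
  refine (isCompact_Icc.prod isCompact_Icc : IsCompact (Icc τ q.1 ×ˢ
    Icc (q.2 - (q.1 - τ)) (q.2 + (q.1 - τ)))).of_isClosed_subset ?_ ?_
  · exact (isClosed_le continuous_const continuous_fst).inter (isClosed_le
      (f := fun r : ℝ × ℝ => |q.2 - r.2|) (g := fun r => q.1 - r.1) (by fun_prop) (by fun_prop))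
  · rintro r ⟨h1, h2⟩
    have h3 := abs_le.1 h2
    have := abs_nonneg (q.2 - r.2)
    exact ⟨⟨h1, by linarith⟩, by constructor <;> linarith⟩

lemma self_mem_pastFrom {τ : ℝ} {q : ℝ × ℝ} (h : τ ≤ q.1) : q ∈ pastFrom τ q := by
  simp [pastFrom, h]

lemma pastFrom_trans {τ τ' : ℝ} {q r s : ℝ × ℝ} (hr : r ∈ pastFrom τ q) (hs : s ∈ pastFrom τ' r)
    (h : τ ≤ s.1) : s ∈ pastFrom τ q := by
  obtain ⟨_, h2⟩ := hr
  obtain ⟨_, h4⟩ := hs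
  refine ⟨h, ?_⟩
  have := abs_sub_le q.2 r.2 s.2
  linarith

lemma pastFrom_line {τ : ℝ} {q : ℝ × ℝ} {c s : ℝ} (hc : |c| ≤ 1) (h1 : τ ≤ s) (h2 : s ≤ q.1) :
    (s, q.2 + c * (q.1 - s)) ∈ pastFrom τ q := by
  refine ⟨h1, ?_⟩
  have : q.2 - (q.2 + c * (q.1 - s)) = -(c * (q.1 - s)) := by ring
  rw [this, abs_neg, abs_mul, abs_of_nonneg (by linarith : 0 ≤ q.1 - s)]
  nlinarith

variable {n : ℕ} {N : Type*} [TopologicalSpace N] [ChartedSpace (Coord n) N]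
variable (g : MetricFamily n N)

/-- A map together with its two null derivatives, in coordinates. -/
def nullJet (Y : ℝ × ℝ → ℝ × Coord n) (r : ℝ × ℝ) :
    (ℝ × Coord n) × (ℝ × Coord n) × (ℝ × Coord n) :=
  (Y r, fderivWithin ℝ Y upper r (1, 1), fderivWithin ℝ Y upper r (1, -1))

lemma contDiffWithinAt_fderivWithin {Y : ℝ × ℝ → ℝ × Coord n} {r : ℝ × ℝ} (hr : r ∈ upper)
    (hY : ContDiffWithinAt ℝ ∞ Y upper r) (d : ℝ × ℝ) :
    ContDiffWithinAt ℝ ∞ (fun r => fderivWithin ℝ Y upper r d) upper r :=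
  (hY.fderivWithin_right (m := ∞) uniqueDiffOn_upper (by simp) hr).clm_apply contDiffWithinAt_const

lemma contDiffWithinAt_nullJet {Y : ℝ × ℝ → ℝ × Coord n} {r : ℝ × ℝ} (hr : r ∈ upper)
    (hY : ContDiffWithinAt ℝ ∞ Y upper r) : ContDiffWithinAt ℝ ∞ (nullJet Y) upper r :=
  hY.prodMk ((contDiffWithinAt_fderivWithin hr hY _).prodMk (contDiffWithinAt_fderivWithin hr hY _))

/-- The two null directions span the plane, so the null jet carries the full first derivative. -/
lemma fderivWithin_eq_of_nullJet_eq {Y₁ Y₂ : ℝ × ℝ → ℝ × Coord n} {r : ℝ × ℝ}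
    (h : nullJet Y₁ r = nullJet Y₂ r) (d : ℝ × ℝ) :
    fderivWithin ℝ Y₁ upper r d = fderivWithin ℝ Y₂ upper r d := by
  simp only [nullJet, Prod.mk.injEq] at h
  have hd : d = ((d.1 + d.2) / 2) • ((1 : ℝ), (1 : ℝ)) + ((d.1 - d.2) / 2) • ((1 : ℝ), (-1 : ℝ)) := by
    ext <;> simp <;> ring
  rw [hd]
  simp only [map_add, map_smul, h.2.1, h.2.2]

lemma hasDerivAt_vertical {Y : ℝ × ℝ → ℝ × Coord n} {x s : ℝ} (hs : 0 < s)
    (hY : ContDiffWithinAt ℝ ∞ Y upper (s, x)) :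
    HasDerivAt (fun s => Y (s, x))
      ((1 / 2 : ℝ) • ((nullJet Y (s, x)).2.1 + (nullJet Y (s, x)).2.2)) s := by
  have h0 : upper ∈ 𝓝 (s, x) := upper_mem_nhds hs
  have hd : DifferentiableAt ℝ Y ((0, x) + s • ((1 : ℝ), (0 : ℝ))) := by
    have := (hY.contDiffAt h0).differentiableAt (by simp)
    simpa using this
  have h1 := hasDerivAt_comp_line hd
  have h2 : (1 / 2 : ℝ) • ((nullJet Y (s, x)).2.1 + (nullJet Y (s, x)).2.2)
      = fderiv ℝ Y (s, x) (1, 0) := by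
    simp only [nullJet, fderivWithin_of_mem_nhds h0]
    rw [← map_add, ← map_smul]
    congr 1
    ext <;> simp; norm_num
  rw [h2]
  simpa using h1

lemma fderiv_fderivWithin {F : Type} [NormedAddCommGroup F] [NormedSpace ℝ F] {Y : ℝ × ℝ → F}
    {p : ℝ × ℝ} (hp : 0 < p.1) (b : ℝ × ℝ) :
    (fun p' => fderivWithin ℝ Y upper p' b) =ᶠ[𝓝 p] fun p' => fderiv ℝ Y p' b := by
  filter_upwards [(isOpen_lt continuous_const continuous_fst).mem_nhds hp] with p' hp'
  rw [fderivWithin_of_mem_nhds (upper_mem_nhds hp')]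

/-- The wave equation read as an ordinary differential equation for P along lines of direction
(1,-1). The companion statement for Q uses the symmetry of second derivatives. -/
lemma hasDerivAt_null_left {q₀ : N} {Y : ℝ × ℝ → ℝ × Coord n} {x s : ℝ} (hs : 0 < s)
    (hY : ContDiffWithinAt ℝ ∞ Y upper (s, x - s)) (hw : g.ChartWave q₀ Y (s, x - s)) :
    HasDerivAt (fun s => (nullJet Y (s, x - s)).2.1)
      (-g.christSharp q₀ (nullJet Y (s, x - s))) s := by
  have h0 : upper ∈ 𝓝 (s, x - s) := upper_mem_nhds hs
  have he : (0, x) + s • ((1 : ℝ), (-1 : ℝ)) = (s, x - s) := by ext <;> simp; ring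
  have hd : DifferentiableAt ℝ (fun r => fderivWithin ℝ Y upper r (1, 1))
      ((0, x) + s • ((1 : ℝ), (-1 : ℝ))) := by
    rw [he]
    exact ((contDiffWithinAt_fderivWithin (le_of_lt hs) hY (1, 1)).contDiffAt h0).differentiableAt
      (by simp)
  have h1 := hasDerivAt_comp_line hd
  rw [he, (fderiv_fderivWithin (by exact hs) _).fderiv_eq] at h1
  have h2 : -g.christSharp q₀ (nullJet Y (s, x - s))
      = fderiv ℝ (fun p' => fderiv ℝ Y p' (1, 1)) (s, x - s) (1, -1) := by
    rw [ChartWave] at hw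
    simp only [nullJet, fderivWithin_of_mem_nhds h0]
    exact (eq_neg_of_add_eq_zero_left hw).symm
  rw [h2]
  refine h1.congr_of_eventuallyEq (Eventually.of_forall fun s => ?_)
  simp [nullJet, sub_eq_add_neg]

lemma hasDerivAt_null_right {q₀ : N} {Y : ℝ × ℝ → ℝ × Coord n} {x s : ℝ} (hs : 0 < s)
    (hY : ContDiffWithinAt ℝ ∞ Y upper (s, x + s)) (hw : g.ChartWave q₀ Y (s, x + s)) :
    HasDerivAt (fun s => (nullJet Y (s, x + s)).2.2)
      (-g.christSharp q₀ (nullJet Y (s, x + s))) s := by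
  have h0 : upper ∈ 𝓝 (s, x + s) := upper_mem_nhds hs
  have he : (0, x) + s • ((1 : ℝ), (1 : ℝ)) = (s, x + s) := by ext <;> simp
  have hd : DifferentiableAt ℝ (fun r => fderivWithin ℝ Y upper r (1, -1))
      ((0, x) + s • ((1 : ℝ), (1 : ℝ))) := by
    rw [he]
    exact ((contDiffWithinAt_fderivWithin (le_of_lt hs) hY (1, -1)).contDiffAt h0).differentiableAt
      (by simp)
  have h1 := hasDerivAt_comp_line hd
  rw [he, (fderiv_fderivWithin (by exact hs) _).fderiv_eq] at h1
  have hY' : ContDiffAt ℝ 2 Y (s, x + s) :=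
    (hY.contDiffAt h0).of_le (mod_cast le_top : ((2 : ℕ∞) : WithTop ℕ∞) ≤ ∞)
  have h2 : -g.christSharp q₀ (nullJet Y (s, x + s))
      = fderiv ℝ (fun p' => fderiv ℝ Y p' (1, -1)) (s, x + s) (1, 1) := by
    rw [ChartWave, fderiv_fderiv_apply hY', (hY'.isSymmSndFDerivAt (by simp)).eq,
      ← fderiv_fderiv_apply hY'] at hw
    simp only [nullJet, fderivWithin_of_mem_nhds h0]
    exact (eq_neg_of_add_eq_zero_left hw).symm
  rw [h2]
  refine h1.congr_of_eventuallyEq (Eventually.of_forall fun s => ?_)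
  simp [nullJet]

/-- Solutions of the wave map equation with equal first order data on the base of a small triangle
agree on the triangle. -/
lemma nullJet_eq_of_base {q₀ : N} {Y₁ Y₂ : ℝ × ℝ → ℝ × Coord n} {τ : ℝ} {q : ℝ × ℝ} (hτ : 0 ≤ τ)
    {C : Set ((ℝ × Coord n) × (ℝ × Coord n) × (ℝ × Coord n))} {L : NNReal}
    (hL : LipschitzOnWith L (g.christSharp q₀) C) (hsmall : (q.1 - τ) * (L + 1) < 1)
    (h₁ : ∀ r ∈ pastFrom τ q, ContDiffWithinAt ℝ ∞ Y₁ upper r)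
    (h₂ : ∀ r ∈ pastFrom τ q, ContDiffWithinAt ℝ ∞ Y₂ upper r)
    (hC₁ : ∀ r ∈ pastFrom τ q, nullJet Y₁ r ∈ C) (hC₂ : ∀ r ∈ pastFrom τ q, nullJet Y₂ r ∈ C)
    (hw₁ : ∀ r ∈ pastFrom τ q, τ < r.1 → g.ChartWave q₀ Y₁ r)
    (hw₂ : ∀ r ∈ pastFrom τ q, τ < r.1 → g.ChartWave q₀ Y₂ r)
    (hbase : ∀ r ∈ pastFrom τ q, r.1 = τ → nullJet Y₁ r = nullJet Y₂ r) :
    ∀ r ∈ pastFrom τ q, nullJet Y₁ r = nullJet Y₂ r := by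
  by_cases hq : pastFrom τ q = ∅
  · simp [hq]
  have hup : ∀ r ∈ pastFrom τ q, r ∈ upper := fun r hr => hτ.trans hr.1
  have hcont : ContinuousOn (fun r => nullJet Y₁ r - nullJet Y₂ r) (pastFrom τ q) := by
    intro r hr
    exact ((contDiffWithinAt_nullJet (hup r hr) (h₁ r hr)).continuousWithinAt.sub
      (contDiffWithinAt_nullJet (hup r hr) (h₂ r hr)).continuousWithinAt).mono hup
  -- Where the difference of the jets has its largest norm m, each component is integrated along its
  -- own characteristic from the base. This gives m ≤ (L + 1) m · height, hence m = 0. The summand 1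
  -- in L + 1 covers the component Y, whose derivative is linear in the jet and not given by Γ.
  obtain ⟨r₀, hr₀, hmax⟩ := (isCompact_pastFrom τ q).exists_isMaxOn
    (nonempty_iff_ne_empty.2 hq) hcont.norm
  set m := ‖nullJet Y₁ r₀ - nullJet Y₂ r₀‖ with hm
  have hle : ∀ r ∈ pastFrom τ q, ‖nullJet Y₁ r - nullJet Y₂ r‖ ≤ m := fun r hr => hmax hr
  have hm0 : 0 ≤ m := norm_nonneg _
  have hF : ∀ r ∈ pastFrom τ q,
      ‖g.christSharp q₀ (nullJet Y₁ r) - g.christSharp q₀ (nullJet Y₂ r)‖ ≤ (L + 1) * m := by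
    intro r hr
    have := hL.dist_le_mul _ (hC₁ r hr) _ (hC₂ r hr)
    rw [dist_eq_norm, dist_eq_norm] at this
    have h2 := hle r hr
    nlinarith [L.coe_nonneg]
  have hmono : ∀ c, |c| ≤ 1 → ∀ s ∈ Icc τ r₀.1, (s, r₀.2 + c * (r₀.1 - s)) ∈ pastFrom τ q :=
    fun c hc s hs => pastFrom_trans hr₀ (pastFrom_line hc hs.1 hs.2) hs.1
  have hline : ∀ c, |c| ≤ 1 → ContinuousOn (fun s => nullJet Y₁ (s, r₀.2 + c * (r₀.1 - s))
      - nullJet Y₂ (s, r₀.2 + c * (r₀.1 - s))) (Icc τ r₀.1) := by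
    intro c hc
    exact hcont.comp (f := fun s => (s, r₀.2 + c * (r₀.1 - s))) (by fun_prop) (hmono c hc)
  have hb : ∀ c, |c| ≤ 1 → nullJet Y₁ (τ, r₀.2 + c * (r₀.1 - τ))
      - nullJet Y₂ (τ, r₀.2 + c * (r₀.1 - τ)) = 0 := fun c hc => by
    rw [hbase _ (hmono c hc τ ⟨le_rfl, hr₀.1⟩) rfl, sub_self]
  have e0 : ∀ c, (r₀.1, r₀.2 + c * (r₀.1 - r₀.1)) = r₀ := fun c => by ext <;> simp
  have b1 : ‖(nullJet Y₁ r₀ - nullJet Y₂ r₀).1‖ ≤ ((L + 1) * m) * (r₀.1 - τ) := by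
    have h0 := hmono 0 (by simp)
    simp only [zero_mul, add_zero] at h0
    have := norm_sub_le_of_hasDerivAt_Ioc (f := fun s => Y₁ (s, r₀.2) - Y₂ (s, r₀.2))
      (a := τ) (b := r₀.1) (C := (L + 1) * m) hr₀.1
      (by simpa [nullJet] using (hline 0 (by simp)).fst)
      (fun s hs => (hasDerivAt_vertical (hτ.trans_lt hs.1) (h₁ _ (h0 s ⟨hs.1.le, hs.2⟩))).sub
        (hasDerivAt_vertical (hτ.trans_lt hs.1) (h₂ _ (h0 s ⟨hs.1.le, hs.2⟩))))
      (fun s hs => by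
        have h3 := hle _ (h0 s ⟨hs.1.le, hs.2⟩)
        rw [← smul_sub, norm_smul, add_sub_add_comm]
        have h4 := (norm_snd_le (nullJet Y₁ (s, r₀.2) - nullJet Y₂ (s, r₀.2))).trans h3
        have h5 := (norm_fst_le (nullJet Y₁ (s, r₀.2) - nullJet Y₂ (s, r₀.2)).2).trans h4
        have h6 := (norm_snd_le (nullJet Y₁ (s, r₀.2) - nullJet Y₂ (s, r₀.2)).2).trans h4
        have h7 := norm_add_le (nullJet Y₁ (s, r₀.2) - nullJet Y₂ (s, r₀.2)).2.1
          (nullJet Y₁ (s, r₀.2) - nullJet Y₂ (s, r₀.2)).2.2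
        have h8 : ‖(1 / 2 : ℝ)‖ = 1 / 2 := by norm_num
        rw [h8]
        simp only [Prod.snd_sub, Prod.fst_sub] at h5 h6 h7
        nlinarith [L.coe_nonneg])
    have hb0 := congrArg Prod.fst (hb 0 (by simp))
    simp only [zero_mul, add_zero, nullJet, Prod.fst_sub, Prod.fst_zero] at hb0
    rw [hb0, sub_zero] at this
    simpa [nullJet] using this
  have b2 : ‖(nullJet Y₁ r₀ - nullJet Y₂ r₀).2.1‖ ≤ ((L + 1) * m) * (r₀.1 - τ) := by
    have hs1 : ∀ s, r₀.2 + 1 * (r₀.1 - s) = (r₀.2 + r₀.1) - s := fun s => by ring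
    have h0 := hmono 1 (by simp)
    have hl := (hline 1 (by simp)).snd.fst
    have hb0 := congrArg (fun e => e.2.1) (hb 1 (by simp))
    have e1 := e0 1
    simp only [hs1] at h0 hl hb0 e1
    have := norm_sub_le_of_hasDerivAt_Ioc
      (f := fun s => (nullJet Y₁ (s, (r₀.2 + r₀.1) - s)).2.1 - (nullJet Y₂ (s, (r₀.2 + r₀.1) - s)).2.1)
      (a := τ) (b := r₀.1) (C := (L + 1) * m) hr₀.1 hl
      (fun s hs => (g.hasDerivAt_null_left (hτ.trans_lt hs.1) (h₁ _ (h0 s ⟨hs.1.le, hs.2⟩))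
          (hw₁ _ (h0 s ⟨hs.1.le, hs.2⟩) hs.1)).sub
        (g.hasDerivAt_null_left (hτ.trans_lt hs.1) (h₂ _ (h0 s ⟨hs.1.le, hs.2⟩))
          (hw₂ _ (h0 s ⟨hs.1.le, hs.2⟩) hs.1)))
      (fun s hs => by
        rw [neg_sub_neg, norm_sub_rev]
        exact hF _ (h0 s ⟨hs.1.le, hs.2⟩))
    simp only [Prod.snd_sub, Prod.fst_sub, Prod.snd_zero, Prod.fst_zero] at hb0 ⊢
    rw [hb0, sub_zero, e1] at this
    exact this
  have b3 : ‖(nullJet Y₁ r₀ - nullJet Y₂ r₀).2.2‖ ≤ ((L + 1) * m) * (r₀.1 - τ) := by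
    have hs1 : ∀ s, r₀.2 + (-1) * (r₀.1 - s) = (r₀.2 - r₀.1) + s := fun s => by ring
    have h0 := hmono (-1) (by simp)
    have hl := (hline (-1) (by simp)).snd.snd
    have hb0 := congrArg (fun e => e.2.2) (hb (-1) (by simp))
    have e1 := e0 (-1)
    simp only [hs1] at h0 hl hb0 e1
    have := norm_sub_le_of_hasDerivAt_Ioc
      (f := fun s => (nullJet Y₁ (s, (r₀.2 - r₀.1) + s)).2.2 - (nullJet Y₂ (s, (r₀.2 - r₀.1) + s)).2.2)
      (a := τ) (b := r₀.1) (C := (L + 1) * m) hr₀.1 hl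
      (fun s hs => (g.hasDerivAt_null_right (hτ.trans_lt hs.1) (h₁ _ (h0 s ⟨hs.1.le, hs.2⟩))
          (hw₁ _ (h0 s ⟨hs.1.le, hs.2⟩) hs.1)).sub
        (g.hasDerivAt_null_right (hτ.trans_lt hs.1) (h₂ _ (h0 s ⟨hs.1.le, hs.2⟩))
          (hw₂ _ (h0 s ⟨hs.1.le, hs.2⟩) hs.1)))
      (fun s hs => by
        rw [neg_sub_neg, norm_sub_rev]
        exact hF _ (h0 s ⟨hs.1.le, hs.2⟩))
    simp only [Prod.snd_sub, Prod.snd_zero] at hb0 ⊢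
    rw [hb0, sub_zero, e1] at this
    exact this
  have hfin : m ≤ ((L + 1) * m) * (r₀.1 - τ) :=
    norm_prod_le_iff.2 ⟨b1, norm_prod_le_iff.2 ⟨b2, b3⟩⟩
  have hr₀q : r₀.1 ≤ q.1 := by
    have := hr₀.2
    have := abs_nonneg (q.2 - r₀.2)
    linarith
  have hm1 : m = 0 := by
    by_contra hne
    have hpos : 0 < m := lt_of_le_of_ne hm0 (Ne.symm hne)
    have h5 : (r₀.1 - τ) * (L + 1) ≤ (q.1 - τ) * (L + 1) := by
      gcongr
    nlinarith
  intro r hr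
  have := hle r hr
  rw [hm1] at this
  exact sub_eq_zero.1 (norm_le_zero_iff.1 this)

end MetricFamily

/-! ### Uniqueness on backward triangles for maps into the manifold -/

namespace MetricFamily

variable {n : ℕ} {N : Type*} [TopologicalSpace N] [ChartedSpace (Coord n) N]
variable (g : MetricFamily n N)

/-- The derivative of `y` at `r` in the direction `d`, as a point of the tangent bundle. -/
def dirDeriv (n : ℕ) {N : Type*} [TopologicalSpace N] [ChartedSpace (Coord n) N]
    (y : ℝ × ℝ → ℝ × N) (r d : ℝ × ℝ) : TangentBundle (stModel n) (ℝ × N) :=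
  ⟨y r, mfderivWithin 𝓘(ℝ, ℝ × ℝ) (stModel n) y upper r d⟩

/-- Equality of the values and the first derivatives of two maps at a point. -/
def JetEq (n : ℕ) {N : Type*} [TopologicalSpace N] [ChartedSpace (Coord n) N]
    (y₁ y₂ : ℝ × ℝ → ℝ × N) (r : ℝ × ℝ) : Prop :=
  ∀ d, dirDeriv n y₁ r d = dirDeriv n y₂ r d

/-- The coordinates of the vector part of a point of the tangent bundle. -/
def bundleCoord (q₀ : N) (V : TangentBundle (stModel n) (ℝ × N)) : ℝ × Coord n :=
  vecCoord (n := n) q₀ V.2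

/-- Smoothness up to the axis, at a point of the half plane. -/
abbrev SmoothAt (n : ℕ) {N : Type*} [TopologicalSpace N] [ChartedSpace (Coord n) N]
    (y : ℝ × ℝ → ℝ × N) (r : ℝ × ℝ) : Prop :=
  ContMDiffWithinAt 𝓘(ℝ, ℝ × ℝ) (stModel n) ∞ y upper r

lemma JetEq.eq {y₁ y₂ : ℝ × ℝ → ℝ × N} {r : ℝ × ℝ} (h : JetEq n y₁ y₂ r) : y₁ r = y₂ r :=
  congrArg Bundle.TotalSpace.proj (h 0)

variable [IsManifold (𝓡 n) ∞ N]

lemma fderivWithin_inCoord {q₀ : N} {y : ℝ × ℝ → ℝ × N} {r : ℝ × ℝ} (hr : r ∈ upper)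
    (hy : SmoothAt n y r) (hq : y r ∈ chartDomain (n := n) q₀) (d : ℝ × ℝ) :
    fderivWithin ℝ (inCoord (n := n) q₀ y) upper r d = bundleCoord q₀ (dirDeriv n y r d) :=
  fderivWithin_stCoord_comp (hy.mdifferentiableWithinAt (by simp)) (uniqueDiffOn_upper r hr) hq d

lemma eq_of_bundleCoord_eq {q₀ : N} {V W : TangentBundle (stModel n) (ℝ × N)}
    (hp : V.proj = W.proj) (hV : V.proj ∈ chartDomain (n := n) q₀)
    (h : bundleCoord q₀ V = bundleCoord q₀ W) : V = W := by
  obtain ⟨p, v⟩ := V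
  obtain ⟨p', w⟩ := W
  obtain rfl : p = p' := hp
  exact congrArg (Bundle.TotalSpace.mk p) (vecCoord_injective (n := n) hV h)

lemma nullJet_eq_of_jetEq {q₀ : N} {y₁ y₂ : ℝ × ℝ → ℝ × N} {r : ℝ × ℝ} (hr : r ∈ upper)
    (h₁ : SmoothAt n y₁ r) (h₂ : SmoothAt n y₂ r) (hq : y₁ r ∈ chartDomain (n := n) q₀)
    (h : JetEq n y₁ y₂ r) : nullJet (inCoord (n := n) q₀ y₁) r = nullJet (inCoord q₀ y₂) r := by
  have hq' : y₂ r ∈ chartDomain (n := n) q₀ := h.eq ▸ hq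
  simp only [nullJet, fderivWithin_inCoord hr h₁ hq, fderivWithin_inCoord hr h₂ hq', h _]
  exact congrArg₂ _ (congrArg (stCoord (n := n) q₀) h.eq) rfl

lemma jetEq_of_nullJet_eq {q₀ : N} {y₁ y₂ : ℝ × ℝ → ℝ × N} {r : ℝ × ℝ} (hr : r ∈ upper)
    (h₁ : SmoothAt n y₁ r) (h₂ : SmoothAt n y₂ r) (hq : y₁ r ∈ chartDomain (n := n) q₀)
    (hq' : y₂ r ∈ chartDomain (n := n) q₀)
    (h : nullJet (inCoord (n := n) q₀ y₁) r = nullJet (inCoord q₀ y₂) r) : JetEq n y₁ y₂ r := by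
  have he : y₁ r = y₂ r := by
    have h1 : stCoord (n := n) q₀ (y₁ r) = stCoord q₀ (y₂ r) := congrArg Prod.fst h
    rw [← stPoint_stCoord hq, h1, stPoint_stCoord hq']
  intro d
  refine eq_of_bundleCoord_eq (q₀ := q₀) he hq ?_
  rw [← fderivWithin_inCoord hr h₁ hq, ← fderivWithin_inCoord hr h₂ hq',
    fderivWithin_eq_of_nullJet_eq h]

lemma continuousWithinAt_nullJet {q₀ : N} {y : ℝ × ℝ → ℝ × N} {r : ℝ × ℝ} (hr : r ∈ upper)
    (hy : SmoothAt n y r) (hq : y r ∈ chartDomain (n := n) q₀) :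
    ContinuousWithinAt (nullJet (inCoord (n := n) q₀ y)) upper r :=
  (contDiffWithinAt_nullJet hr (contDiffWithinAt_inCoord hy hq)).continuousWithinAt

lemma chartWave_of_waveMapAt {q₀ : N} {y : ℝ × ℝ → ℝ × N} {r : ℝ × ℝ} (hr : 0 < r.1)
    (hy : SmoothAt n y r) (hq : y r ∈ chartDomain (n := n) q₀) (hw : g.WaveMapAt y r) :
    g.ChartWave q₀ (inCoord q₀ y) r :=
  (g.waveMapAt_iff_chartWave (hy.contMDiffAt (upper_mem_nhds hr)) hq).1 hw

/-- Uniqueness for the initial value problem of the wave map equation, with data at time `τ`. -/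
theorem jetEq_of_base [T2Space N] {y₁ y₂ : ℝ × ℝ → ℝ × N} {τ : ℝ} (hτ : 0 ≤ τ) {q : ℝ × ℝ}
    (h₁ : ∀ r ∈ pastFrom τ q, SmoothAt n y₁ r) (h₂ : ∀ r ∈ pastFrom τ q, SmoothAt n y₂ r)
    (hw₁ : ∀ r ∈ pastFrom τ q, τ < r.1 → g.WaveMapAt y₁ r)
    (hw₂ : ∀ r ∈ pastFrom τ q, τ < r.1 → g.WaveMapAt y₂ r)
    (hbase : ∀ r ∈ pastFrom τ q, r.1 = τ → JetEq n y₁ y₂ r) :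
    ∀ r ∈ pastFrom τ q, JetEq n y₁ y₂ r := by
  by_contra! hbad
  -- A lowest point s of the closure of the bad set leads to a contradiction: the jets agree below
  -- the level of s, by continuity also on it, and then near s by uniqueness in a chart on small
  -- triangles based on that level.
  set B := {r | r ∈ pastFrom τ q ∧ ¬ JetEq n y₁ y₂ r} with hB
  have hBs : closure B ⊆ pastFrom τ q :=
    closure_minimal (fun r hr => hr.1) (isCompact_pastFrom τ q).isClosed
  have hBc : IsCompact (closure B) := (isCompact_pastFrom τ q).of_isClosed_subset isClosed_closure hBs
  obtain ⟨r₁, hr₁, hr₁'⟩ := hbad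
  obtain ⟨s, hs, hmin⟩ := hBc.exists_isMinOn ⟨r₁, subset_closure ⟨hr₁, hr₁'⟩⟩
    continuous_fst.continuousOn
  have hlow : ∀ r ∈ pastFrom τ q, r.1 < s.1 → JetEq n y₁ y₂ r := by
    intro r hr hrs
    by_contra h
    exact absurd (hmin (subset_closure ⟨hr, h⟩)) (not_le.2 hrs)
  have hup : ∀ r ∈ pastFrom τ q, r ∈ upper := fun r hr => hτ.trans hr.1
  have hlevel : ∀ r ∈ pastFrom τ q, r.1 = s.1 → JetEq n y₁ y₂ r := by
    intro r hr hrs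
    rcases eq_or_lt_of_le hr.1 with h0 | h0
    · exact hbase r hr h0.symm
    have hev : ∀ᶠ σ in 𝓝[>] (0 : ℝ), (r.1 - σ, r.2) ∈ pastFrom τ q ∧ r.1 - σ < s.1 := by
      filter_upwards [Ioo_mem_nhdsGT (sub_pos.2 h0)] with σ hσ
      refine ⟨⟨by simp only; linarith [hσ.2], ?_⟩, by linarith [hσ.1]⟩
      have := hr.2
      simp only
      linarith [hσ.1]
    have hlim : Tendsto (fun σ : ℝ => (r.1 - σ, r.2)) (𝓝[>] 0) (𝓝[upper] r) := by
      refine tendsto_nhdsWithin_iff.2 ⟨?_, hev.mono fun σ hσ => hup _ hσ.1⟩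
      have : Tendsto (fun σ : ℝ => (r.1 - σ, r.2)) (𝓝 0) (𝓝 (r.1 - 0, r.2)) :=
        Continuous.tendsto (by fun_prop) 0
      rw [sub_zero] at this
      exact this.mono_left nhdsWithin_le_nhds
    have hy : y₁ r = y₂ r := by
      refine tendsto_nhds_unique (((h₁ r hr).continuousWithinAt.tendsto).comp hlim) ?_
      refine (((h₂ r hr).continuousWithinAt.tendsto).comp hlim).congr' ?_
      filter_upwards [hev] with σ hσ
      exact (hlow _ hσ.1 hσ.2).eq.symm
    have hd₁ : y₁ r ∈ chartDomain (n := n) (y₁ r).2 := mem_chartDomain_self _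
    have hd₂ : y₂ r ∈ chartDomain (n := n) (y₁ r).2 := by rw [← hy]; exact hd₁
    refine jetEq_of_nullJet_eq (hup r hr) (h₁ r hr) (h₂ r hr) hd₁ hd₂ ?_
    refine tendsto_nhds_unique
      ((continuousWithinAt_nullJet (hup r hr) (h₁ r hr) hd₁).tendsto.comp hlim) ?_
    refine ((continuousWithinAt_nullJet (hup r hr) (h₂ r hr) hd₂).tendsto.comp hlim).congr' ?_
    have hd : ∀ᶠ σ in 𝓝[>] (0 : ℝ), y₁ (r.1 - σ, r.2) ∈ chartDomain (n := n) (y₁ r).2 :=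
      (((h₁ r hr).continuousWithinAt.tendsto).comp hlim) ((isOpen_chartDomain _).mem_nhds hd₁)
    filter_upwards [hev, hd] with σ hσ hσ'
    exact (nullJet_eq_of_jetEq (hup _ hσ.1) (h₁ _ hσ.1) (h₂ _ hσ.1) hσ' (hlow _ hσ.1 hσ.2)).symm
  have hsΔ := hBs hs
  have hjs := hlevel s hsΔ rfl
  set q₀ := (y₁ s).2 with hq₀
  have hd₁ : y₁ s ∈ chartDomain (n := n) q₀ := mem_chartDomain_self _
  have hd₂ : y₂ s ∈ chartDomain (n := n) q₀ := by rw [← hjs.eq]; exact hd₁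
  have hc₁ := continuousWithinAt_nullJet (hup s hsΔ) (h₁ s hsΔ) hd₁
  have hc₂ := continuousWithinAt_nullJet (hup s hsΔ) (h₂ s hsΔ) hd₂
  have hjet := nullJet_eq_of_jetEq (hup s hsΔ) (h₁ s hsΔ) (h₂ s hsΔ) hd₁ hjs
  have hΓ : ContDiffAt ℝ 1 (g.christSharp q₀) (nullJet (inCoord q₀ y₁) s) :=
    ((g.contDiffOn_christSharp q₀).contDiffAt (((isOpen_chartRange q₀).prod isOpen_univ).mem_nhds
      ⟨stCoord_mem hd₁, mem_univ _⟩)).of_le (by simp)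
  obtain ⟨L, C, hC, hL⟩ := hΓ.exists_lipschitzOnWith
  have hev : ∀ᶠ r in 𝓝[upper] s, y₁ r ∈ chartDomain (n := n) q₀ ∧ y₂ r ∈ chartDomain (n := n) q₀ ∧
      nullJet (inCoord q₀ y₁) r ∈ C ∧ nullJet (inCoord q₀ y₂) r ∈ C := by
    have e1 : ∀ᶠ r in 𝓝[upper] s, y₁ r ∈ chartDomain (n := n) q₀ :=
      (h₁ s hsΔ).continuousWithinAt.tendsto ((isOpen_chartDomain _).mem_nhds hd₁)
    have e2 : ∀ᶠ r in 𝓝[upper] s, y₂ r ∈ chartDomain (n := n) q₀ :=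
      (h₂ s hsΔ).continuousWithinAt.tendsto ((isOpen_chartDomain _).mem_nhds hd₂)
    have e3 : ∀ᶠ r in 𝓝[upper] s, nullJet (inCoord q₀ y₁) r ∈ C := hc₁.tendsto hC
    have e4 : ∀ᶠ r in 𝓝[upper] s, nullJet (inCoord q₀ y₂) r ∈ C :=
      hc₂.tendsto (by rw [← hjet]; exact hC)
    exact e1.and (e2.and (e3.and e4))
  obtain ⟨ρ, hρ, hball⟩ := Metric.mem_nhdsWithin_iff.1 hev
  -- The first bound keeps the small triangles below points within h of s inside the ρ-ball, since
  -- they reach at most 2h away; the second is the smallness condition of `nullJet_eq_of_base`.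
  set h := min (ρ / 3) (1 / (2 * (L + 1))) with hh
  have hhpos : 0 < h := lt_min (by positivity) (by positivity)
  have hnear : ∀ r ∈ pastFrom τ q, dist r s < h → JetEq n y₁ y₂ r := by
    intro r hr hrs
    rcases lt_or_ge r.1 s.1 with hlt | hge
    · exact hlow r hr hlt
    have hdr : dist r.1 s.1 < h ∧ dist r.2 s.2 < h := by
      rw [Prod.dist_eq, max_lt_iff] at hrs; exact hrs
    rw [Real.dist_eq, Real.dist_eq, abs_lt, abs_lt] at hdr
    have hh1 : h ≤ ρ / 3 := min_le_left _ _
    have hh2 : h * (L + 1) ≤ 1 / 2 := by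
      calc h * (L + 1) ≤ 1 / (2 * (L + 1)) * (L + 1) := by gcongr; exact min_le_right _ _
        _ = 1 / 2 := by field_simp
    have hsub : ∀ r' ∈ pastFrom s.1 r, r' ∈ pastFrom τ q ∧ y₁ r' ∈ chartDomain (n := n) q₀ ∧
        y₂ r' ∈ chartDomain (n := n) q₀ ∧ nullJet (inCoord q₀ y₁) r' ∈ C ∧
        nullJet (inCoord q₀ y₂) r' ∈ C := by
      intro r' hr'
      have h1 := pastFrom_trans hr hr' (hsΔ.1.trans hr'.1)
      refine ⟨h1, hball ⟨?_, hup _ h1⟩⟩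
      have h2 := abs_le.1 hr'.2
      have h3 := hr'.1
      have h4 := abs_nonneg (r.2 - r'.2)
      have h5 := hr'.2
      rw [Metric.mem_ball, Prod.dist_eq, max_lt_iff, Real.dist_eq, Real.dist_eq, abs_lt, abs_lt]
      refine ⟨⟨?_, ?_⟩, ?_, ?_⟩ <;> linarith [hdr.1.1, hdr.1.2, hdr.2.1, hdr.2.2]
    have hres := g.nullJet_eq_of_base (q₀ := q₀) (Y₁ := inCoord q₀ y₁) (Y₂ := inCoord q₀ y₂)
      (τ := s.1) (q := r) (hup s hsΔ) hL (by nlinarith [hdr.1.2, L.coe_nonneg])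
      (fun r' hr' => contDiffWithinAt_inCoord (h₁ r' (hsub r' hr').1) (hsub r' hr').2.1)
      (fun r' hr' => contDiffWithinAt_inCoord (h₂ r' (hsub r' hr').1) (hsub r' hr').2.2.1)
      (fun r' hr' => (hsub r' hr').2.2.2.1) (fun r' hr' => (hsub r' hr').2.2.2.2)
      (fun r' hr' hlt => g.chartWave_of_waveMapAt ((hup s hsΔ).trans_lt hlt)
        (h₁ r' (hsub r' hr').1) (hsub r' hr').2.1 (hw₁ r' (hsub r' hr').1 (hsΔ.1.trans_lt hlt)))
      (fun r' hr' hlt => g.chartWave_of_waveMapAt ((hup s hsΔ).trans_lt hlt)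
        (h₂ r' (hsub r' hr').1) (hsub r' hr').2.2.1 (hw₂ r' (hsub r' hr').1 (hsΔ.1.trans_lt hlt)))
      (fun r' hr' he => nullJet_eq_of_jetEq (hup _ (hsub r' hr').1) (h₁ r' (hsub r' hr').1)
        (h₂ r' (hsub r' hr').1) (hsub r' hr').2.1 (hlevel r' (hsub r' hr').1 he))
      r (self_mem_pastFrom hge)
    have hr' := hsub r (self_mem_pastFrom hge)
    exact jetEq_of_nullJet_eq (hup r hr) (h₁ r hr) (h₂ r hr) hr'.2.1 hr'.2.2.1 hres
  obtain ⟨b, hb, hbs⟩ := Metric.mem_closure_iff.1 hs h hhpos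
  exact hb.2 (hnear b hb.1 (by rwa [dist_comm]))

end MetricFamily

/-! ### From the Duhamel formula to the differential equations -/

section TransportPDE

variable {E : Type} [NormedAddCommGroup E] [NormedSpace ℝ E] [CompleteSpace E]

/-- Substitution turns the rescaled expression into the integral of G from 0 to s. -/
lemma hasDerivAt_smul_integral {G : ℝ → E} {ε : ℝ} (hG : ContinuousOn G (Ioo (-ε) ε)) {s : ℝ}
    (hs : s ∈ Ioo (-ε) ε) :
    HasDerivAt (fun s : ℝ => s • ∫ σ in (0:ℝ)..1, G (σ * s)) (G s) s := by
  have h0 : (0 : ℝ) ∈ Ioo (-ε) ε := by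
    have := hs.1.trans hs.2
    constructor <;> linarith
  have h1 : ∀ r : ℝ, (r • ∫ σ in (0:ℝ)..1, G (σ * r)) = ∫ σ in (0:ℝ)..r, G σ := by
    intro r
    rw [intervalIntegral.smul_integral_comp_mul_right]
    simp
  simp only [h1]
  have hsub : uIcc 0 s ⊆ Ioo (-ε) ε := (ordConnected_Ioo (a := -ε) (b := ε)).uIcc_subset h0 hs
  refine intervalIntegral.integral_hasDerivAt_right (hG.mono hsub).intervalIntegrable ?_ ?_
  · exact hG.stronglyMeasurableAtFilter isOpen_Ioo s hs
  · exact hG.continuousAt (isOpen_Ioo.mem_nhds hs)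

/-- Local existence of smooth solutions of semilinear transport systems with finitely many speeds;
the time of existence depends on the nonlinearity only. -/
theorem exists_transport_solution' {ι : Type} [Fintype ι] (c : ι → Icc (-1 : ℝ) 1)
    (A : ι → E →L[ℝ] E) (hA1 : ∀ e, ∑ i, A i e = e)
    (hA2 : ∀ i e, A i (A i e) = A i e) (hA3 : ∀ i j, i ≠ j → ∀ e, A i (A j e) = 0)
    {F : E → E} (hF : ContDiff ℝ ∞ F)
    {L : NNReal} (hL : LipschitzWith L F) {M : ℝ} (hM : ∀ e, ‖F e‖ ≤ M) :
    ∃ ε > 0, ∀ (τ : ℝ) (w₀ : ℝ → E), ContDiff ℝ ∞ w₀ → ∃ v : ℝ × ℝ → E,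
      ContDiffOn ℝ ∞ v {p | |p.1 - τ| < ε} ∧ (∀ x, v (τ, x) = w₀ x) ∧
      ∀ p : ℝ × ℝ, |p.1 - τ| < ε → ∀ i, A i (fderiv ℝ v p (1, -(c i : ℝ))) = A i (F (v p)) ∧
        ‖A i (v p) - A i (w₀ (p.2 + c i * (p.1 - τ)))‖ ≤ ‖A i‖ * (|p.1 - τ| * M) := by
  obtain ⟨ε, hε, hsol⟩ := exists_transport_solution c A F hF hL
  refine ⟨ε, hε, fun τ w₀ hw₀ => ?_⟩
  obtain ⟨w, hw, hwe⟩ := hsol w₀ hw₀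
  -- The operators A i are complementary projections, so applying one of them isolates the summand
  -- with its speed.
  have hAw : ∀ t x i, |t| < ε → A i (w (t, x)) = A i (w₀ (x + c i * t))
      + t • ∫ σ in (0:ℝ)..1, A i (F (w (σ * t, x + c i * (t * (1 - σ))))) := by
    intro t x i ht
    have hint : IntervalIntegrable (fun σ => F (w (σ * t, x + c i * (t * (1 - σ))))) volume 0 1 := by
      refine ContinuousOn.intervalIntegrable ?_
      rw [uIcc_of_le zero_le_one]
      refine hF.continuous.comp_continuousOn
        (hw.continuousOn.comp (by fun_prop) fun σ hσ => ?_)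
      simp only [mem_ofPred_eq, abs_mul, abs_of_nonneg hσ.1]
      exact lt_of_le_of_lt (mul_le_of_le_one_left (abs_nonneg t) hσ.2) ht
    rw [hwe t x ht, map_sum, Finset.sum_eq_single i]
    · rw [hA2, map_add, map_smul, ← (A i).intervalIntegral_comp_comm hint]
    · intro j _ hj
      exact hA3 i j hj.symm _
    · simp
  have hshift : ContDiff ℝ ∞ (fun p : ℝ × ℝ => (p.1 - τ, p.2)) := by fun_prop
  have hv : ContDiffOn ℝ ∞ (fun p : ℝ × ℝ => w (p.1 - τ, p.2)) {p | |p.1 - τ| < ε} :=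
    hw.comp hshift.contDiffOn fun p hp => hp
  have hop : IsOpen {p : ℝ × ℝ | |p.1 - τ| < ε} :=
    isOpen_lt (f := fun p : ℝ × ℝ => |p.1 - τ|) (by fun_prop) continuous_const
  refine ⟨fun p => w (p.1 - τ, p.2), hv, fun x => ?_, fun p hp i => ⟨?_, ?_⟩⟩
  · have := hwe 0 x (by simpa using hε)
    simp only [sub_self]
    rw [this]
    simp [hA1]
  · set d : ℝ × ℝ := (1, -(c i : ℝ)) with hd
    have hdiff : DifferentiableAt ℝ (fun p : ℝ × ℝ => w (p.1 - τ, p.2)) p :=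
      (hv.contDiffAt (hop.mem_nhds hp)).differentiableAt (by simp)
    -- The point where the characteristic of speed c i through p meets the initial line.
    set r : ℝ × ℝ := p - (p.1 - τ) • d with hr
    have hrp : r + (p.1 - τ) • d = p := by rw [hr]; abel
    have h1 := hasDerivAt_comp_line (f := fun p : ℝ × ℝ => w (p.1 - τ, p.2)) (r := r) (d := d)
      (s := p.1 - τ) (by rw [hrp]; exact hdiff)
    rw [hrp] at h1
    have h2 := (A i).hasFDerivAt.comp_hasDerivAt _ h1
    set G : ℝ → E := fun s => A i (F (w (s, r.2 - c i * s))) with hG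
    have hr1 : r.1 = τ := by simp [hr, hd]
    have hGc : ContinuousOn G (Ioo (-ε) ε) := by
      refine ((A i).continuous.comp hF.continuous).comp_continuousOn
        (hw.continuousOn.comp (by fun_prop) fun s hs => ?_)
      exact abs_lt.2 hs
    have h3 := (hasDerivAt_smul_integral hGc (abs_lt.1 hp)).const_add (A i (w₀ r.2))
    have h4 : (fun s => A i (w₀ r.2) + s • ∫ σ in (0:ℝ)..1, G (σ * s)) =ᶠ[𝓝 (p.1 - τ)]
        (A i) ∘ (fun s => w ((r + s • d).1 - τ, (r + s • d).2)) := by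
      filter_upwards [isOpen_Ioo.mem_nhds (abs_lt.1 hp)] with s hs
      have e1 : (r + s • d).1 - τ = s := by simp [hd, hr1]
      have e2 : (r + s • d).2 = r.2 - c i * s := by simp [hd]; ring
      simp only [Function.comp_apply]
      rw [e1, e2, hAw s _ i (abs_lt.2 hs)]
      congr 3
      · ring
      · funext σ
        simp only [hG]
        congr 4
        ring
    have h5 := h2.unique (h3.congr_of_eventuallyEq h4.symm)
    rw [h5, hG]
    simp only
    congr 4
    have : p.2 = (r + (p.1 - τ) • d).2 := by rw [hrp]
    rw [this]
    simp [hd]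
    ring
  · simp only
    rw [hAw _ _ i hp, add_sub_cancel_left, norm_smul, Real.norm_eq_abs]
    have hb : ‖∫ σ in (0:ℝ)..1, A i (F (w (σ * (p.1 - τ), p.2 + c i * ((p.1 - τ) * (1 - σ)))))‖
        ≤ (‖A i‖ * M) * |1 - 0| := by
      refine intervalIntegral.norm_integral_le_of_norm_le_const fun σ _ => ?_
      exact (A i).le_of_opNorm_le_of_le le_rfl (hM _)
    simp only [sub_zero, abs_one, mul_one] at hb
    calc _ ≤ |p.1 - τ| * (‖A i‖ * M) := by gcongr
      _ = _ := by ring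

end TransportPDE

/-! ### Modification of smooth functions away from a compact set -/

section Cutoff

variable {E F : Type} [NormedAddCommGroup E] [NormedSpace ℝ E] [FiniteDimensional ℝ E]
  [NormedAddCommGroup F] [NormedSpace ℝ F]

/-- A smooth function on an open set can be changed away from a given compact set into a smooth
function with compact support on the whole space. -/
lemma exists_contDiff_hasCompactSupport_eqOn {C U : Set E} (hC : IsCompact C) (hU : IsOpen U)
    (hCU : C ⊆ U) {f : E → F} (hf : ContDiffOn ℝ ∞ f U) :
    ∃ f' : E → F, ContDiff ℝ ∞ f' ∧ HasCompactSupport f' ∧ EqOn f' f C := by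
  obtain ⟨δ, hδ, hδU⟩ := hC.exists_cthickening_subset_open hU hCU
  have hK : IsCompact (Metric.cthickening δ C) := hC.cthickening
  obtain ⟨ψ, h0, h1, -⟩ := exists_contMDiffMap_zero_one_of_isClosed (n := ⊤) 𝓘(ℝ, E)
    (s := (Metric.thickening δ C)ᶜ) (t := C) Metric.isOpen_thickening.isClosed_compl hC.isClosed
    (disjoint_compl_left_iff_subset.2 (Metric.self_subset_thickening hδ C))
  have hψ : ContDiff ℝ ∞ ψ := contMDiff_iff_contDiff.1 ψ.contMDiff
  have hzero : ∀ e ∉ Metric.cthickening δ C, ψ e = 0 := fun e he =>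
    h0 fun h => he (Metric.thickening_subset_cthickening δ C h)
  refine ⟨fun e => ψ e • f e, ?_, ?_, fun e he => ?_⟩
  · rw [contDiff_iff_contDiffAt]
    intro e
    by_cases he : e ∈ Metric.cthickening δ C
    · exact hψ.contDiffAt.smul (hf.contDiffAt (hU.mem_nhds (hδU he)))
    · refine (contDiffAt_const (c := (0 : F))).congr_of_eventuallyEq ?_
      filter_upwards [Metric.isClosed_cthickening.isOpen_compl.mem_nhds he] with e' he'
      rw [hzero e' he', zero_smul]
  · exact HasCompactSupport.intro hK fun e he => by rw [hzero e he, zero_smul]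
  · simp only
    rw [h1 he]
    simp

end Cutoff

/-! ### Local existence in a chart, with a uniform time of existence -/

namespace MetricFamily

/-- The open diamond of radius `η` around `(τ, x₁)`. -/
def diamond (τ x₁ η : ℝ) : Set (ℝ × ℝ) := {p | |p.1 - τ| + |p.2 - x₁| < η}

lemma isOpen_diamond (τ x₁ η : ℝ) : IsOpen (diamond τ x₁ η) :=
  isOpen_lt (f := fun p : ℝ × ℝ => |p.1 - τ| + |p.2 - x₁|) (by fun_prop) continuous_const

section Speeds

variable (X : Type) [NormedAddCommGroup X] [NormedSpace ℝ X]

/-- The speeds of the components of the null jet of a wave map. -/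
def nullSpeed : Fin 3 → Icc (-1 : ℝ) 1
  | 0 => ⟨0, by norm_num⟩
  | 1 => ⟨1, by norm_num⟩
  | 2 => ⟨-1, by norm_num⟩

/-- The projections to the components of a null jet. -/
def nullProj : Fin 3 → (X × X × X) →L[ℝ] (X × X × X)
  | 0 => (ContinuousLinearMap.fst ℝ X (X × X)).prod 0
  | 1 => (0 : (X × X × X) →L[ℝ] X).prod
      (((ContinuousLinearMap.fst ℝ X X).comp (ContinuousLinearMap.snd ℝ X (X × X))).prod 0)
  | 2 => (0 : (X × X × X) →L[ℝ] X).prod ((0 : (X × X × X) →L[ℝ] X).prod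
      ((ContinuousLinearMap.snd ℝ X X).comp (ContinuousLinearMap.snd ℝ X (X × X))))

variable {X}

lemma nullProj_zero (e : X × X × X) : nullProj X 0 e = (e.1, 0, 0) := rfl
lemma nullProj_one (e : X × X × X) : nullProj X 1 e = (0, e.2.1, 0) := rfl
lemma nullProj_two (e : X × X × X) : nullProj X 2 e = (0, 0, e.2.2) := rfl

lemma norm_nullProj_le (i : Fin 3) : ‖nullProj X i‖ ≤ 1 := by
  refine ContinuousLinearMap.opNorm_le_bound _ zero_le_one fun e => ?_
  rw [one_mul]
  have h1 := norm_fst_le e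
  have h2 := norm_snd_le e
  have h3 := (norm_fst_le e.2).trans h2
  have h4 := (norm_snd_le e.2).trans h2
  fin_cases i
  · change ‖nullProj X 0 e‖ ≤ _
    rw [nullProj_zero]; simp [Prod.norm_def]
  · change ‖nullProj X 1 e‖ ≤ _
    rw [nullProj_one]; simp [Prod.norm_def]
  · change ‖nullProj X 2 e‖ ≤ _
    rw [nullProj_two]; simp [Prod.norm_def]

end Speeds

variable {n : ℕ} {N : Type*} [TopologicalSpace N] [ChartedSpace (Coord n) N]
variable (g : MetricFamily n N) [IsManifold (𝓡 n) ∞ N]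

/-- Local existence for the wave map equation in a chart, for initial data with values in a given
compact set, with a uniform lower bound on the size of the domain. -/
theorem exists_chartWave {q₀ : N} {K K₁ K₂ : Set (ℝ × Coord n)} (hK : IsCompact K)
    (hK₁ : IsCompact K₁) (hK₂ : IsCompact K₂) (hKr : K ⊆ chartRange q₀) :
    ∃ η₀ > 0, ∀ (τ x₁ η : ℝ), η ≤ η₀ → ∀ (I : Set ℝ), IsOpen I → Icc (x₁ - η) (x₁ + η) ⊆ I →
      ∀ Y₀ P₀ Q₀ : ℝ → ℝ × Coord n, ContDiffOn ℝ ∞ Y₀ I → ContDiffOn ℝ ∞ P₀ I →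
      ContDiffOn ℝ ∞ Q₀ I → (∀ x ∈ Icc (x₁ - η) (x₁ + η), Y₀ x ∈ K ∧ P₀ x ∈ K₁ ∧ Q₀ x ∈ K₂) →
      (∀ x ∈ Ioo (x₁ - η) (x₁ + η), HasDerivAt Y₀ ((1 / 2 : ℝ) • (P₀ x - Q₀ x)) x) →
      ∃ Y : ℝ × ℝ → ℝ × Coord n, ContDiffOn ℝ ∞ Y (diamond τ x₁ η) ∧
        (∀ p ∈ diamond τ x₁ η, Y p ∈ chartRange q₀ ∧ g.ChartWave q₀ Y p) ∧
        ∀ x, |x - x₁| < η → Y (τ, x) = Y₀ x ∧ fderiv ℝ Y (τ, x) (1, 1) = P₀ x ∧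
          fderiv ℝ Y (τ, x) (1, -1) = Q₀ x := by
  set E := (ℝ × Coord n) × (ℝ × Coord n) × (ℝ × Coord n) with hE
  have hC : IsCompact (K ×ˢ K₁ ×ˢ K₂ : Set E) := hK.prod (hK₁.prod hK₂)
  have hU : IsOpen (chartRange (n := n) q₀ ×ˢ univ : Set E) := (isOpen_chartRange q₀).prod isOpen_univ
  -- The nonlinearity is kept on a δ-neighbourhood of the possible data and cut off outside, which
  -- makes it globally Lipschitz and bounded. The solution never leaves this neighbourhood, so it
  -- solves the original system.
  obtain ⟨δ, hδ, hδU⟩ := hC.exists_cthickening_subset_open hU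
    (fun e he => ⟨hKr he.1, mem_univ _⟩)
  have hC' : IsCompact (Metric.cthickening δ (K ×ˢ K₁ ×ˢ K₂ : Set E)) := hC.cthickening
  let F₀ : E → E := fun e => ((1 / 2 : ℝ) • (e.2.1 + e.2.2), -g.christSharp q₀ e, -g.christSharp q₀ e)
  have hF₀ : ContDiffOn ℝ ∞ F₀ (chartRange q₀ ×ˢ univ) := by
    have h1 := (g.contDiffOn_christSharp q₀).neg
    have h2 : ContDiff ℝ ∞ (fun e : E => (1 / 2 : ℝ) • (e.2.1 + e.2.2)) := by fun_prop
    exact h2.contDiffOn.prodMk (h1.prodMk h1)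
  obtain ⟨F, hF, hFc, hFe⟩ := exists_contDiff_hasCompactSupport_eqOn hC' hU hδU hF₀
  obtain ⟨L, hL⟩ := hF.lipschitzWith_of_hasCompactSupport hFc (by simp)
  obtain ⟨M, hM⟩ := hFc.exists_bound_of_continuous hF.continuous
  have hM0 : 0 ≤ M := (norm_nonneg _).trans (hM 0)
  obtain ⟨ε, hε, hsol⟩ := exists_transport_solution' nullSpeed (nullProj (ℝ × Coord n))
    (fun e => by
      simp only [Fin.sum_univ_three, nullProj_zero, nullProj_one, nullProj_two]
      simp)
    (fun i e => by fin_cases i <;> rfl)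
    (fun i j hij e => by fin_cases i <;> fin_cases j <;> first | exact absurd rfl hij | rfl)
    hF hL hM
  -- Within time η each component moves at most η M from its value at the foot of its
  -- characteristic, and η M ≤ δ is what keeps the cutoff invisible. The summand 1 avoids dividing
  -- by zero.
  refine ⟨min ε (δ / (M + 1)), lt_min hε (by positivity), ?_⟩
  intro τ x₁ η hη I hI hIsub Y₀ P₀ Q₀ hY₀ hP₀ hQ₀ hdata hder
  obtain ⟨w₀, hw₀, -, hw₀e⟩ := exists_contDiff_hasCompactSupport_eqOn (isCompact_Icc) hI hIsub
    (hY₀.prodMk (hP₀.prodMk hQ₀))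
  obtain ⟨v, hv, hv0, hve⟩ := hsol τ w₀ hw₀
  have hηε : η ≤ ε := hη.trans (min_le_left _ _)
  have hηδ : η * M ≤ δ := by
    have h1 : η ≤ δ / (M + 1) := hη.trans (min_le_right _ _)
    calc η * M ≤ δ / (M + 1) * M := by gcongr
      _ ≤ δ / (M + 1) * (M + 1) := by gcongr; linarith
      _ = δ := by field_simp
  have hstrip : ∀ p ∈ diamond τ x₁ η, |p.1 - τ| < ε := fun p hp => by
    have h1 : |p.1 - τ| + |p.2 - x₁| < η := hp
    have := abs_nonneg (p.2 - x₁)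
    linarith
  have hvD : ContDiffOn ℝ ∞ v (diamond τ x₁ η) := hv.mono hstrip
  have hop := isOpen_diamond τ x₁ η
  have hfoot : ∀ p ∈ diamond τ x₁ η, ∀ c : ℝ, |c| ≤ 1 →
      p.2 + c * (p.1 - τ) ∈ Icc (x₁ - η) (x₁ + η) := by
    intro p hp c hc
    have h1 : |p.1 - τ| + |p.2 - x₁| < η := hp
    have h2 : |c * (p.1 - τ)| ≤ |p.1 - τ| := by
      rw [abs_mul]; exact mul_le_of_le_one_left (abs_nonneg _) hc
    have h3 := abs_le.1 h2
    have h4 := abs_le.1 (le_refl |p.2 - x₁|)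
    constructor <;> linarith
  have hFv : ∀ p ∈ diamond τ x₁ η, F (v p) = F₀ (v p) ∧ v p ∈ (chartRange q₀ ×ˢ univ : Set E) := by
    intro p hp
    suffices h : v p ∈ Metric.cthickening δ (K ×ˢ K₁ ×ˢ K₂ : Set E) from ⟨hFe h, hδU h⟩
    have hf0 := hfoot p hp 0 (by simp)
    have hf1 := hfoot p hp 1 (by simp)
    have hf2 := hfoot p hp (-1) (by simp)
    refine Metric.mem_cthickening_of_dist_le _
      ((Y₀ (p.2 + 0 * (p.1 - τ)), P₀ (p.2 + 1 * (p.1 - τ)), Q₀ (p.2 + (-1) * (p.1 - τ))) : E) _ _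
      ⟨(hdata _ hf0).1, (hdata _ hf1).2.1, (hdata _ hf2).2.2⟩ ?_
    have hb : ∀ i, ‖nullProj (ℝ × Coord n) i (v p)
        - nullProj (ℝ × Coord n) i (w₀ (p.2 + nullSpeed i * (p.1 - τ)))‖ ≤ δ := by
      intro i
      refine ((hve p (hstrip p hp) i).2).trans ?_
      have h1 : |p.1 - τ| ≤ η := by
        have h1 : |p.1 - τ| + |p.2 - x₁| < η := hp
        have := abs_nonneg (p.2 - x₁)
        linarith
      calc _ ≤ 1 * (η * M) := by gcongr; exact norm_nullProj_le i
        _ ≤ δ := by rw [one_mul]; exact hηδ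
    have hb0 := hb 0
    have hb1 := hb 1
    have hb2 := hb 2
    simp only [nullSpeed] at hb0 hb1 hb2
    rw [hw₀e hf0, nullProj_zero, nullProj_zero] at hb0
    rw [hw₀e hf1, nullProj_one, nullProj_one] at hb1
    rw [hw₀e hf2, nullProj_two, nullProj_two] at hb2
    have hc0 := (norm_fst_le _).trans hb0
    have hc1 := (norm_fst_le _).trans ((norm_snd_le _).trans hb1)
    have hc2 := (norm_snd_le _).trans ((norm_snd_le _).trans hb2)
    rw [dist_eq_norm]
    exact norm_prod_le_iff.2 ⟨hc0, norm_prod_le_iff.2 ⟨hc1, hc2⟩⟩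
  -- the components of the solution and their equations
  have hvd : ∀ p ∈ diamond τ x₁ η, DifferentiableAt ℝ v p := fun p hp =>
    (hvD.contDiffAt (hop.mem_nhds hp)).differentiableAt (by simp)
  have hYc : ContDiffOn ℝ ∞ (fun p => (v p).1) (diamond τ x₁ η) := hvD.fst
  have hPc : ContDiffOn ℝ ∞ (fun p => (v p).2.1) (diamond τ x₁ η) := hvD.snd.fst
  have hQc : ContDiffOn ℝ ∞ (fun p => (v p).2.2) (diamond τ x₁ η) := hvD.snd.snd
  have eY : ∀ p ∈ diamond τ x₁ η, fderiv ℝ (fun p => (v p).1) p (1, 0)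
      = (1 / 2 : ℝ) • ((v p).2.1 + (v p).2.2) := by
    intro p hp
    have h1 := (hve p (hstrip p hp) 0).1
    rw [nullProj_zero, nullProj_zero, (hFv p hp).1] at h1
    simp only [nullSpeed, neg_zero] at h1
    rw [(hvd p hp).hasFDerivAt.fst.fderiv]
    exact (Prod.ext_iff.1 h1).1
  have eP : ∀ p ∈ diamond τ x₁ η, fderiv ℝ (fun p => (v p).2.1) p (1, -1)
      = -g.christSharp q₀ (v p) := by
    intro p hp
    have h1 := (hve p (hstrip p hp) 1).1
    rw [nullProj_one, nullProj_one, (hFv p hp).1] at h1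
    simp only [nullSpeed] at h1
    rw [(hvd p hp).hasFDerivAt.snd.fst.fderiv]
    exact (Prod.ext_iff.1 (Prod.ext_iff.1 h1).2).1
  have eQ : ∀ p ∈ diamond τ x₁ η, fderiv ℝ (fun p => (v p).2.2) p (1, 1)
      = -g.christSharp q₀ (v p) := by
    intro p hp
    have h1 := (hve p (hstrip p hp) 2).1
    rw [nullProj_two, nullProj_two, (hFv p hp).1] at h1
    simp only [nullSpeed, neg_neg] at h1
    rw [(hvd p hp).hasFDerivAt.snd.snd.fderiv]
    exact (Prod.ext_iff.1 (Prod.ext_iff.1 h1).2).2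
  -- compatibility of the components with the derivatives of the first one
  have hbase : ∀ x, |x - x₁| < η → (τ, x) ∈ diamond τ x₁ η := fun x hx => by
    simpa [diamond] using hx
  have hdata0 : ∀ x, |x - x₁| < η → v (τ, x) = (Y₀ x, P₀ x, Q₀ x) := by
    intro x hx
    have h1 := abs_lt.1 hx
    rw [hv0, hw₀e ⟨by linarith, by linarith⟩]
  have hx0 : ∀ x, |x - x₁| < η → fderiv ℝ (fun p => (v p).1) (τ, x) (0, 1)
      = (1 / 2 : ℝ) • ((v (τ, x)).2.1 - (v (τ, x)).2.2) := by
    intro x hx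
    have h1 := hasDerivAt_comp_line (f := fun p => (v p).1) (r := (τ, 0)) (d := (0, 1)) (s := x)
      (by
        have : ((τ, 0) : ℝ × ℝ) + x • ((0 : ℝ), (1 : ℝ)) = (τ, x) := by simp
        rw [this]
        exact (hvd _ (hbase x hx)).fst)
    have e : ∀ s : ℝ, ((τ, 0) : ℝ × ℝ) + s • ((0 : ℝ), (1 : ℝ)) = (τ, s) := fun s => by simp
    simp only [e] at h1
    have hx' := abs_lt.1 hx
    have h2 := hder x ⟨by linarith, by linarith⟩
    have h3 : (fun s => (v (τ, s)).1) =ᶠ[𝓝 x] Y₀ := by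
      have : ∀ᶠ s in 𝓝 x, |s - x₁| < η :=
        (isOpen_lt (f := fun s : ℝ => |s - x₁|) (by fun_prop) continuous_const).mem_nhds hx
      filter_upwards [this] with s hs
      rw [hdata0 s hs]
    rw [h1.unique (h2.congr_of_eventuallyEq h3), hdata0 x hx]
  have hR : ∀ p ∈ diamond τ x₁ η, fderiv ℝ (fun p => (v p).1) p (0, 1)
      = (1 / 2 : ℝ) • ((v p).2.1 - (v p).2.2) := by
    intro p hp
    -- R measures the failure of the last two components P, Q to be the null derivatives of the
    -- first. It vanishes on the base, and its t-derivative is ½(∂ₓP + ∂ₓQ) - ½(∂ₜP - ∂ₜQ). This is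
    -- zero because (∂ₜ - ∂ₓ)P and (∂ₜ + ∂ₓ)Q have the same right-hand side.
    set R : ℝ × ℝ → ℝ × Coord n := fun p => fderiv ℝ (fun p => (v p).1) p (0, 1)
      - (1 / 2 : ℝ) • ((v p).2.1 - (v p).2.2) with hRdef
    have hvert : ∀ s ∈ uIcc τ p.1, (s, p.2) ∈ diamond τ x₁ η := by
      intro s hs
      have h1 : |p.1 - τ| + |p.2 - x₁| < η := hp
      have h2 := abs_sub_left_of_mem_uIcc hs
      simp only [diamond, mem_ofPred_eq]
      linarith
    have hder0 : ∀ p ∈ diamond τ x₁ η, HasFDerivAt R (fderiv ℝ R p) p ∧ fderiv ℝ R p (1, 0) = 0 := by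
      intro p hp
      have hY2 : ContDiffAt ℝ ∞ (fun p => (v p).1) p := hYc.contDiffAt (hop.mem_nhds hp)
      have hY2' : ContDiffAt ℝ 2 (fun p => (v p).1) p :=
        hY2.of_le (mod_cast le_top : ((2 : ℕ∞) : WithTop ℕ∞) ≤ ∞)
      have d1 : DifferentiableAt ℝ (fun p' => fderiv ℝ (fun p => (v p).1) p' (0, 1)) p :=
        ((hY2.fderiv_right (m := ∞) (by simp)).clm_apply contDiffAt_const).differentiableAt (by simp)
      have d2 : DifferentiableAt ℝ (fun p => (v p).2.1) p := (hvd p hp).snd.fst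
      have d3 : DifferentiableAt ℝ (fun p => (v p).2.2) p := (hvd p hp).snd.snd
      have hRd : HasFDerivAt R _ p :=
        d1.hasFDerivAt.sub ((d2.hasFDerivAt.sub d3.hasFDerivAt).const_smul (1 / 2 : ℝ))
      refine ⟨hRd.differentiableAt.hasFDerivAt, ?_⟩
      rw [hRd.fderiv]
      have e1 : fderiv ℝ (fun p' => fderiv ℝ (fun p => (v p).1) p' (0, 1)) p (1, 0)
          = (1 / 2 : ℝ) • (fderiv ℝ (fun p => (v p).2.1) p (0, 1)
            + fderiv ℝ (fun p => (v p).2.2) p (0, 1)) := by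
        rw [fderiv_fderiv_apply hY2', (hY2'.isSymmSndFDerivAt (by simp)).eq,
          ← fderiv_fderiv_apply hY2']
        have hev : (fun p' => fderiv ℝ (fun p => (v p).1) p' (1, 0)) =ᶠ[𝓝 p]
            fun p => (1 / 2 : ℝ) • ((v p).2.1 + (v p).2.2) := by
          filter_upwards [hop.mem_nhds hp] with p' hp'
          exact eY p' hp'
        have hsum : HasFDerivAt (fun p => (1 / 2 : ℝ) • ((v p).2.1 + (v p).2.2)) _ p :=
          (d2.hasFDerivAt.add d3.hasFDerivAt).const_smul (1 / 2 : ℝ)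
        rw [hev.fderiv_eq, hsum.fderiv]
        rfl
      have s1 : ((1 : ℝ), (-1 : ℝ)) = (1, 0) - (0, 1) := by simp
      have s2 : ((1 : ℝ), (1 : ℝ)) = (1, 0) + (0, 1) := by simp
      have e2 := eP p hp
      have e3 := eQ p hp
      rw [s1, map_sub] at e2
      rw [s2, map_add] at e3
      simp only [sub_apply, smul_apply]
      rw [e1]
      have e4 : fderiv ℝ (fun p => (v p).2.1) p (1, 0) - fderiv ℝ (fun p => (v p).2.2) p (1, 0)
          = fderiv ℝ (fun p => (v p).2.1) p (0, 1) + fderiv ℝ (fun p => (v p).2.2) p (0, 1) := by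
        rw [sub_eq_iff_eq_add.1 e2, eq_sub_of_add_eq e3]
        abel
      rw [e4, sub_self]
    have hconst : R (p.1, p.2) = R (τ, p.2) := by
      have hdl : ∀ s ∈ uIcc τ p.1, HasDerivWithinAt (fun s => R (s, p.2)) 0 (uIcc τ p.1) s := by
        intro s hs
        have e : ∀ s : ℝ, ((0, p.2) : ℝ × ℝ) + s • ((1 : ℝ), (0 : ℝ)) = (s, p.2) := fun s => by simp
        have h1 := hasDerivAt_comp_line (f := R) (r := (0, p.2)) (d := (1, 0)) (s := s)
          (by rw [e]; exact (hder0 _ (hvert s hs)).1.differentiableAt)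
        simp only [e] at h1
        rw [(hder0 _ (hvert s hs)).2] at h1
        exact h1.hasDerivWithinAt
      have h2 := (convex_uIcc τ p.1).norm_image_sub_le_of_norm_hasDerivWithin_le (C := 0) hdl
        (by simp) left_mem_uIcc right_mem_uIcc
      simp only [zero_mul, norm_le_zero_iff, sub_eq_zero] at h2
      exact h2
    have hpx : |p.2 - x₁| < η := by
      have h1 : |p.1 - τ| + |p.2 - x₁| < η := hp
      have := abs_nonneg (p.1 - τ)
      linarith
    have h3 : R (τ, p.2) = 0 := by simp only [hRdef, hx0 p.2 hpx, sub_self]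
    exact sub_eq_zero.1 (hconst.trans h3)
  have hPe : ∀ p ∈ diamond τ x₁ η, fderiv ℝ (fun p => (v p).1) p (1, 1) = (v p).2.1 := by
    intro p hp
    have s2 : ((1 : ℝ), (1 : ℝ)) = (1, 0) + (0, 1) := by simp
    rw [s2, map_add, eY p hp, hR p hp, ← smul_add]
    rw [show (v p).2.1 + (v p).2.2 + ((v p).2.1 - (v p).2.2) = (2 : ℝ) • (v p).2.1 by
      rw [two_smul]; abel, smul_smul]
    norm_num
  have hQe : ∀ p ∈ diamond τ x₁ η, fderiv ℝ (fun p => (v p).1) p (1, -1) = (v p).2.2 := by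
    intro p hp
    have s2 : ((1 : ℝ), (-1 : ℝ)) = (1, 0) - (0, 1) := by simp
    rw [s2, map_sub, eY p hp, hR p hp, ← smul_sub]
    rw [show (v p).2.1 + (v p).2.2 - ((v p).2.1 - (v p).2.2) = (2 : ℝ) • (v p).2.2 by
      rw [two_smul]; abel, smul_smul]
    norm_num
  refine ⟨fun p => (v p).1, hYc, fun p hp => ⟨(hFv p hp).2.1, ?_⟩, fun x hx => ⟨?_, ?_, ?_⟩⟩
  · have hev : (fun p' => fderiv ℝ (fun p => (v p).1) p' (1, 1)) =ᶠ[𝓝 p] fun p => (v p).2.1 := by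
      filter_upwards [hop.mem_nhds hp] with p' hp'
      exact hPe p' hp'
    rw [ChartWave, hev.fderiv_eq, eP p hp, hPe p hp, hQe p hp]
    exact neg_add_cancel _
  · simp only [hdata0 x hx]
  · rw [hPe _ (hbase x hx), hdata0 x hx]
  · rw [hQe _ (hbase x hx), hdata0 x hx]

end MetricFamily

/-! ### Local solutions on past-closed sets and their union -/

namespace MetricFamily

variable {n : ℕ} {N : Type*} [TopologicalSpace N] [ChartedSpace (Coord n) N]
variable (g : MetricFamily n N)

lemma upper_mem_of_open {Ω O : Set (ℝ × ℝ)} (hO : IsOpen O) (h : Ω = O ∩ upper) {r : ℝ × ℝ}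
    (hr : r ∈ Ω) : Ω ∈ 𝓝[upper] r := by
  rw [h, inter_comm]
  exact inter_mem_nhdsWithin _ (hO.mem_nhds (h ▸ hr).1)

lemma hasDerivAt_horizontal {F : Type} [NormedAddCommGroup F] [NormedSpace ℝ F] {Y : ℝ × ℝ → F}
    {t x : ℝ} (ht : 0 ≤ t) (hY : DifferentiableWithinAt ℝ Y upper (t, x)) :
    HasDerivAt (fun s => Y (t, s)) (fderivWithin ℝ Y upper (t, x) (0, 1)) x := by
  have h1 : HasDerivWithinAt (fun s : ℝ => (t, s)) ((0 : ℝ), (1 : ℝ)) univ x := by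
    have := ((hasDerivAt_const x t).prodMk (hasDerivAt_id x))
    exact this.hasDerivWithinAt
  exact hasDerivWithinAt_univ.1 (hY.hasFDerivWithinAt.comp_hasDerivWithinAt x h1 fun s _ => ht)

lemma eventuallyEq_nhdsWithin_upper {β : Type*} {y₁ y₂ : ℝ × ℝ → β} {Ω : Set (ℝ × ℝ)} {r : ℝ × ℝ}
    (hΩ : Ω ∈ 𝓝[upper] r) (h : EqOn y₁ y₂ Ω) : y₁ =ᶠ[𝓝[upper] r] y₂ :=
  mem_of_superset hΩ h

section Congr

variable {y₁ y₂ : ℝ × ℝ → ℝ × N} {r : ℝ × ℝ}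

lemma dirDeriv_congr (hr : r ∈ upper) (h : y₁ =ᶠ[𝓝[upper] r] y₂) : JetEq n y₁ y₂ r := by
  have h0 : y₁ r = y₂ r := h.self_of_nhdsWithin hr
  intro d
  have h1 : mfderivWithin 𝓘(ℝ, ℝ × ℝ) (stModel n) y₁ upper r
      = mfderivWithin 𝓘(ℝ, ℝ × ℝ) (stModel n) y₂ upper r := h.mfderivWithin_eq h0
  unfold dirDeriv
  congr 1
  exact congrArg (fun T : (ℝ × ℝ) →L[ℝ] (ℝ × Coord n) => T d) h1

lemma smoothAt_congr (hr : r ∈ upper) (h : y₁ =ᶠ[𝓝[upper] r] y₂) (h₂ : SmoothAt n y₂ r) :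
    SmoothAt n y₁ r :=
  ContMDiffWithinAt.congr_of_eventuallyEq h₂ h (h.self_of_nhdsWithin hr)

lemma waveMapAt_congr (h : y₁ =ᶠ[𝓝 r] y₂) : g.WaveMapAt y₁ r ↔ g.WaveMapAt y₂ r := by
  have h0 : y₁ r = y₂ r := h.self_of_nhds
  have h1 : inCoord (n := n) (y₁ r).2 y₁ =ᶠ[𝓝 r] inCoord (n := n) (y₁ r).2 y₂ :=
    h.fun_comp (stCoord (n := n) (y₁ r).2)
  have h2 : ∀ d : ℝ × ℝ, (fun p' => fderiv ℝ (inCoord (n := n) (y₁ r).2 y₁) p' d)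
      =ᶠ[𝓝 r] fun p' => fderiv ℝ (inCoord (n := n) (y₁ r).2 y₂) p' d := fun d =>
    h1.fderiv.fun_comp (fun T => T d)
  unfold WaveMapAt
  simp only
  rw [← h0, (h2 (1, 0)).fderiv_eq, (h2 (0, 1)).fderiv_eq, h1.fderiv_eq, h1.eq_of_nhds]

end Congr

/-- A smooth wave map with the initial data `k`, on a past-closed relatively open subset of the half
plane that need not contain the whole axis. -/
structure IsLocalSolution (k : ℝ → TangentBundle (stModel n) (ℝ × N)) (Ω : Set (ℝ × ℝ))
    (y : ℝ × ℝ → ℝ × N) : Prop where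
  isOpen : ∃ O : Set (ℝ × ℝ), IsOpen O ∧ Ω = O ∩ upper
  past : PastClosed Ω
  smooth : ∀ r ∈ Ω, SmoothAt n y r
  wave : ∀ r ∈ Ω, 0 < r.1 → g.WaveMapAt y r
  initial : ∀ x : ℝ, ((0 : ℝ), x) ∈ Ω → dirDeriv n y (0, x) (1, 0) = k x

namespace IsLocalSolution

variable {g} {k : ℝ → TangentBundle (stModel n) (ℝ × N)} {Ω Ω₁ Ω₂ : Set (ℝ × ℝ)}
  {y y₁ y₂ : ℝ × ℝ → ℝ × N}

lemma subset_upper (h : g.IsLocalSolution k Ω y) : Ω ⊆ upper := by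
  obtain ⟨O, _, rfl⟩ := h.isOpen
  exact inter_subset_right

lemma mem_nhdsWithin (h : g.IsLocalSolution k Ω y) {r : ℝ × ℝ} (hr : r ∈ Ω) : Ω ∈ 𝓝[upper] r := by
  obtain ⟨O, hO, he⟩ := h.isOpen
  exact upper_mem_of_open hO he hr

lemma mem_nhds (h : g.IsLocalSolution k Ω y) {r : ℝ × ℝ} (hr : r ∈ Ω) (hr0 : 0 < r.1) :
    Ω ∈ 𝓝 r := by
  have := h.mem_nhdsWithin hr
  rwa [nhdsWithin_eq_nhds.2 (upper_mem_nhds hr0)] at this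

lemma pastFrom_subset (h : g.IsLocalSolution k Ω y) {q : ℝ × ℝ} (hq : q ∈ Ω) :
    pastFrom 0 q ⊆ Ω := fun r hr => h.past q hq r hr.1 hr.2

lemma proj_eq (h : g.IsLocalSolution k Ω y) {x : ℝ} (hx : ((0 : ℝ), x) ∈ Ω) :
    y (0, x) = (k x).proj := congrArg Bundle.TotalSpace.proj (h.initial x hx)

lemma axis_eventually (h : g.IsLocalSolution k Ω y) {x : ℝ} (hx : ((0 : ℝ), x) ∈ Ω) :
    ∀ᶠ s in 𝓝 x, ((0 : ℝ), s) ∈ Ω := by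
  have h1 : Tendsto (fun s : ℝ => ((0 : ℝ), s)) (𝓝 x) (𝓝[upper] ((0 : ℝ), x)) := by
    refine tendsto_nhdsWithin_iff.2 ⟨Continuous.tendsto (by fun_prop) x, Eventually.of_forall ?_⟩
    intro s
    exact le_refl (0 : ℝ)
  exact h1 (h.mem_nhdsWithin hx)

variable [IsManifold (𝓡 n) ∞ N]

/-- The coordinates of the initial velocities. -/
lemma nullJet_axis (h : g.IsLocalSolution k Ω y) {x : ℝ} (hx : ((0 : ℝ), x) ∈ Ω) {q₀ : N}
    (hq : (k x).proj ∈ chartDomain (n := n) q₀) :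
    fderivWithin ℝ (inCoord (n := n) q₀ y) upper (0, x) (1, 0) = bundleCoord q₀ (k x) ∧
    HasDerivAt (fun s => stCoord (n := n) q₀ (k s).proj)
      (fderivWithin ℝ (inCoord (n := n) q₀ y) upper (0, x) (0, 1)) x := by
  have hs := h.smooth _ hx
  have hq' : y (0, x) ∈ chartDomain (n := n) q₀ := by rw [h.proj_eq hx]; exact hq
  refine ⟨by rw [fderivWithin_inCoord (h.subset_upper hx) hs hq', h.initial x hx], ?_⟩
  refine (hasDerivAt_horizontal le_rfl ((contDiffWithinAt_inCoord hs hq').differentiableWithinAt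
    (by simp))).congr_of_eventuallyEq ?_
  filter_upwards [h.axis_eventually hx] with s hs
  exact congrArg (stCoord (n := n) q₀) (h.proj_eq hs).symm

/-- The data prescribe the value and the t-derivative; the x-derivative is that of the base curve of
k. -/
lemma jetEq_axis (h₁ : g.IsLocalSolution k Ω₁ y₁) (h₂ : g.IsLocalSolution k Ω₂ y₂) {x : ℝ}
    (hx₁ : ((0 : ℝ), x) ∈ Ω₁) (hx₂ : ((0 : ℝ), x) ∈ Ω₂) : JetEq n y₁ y₂ (0, x) := by
  have hq : (k x).proj ∈ chartDomain (n := n) (k x).proj.2 := mem_chartDomain_self _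
  obtain ⟨a₁, b₁⟩ := h₁.nullJet_axis hx₁ hq
  obtain ⟨a₂, b₂⟩ := h₂.nullJet_axis hx₂ hq
  have e := b₁.unique b₂
  refine jetEq_of_nullJet_eq (h₁.subset_upper hx₁) (h₁.smooth _ hx₁) (h₂.smooth _ hx₂)
    (by rw [h₁.proj_eq hx₁]; exact hq) (by rw [h₂.proj_eq hx₂]; exact hq) ?_
  have s1 : ((1 : ℝ), (-1 : ℝ)) = (1, 0) - (0, 1) := by simp
  have s2 : ((1 : ℝ), (1 : ℝ)) = (1, 0) + (0, 1) := by simp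
  simp only [nullJet, s1, s2, map_add, map_sub, a₁, a₂, e]
  exact congrArg₂ _ (congrArg (stCoord (n := n) _) ((h₁.proj_eq hx₁).trans (h₂.proj_eq hx₂).symm)) rfl

/-- Local solutions agree on the intersections of their domains. -/
theorem jetEq [T2Space N] (h₁ : g.IsLocalSolution k Ω₁ y₁) (h₂ : g.IsLocalSolution k Ω₂ y₂)
    {r : ℝ × ℝ} (hr₁ : r ∈ Ω₁) (hr₂ : r ∈ Ω₂) : JetEq n y₁ y₂ r := by
  have s₁ := h₁.pastFrom_subset hr₁
  have s₂ := h₂.pastFrom_subset hr₂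
  refine g.jetEq_of_base (τ := 0) (q := r) le_rfl (fun r' hr' => h₁.smooth _ (s₁ hr'))
    (fun r' hr' => h₂.smooth _ (s₂ hr')) (fun r' hr' => h₁.wave _ (s₁ hr'))
    (fun r' hr' => h₂.wave _ (s₂ hr')) (fun r' hr' h0 => ?_) r
    (self_mem_pastFrom (h₁.subset_upper hr₁))
  obtain ⟨t, x⟩ := r'
  obtain rfl : t = 0 := h0
  exact h₁.jetEq_axis h₂ (s₁ hr') (s₂ hr')

lemma congr (h : g.IsLocalSolution k Ω y₂) (he : EqOn y₁ y₂ Ω) : g.IsLocalSolution k Ω y₁ where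
  isOpen := h.isOpen
  past := h.past
  smooth r hr := smoothAt_congr (h.subset_upper hr)
    (eventuallyEq_nhdsWithin_upper (h.mem_nhdsWithin hr) he) (h.smooth r hr)
  wave r hr hr0 := (g.waveMapAt_congr (he.eventuallyEq_of_mem (h.mem_nhds hr hr0))).2
    (h.wave r hr hr0)
  initial x hx := (dirDeriv_congr (h.subset_upper hx)
    (eventuallyEq_nhdsWithin_upper (h.mem_nhdsWithin hx) he) _).trans (h.initial x hx)

end IsLocalSolution

section Maximal

variable (k : ℝ → TangentBundle (stModel n) (ℝ × N))

/-- The union of the domains of all local solutions. -/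
def maxDomain : Set (ℝ × ℝ) := {r | ∃ Ω y, g.IsLocalSolution k Ω y ∧ r ∈ Ω}

open Classical in
/-- The common extension of all local solutions. -/
def maxSolution (r : ℝ × ℝ) : ℝ × N :=
  -- The value off the maximal domain is arbitrary.
  if h : ∃ Ω y, g.IsLocalSolution k Ω y ∧ r ∈ Ω then h.choose_spec.choose r else (k 0).proj

variable {g k} [IsManifold (𝓡 n) ∞ N] [T2Space N]

lemma IsLocalSolution.subset_maxDomain {Ω : Set (ℝ × ℝ)} {y : ℝ × ℝ → ℝ × N}
    (h : g.IsLocalSolution k Ω y) : Ω ⊆ g.maxDomain k := fun _ hr => ⟨Ω, y, h, hr⟩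

lemma IsLocalSolution.eqOn_maxSolution {Ω : Set (ℝ × ℝ)} {y : ℝ × ℝ → ℝ × N}
    (h : g.IsLocalSolution k Ω y) : EqOn (g.maxSolution k) y Ω := by
  intro r hr
  have hex : ∃ Ω y, g.IsLocalSolution k Ω y ∧ r ∈ Ω := ⟨Ω, y, h, hr⟩
  rw [maxSolution, dif_pos hex]
  have hs := hex.choose_spec.choose_spec
  exact (hs.1.jetEq h hs.2 hr).eq

/-- The maximal local solution. -/
theorem isLocalSolution_max : g.IsLocalSolution k (g.maxDomain k) (g.maxSolution k) := by
  have hloc : ∀ Ω y, g.IsLocalSolution k Ω y → g.IsLocalSolution k Ω (g.maxSolution k) :=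
    fun Ω y h => h.congr h.eqOn_maxSolution
  refine ⟨?_, ?_, ?_, ?_, ?_⟩
  · have : ∀ r : g.maxDomain k, ∃ O : Set (ℝ × ℝ), IsOpen O ∧ r.1 ∈ O ∧ O ∩ upper ⊆ g.maxDomain k := by
      rintro ⟨r, Ω, y, h, hr⟩
      obtain ⟨O, hO, he⟩ := h.isOpen
      exact ⟨O, hO, (he ▸ hr).1, he ▸ h.subset_maxDomain⟩
    choose O hO hm hs using this
    refine ⟨⋃ r, O r, isOpen_iUnion hO, Subset.antisymm (fun r hr => ⟨?_, ?_⟩) ?_⟩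
    · exact mem_iUnion.2 ⟨⟨r, hr⟩, hm _⟩
    · obtain ⟨Ω, y, h, hr⟩ := hr
      exact h.subset_upper hr
    · rintro r ⟨hr, hr'⟩
      obtain ⟨i, hi⟩ := mem_iUnion.1 hr
      exact hs i ⟨hi, hr'⟩
  · rintro p ⟨Ω, y, h, hp⟩ q hq hpq
    exact ⟨Ω, y, h, h.past p hp q hq hpq⟩
  · rintro r ⟨Ω, y, h, hr⟩
    exact (hloc Ω y h).smooth r hr
  · rintro r ⟨Ω, y, h, hr⟩
    exact (hloc Ω y h).wave r hr
  · rintro x ⟨Ω, y, h, hr⟩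
    exact (hloc Ω y h).initial x hr

end Maximal

section Diamond

variable [IsManifold (𝓡 n) ∞ N]

lemma smoothAt_of_diamond {q₀ : N} {τ x₁ η : ℝ} {Y : ℝ × ℝ → ℝ × Coord n}
    (hY : ContDiffOn ℝ ∞ Y (diamond τ x₁ η)) (hr : ∀ p ∈ diamond τ x₁ η, Y p ∈ chartRange q₀)
    {p : ℝ × ℝ} (hp : p ∈ diamond τ x₁ η) :
    ContMDiffAt 𝓘(ℝ, ℝ × ℝ) (stModel n) ∞ (stPoint (n := n) q₀ ∘ Y) p :=
  ((contMDiffOn_stPoint q₀).contMDiffAt ((isOpen_chartRange q₀).mem_nhds (hr p hp))).comp p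
    (contMDiffAt_iff_contDiffAt.2 (hY.contDiffAt ((isOpen_diamond _ _ _).mem_nhds hp)))

lemma inCoord_diamond {q₀ : N} {τ x₁ η : ℝ} {Y : ℝ × ℝ → ℝ × Coord n}
    (hr : ∀ p ∈ diamond τ x₁ η, Y p ∈ chartRange q₀) :
    EqOn (inCoord (n := n) q₀ (stPoint q₀ ∘ Y)) Y (diamond τ x₁ η) := fun p hp =>
  stCoord_stPoint (hr p hp)

lemma waveMapAt_of_diamond {q₀ : N} {τ x₁ η : ℝ} {Y : ℝ × ℝ → ℝ × Coord n}
    (hY : ContDiffOn ℝ ∞ Y (diamond τ x₁ η)) (hr : ∀ p ∈ diamond τ x₁ η, Y p ∈ chartRange q₀)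
    (hw : ∀ p ∈ diamond τ x₁ η, g.ChartWave q₀ Y p)
    {p : ℝ × ℝ} (hp : p ∈ diamond τ x₁ η) : g.WaveMapAt (stPoint (n := n) q₀ ∘ Y) p := by
  rw [g.waveMapAt_iff_chartWave (smoothAt_of_diamond hY hr hp) (stPoint_mem (hr p hp))]
  have he : inCoord (n := n) q₀ (stPoint q₀ ∘ Y) =ᶠ[𝓝 p] Y :=
    (inCoord_diamond hr).eventuallyEq_of_mem ((isOpen_diamond _ _ _).mem_nhds hp)
  have h2 : (fun p' => fderiv ℝ (inCoord (n := n) q₀ (stPoint q₀ ∘ Y)) p' (1, 1))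
      =ᶠ[𝓝 p] fun p' => fderiv ℝ Y p' (1, 1) := he.fderiv.fun_comp (fun T => T (1, 1))
  unfold ChartWave
  rw [h2.fderiv_eq, he.fderiv_eq, he.eq_of_nhds]
  exact hw p hp

lemma mfderiv_stCoord_apply {q₀ : N} {p : ℝ × N} (hp : p ∈ chartDomain (n := n) q₀)
    (V : TangentSpace (stModel n) p) :
    mfderiv (stModel n) 𝓘(ℝ, ℝ × Coord n) (stCoord (n := n) q₀) p V = vecCoord q₀ V := by
  have : IsManifold (𝓡 n) 1 N := IsManifold.of_le (n := ∞) (by simp)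
  have h1 : MDifferentiableAt (stModel n) 𝓘(ℝ, ℝ) (Prod.fst : ℝ × N → ℝ) p := mdifferentiableAt_fst
  have h2 : MDifferentiableAt (stModel n) (𝓡 n) (Prod.snd : ℝ × N → N) p := mdifferentiableAt_snd
  have h3 : MDifferentiableAt (𝓡 n) 𝓘(ℝ, Coord n) (extChartAt (𝓡 n) q₀) p.2 :=
    mdifferentiableAt_extChartAt (by simpa [chartDomain] using hp)
  have h5 := HasMFDerivAt.comp p h3.hasMFDerivAt h2.hasMFDerivAt
  have h6 : HasMFDerivAt (stModel n) 𝓘(ℝ, ℝ × Coord n) (stCoord (n := n) q₀) p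
      ((mfderiv (stModel n) 𝓘(ℝ, ℝ) (Prod.fst : ℝ × N → ℝ) p).prod
        ((mfderiv (𝓡 n) 𝓘(ℝ, Coord n) (extChartAt (𝓡 n) q₀) p.2).comp
          (mfderiv (stModel n) (𝓡 n) (Prod.snd : ℝ × N → N) p))) :=
    ⟨h1.hasMFDerivAt.1.prodMk h5.1, h1.hasMFDerivAt.2.prodMk h5.2⟩
  exact congrArg (fun T : (ℝ × Coord n) →L[ℝ] (ℝ × Coord n) => T V) h6.mfderiv

lemma contMDiffOn_bundleCoord (q₀ : N) :
    ContMDiffOn (stModel n).tangent 𝓘(ℝ, ℝ × Coord n) ∞ (bundleCoord (n := n) (N := N) q₀)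
      (Bundle.TotalSpace.proj ⁻¹' chartDomain (n := n) q₀) := by
  have h1 := (contMDiffOn_stCoord (n := n) q₀).contMDiffOn_tangentMapWithin (m := ∞) (by simp)
    (isOpen_chartDomain q₀).uniqueMDiffOn
  have h2 := (contMDiff_snd_tangentBundle_modelSpace (n := ∞) (ℝ × Coord n)
    𝓘(ℝ, ℝ × Coord n)).comp_contMDiffOn h1
  refine h2.congr fun V hV => ?_
  have h3 : UniqueMDiffWithinAt (stModel n) (chartDomain (n := n) q₀) V.proj :=
    (isOpen_chartDomain q₀).uniqueMDiffWithinAt hV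
  have hm : MDifferentiableAt (stModel n) 𝓘(ℝ, ℝ × Coord n) (stCoord (n := n) q₀) V.proj :=
    ((contMDiffOn_stCoord q₀).contMDiffAt ((isOpen_chartDomain q₀).mem_nhds hV)).mdifferentiableAt
      (by simp)
  have h4 : mfderivWithin (stModel n) 𝓘(ℝ, ℝ × Coord n) (stCoord (n := n) q₀)
      (chartDomain (n := n) q₀) V.proj
      = mfderiv (stModel n) 𝓘(ℝ, ℝ × Coord n) (stCoord (n := n) q₀) V.proj :=
    mfderivWithin_of_isOpen (isOpen_chartDomain q₀) hV
  refine (mfderiv_stCoord_apply hV V.2).symm.trans ?_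
  exact congrArg (fun T : (ℝ × Coord n) →L[ℝ] (ℝ × Coord n) => T V.2) h4.symm

end Diamond

end MetricFamily

/-! ### Local existence at the axis -/

namespace MetricFamily

variable {n : ℕ} {N : Type*} [TopologicalSpace N] [ChartedSpace (Coord n) N]
variable (g : MetricFamily n N)

lemma pastClosed_diamond (x₁ η : ℝ) : PastClosed (diamond 0 x₁ η ∩ upper) := by
  rintro p ⟨hp, hp0⟩ q hq hpq
  refine ⟨?_, hq⟩
  simp only [diamond, mem_ofPred_eq, sub_zero, mem_upper] at hp hp0 hq ⊢
  rw [abs_of_nonneg hp0] at hp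
  rw [abs_of_nonneg hq]
  have := abs_sub_le q.2 p.2 x₁
  rw [abs_sub_comm p.2] at hpq
  linarith

variable [IsManifold (𝓡 n) ∞ N]

section

variable {k : ℝ → TangentBundle (stModel n) (ℝ × N)}

lemma isOpen_proj_mem_chartDomain (hk : ContMDiff 𝓘(ℝ, ℝ) (stModel n).tangent ∞ k) (q₀ : N) :
    IsOpen {x | (k x).proj ∈ chartDomain (n := n) q₀} :=
  (isOpen_chartDomain q₀).preimage
    ((FiberBundle.continuous_proj (ℝ × Coord n) (TangentSpace (stModel n))).comp hk.continuous)

lemma contDiffOn_stCoord_proj (hk : ContMDiff 𝓘(ℝ, ℝ) (stModel n).tangent ∞ k) (q₀ : N) :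
    ContDiffOn ℝ ∞ (fun x => stCoord (n := n) q₀ (k x).proj)
      {x | (k x).proj ∈ chartDomain (n := n) q₀} := by
  rw [← contMDiffOn_iff_contDiffOn]
  have h : ContMDiff 𝓘(ℝ, ℝ) (stModel n) ∞ (fun x => (k x).proj) :=
    (Bundle.contMDiff_proj (TangentSpace (stModel n))).comp hk
  exact (contMDiffOn_stCoord q₀).comp h.contMDiffOn fun x hx => hx

lemma contDiffOn_bundleCoord_comp (hk : ContMDiff 𝓘(ℝ, ℝ) (stModel n).tangent ∞ k) (q₀ : N) :
    ContDiffOn ℝ ∞ (fun x => bundleCoord (n := n) q₀ (k x))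
      {x | (k x).proj ∈ chartDomain (n := n) q₀} := by
  rw [← contMDiffOn_iff_contDiffOn]
  exact (contMDiffOn_bundleCoord q₀).comp hk.contMDiffOn fun x hx => hx

/-- Local existence for the initial value problem; the solution extends smoothly across the axis. -/
theorem exists_isLocalSolution_axis (hk : ContMDiff 𝓘(ℝ, ℝ) (stModel n).tangent ∞ k) (x₁ : ℝ) :
    ∃ η > 0, ∃ Y : ℝ × ℝ → ℝ × Coord n, ContDiffOn ℝ ∞ Y (diamond 0 x₁ η) ∧
      (∀ p ∈ diamond 0 x₁ η, Y p ∈ chartRange (k x₁).proj.2) ∧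
      g.IsLocalSolution k (diamond 0 x₁ η ∩ upper) (stPoint (k x₁).proj.2 ∘ Y) := by
  set q₀ := (k x₁).proj.2
  set I := {x | (k x).proj ∈ chartDomain (n := n) q₀}
  have hI : IsOpen I := isOpen_proj_mem_chartDomain hk q₀
  have hx₁ : x₁ ∈ I := mem_chartDomain_self _
  set Y₀ : ℝ → ℝ × Coord n := fun x => stCoord (n := n) q₀ (k x).proj
  set T₀ : ℝ → ℝ × Coord n := fun x => bundleCoord (n := n) q₀ (k x)
  have hY₀ : ContDiffOn ℝ ∞ Y₀ I := contDiffOn_stCoord_proj hk q₀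
  have hT₀ : ContDiffOn ℝ ∞ T₀ I := contDiffOn_bundleCoord_comp hk q₀
  have hD : ContDiffOn ℝ ∞ (deriv Y₀) I := hY₀.deriv_of_isOpen hI (by simp)
  -- The initial null derivatives are k₁ + ∂ₓk₀ and k₁ - ∂ₓk₀ in coordinates.
  have hP := hT₀.add hD
  have hQ := hT₀.sub hD
  obtain ⟨η₁, hη₁, hball⟩ := Metric.isOpen_iff.1 hI x₁ hx₁
  have hIcc : Icc (x₁ - η₁ / 2) (x₁ + η₁ / 2) ⊆ I := fun x hx => hball (by
    rw [Metric.mem_ball, Real.dist_eq, abs_lt]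
    constructor <;> linarith [hx.1, hx.2])
  have hc : ∀ f : ℝ → ℝ × Coord n, ContDiffOn ℝ ∞ f I →
      IsCompact (f '' Icc (x₁ - η₁ / 2) (x₁ + η₁ / 2)) := fun f hf =>
    isCompact_Icc.image_of_continuousOn (hf.continuousOn.mono hIcc)
  obtain ⟨η₀, hη₀, hex⟩ := g.exists_chartWave (q₀ := q₀) (hc Y₀ hY₀) (hc _ hP) (hc _ hQ)
    (by rintro _ ⟨x, hx, rfl⟩; exact stCoord_mem (hIcc hx))
  set η := min η₀ (η₁ / 2)
  have hη : 0 < η := lt_min hη₀ (by positivity)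
  have hsub : Icc (x₁ - η) (x₁ + η) ⊆ Icc (x₁ - η₁ / 2) (x₁ + η₁ / 2) := by
    have := min_le_right η₀ (η₁ / 2)
    exact Icc_subset_Icc (by linarith) (by linarith)
  obtain ⟨Y, hY, hYw, hY0⟩ := hex 0 x₁ η (min_le_left _ _) I hI (hsub.trans hIcc) Y₀ _ _ hY₀ hP hQ
    (fun x hx => ⟨mem_image_of_mem _ (hsub hx), mem_image_of_mem _ (hsub hx),
      mem_image_of_mem _ (hsub hx)⟩)
    (fun x hx => by
      have h1 := ((hY₀.contDiffAt (hI.mem_nhds (hIcc (hsub (Ioo_subset_Icc_self hx))))).differentiableAt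
        (by simp)).hasDerivAt
      refine h1.congr_deriv ?_
      change deriv Y₀ x = (1 / 2 : ℝ) • ((T₀ x + deriv Y₀ x) - (T₀ x - deriv Y₀ x))
      module)
  have hr := fun p hp => (hYw p hp).1
  refine ⟨η, hη, Y, hY, hr, ⟨_, isOpen_diamond _ _ _, rfl⟩, pastClosed_diamond _ _,
    fun r hr' => (smoothAt_of_diamond hY hr hr'.1).contMDiffWithinAt,
    fun r hr' _ => g.waveMapAt_of_diamond hY hr (fun p hp => (hYw p hp).2) hr'.1, fun x hx => ?_⟩
  have hx' : |x - x₁| < η := by simpa [diamond] using hx.1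
  have hxI : x ∈ I := hIcc (hsub (by
    rw [abs_lt] at hx'; constructor <;> linarith))
  obtain ⟨e1, e2, e3⟩ := hY0 x hx'
  have hp : (stPoint (n := n) q₀ ∘ Y) (0, x) = (k x).proj := by
    simp only [Function.comp, e1]
    exact stPoint_stCoord hxI
  have hpd : (stPoint (n := n) q₀ ∘ Y) (0, x) ∈ chartDomain (n := n) q₀ := by rw [hp]; exact hxI
  refine eq_of_bundleCoord_eq (q₀ := q₀) hp hpd ?_
  have he : inCoord (n := n) q₀ (stPoint q₀ ∘ Y) =ᶠ[𝓝 (0, x)] Y :=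
    (inCoord_diamond hr).eventuallyEq_of_mem ((isOpen_diamond _ _ _).mem_nhds hx.1)
  have hdY : DifferentiableAt ℝ Y (0, x) :=
    (hY.contDiffAt ((isOpen_diamond _ _ _).mem_nhds hx.1)).differentiableAt (by simp)
  rw [← fderivWithin_inCoord hx.2 (smoothAt_of_diamond hY hr hx.1).contMDiffWithinAt hpd,
    (he.filter_mono nhdsWithin_le_nhds).fderivWithin_eq he.eq_of_nhds,
    hdY.fderivWithin (uniqueDiffOn_upper _ hx.2)]
  have s1 : ((1 : ℝ), (0 : ℝ)) = (1 / 2 : ℝ) • ((1, 1) + (1, -1)) := by ext <;> norm_num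
  rw [s1, map_smul, map_add, e2, e3]
  change (1 / 2 : ℝ) • ((T₀ x + deriv Y₀ x) + (T₀ x - deriv Y₀ x)) = T₀ x
  module

lemma axis_mem_maxDomain (hk : ContMDiff 𝓘(ℝ, ℝ) (stModel n).tangent ∞ k) [T2Space N] (x : ℝ) :
    ((0 : ℝ), x) ∈ g.maxDomain k := by
  obtain ⟨η, hη, Y, -, -, h⟩ := g.exists_isLocalSolution_axis hk x
  exact h.subset_maxDomain ⟨by simpa [diamond] using hη, le_refl (0 : ℝ)⟩

end

end MetricFamily

/-! ### Lorentzian algebra, and the causal character of the initial data -/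

namespace MetricFamily

variable {n : ℕ} {N : Type*} [TopologicalSpace N] [ChartedSpace (Coord n) N]
variable (g : MetricFamily n N)

section Algebra

variable {p : ℝ × N}

lemma timePart_add (V W : TangentSpace (stModel n) p) :
    timePart (V + W) = timePart V + timePart W := map_add _ V W

lemma timePart_smul (c : ℝ) (V : TangentSpace (stModel n) p) :
    timePart (c • V) = c * timePart V := map_smul _ c V

lemma spacePart_add (V W : TangentSpace (stModel n) p) :
    spacePart (V + W) = spacePart V + spacePart W := map_add _ V W

lemma spacePart_smul (c : ℝ) (V : TangentSpace (stModel n) p) :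
    spacePart (c • V) = c • spacePart V := map_smul _ c V

lemma vecCoord_add (q₀ : N) (V W : TangentSpace (stModel n) p) :
    vecCoord (n := n) q₀ (V + W) = vecCoord q₀ V + vecCoord q₀ W := by
  refine Prod.ext (timePart_add V W) ?_
  simp only [vecCoord, spacePart_add]
  exact map_add _ _ _

lemma vecCoord_smul (q₀ : N) (c : ℝ) (V : TangentSpace (stModel n) p) :
    vecCoord (n := n) q₀ (c • V) = c • vecCoord q₀ V := by
  refine Prod.ext (timePart_smul c V) ?_
  simp only [vecCoord, spacePart_smul]
  exact map_smul _ _ _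

lemma lor_symm (V W : TangentSpace (stModel n) p) : g.lor p V W = g.lor p W V := by
  simp only [lor]
  rw [g.symm, mul_comm]

lemma lor_add_left (U V W : TangentSpace (stModel n) p) :
    g.lor p (U + V) W = g.lor p U W + g.lor p V W := by
  simp only [lor, timePart_add, spacePart_add, map_add, add_apply]
  ring

lemma lor_smul_left (c : ℝ) (V W : TangentSpace (stModel n) p) :
    g.lor p (c • V) W = c * g.lor p V W := by
  simp only [lor, timePart_smul, spacePart_smul, map_smul, smul_apply, smul_eq_mul]
  ring

lemma lor_add_right (U V W : TangentSpace (stModel n) p) :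
    g.lor p U (V + W) = g.lor p U V + g.lor p U W := by
  rw [g.lor_symm, g.lor_add_left, g.lor_symm V, g.lor_symm W]

lemma lor_smul_right (c : ℝ) (V W : TangentSpace (stModel n) p) :
    g.lor p V (c • W) = c * g.lor p V W := by
  rw [g.lor_symm, g.lor_smul_left, g.lor_symm W]

lemma inner_self_nonneg (t : ℝ) (q : N) (v : TangentSpace (𝓡 n) q) : 0 ≤ g.inner t q v v := by
  rcases eq_or_ne v 0 with rfl | hv
  · simp
  · exact (g.pos t q v hv).le

/-- Two future-directed null vectors have nonpositive inner product. -/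
lemma lor_nonpos_of_null {V W : TangentSpace (stModel n) p} (hV : g.lor p V V = 0)
    (hW : g.lor p W W = 0) (hV0 : 0 < timePart V) (hW0 : 0 < timePart W) : g.lor p V W ≤ 0 := by
  set a := timePart V with ha
  set b := timePart W with hb
  -- Cauchy–Schwarz for the spatial parts: these have lengths a and b because V and W are null, so
  -- the square is 2ab(ab - ⟨v, w⟩).
  have h := g.inner_self_nonneg p.1 p.2 (b • spacePart V + (-a) • spacePart W)
  simp only [map_add, map_smul, add_apply, smul_apply, smul_eq_mul] at h
  rw [g.symm _ _ (spacePart W) (spacePart V)] at h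
  simp only [lor, ← ha, ← hb] at hV hW ⊢
  have h1 : 0 < a * b := mul_pos hV0 hW0
  have h2 : 0 ≤ a * b * (a * b - g.inner p.1 p.2 (spacePart V) (spacePart W)) := by nlinarith
  have := nonneg_of_mul_nonneg_right h2 h1
  linarith

/-- A nonzero null vector has nonzero time component. -/
lemma timePart_ne_zero [IsManifold (𝓡 n) ∞ N] {V : TangentSpace (stModel n) p} (hV : g.lor p V V = 0) (h0 : V ≠ 0) :
    timePart V ≠ 0 := by
  intro h
  rw [lor, h] at hV
  have h2 : spacePart V = 0 := by
    by_contra h2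
    have := g.pos p.1 p.2 _ h2
    linarith
  rw [timePart_eq] at h
  rw [spacePart_eq] at h2
  exact h0 (Prod.ext h h2)

end Algebra

/-- The derivative of `y` at `r` in the direction `d`. -/
def vel (n : ℕ) {N : Type*} [TopologicalSpace N] [ChartedSpace (Coord n) N]
    (y : ℝ × ℝ → ℝ × N) (r d : ℝ × ℝ) : TangentSpace (stModel n) (y r) :=
  mfderivWithin 𝓘(ℝ, ℝ × ℝ) (stModel n) y upper r d

lemma vel_add (y : ℝ × ℝ → ℝ × N) (r d d' : ℝ × ℝ) :
    vel n y r (d + d') = vel n y r d + vel n y r d' := map_add _ d d'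

lemma vel_smul (y : ℝ × ℝ → ℝ × N) (r d : ℝ × ℝ) (c : ℝ) :
    vel n y r (c • d) = c • vel n y r d := map_smul _ c d

section Chart

variable [IsManifold (𝓡 n) ∞ N] {q₀ : N} {y : ℝ × ℝ → ℝ × N} {r : ℝ × ℝ}

lemma vecCoord_vel (hr : r ∈ upper) (hy : SmoothAt n y r) (hq : y r ∈ chartDomain (n := n) q₀)
    (d : ℝ × ℝ) : vecCoord q₀ (vel n y r d) = fderivWithin ℝ (inCoord (n := n) q₀ y) upper r d :=
  (fderivWithin_inCoord hr hy hq d).symm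

lemma lor_vel (hr : r ∈ upper) (hy : SmoothAt n y r) (hq : y r ∈ chartDomain (n := n) q₀)
    (d d' : ℝ × ℝ) : g.lor (y r) (vel n y r d) (vel n y r d')
      = g.metricForm q₀ (inCoord (n := n) q₀ y r) (fderivWithin ℝ (inCoord (n := n) q₀ y) upper r d)
        (fderivWithin ℝ (inCoord (n := n) q₀ y) upper r d') := by
  rw [g.lor_eq_coordMetric hq, vecCoord_vel hr hy hq, vecCoord_vel hr hy hq, metricForm_apply]
  rfl

lemma timePart_vel (hr : r ∈ upper) (hy : SmoothAt n y r) (hq : y r ∈ chartDomain (n := n) q₀)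
    (d : ℝ × ℝ) :
    timePart (vel n y r d) = (fderivWithin ℝ (inCoord (n := n) q₀ y) upper r d).1 := by
  rw [← vecCoord_vel hr hy hq]; rfl

lemma christSharp_symm {z : ℝ × Coord n} (hz : z ∈ chartRange q₀) (U V : ℝ × Coord n) :
    g.christSharp q₀ (z, U, V) = g.christSharp q₀ (z, V, U) := by
  simp only [christSharp]
  congr 1
  exact ContinuousLinearMap.ext fun W => g.christForm_symm hz U V W

end Chart

lemma hasDerivAt_line {F : Type} [NormedAddCommGroup F] [NormedSpace ℝ F] {Y : ℝ × ℝ → F}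
    {x c s : ℝ} (hs : 0 < s) (hY : DifferentiableWithinAt ℝ Y upper (s, x + c * s)) :
    HasDerivAt (fun s => Y (s, x + c * s)) (fderivWithin ℝ Y upper (s, x + c * s) (1, c)) s := by
  have h0 : upper ∈ 𝓝 (s, x + c * s) := upper_mem_nhds hs
  have h1 : HasDerivAt (fun s : ℝ => (s, x + c * s)) (1, c) s := by
    refine (hasDerivAt_id s).prodMk ?_
    simpa using ((hasDerivAt_id s).const_mul c).const_add x
  have h2 := (hY.hasFDerivWithinAt.hasFDerivAt h0)
  exact h2.comp_hasDerivAt s h1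

/-- Both transport equations in one: the sign ε selects the derivative in direction (1, ε), which is
transported along (1, -ε). Later propagation arguments are thereby given once for P and Q. -/
lemma hasDerivAt_null [IsManifold (𝓡 n) ∞ N] {q₀ : N} {Y : ℝ × ℝ → ℝ × Coord n} {x s ε : ℝ}
    (hε : ε = 1 ∨ ε = -1) (hs : 0 < s) (hY : ContDiffWithinAt ℝ ∞ Y upper (s, x + -ε * s))
    (hz : Y (s, x + -ε * s) ∈ chartRange q₀) (hw : g.ChartWave q₀ Y (s, x + -ε * s)) :
    HasDerivAt (fun s => fderivWithin ℝ Y upper (s, x + -ε * s) (1, ε))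
      (-g.christSharp q₀ (Y (s, x + -ε * s), fderivWithin ℝ Y upper (s, x + -ε * s) (1, ε),
        fderivWithin ℝ Y upper (s, x + -ε * s) (1, -ε))) s := by
  rcases hε with rfl | rfl
  · have e : ∀ s : ℝ, x + -1 * s = x - s := fun s => by ring
    simp only [e] at hY hz hw ⊢
    exact g.hasDerivAt_null_left hs hY hw
  · have e : ∀ s : ℝ, x + -(-1) * s = x + s := fun s => by ring
    simp only [e] at hY hz hw ⊢
    rw [g.christSharp_symm hz, neg_neg]
    exact g.hasDerivAt_null_right hs hY hw

/-- The metric in coordinates is compatible with the Christoffel symbols: this is the derivative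
of `⟨P, P⟩` along the transport equation of `P`. -/
lemma fderiv_metricForm_sub [IsManifold (𝓡 n) ∞ N] {q₀ : N} {z : ℝ × Coord n}
    (hz : z ∈ chartRange q₀) (P Q : ℝ × Coord n) :
    fderiv ℝ (g.metricForm q₀) z Q P P + g.metricForm q₀ z (-g.christSharp q₀ (z, P, Q)) P
      + g.metricForm q₀ z P (-g.christSharp q₀ (z, P, Q)) = 0 := by
  have h1 : fderiv ℝ (g.metricForm q₀) z P Q P = fderiv ℝ (g.metricForm q₀) z P P Q := by
    rw [← g.fderiv_coordMetric hz, ← g.fderiv_coordMetric hz]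
    congr 2
    funext z'
    rw [← metricForm_apply, metricForm_symm, metricForm_apply]
  rw [g.metricForm_symm q₀ z P, map_neg, neg_apply, g.metricForm_christSharp hz, christForm_apply,
    h1]
  ring

section Data

variable {g}

/-- The velocity of a curve has the derivative of its time component as time component. -/
lemma timePart_velocity [IsManifold (𝓡 n) ∞ N] {c : ℝ → ℝ × N} {s : ℝ}
    (hc : MDifferentiableAt 𝓘(ℝ, ℝ) (stModel n) c s) :
    HasDerivAt (fun s => (c s).1) (timePart (velocity (n := n) c s)) s := by
  have h1 : DifferentiableAt ℝ (stCoord (n := n) (c s).2 ∘ c) s := by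
    have := (((contMDiffOn_stCoord (n := n) (c s).2).contMDiffAt ((isOpen_chartDomain _).mem_nhds
      (mem_chartDomain_self (c s)))).mdifferentiableAt (by simp)).comp s hc
    exact this.differentiableAt
  have h2 := h1.hasFDerivAt.hasDerivAt
  rw [fderiv_stCoord_comp hc (mem_chartDomain_self (c s))] at h2
  exact h2.fst

namespace IsInitialData

variable [IsManifold (𝓡 n) ∞ N] {k : ℝ → TangentBundle (stModel n) (ℝ × N)}

lemma contMDiff_proj (hk : g.IsInitialData k) :
    ContMDiff 𝓘(ℝ, ℝ) (stModel n) ∞ (fun x => (k x).proj) :=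
  (Bundle.contMDiff_proj (TangentSpace (stModel n))).comp hk.smooth

lemma contDiff_time (hk : g.IsInitialData k) : ContDiff ℝ ∞ (fun x => (k x).proj.1) := by
  rw [← contMDiff_iff_contDiff]
  exact contMDiff_fst.comp hk.contMDiff_proj

lemma lor_null (hk : g.IsInitialData k) (x : ℝ) {ε : ℝ} (hε : ε = 1 ∨ ε = -1) :
    g.lor (k x).proj ((k x).snd + ε • baseDeriv k x) ((k x).snd + ε • baseDeriv k x) = 0 := by
  have hε2 : ε * ε = 1 := by rcases hε with rfl | rfl <;> norm_num
  simp only [lor_add_left, lor_add_right, lor_smul_left, lor_smul_right]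
  have h1 := hk.perp x
  have h2 := hk.norm_eq x
  rw [g.lor_symm] at h1
  rw [g.lor_symm (baseDeriv k x) (k x).snd, h1, h2]
  linear_combination (-g.lor (k x).proj (k x).snd (k x).snd) * hε2

/-- The vectors k₁ ± ∂ₓk₀ are null and nonzero, so their time parts never vanish and have constant
sign on the line. The sign is positive because the periodic function k₀⁰ has a critical point, where
the time part equals dt(k₁). -/
lemma timePart_pos (hk : g.IsInitialData k) (x : ℝ) {ε : ℝ} (hε : ε = 1 ∨ ε = -1) :
    0 < timePart ((k x).snd + ε • baseDeriv k x) := by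
  set u : ℝ → ℝ := fun x => timePart (k x).snd with hu
  set v : ℝ → ℝ := fun x => timePart (baseDeriv k x) with hv
  have hvd : ∀ x, HasDerivAt (fun x => (k x).proj.1) (v x) x := fun x =>
    timePart_velocity (hk.contMDiff_proj.mdifferentiableAt (by simp))
  have huc : Continuous u := by
    rw [continuous_iff_continuousAt]
    intro x₁
    have h1 : ContinuousAt (fun x => bundleCoord (n := n) (k x₁).proj.2 (k x)) x₁ :=
      ((contDiffOn_bundleCoord_comp hk.smooth _).continuousOn).continuousAt
        ((isOpen_proj_mem_chartDomain hk.smooth _).mem_nhds (mem_chartDomain_self (k x₁).proj))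
    exact h1.fst
  have hvc : Continuous v := by
    have : v = deriv (fun x => (k x).proj.1) := funext fun x => (hvd x).deriv.symm
    rw [this]
    exact hk.contDiff_time.continuous_deriv (by simp)
  have hval : ∀ ε x, timePart ((k x).snd + ε • baseDeriv k x) = u x + ε * v x := fun ε x => by
    rw [timePart_add, timePart_smul]
  have hne : ∀ ε, (ε = 1 ∨ ε = -1) → ∀ x, u x + ε * v x ≠ 0 := by
    intro ε hε x
    rw [← hval]
    refine g.timePart_ne_zero (hk.lor_null x hε) ?_
    rcases hε with rfl | rfl
    · rw [one_smul]; exact hk.add_ne x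
    · rw [neg_one_smul, ← sub_eq_add_neg]; exact hk.sub_ne x
  rw [hval]
  by_contra hcon
  have hx : u x + ε * v x < 0 := lt_of_le_of_ne (not_lt.1 hcon) (hne ε hε x)
  have hall : ∀ x', u x' + ε * v x' < 0 := by
    intro x'
    by_contra h'
    have h'' := not_lt.1 h'
    have hc : Continuous fun x => u x + ε * v x := by fun_prop
    obtain ⟨w, hw⟩ := mem_range_of_exists_le_of_exists_ge hc ⟨x, hx.le⟩ ⟨x', h''⟩
    exact hne ε hε w hw
  have hper : (k (x + 2 * Real.pi)).proj.1 = (k x).proj.1 := by rw [hk.periodic x]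
  have hpi : x < x + 2 * Real.pi := by linarith [Real.pi_pos]
  obtain ⟨w, -, hw⟩ := exists_hasDerivAt_eq_slope (fun x => (k x).proj.1) v hpi
    hk.contDiff_time.continuous.continuousOn fun x _ => hvd x
  rw [hper, sub_self, zero_div] at hw
  have h1 := hall w
  rw [hw, mul_zero, add_zero] at h1
  exact absurd (hk.future w) (not_lt.2 h1.le)

end IsInitialData

end Data

/-! ### Propagation of the null condition, and bounds for causal vectors -/

namespace IsLocalSolution

variable {g} [IsManifold (𝓡 n) ∞ N] {k : ℝ → TangentBundle (stModel n) (ℝ × N)} {Ω : Set (ℝ × ℝ)}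
  {y : ℝ × ℝ → ℝ × N}

lemma vecCoord_vel_axis (h : g.IsLocalSolution k Ω y) (hk : g.IsInitialData k) {x : ℝ}
    (hx : ((0 : ℝ), x) ∈ Ω) (ε : ℝ) :
    fderivWithin ℝ (inCoord (n := n) (k x).proj.2 y) upper (0, x) (1, ε)
      = vecCoord (k x).proj.2 ((k x).snd + ε • baseDeriv k x) := by
  have hq := mem_chartDomain_self (n := n) (k x).proj
  obtain ⟨h1, h2⟩ := h.nullJet_axis hx hq
  have h3 := fderiv_stCoord_comp (hk.contMDiff_proj.mdifferentiableAt (x := x) (by simp)) hq (1 : ℝ)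
  have h4 : fderivWithin ℝ (inCoord (n := n) (k x).proj.2 y) upper (0, x) (0, 1)
      = vecCoord (k x).proj.2 (baseDeriv k x) := h2.deriv.symm.trans h3
  have s1 : ((1 : ℝ), ε) = (1, 0) + ε • (0, 1) := by simp
  rw [s1, map_add, map_smul, h1, h4, vecCoord_add, vecCoord_smul]
  rfl

lemma null_axis (h : g.IsLocalSolution k Ω y) (hk : g.IsInitialData k) {x : ℝ}
    (hx : ((0 : ℝ), x) ∈ Ω) {ε : ℝ} (hε : ε = 1 ∨ ε = -1) :
    g.lor (y (0, x)) (vel n y (0, x) (1, ε)) (vel n y (0, x) (1, ε)) = 0 ∧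
      0 < timePart (vel n y (0, x) (1, ε)) := by
  have hq := mem_chartDomain_self (n := n) (k x).proj
  have hq' : y (0, x) ∈ chartDomain (n := n) (k x).proj.2 := by rw [h.proj_eq hx]; exact hq
  have hs := h.smooth _ hx
  rw [g.lor_vel (h.subset_upper hx) hs hq', timePart_vel (h.subset_upper hx) hs hq',
    h.vecCoord_vel_axis hk hx]
  refine ⟨?_, hk.timePart_pos x hε⟩
  have h1 := hk.lor_null x hε
  rw [g.lor_eq_coordMetric hq] at h1
  rw [metricForm_apply, inCoord_eq, Function.comp, h.proj_eq hx]
  exact h1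

lemma line_mem (h : g.IsLocalSolution k Ω y) {r : ℝ × ℝ} (hr : r ∈ Ω) {c : ℝ} (hc : |c| ≤ 1) {s : ℝ}
    (hs : s ∈ Icc 0 r.1) : (s, r.2 - c * r.1 + c * s) ∈ Ω := by
  refine h.pastFrom_subset hr ?_
  have := pastFrom_line (q := r) (c := -c) (by rwa [abs_neg]) hs.1 hs.2
  convert this using 2
  ring

lemma tendsto_line {x c s : ℝ} : Tendsto (fun s => (s, x + c * s)) (𝓝 s) (𝓝 (s, x + c * s)) :=
  Continuous.tendsto (by fun_prop) s

/-- Continuity along lines of quantities that are continuous on the half plane. -/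
lemma continuousOn_line {β : Type*} [TopologicalSpace β] {f : ℝ × ℝ → β} {x c : ℝ} {S : Set ℝ}
    (hS : S ⊆ Ici 0) (hf : ∀ s ∈ S, ContinuousWithinAt f upper (s, x + c * s)) :
    ContinuousOn (fun s => f (s, x + c * s)) S := fun s hs =>
  ContinuousWithinAt.comp (t := upper) (hf s hs)
    (Continuous.continuousWithinAt (by fun_prop)) fun _ hs' => hS hs'

lemma eventually_chart (h : g.IsLocalSolution k Ω y) {r : ℝ × ℝ} (hr : r ∈ Ω) :
    ∀ᶠ r' in 𝓝[upper] r, r' ∈ upper ∧ r' ∈ Ω ∧ y r' ∈ chartDomain (n := n) (y r).2 := by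
  have e1 : ∀ᶠ r' in 𝓝[upper] r, r' ∈ Ω := h.mem_nhdsWithin hr
  have e2 : ∀ᶠ r' in 𝓝[upper] r, y r' ∈ chartDomain (n := n) (y r).2 :=
    (h.smooth r hr).continuousWithinAt.tendsto ((isOpen_chartDomain _).mem_nhds
      (mem_chartDomain_self _))
  exact (eventually_mem_nhdsWithin.and (e1.and e2))

lemma lor_eventuallyEq (h : g.IsLocalSolution k Ω y) {r : ℝ × ℝ} (hr : r ∈ Ω) (d : ℝ × ℝ) :
    (fun r => g.lor (y r) (vel n y r d) (vel n y r d)) =ᶠ[𝓝[upper] r] fun r' =>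
      g.metricForm (y r).2 (inCoord (n := n) (y r).2 y r')
        (fderivWithin ℝ (inCoord (n := n) (y r).2 y) upper r' d)
        (fderivWithin ℝ (inCoord (n := n) (y r).2 y) upper r' d) := by
  filter_upwards [h.eventually_chart hr] with r' hr'
  exact g.lor_vel hr'.1 (h.smooth r' hr'.2.1) hr'.2.2 d d

lemma continuousWithinAt_lor (h : g.IsLocalSolution k Ω y) {r : ℝ × ℝ} (hr : r ∈ Ω) (d : ℝ × ℝ) :
    ContinuousWithinAt (fun r => g.lor (y r) (vel n y r d) (vel n y r d)) upper r := by
  have hq := mem_chartDomain_self (n := n) (y r)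
  have hu := h.subset_upper hr
  have hY := contDiffWithinAt_inCoord (h.smooth r hr) hq
  refine ContinuousWithinAt.congr_of_eventuallyEq ?_ (h.lor_eventuallyEq hr d)
    ((h.lor_eventuallyEq hr d).self_of_nhdsWithin hu)
  have h1 : ContinuousWithinAt (fun r' => g.metricForm (y r).2 (inCoord (n := n) (y r).2 y r'))
      upper r :=
    ContinuousAt.comp_continuousWithinAt (f := inCoord (n := n) (y r).2 y)
      ((g.contDiffOn_metricForm (y r).2).continuousOn.continuousAt
      ((isOpen_chartRange _).mem_nhds (stCoord_mem hq))) hY.continuousWithinAt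
  have h2 := (contDiffWithinAt_fderivWithin hu hY d).continuousWithinAt
  exact (h1.clm_apply h2).clm_apply h2

/-- Each null derivative is parallel along the other null direction, and the Levi-Civita connection
is metric. -/
lemma hasDerivAt_lor (h : g.IsLocalSolution k Ω y) {x s ε : ℝ} (hε : ε = 1 ∨ ε = -1) (hs : 0 < s)
    (hr : (s, x + -ε * s) ∈ Ω) :
    HasDerivAt (fun s => g.lor (y (s, x + -ε * s)) (vel n y (s, x + -ε * s) (1, ε))
      (vel n y (s, x + -ε * s) (1, ε))) 0 s := by
  set r : ℝ × ℝ := (s, x + -ε * s) with hrdef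
  have hq := mem_chartDomain_self (n := n) (y r)
  have hu := h.subset_upper hr
  have hY := contDiffWithinAt_inCoord (h.smooth r hr) hq
  have hz : inCoord (n := n) (y r).2 y r ∈ chartRange (n := n) (y r).2 := stCoord_mem hq
  have hw := g.chartWave_of_waveMapAt hs (h.smooth r hr) hq (h.wave r hr hs)
  have h1 := g.hasDerivAt_null hε hs hY hz hw
  have h2 := hasDerivAt_line hs (hY.differentiableWithinAt (by simp))
  have h3 := (g.differentiableAt_metricForm hz).hasFDerivAt.comp_hasDerivAt s h2
  have h4 := (h3.clm_apply h1).clm_apply h1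
  have hev := h.lor_eventuallyEq hr (1, ε)
  rw [nhdsWithin_eq_nhds.2 (upper_mem_nhds hs)] at hev
  refine (h4.congr_of_eventuallyEq (tendsto_line.eventually hev)).congr_deriv ?_
  exact g.fderiv_metricForm_sub hz _ _

/-- The null directions of the plane are mapped to null vectors. -/
theorem lor_null (h : g.IsLocalSolution k Ω y) (hk : g.IsInitialData k) {r : ℝ × ℝ} (hr : r ∈ Ω)
    {ε : ℝ} (hε : ε = 1 ∨ ε = -1) : g.lor (y r) (vel n y r (1, ε)) (vel n y r (1, ε)) = 0 := by
  have hc : |-ε| ≤ 1 := by rcases hε with rfl | rfl <;> simp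
  set x := r.2 - -ε * r.1
  have hm : ∀ s ∈ Icc 0 r.1, (s, x + -ε * s) ∈ Ω := fun s hs => h.line_mem hr hc hs
  have hr0 : 0 ≤ r.1 := h.subset_upper hr
  have h1 := norm_sub_le_of_hasDerivAt_Ioc (f := fun s => g.lor (y (s, x + -ε * s))
    (vel n y (s, x + -ε * s) (1, ε)) (vel n y (s, x + -ε * s) (1, ε))) (f' := fun _ => 0) (C := 0)
    hr0 (continuousOn_line (f := fun r => g.lor (y r) (vel n y r (1, ε)) (vel n y r (1, ε)))
      (fun s hs => hs.1) fun s hs => h.continuousWithinAt_lor (hm s hs) _)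
    (fun s hs => h.hasDerivAt_lor hε hs.1 (hm s ⟨hs.1.le, hs.2⟩)) (by simp)
  have e0 : ((0 : ℝ), x + -ε * 0) = (0, x) := by simp
  have e1 : (r.1, x + -ε * r.1) = r := Prod.ext rfl (by simp only [x]; ring)
  rw [zero_mul, norm_le_zero_iff, sub_eq_zero] at h1
  have h0 := hm 0 ⟨le_rfl, hr0⟩
  rw [e0] at h0 h1
  rw [e1] at h1
  rw [h1, (h.null_axis hk h0 hε).1]

end IsLocalSolution

section Bounds

variable [IsManifold (𝓡 n) ∞ N]

/-- On compact sets, causal vectors are bounded by their time components. -/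
lemma exists_norm_le_of_causal {q₀ : N} {K : Set (ℝ × Coord n)} (hK : IsCompact K)
    (hKr : K ⊆ chartRange q₀) :
    ∃ C ≥ 1, ∀ z ∈ K, ∀ V : ℝ × Coord n, g.metricForm q₀ z V V ≤ 0 → ‖V‖ ≤ C * |V.1| := by
  have hS : IsCompact (K ×ˢ Metric.sphere (0 : Coord n) 1) := hK.prod (isCompact_sphere _ _)
  have hc : ContinuousOn (fun e : (ℝ × Coord n) × Coord n =>
      g.metricForm q₀ e.1 ((0 : ℝ), e.2) ((0 : ℝ), e.2)) (K ×ˢ Metric.sphere (0 : Coord n) 1) := by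
    have h1 : ContinuousOn (fun e : (ℝ × Coord n) × Coord n => g.metricForm q₀ e.1)
        (K ×ˢ Metric.sphere (0 : Coord n) 1) :=
      (g.contDiffOn_metricForm q₀).continuousOn.comp continuousOn_fst fun e he => hKr he.1
    have h2 : ContinuousOn (fun e : (ℝ × Coord n) × Coord n => ((0 : ℝ), e.2))
        (K ×ˢ Metric.sphere (0 : Coord n) 1) := by fun_prop
    exact (h1.clm_apply h2).clm_apply h2
  have hpos : ∀ e ∈ K ×ˢ Metric.sphere (0 : Coord n) 1,
      0 < g.metricForm q₀ e.1 ((0 : ℝ), e.2) ((0 : ℝ), e.2) := by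
    rintro ⟨z, v⟩ ⟨hz, hv⟩
    rw [metricForm_apply, coordMetric]
    simp only [mul_zero, neg_zero, zero_add]
    refine g.pos _ _ _ fun h0 => ?_
    have h1 := mfderiv_chartInvDeriv (hKr hz).2 v
    rw [h0] at h1
    have h2 : v = 0 := h1.symm.trans (map_zero _)
    rw [h2] at hv
    simp at hv
  -- A positive lower bound of the spatial metric on unit vectors over K; for a causal V it gives
  -- m‖V.2‖² ≤ V.1².
  obtain ⟨m, hm, hmin⟩ := hS.exists_forall_le' hc hpos
  set M := max 1 (Real.sqrt m)⁻¹
  refine ⟨M, le_max_left _ _, fun z hz V hV => ?_⟩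
  have hsm : 0 < Real.sqrt m := Real.sqrt_pos.2 hm
  have h1 : m * ‖V.2‖ ^ 2 ≤ V.1 ^ 2 := by
    rw [metricForm_apply, coordMetric] at hV
    rcases eq_or_ne V.2 0 with h0 | h0
    · rw [h0]; simp; positivity
    have hn : 0 < ‖V.2‖ := norm_pos_iff.2 h0
    have h2 := hmin (z, ‖V.2‖⁻¹ • V.2) ⟨hz, by simp [norm_smul, hn.ne']⟩
    rw [metricForm_apply, coordMetric] at h2
    simp only [mul_zero, neg_zero, zero_add, map_smul, smul_apply, smul_eq_mul] at h2
    have h3 : m * ‖V.2‖ ^ 2 ≤ ‖V.2‖⁻¹ * (‖V.2‖⁻¹ * (g.inner z.1 ((extChartAt (𝓡 n) q₀).symm z.2)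
      (chartInvDeriv q₀ z.2 V.2) (chartInvDeriv q₀ z.2 V.2))) * ‖V.2‖ ^ 2 := by gcongr
    have h4 : ‖V.2‖⁻¹ * (‖V.2‖⁻¹ * (g.inner z.1 ((extChartAt (𝓡 n) q₀).symm z.2)
      (chartInvDeriv q₀ z.2 V.2) (chartInvDeriv q₀ z.2 V.2))) * ‖V.2‖ ^ 2
      = g.inner z.1 ((extChartAt (𝓡 n) q₀).symm z.2)
      (chartInvDeriv q₀ z.2 V.2) (chartInvDeriv q₀ z.2 V.2) := by field_simp
    nlinarith
  have h2 : Real.sqrt m * ‖V.2‖ ≤ |V.1| := by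
    rw [← abs_of_nonneg (by positivity : 0 ≤ Real.sqrt m * ‖V.2‖), ← sq_le_sq, mul_pow,
      Real.sq_sqrt hm.le]
    exact h1
  rw [Prod.norm_def, Real.norm_eq_abs, max_le_iff]
  constructor
  · exact le_mul_of_one_le_left (abs_nonneg _) (le_max_left _ _)
  · calc ‖V.2‖ = (Real.sqrt m)⁻¹ * (Real.sqrt m * ‖V.2‖) := by field_simp
      _ ≤ M * |V.1| := by gcongr; exact le_max_right _ _

/-- On compact sets, the time components of the acceleration terms of the transport equations are
bounded by the products of the time components of the null vectors. -/
lemma exists_christSharp_le {q₀ : N} {K : Set (ℝ × Coord n)} (hK : IsCompact K)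
    (hKr : K ⊆ chartRange q₀) :
    ∃ C ≥ 0, ∀ z ∈ K, ∀ U V : ℝ × Coord n, g.metricForm q₀ z U U ≤ 0 → g.metricForm q₀ z V V ≤ 0 →
      |(g.christSharp q₀ (z, U, V)).1| ≤ C * (|U.1| * |V.1|) := by
  obtain ⟨C₁, hC₁, hb⟩ := g.exists_norm_le_of_causal hK hKr
  have h1 : ContinuousOn (fun z => (g.metricForm q₀ z).inverse) K := by
    intro z hz
    have h2 : ContDiffAt ℝ ∞ (g.metricForm q₀) z :=
      (g.contDiffOn_metricForm q₀).contDiffAt ((isOpen_chartRange q₀).mem_nhds (hKr hz))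
    exact (ContDiffAt.continuousAt (n := ∞)
      ((g.isInvertible_metricForm (hKr hz)).contDiffAt_map_inverse.comp z h2)).continuousWithinAt
  have h2 : ContinuousOn (christForm (g.metricForm q₀)) K :=
    ((g.contDiffOn_metricForm q₀).christForm (isOpen_chartRange q₀)).continuousOn.mono hKr
  obtain ⟨A, hA⟩ := hK.exists_bound_of_continuousOn h1
  obtain ⟨B, hB⟩ := hK.exists_bound_of_continuousOn h2
  refine ⟨|A| * |B| * (C₁ * C₁), by positivity, fun z hz U V hU hV => ?_⟩
  have hU' := hb z hz U hU
  have hV' := hb z hz V hV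
  calc |(g.christSharp q₀ (z, U, V)).1| ≤ ‖g.christSharp q₀ (z, U, V)‖ := norm_fst_le (g.christSharp q₀ (z, U, V))
    _ ≤ ‖(g.metricForm q₀ z).inverse‖ * ‖christForm (g.metricForm q₀) z U V‖ :=
        ContinuousLinearMap.le_opNorm _ _
    _ ≤ ‖(g.metricForm q₀ z).inverse‖ * (‖christForm (g.metricForm q₀) z‖ * ‖U‖ * ‖V‖) := by
        gcongr
        exact ContinuousLinearMap.le_opNorm₂ _ _ _
    _ ≤ |A| * (|B| * (C₁ * |U.1|) * (C₁ * |V.1|)) := by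
        gcongr
        · exact (hA z hz).trans (le_abs_self A)
        · exact (hB z hz).trans (le_abs_self B)
    _ = |A| * |B| * (C₁ * C₁) * (|U.1| * |V.1|) := by ring

end Bounds

end MetricFamily

/-! ### Null derivatives remain future-directed -/

namespace MetricFamily

variable {n : ℕ} {N : Type*} [TopologicalSpace N] [ChartedSpace (Coord n) N]
variable {g : MetricFamily n N}

namespace IsLocalSolution

variable [IsManifold (𝓡 n) ∞ N] {k : ℝ → TangentBundle (stModel n) (ℝ × N)} {Ω : Set (ℝ × ℝ)}
  {y : ℝ × ℝ → ℝ × N}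

lemma continuousWithinAt_timePart (h : g.IsLocalSolution k Ω y) {r : ℝ × ℝ} (hr : r ∈ Ω)
    (d : ℝ × ℝ) : ContinuousWithinAt (fun r => timePart (vel n y r d)) upper r := by
  have hq := mem_chartDomain_self (n := n) (y r)
  have hu := h.subset_upper hr
  have hY := contDiffWithinAt_inCoord (h.smooth r hr) hq
  have he : (fun r => timePart (vel n y r d)) =ᶠ[𝓝[upper] r] fun r' =>
      (fderivWithin ℝ (inCoord (n := n) (y r).2 y) upper r' d).1 := by
    filter_upwards [h.eventually_chart hr] with r' hr'
    exact timePart_vel hr'.1 (h.smooth r' hr'.2.1) hr'.2.2 d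
  exact ContinuousWithinAt.congr_of_eventuallyEq
    (contDiffWithinAt_fderivWithin hu hY d).continuousWithinAt.fst he (he.self_of_nhdsWithin hu)

lemma hasDerivAt_timePart (h : g.IsLocalSolution k Ω y) {x s ε : ℝ} (hε : ε = 1 ∨ ε = -1)
    (hs : 0 < s) (hr : (s, x + -ε * s) ∈ Ω) {q₀ : N}
    (hq : y (s, x + -ε * s) ∈ chartDomain (n := n) q₀) :
    HasDerivAt (fun s => timePart (vel n y (s, x + -ε * s) (1, ε)))
      (-g.christSharp q₀ (inCoord (n := n) q₀ y (s, x + -ε * s),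
        fderivWithin ℝ (inCoord (n := n) q₀ y) upper (s, x + -ε * s) (1, ε),
        fderivWithin ℝ (inCoord (n := n) q₀ y) upper (s, x + -ε * s) (1, -ε))).1 s := by
  have hu := h.subset_upper hr
  have hsm := h.smooth _ hr
  have hY := contDiffWithinAt_inCoord hsm hq
  have h1 := g.hasDerivAt_null hε hs hY (stCoord_mem hq)
    (g.chartWave_of_waveMapAt hs hsm hq (h.wave _ hr hs))
  have hev : ∀ᶠ r' in 𝓝 (s, x + -ε * s), r' ∈ upper ∧ r' ∈ Ω ∧ y r' ∈ chartDomain (n := n) q₀ := by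
    have e0 : ∀ᶠ r' in 𝓝 (s, x + -ε * s), r' ∈ upper := upper_mem_nhds hs
    have e1 : ∀ᶠ r' in 𝓝 (s, x + -ε * s), r' ∈ Ω := h.mem_nhds hr hs
    have e2 : ∀ᶠ r' in 𝓝 (s, x + -ε * s), y r' ∈ chartDomain (n := n) q₀ :=
      (hsm.contMDiffAt (upper_mem_nhds hs)).continuousAt.tendsto
        ((isOpen_chartDomain _).mem_nhds hq)
    exact e0.and (e1.and e2)
  have he : (fun s => timePart (vel n y (s, x + -ε * s) (1, ε))) =ᶠ[𝓝 s] fun s =>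
      (fderivWithin ℝ (inCoord (n := n) q₀ y) upper (s, x + -ε * s) (1, ε)).1 := by
    filter_upwards [tendsto_line.eventually hev] with s' hs'
    exact timePart_vel hs'.1 (h.smooth _ hs'.2.1) hs'.2.2 _
  have h2 : HasDerivAt (fun s => (fderivWithin ℝ (inCoord (n := n) q₀ y) upper (s, x + -ε * s) (1, ε)).1)
    _ s := h1.fst
  exact h2.congr_of_eventuallyEq he

lemma metricForm_null (h : g.IsLocalSolution k Ω y) (hk : g.IsInitialData k) {r : ℝ × ℝ} (hr : r ∈ Ω)
    {ε : ℝ} (hε : ε = 1 ∨ ε = -1) {q₀ : N} (hq : y r ∈ chartDomain (n := n) q₀) :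
    g.metricForm q₀ (inCoord (n := n) q₀ y r) (fderivWithin ℝ (inCoord (n := n) q₀ y) upper r (1, ε))
      (fderivWithin ℝ (inCoord (n := n) q₀ y) upper r (1, ε)) = 0 := by
  rw [← g.lor_vel (h.subset_upper hr) (h.smooth r hr) hq, h.lor_null hk hr hε]

/-- The derivative of the time component of a null derivative, along the other null direction. -/
lemma exists_hasDerivAt_timePart (h : g.IsLocalSolution k Ω y) (hk : g.IsInitialData k)
    {q₀ : N} {K : Set (ℝ × Coord n)} {C : ℝ}
    (hC : ∀ z ∈ K, ∀ U V : ℝ × Coord n, g.metricForm q₀ z U U ≤ 0 → g.metricForm q₀ z V V ≤ 0 →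
      |(g.christSharp q₀ (z, U, V)).1| ≤ C * (|U.1| * |V.1|))
    {x s ε : ℝ} (hε : ε = 1 ∨ ε = -1) (hs : 0 < s) (hr : (s, x + -ε * s) ∈ Ω)
    (hq : y (s, x + -ε * s) ∈ chartDomain (n := n) q₀)
    (hK : inCoord (n := n) q₀ y (s, x + -ε * s) ∈ K) :
    ∃ α', HasDerivAt (fun s => timePart (vel n y (s, x + -ε * s) (1, ε))) α' s ∧
      |α'| ≤ C * (|timePart (vel n y (s, x + -ε * s) (1, ε))|
        * |timePart (vel n y (s, x + -ε * s) (1, -ε))|) := by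
  have hε' : -ε = 1 ∨ -ε = -1 := by rcases hε with rfl | rfl <;> simp
  refine ⟨_, h.hasDerivAt_timePart hε hs hr hq, ?_⟩
  have hu := h.subset_upper hr
  have hsm := h.smooth _ hr
  rw [timePart_vel hu hsm hq, timePart_vel hu hsm hq, Prod.fst_neg, abs_neg]
  exact hC _ hK _ _ (h.metricForm_null hk hr hε hq).le (h.metricForm_null hk hr hε' hq).le

/-- The null directions of the plane are mapped to future-directed vectors. -/
theorem timePart_pos (h : g.IsLocalSolution k Ω y) (hk : g.IsInitialData k) {r : ℝ × ℝ} (hr : r ∈ Ω)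
    {ε : ℝ} (hε : ε = 1 ∨ ε = -1) : 0 < timePart (vel n y r (1, ε)) := by
  have hc : |-ε| ≤ 1 := by rcases hε with rfl | rfl <;> simp
  set x := r.2 - -ε * r.1
  have hm : ∀ s ∈ Icc 0 r.1, (s, x + -ε * s) ∈ Ω := fun s hs => h.line_mem hr hc hs
  have hr0 : 0 ≤ r.1 := h.subset_upper hr
  have e0 : ((0 : ℝ), x + -ε * 0) = (0, x) := by simp
  have e1 : (r.1, x + -ε * r.1) = r := Prod.ext rfl (by simp only [x]; ring)
  set α : ℝ → ℝ := fun s => timePart (vel n y (s, x + -ε * s) (1, ε)) with hα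
  have hα0 : 0 < α 0 := by
    have h0 := hm 0 ⟨le_rfl, hr0⟩
    rw [e0] at h0
    simp only [hα]
    rw [e0]
    exact (h.null_axis hk h0 hε).2
  have hcont : ∀ d, ContinuousOn (fun s => timePart (vel n y (s, x + -ε * s) d)) (Icc 0 r.1) :=
    fun d => continuousOn_line (f := fun r => timePart (vel n y r d)) (fun s hs => hs.1)
      fun s hs => h.continuousWithinAt_timePart (hm s hs) d
  by_contra hcon
  have hend : α r.1 ≤ 0 := by simp only [hα]; rw [e1]; exact not_lt.1 hcon
  have hSc : IsCompact (Icc 0 r.1 ∩ α ⁻¹' Iic 0) :=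
    isCompact_Icc.of_isClosed_subset ((hcont _).preimage_isClosed_of_isClosed isClosed_Icc
      isClosed_Iic) inter_subset_left
  -- The first parameter at which positivity fails. Just before it the curve lies in one chart and
  -- in one compact set, where the constants are uniform.
  obtain ⟨s₁, ⟨hs₁, hs₁'⟩, hmin⟩ := hSc.exists_isLeast ⟨r.1, ⟨hr0, le_rfl⟩, hend⟩
  have hs₁0 : 0 < s₁ := by
    rcases hs₁.1.eq_or_lt with h0 | h0
    · rw [← h0] at hs₁'; exact absurd hs₁' (not_le.2 hα0)
    · exact h0
  have hpos : ∀ s ∈ Ico 0 s₁, 0 < α s := by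
    intro s hs
    by_contra hs'
    exact absurd (hmin ⟨⟨hs.1, hs.2.le.trans hs₁.2⟩, not_lt.1 hs'⟩) (not_le.2 hs.2)
  set r₁ : ℝ × ℝ := (s₁, x + -ε * s₁) with hr₁
  have hr₁Ω := hm s₁ hs₁
  have hq := mem_chartDomain_self (n := n) (y r₁)
  obtain ⟨K, hK, hKr, hKc⟩ := local_compact_nhds ((isOpen_chartRange (y r₁).2).mem_nhds
    (stCoord_mem (n := n) hq))
  obtain ⟨C, hC0, hC⟩ := g.exists_christSharp_le hKc hKr
  obtain ⟨B, hB⟩ := isCompact_Icc.exists_bound_of_continuousOn (hcont (1, -ε))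
  have hB0 : 0 ≤ B := (norm_nonneg _).trans (hB s₁ hs₁)
  have hev : ∀ᶠ s in 𝓝[Icc 0 r.1] s₁, y (s, x + -ε * s) ∈ chartDomain (n := n) (y r₁).2 ∧
      inCoord (n := n) (y r₁).2 y (s, x + -ε * s) ∈ K := by
    have e1 : ContinuousOn (fun s => y (s, x + -ε * s)) (Icc 0 r.1) :=
      continuousOn_line (f := y) (fun s hs => hs.1) fun s hs => (h.smooth _ (hm s hs)).continuousWithinAt
    have e2 : ∀ᶠ s in 𝓝[Icc 0 r.1] s₁, y (s, x + -ε * s) ∈ chartDomain (n := n) (y r₁).2 :=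
      (e1 s₁ hs₁).tendsto ((isOpen_chartDomain _).mem_nhds hq)
    have e3 : ∀ᶠ s in 𝓝[Icc 0 r.1] s₁, inCoord (n := n) (y r₁).2 y (s, x + -ε * s) ∈ K :=
      ((((continuousOn_stCoord _).continuousAt ((isOpen_chartDomain _).mem_nhds hq)).tendsto).comp
        (e1 s₁ hs₁).tendsto) hK
    exact e2.and e3
  obtain ⟨δ, hδ, hball⟩ := Metric.mem_nhdsWithin_iff.1 hev
  set s₀ := max 0 (s₁ - δ / 2) with hs₀
  have hs₀1 : s₀ < s₁ := max_lt hs₁0 (by linarith)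
  have hs₀0 : 0 ≤ s₀ := le_max_left _ _
  have hnear : ∀ s ∈ Icc s₀ s₁, y (s, x + -ε * s) ∈ chartDomain (n := n) (y r₁).2 ∧
      inCoord (n := n) (y r₁).2 y (s, x + -ε * s) ∈ K := by
    intro s hs
    refine hball ⟨?_, hs₀0.trans hs.1, hs.2.trans hs₁.2⟩
    have := (le_max_right _ _).trans hs.1
    rw [Metric.mem_ball, Real.dist_eq, abs_lt]
    constructor <;> linarith [hs.2]
  -- The bound |α'| ≤ C α β with β ≤ B makes α exp(CBs) nondecreasing, so α cannot reach zero at s₁.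
  have hder : ∀ s ∈ Ioo s₀ s₁, ∃ α', HasDerivAt α α' s ∧ 0 ≤ α' + C * B * α s := by
    intro s hs
    have hsI : s ∈ Icc 0 r.1 := ⟨hs₀0.trans hs.1.le, hs.2.le.trans hs₁.2⟩
    have hn := hnear s (Ioo_subset_Icc_self hs)
    obtain ⟨α', h1, h2⟩ := h.exists_hasDerivAt_timePart hk hC hε (hs₀0.trans_lt hs.1) (hm s hsI)
      hn.1 hn.2
    refine ⟨α', h1, ?_⟩
    have h3 : |α s| = α s := abs_of_pos (hpos s ⟨hs₀0.trans hs.1.le, hs.2⟩)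
    have h4 : |timePart (vel n y (s, x + -ε * s) (1, -ε))| ≤ B := hB s hsI
    have h5 : |α'| ≤ C * (α s * B) := by
      refine h2.trans ?_
      rw [← h3]
      gcongr
    have := (abs_le.1 h5).1
    linarith
  have hmono : MonotoneOn (fun s => α s * Real.exp (C * B * s)) (Icc s₀ s₁) := by
    have hd : ∀ s ∈ Ioo s₀ s₁, ∃ d, HasDerivAt (fun s => α s * Real.exp (C * B * s)) d s ∧ 0 ≤ d := by
      intro s hs
      obtain ⟨α', h1, h2⟩ := hder s hs
      have h3 : HasDerivAt (fun s : ℝ => Real.exp (C * B * s)) (Real.exp (C * B * s) * (C * B)) s := by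
        simpa using ((hasDerivAt_id s).const_mul (C * B)).exp
      refine ⟨_, h1.mul h3, ?_⟩
      have : α' * Real.exp (C * B * s) + α s * (Real.exp (C * B * s) * (C * B))
        = (α' + C * B * α s) * Real.exp (C * B * s) := by ring
      rw [this]
      exact mul_nonneg h2 (Real.exp_pos _).le
    refine monotoneOn_of_deriv_nonneg (convex_Icc _ _) ?_ ?_ ?_
    · refine ContinuousOn.mul ((hcont _).mono (Icc_subset_Icc hs₀0 hs₁.2)) (by fun_prop)
    · rw [interior_Icc]
      intro s hs
      obtain ⟨d, h1, -⟩ := hd s hs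
      exact h1.differentiableAt.differentiableWithinAt
    · rw [interior_Icc]
      intro s hs
      obtain ⟨d, h1, h2⟩ := hd s hs
      rw [h1.deriv]
      exact h2
  have h1 := hmono ⟨le_rfl, hs₀1.le⟩ ⟨hs₀1.le, le_rfl⟩ hs₀1.le
  have h2 : 0 < α s₀ * Real.exp (C * B * s₀) := mul_pos (hpos s₀ ⟨hs₀0, hs₀1⟩) (Real.exp_pos _)
  have h3 : α s₁ * Real.exp (C * B * s₁) ≤ 0 := mul_nonpos_of_nonpos_of_nonneg hs₁' (Real.exp_pos _).le
  simp only at h1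
  linarith

/-- Causal directions of the plane are mapped to future-directed causal vectors. -/
lemma vel_causal (h : g.IsLocalSolution k Ω y) (hk : g.IsInitialData k) {r : ℝ × ℝ} (hr : r ∈ Ω)
    {c : ℝ} (hc : |c| ≤ 1) :
    g.lor (y r) (vel n y r (1, c)) (vel n y r (1, c)) ≤ 0 ∧ 0 < timePart (vel n y r (1, c)) := by
  -- A causal direction is a convex combination of the two null directions, whose images are
  -- future-directed null vectors with nonpositive product.
  have s1 : ((1 : ℝ), c) = ((1 + c) / 2) • ((1 : ℝ), (1 : ℝ)) + ((1 - c) / 2) • (1, -1) := by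
    ext <;> simp <;> ring
  have hP := h.lor_null hk hr (ε := 1) (Or.inl rfl)
  have hQ := h.lor_null hk hr (ε := -1) (Or.inr rfl)
  have hP' := h.timePart_pos hk hr (ε := 1) (Or.inl rfl)
  have hQ' := h.timePart_pos hk hr (ε := -1) (Or.inr rfl)
  have hPQ := g.lor_nonpos_of_null hP hQ hP' hQ'
  obtain ⟨hc1, hc2⟩ := abs_le.1 hc
  rw [s1, vel_add, vel_smul, vel_smul]
  constructor
  · simp only [lor_add_left, lor_add_right, lor_smul_left, lor_smul_right, hP, hQ]
    rw [g.lor_symm (vel n y r (1, -1)) (vel n y r (1, 1))]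
    nlinarith [mul_nonneg (by linarith : 0 ≤ 1 + c) (by linarith : 0 ≤ 1 - c)]
  · rw [timePart_add, timePart_smul, timePart_smul]
    rcases lt_or_ge c 0 with h0 | h0
    · have := mul_pos (by linarith : 0 < (1 - c) / 2) hQ'
      have := mul_nonneg (by linarith : 0 ≤ (1 + c) / 2) hP'.le
      linarith
    · have := mul_nonneg (by linarith : 0 ≤ (1 - c) / 2) hQ'.le
      have := mul_pos (by linarith : 0 < (1 + c) / 2) hP'
      linarith

end IsLocalSolution

end MetricFamily

/-! ### Convergence of causal curves with bounded time, and monotonicity of time -/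

namespace MetricFamily

variable {n : ℕ} {N : Type*} [TopologicalSpace N] [ChartedSpace (Coord n) N]
variable {g : MetricFamily n N}

section Curves

/-- Future-directed causal velocity. -/
def CausalVec (g : MetricFamily n N) (V : TangentBundle (stModel n) (ℝ × N)) : Prop :=
  g.lor V.proj V.2 V.2 ≤ 0 ∧ 0 < timePart V.2

lemma velocity_congr {c c' : ℝ → ℝ × N} {s : ℝ} (h : c =ᶠ[𝓝 s] c') :
    (⟨c s, velocity c s⟩ : TangentBundle (stModel n) (ℝ × N)) = ⟨c' s, velocity c' s⟩ := by
  have h0 : c s = c' s := h.self_of_nhds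
  have h1 : mfderiv 𝓘(ℝ, ℝ) (stModel n) c s = mfderiv 𝓘(ℝ, ℝ) (stModel n) c' s := h.mfderiv_eq
  have h2 : ∀ (p p' : ℝ × N) (hp : p = p') (v : ℝ × Coord n) (w : ℝ × Coord n), v = w →
      (⟨p, v⟩ : TangentBundle (stModel n) (ℝ × N)) = ⟨p', w⟩ := by
    rintro p _ rfl v _ rfl
    rfl
  exact h2 _ _ h0 _ _ (congrArg (fun T : ℝ →L[ℝ] (ℝ × Coord n) => T (1 : ℝ)) h1)

variable [IsManifold (𝓡 n) ∞ N]

lemma causalVec_vertical (p : ℝ × N) (s : ℝ) :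
    g.CausalVec ⟨(p.1 + s, p.2), velocity (n := n) (fun s => (p.1 + s, p.2)) s⟩ := by
  set c : ℝ → ℝ × N := fun s => (p.1 + s, p.2)
  have hfst : ContMDiff 𝓘(ℝ, ℝ) 𝓘(ℝ, ℝ) ∞ fun s : ℝ => p.1 + s :=
    (contDiff_const.add contDiff_id).contMDiff
  have hc : MDifferentiableAt 𝓘(ℝ, ℝ) (stModel n) c s :=
    (hfst.prodMk contMDiff_const).mdifferentiableAt (by simp)
  have h1 : timePart (velocity (n := n) c s) = 1 :=
    (timePart_velocity hc).unique (by simpa using (hasDerivAt_id s).const_add p.1)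
  have h2 : spacePart (velocity (n := n) c s) = 0 := by
    have h3 := mfderiv_comp s (mdifferentiableAt_snd (I := 𝓘(ℝ, ℝ)) (I' := 𝓡 n) (x := c s)) hc
    have h4 : mfderiv 𝓘(ℝ, ℝ) (𝓡 n) (Prod.snd ∘ c) s = 0 := mfderiv_const
    rw [h4] at h3
    exact (congrArg (fun T : ℝ →L[ℝ] Coord n => T (1 : ℝ)) h3).symm
  constructor
  · change g.lor (c s) (velocity (n := n) c s) (velocity (n := n) c s) ≤ 0
    rw [lor, h1, h2]
    simp
  · change 0 < timePart (velocity (n := n) c s)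
    rw [h1]; norm_num

/-- A causal curve along which time is bounded converges, if the slices of constant time are Cauchy
hypersurfaces. -/
theorem exists_tendsto_of_causal
    (hslice : ∀ τ : ℝ, g.IsCauchyHypersurface {p : ℝ × N | p.1 = τ}) {γ : ℝ → ℝ × N} {B : ℝ}
    (hc : ContinuousOn γ (Ici 0)) (hs : ContMDiffOn 𝓘(ℝ, ℝ) (stModel n) 1 γ (Ioi 0))
    (hv : ∀ s > 0, g.CausalVec ⟨γ s, velocity γ s⟩) (hB : ∀ s ≥ 0, (γ s).1 ≤ B) :
    ∃ z, Tendsto γ atTop (𝓝 z) := by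
  -- The curve is prolonged to the past by a vertical line, on which time tends to -∞, so there is
  -- no past endpoint. Without a future endpoint the curve would have to meet the slice at time B +
  -- 1, although time stays at most B on it.
  set c : ℝ → ℝ × N := fun s => if 0 ≤ s then γ s else ((γ 0).1 + s, (γ 0).2) with hcdef
  set l : ℝ → ℝ × N := fun s => ((γ 0).1 + s, (γ 0).2) with hl
  have hlc : Continuous l := by fun_prop
  have hpos : ∀ s > 0, c =ᶠ[𝓝 s] γ := fun s hs => by
    filter_upwards [lt_mem_nhds hs] with s' hs'
    simp [hcdef, hs'.le]
  have hneg : ∀ s < 0, c =ᶠ[𝓝 s] l := fun s hs => by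
    filter_upwards [gt_mem_nhds hs] with s' hs'
    simp [hcdef, hl, hs']
  have hcc : Continuous c := by
    refine continuous_if_le continuous_const continuous_id (hc.mono ?_) hlc.continuousOn ?_
    · intro s hs; exact hs
    · rintro s rfl; simp [hl]
  have hcausal : g.IsCausalCurveOn c univ := by
    refine ⟨hcc.continuousOn, {0}, finite_singleton 0, ?_, ?_⟩
    · rintro s ⟨-, hs0⟩
      refine ContMDiffAt.contMDiffWithinAt ?_
      rcases lt_or_gt_of_ne (show s ≠ 0 from hs0) with h | h
      · have hfst : ContMDiff 𝓘(ℝ, ℝ) 𝓘(ℝ, ℝ) 1 fun s : ℝ => (γ 0).1 + s :=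
          (contDiff_const.add contDiff_id).contMDiff
        exact (hfst.prodMk contMDiff_const s).congr_of_eventuallyEq (hneg s h)
      · exact (hs.contMDiffAt (Ioi_mem_nhds h)).congr_of_eventuallyEq (hpos s h)
    · rintro s ⟨-, hs0⟩
      have key : g.CausalVec ⟨c s, velocity c s⟩ := by
        rcases lt_or_gt_of_ne (show s ≠ 0 from hs0) with h | h
        · rw [velocity_congr (hneg s h)]
          exact causalVec_vertical (γ 0) s
        · rw [velocity_congr (hpos s h)]
          exact hv s h
      exact key
  have hev : c =ᶠ[atTop] γ := by
    filter_upwards [eventually_ge_atTop 0] with s hs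
    simp [hcdef, hs]
  by_contra hcon
  have htop : ¬ ∃ p, Tendsto c atTop (𝓝 p) := fun ⟨p, hp⟩ => hcon ⟨p, hp.congr' hev⟩
  have hbot : ¬ ∃ p, Tendsto c atBot (𝓝 p) := by
    rintro ⟨p, hp⟩
    have h1 : Tendsto (fun s => (c s).1) atBot (𝓝 p.1) := (continuous_fst.tendsto p).comp hp
    refine not_tendsto_nhds_of_tendsto_atBot ?_ p.1 h1
    refine (tendsto_atBot_add_const_left atBot (γ 0).1 tendsto_id).congr' ?_
    filter_upwards [eventually_lt_atBot 0] with s hs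
    simp only [hcdef, if_neg (not_le.2 hs)]
    rfl
  obtain ⟨s, hs, -⟩ := hslice (B + 1) c hcausal htop hbot
  change (c s).1 = B + 1 at hs
  by_cases h0 : 0 ≤ s
  · have := hB s h0
    simp only [hcdef, h0, if_true] at hs
    linarith
  · have := hB 0 le_rfl
    simp only [hcdef, h0, if_false] at hs
    linarith

lemma velocity_comp {y : ℝ × ℝ → ℝ × N} {γ : ℝ → ℝ × ℝ} {d : ℝ × ℝ} {s : ℝ} (hγ : HasDerivAt γ d s)
    (hr : 0 < (γ s).1) (hy : SmoothAt n y (γ s)) :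
    velocity (n := n) (y ∘ γ) s = vel n y (γ s) d := by
  have hy' : MDifferentiableAt 𝓘(ℝ, ℝ × ℝ) (stModel n) y (γ s) :=
    (hy.contMDiffAt (upper_mem_nhds hr)).mdifferentiableAt (by simp)
  have h1 := mfderiv_comp s hy' hγ.differentiableAt.mdifferentiableAt
  have h2 : vel n y (γ s) d = mfderiv 𝓘(ℝ, ℝ × ℝ) (stModel n) y (γ s) d := by
    unfold vel
    rw [mfderivWithin_of_mem_nhds (upper_mem_nhds hr)]
  have h3 : mfderiv 𝓘(ℝ, ℝ) 𝓘(ℝ, ℝ × ℝ) γ s (1 : ℝ) = d := by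
    rw [mfderiv_eq_fderiv]
    exact hγ.deriv
  rw [h2]
  refine (congrArg (fun T : ℝ →L[ℝ] (ℝ × Coord n) => T (1 : ℝ)) h1).trans ?_
  exact congrArg (mfderiv 𝓘(ℝ, ℝ × ℝ) (stModel n) y (γ s)) h3

end Curves

namespace IsLocalSolution

variable [IsManifold (𝓡 n) ∞ N] {k : ℝ → TangentBundle (stModel n) (ℝ × N)} {Ω : Set (ℝ × ℝ)}
  {y : ℝ × ℝ → ℝ × N}

/-- The reparametrization φ allows for both uses: vertical segments of finite length are stretched
to a half line, and infinite vertical rays are taken with φ the identity. -/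
lemma exists_tendsto_comp (hslice : ∀ τ : ℝ, g.IsCauchyHypersurface {p : ℝ × N | p.1 = τ})
    (h : g.IsLocalSolution k Ω y) (hk : g.IsInitialData k) {x B : ℝ} {φ φ' : ℝ → ℝ}
    (hφ : ContDiff ℝ ∞ φ) (hφ' : ∀ s, HasDerivAt φ (φ' s) s) (hpos : ∀ s, 0 < φ' s) (h0 : φ 0 = 0)
    (hΩ : ∀ s ≥ 0, (φ s, x) ∈ Ω) (hB : ∀ s ≥ 0, (y (φ s, x)).1 ≤ B) :
    ∃ z, Tendsto (fun s => y (φ s, x)) atTop (𝓝 z) := by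
  have hmono : StrictMono φ := strictMono_of_hasDerivAt_pos hφ' hpos
  have hp : ∀ s > 0, 0 < φ s := fun s hs => by rw [← h0]; exact hmono hs
  have hγ : ContDiff ℝ ∞ fun s => (φ s, x) := hφ.prodMk contDiff_const
  refine exists_tendsto_of_causal hslice (B := B) ?_ ?_ ?_ hB
  · intro s hs
    refine ContinuousWithinAt.comp (t := upper) (h.smooth _ (hΩ s hs)).continuousWithinAt
      hγ.continuous.continuousWithinAt fun s' hs' => h.subset_upper (hΩ s' hs')
  · intro s hs
    have hs' : 0 < s := hs
    have h1 := (h.smooth _ (hΩ s hs'.le)).contMDiffAt (upper_mem_nhds (hp s hs'))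
    exact ((h1.comp s hγ.contMDiff.contMDiffAt).of_le (by simp)).contMDiffWithinAt
  · intro s hs
    have h1 : HasDerivAt (fun s => (φ s, x)) (φ' s • ((1 : ℝ), (0 : ℝ))) s := by
      simpa using (hφ' s).prodMk (hasDerivAt_const s x)
    have h2 := velocity_comp h1 (hp s hs) (h.smooth _ (hΩ s hs.le))
    have h3 := h.vel_causal hk (hΩ s hs.le) (c := 0) (by simp)
    rw [vel_smul] at h2
    have key : g.lor (y (φ s, x)) (φ' s • vel n y (φ s, x) (1, 0)) (φ' s • vel n y (φ s, x) (1, 0)) ≤ 0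
        ∧ 0 < timePart (φ' s • vel n y (φ s, x) (1, 0)) := by
      rw [lor_smul_left, lor_smul_right, timePart_smul]
      exact ⟨by nlinarith [mul_pos (hpos s) (hpos s)], mul_pos (hpos s) h3.2⟩
    rw [← h2] at key
    exact key

/-- Vertical lines of finite length along which time is bounded are mapped to curves with a
limit. -/
lemma exists_tendsto_vertical (hslice : ∀ τ : ℝ, g.IsCauchyHypersurface {p : ℝ × N | p.1 = τ})
    (h : g.IsLocalSolution k Ω y) (hk : g.IsInitialData k) {x B T : ℝ} (hT : 0 < T)
    (hΩ : ∀ s ∈ Ico 0 T, (s, x) ∈ Ω) (hB : ∀ s ∈ Ico 0 T, (y (s, x)).1 ≤ B) :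
    ∃ z, Tendsto (fun s => y (s, x)) (𝓝[<] T) (𝓝 z) := by
  have hφ : ∀ s ≥ 0, T * (1 - Real.exp (-s)) ∈ Ico 0 T := by
    intro s hs
    have h1 : Real.exp (-s) ≤ 1 := Real.exp_le_one_iff.2 (by linarith)
    have h2 := Real.exp_pos (-s)
    constructor <;> nlinarith
  obtain ⟨z, hz⟩ := h.exists_tendsto_comp hslice hk (x := x) (B := B)
    (φ := fun s => T * (1 - Real.exp (-s))) (φ' := fun s => T * Real.exp (-s)) (by fun_prop)
    (fun s => by
      have := (((hasDerivAt_id s).neg.exp).const_sub 1).const_mul T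
      simpa using this)
    (fun s => mul_pos hT (Real.exp_pos _)) (by simp) (fun s hs => hΩ _ (hφ s hs))
    (fun s hs => hB _ (hφ s hs))
  refine ⟨z, ?_⟩
  have h1 : Tendsto (fun s => -Real.log (1 - s / T)) (𝓝[<] T) atTop := by
    refine tendsto_neg_atBot_atTop.comp (Real.tendsto_log_nhdsGT_zero.comp ?_)
    refine tendsto_nhdsWithin_iff.2 ⟨?_, ?_⟩
    · have : Tendsto (fun s => 1 - s / T) (𝓝 T) (𝓝 (1 - T / T)) :=
        Continuous.tendsto (by fun_prop) T
      rw [div_self hT.ne', sub_self] at this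
      exact this.mono_left nhdsWithin_le_nhds
    · filter_upwards [self_mem_nhdsWithin] with s hs
      have : s / T < 1 := (div_lt_one hT).2 hs
      exact sub_pos.2 this
  refine (hz.comp h1).congr' ?_
  filter_upwards [self_mem_nhdsWithin] with s hs
  have : s / T < 1 := (div_lt_one hT).2 hs
  simp only [Function.comp]
  rw [neg_neg, Real.exp_log (by linarith)]
  congr 2
  field_simp
  ring

lemma hasDerivAt_time (h : g.IsLocalSolution k Ω y) {x c s : ℝ} (hs : 0 < s)
    (hr : (s, x + c * s) ∈ Ω) :
    HasDerivAt (fun s => (y (s, x + c * s)).1) (timePart (vel n y (s, x + c * s) (1, c))) s := by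
  have hq := mem_chartDomain_self (n := n) (y (s, x + c * s))
  have hsm := h.smooth _ hr
  rw [timePart_vel (h.subset_upper hr) hsm hq]
  exact (hasDerivAt_line hs ((contDiffWithinAt_inCoord hsm hq).differentiableWithinAt (by simp))).fst

/-- Time increases along causal lines. -/
lemma time_le (h : g.IsLocalSolution k Ω y) (hk : g.IsInitialData k) {r q : ℝ × ℝ} (hr : r ∈ Ω)
    (hq : q ∈ pastFrom 0 r) : (y q).1 ≤ (y r).1 ∧ (q.1 < r.1 → (y q).1 < (y r).1) := by
  rcases eq_or_lt_of_le (show q.1 ≤ r.1 by have := (abs_nonneg _).trans hq.2; linarith) with he | hlt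
  · have h2 := hq.2
    rw [he, sub_self, abs_nonpos_iff, sub_eq_zero] at h2
    rw [show q = r from Prod.ext he h2.symm]
    exact ⟨le_rfl, fun h => absurd h (lt_irrefl _)⟩
  have hd : 0 < r.1 - q.1 := by linarith
  set c := (r.2 - q.2) / (r.1 - q.1) with hc
  have hc1 : |c| ≤ 1 := by
    rw [hc, abs_div, abs_of_pos hd, div_le_one hd]
    exact hq.2
  set x := r.2 - c * r.1
  have e0 : (q.1, x + c * q.1) = q := by
    refine Prod.ext rfl ?_
    have : c * (r.1 - q.1) = r.2 - q.2 := by rw [hc]; field_simp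
    simp only [x]; linarith
  have e1 : (r.1, x + c * r.1) = r := Prod.ext rfl (by simp only [x]; ring)
  have hm : ∀ s ∈ Icc q.1 r.1, (s, x + c * s) ∈ Ω := fun s hs =>
    h.line_mem hr hc1 ⟨hq.1.trans hs.1, hs.2⟩
  have hmono : StrictMonoOn (fun s => (y (s, x + c * s)).1) (Icc q.1 r.1) := by
    refine strictMonoOn_of_deriv_pos (convex_Icc _ _) ?_ ?_
    · exact continuous_fst.comp_continuousOn (continuousOn_line (f := y) (fun s hs => hq.1.trans hs.1)
        fun s hs => (h.smooth _ (hm s hs)).continuousWithinAt)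
    · rw [interior_Icc]
      intro s hs
      have hs' := hm s (Ioo_subset_Icc_self hs)
      rw [(h.hasDerivAt_time (hq.1.trans_lt hs.1) hs').deriv]
      exact (h.vel_causal hk hs' hc1).2
  have h1 := hmono (left_mem_Icc.2 hlt.le) (right_mem_Icc.2 hlt.le) hlt
  simp only [e0, e1] at h1
  exact ⟨h1.le, fun _ => h1⟩

end IsLocalSolution

end MetricFamily

/-! ### Trapping in a chart and estimates for the null derivatives -/

namespace MetricFamily

variable {n : ℕ} {N : Type*} [TopologicalSpace N] [ChartedSpace (Coord n) N]
variable {g : MetricFamily n N}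

namespace IsLocalSolution

variable [IsManifold (𝓡 n) ∞ N] {k : ℝ → TangentBundle (stModel n) (ℝ × N)} {Ω : Set (ℝ × ℝ)}
  {y : ℝ × ℝ → ℝ × N}

lemma exists_line {q r : ℝ × ℝ} (hq : q ∈ pastFrom 0 r) (hlt : q.1 < r.1) :
    ∃ x c : ℝ, |c| ≤ 1 ∧ (q.1, x + c * q.1) = q ∧ (r.1, x + c * r.1) = r ∧
      ∀ s ∈ Icc q.1 r.1, (s, x + c * s) ∈ pastFrom 0 r := by
  have hd : 0 < r.1 - q.1 := by linarith
  set c := (r.2 - q.2) / (r.1 - q.1) with hc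
  have hc1 : |c| ≤ 1 := by
    rw [hc, abs_div, abs_of_pos hd, div_le_one hd]
    exact hq.2
  refine ⟨r.2 - c * r.1, c, hc1, ?_, Prod.ext rfl (by ring), fun s hs => ?_⟩
  · refine Prod.ext rfl ?_
    have : c * (r.1 - q.1) = r.2 - q.2 := by rw [hc]; field_simp
    simp only; linarith
  · have := pastFrom_line (τ := 0) (q := r) (c := -c) (by rwa [abs_neg]) (hq.1.trans hs.1) hs.2
    convert this using 2
    ring

/-- Causal curves that start close to the centre of a ball in a chart, and along which time varies
little, stay in the ball. -/
theorem trapped [T2Space N] (h : g.IsLocalSolution k Ω y) (hk : g.IsInitialData k) {q₀ : N}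
    {z₀ : ℝ × Coord n} {ρ C : ℝ} (hKr : Metric.closedBall z₀ ρ ⊆ chartRange q₀) (hC0 : 0 ≤ C)
    (hC : ∀ z ∈ Metric.closedBall z₀ ρ, ∀ V : ℝ × Coord n, g.metricForm q₀ z V V ≤ 0 →
      ‖V‖ ≤ C * |V.1|) {q r : ℝ × ℝ} (hr : r ∈ Ω) (hq : q ∈ pastFrom 0 r) (hq0 : 0 < q.1)
    (hqd : y q ∈ chartDomain (n := n) q₀) (hqb : dist (inCoord (n := n) q₀ y q) z₀ ≤ ρ / 2)
    (ht : C * ((y r).1 - (y q).1) < ρ / 2) :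
    y r ∈ chartDomain (n := n) q₀ ∧ inCoord (n := n) q₀ y r ∈ Metric.closedBall z₀ ρ := by
  have hρ : 0 ≤ ρ := by linarith [dist_nonneg.trans hqb]
  rcases eq_or_lt_of_le (show q.1 ≤ r.1 by have := (abs_nonneg _).trans hq.2; linarith) with he | hlt
  · have h2 := hq.2
    rw [he, sub_self, abs_nonpos_iff, sub_eq_zero] at h2
    rw [← show q = r from Prod.ext he h2.symm]
    exact ⟨hqd, hqb.trans (by linarith)⟩
  obtain ⟨x, c, hc, e0, e1, hline⟩ := exists_line hq hlt
  have hm : ∀ s ∈ Icc q.1 r.1, (s, x + c * s) ∈ Ω := fun s hs => h.pastFrom_subset hr (hline s hs)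
  set F : ℝ → ℝ × N := fun s => y (s, x + c * s) with hF
  have hFc : ContinuousOn F (Icc q.1 r.1) := continuousOn_line (f := y)
    (fun s hs => hq0.le.trans hs.1) fun s hs => (h.smooth _ (hm s hs)).continuousWithinAt
  set Yq := inCoord (n := n) q₀ y q with hYq
  -- A continuity argument. The set of parameters whose image lies in K' is closed, as K' is compact
  -- and the manifold is Hausdorff. It is open to the right: the cone condition and the bound on
  -- elapsed time put the point in the open ball, and there the speed is at most C times the speed
  -- of time, which preserves the cone condition.
  set K' := Metric.closedBall z₀ ρ ∩ {z | ‖z - Yq‖ ≤ C * (z.1 - Yq.1)} with hK'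
  have hK'c : IsCompact K' := (isCompact_closedBall _ _).inter_right
    (isClosed_le (by fun_prop) (by fun_prop))
  have hT : IsClosed (stPoint (n := n) q₀ '' K') :=
    (hK'c.image_of_continuousOn ((continuousOn_stPoint q₀).mono
      (inter_subset_left.trans hKr))).isClosed
  have hmemT : ∀ p ∈ chartDomain (n := n) q₀, stCoord (n := n) q₀ p ∈ K' →
      p ∈ stPoint (n := n) q₀ '' K' := fun p hp hp' => ⟨_, hp', stPoint_stCoord hp⟩
  have hTmem : ∀ p ∈ stPoint (n := n) q₀ '' K', p ∈ chartDomain (n := n) q₀ ∧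
      stCoord (n := n) q₀ p ∈ K' := by
    rintro _ ⟨z, hz, rfl⟩
    rw [stCoord_stPoint (hKr hz.1)]
    exact ⟨stPoint_mem (hKr hz.1), hz⟩
  have htime : ∀ s ∈ Icc q.1 r.1, (F s).1 ≤ (y r).1 := fun s hs =>
    (h.time_le hk hr (hline s hs)).1
  have hall : Icc q.1 r.1 ⊆ F ⁻¹' (stPoint (n := n) q₀ '' K') := by
    refine IsClosed.Icc_subset_of_forall_mem_nhdsWithin ?_ ?_ ?_
    · rw [inter_comm]
      exact hFc.preimage_isClosed_of_isClosed isClosed_Icc hT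
    · change F q.1 ∈ stPoint (n := n) q₀ '' K'
      simp only [hF, e0]
      refine hmemT _ hqd ⟨hqb.trans (by linarith), ?_⟩
      change ‖Yq - Yq‖ ≤ C * (Yq.1 - Yq.1)
      simp
    · rintro s ⟨hs, hsI⟩
      have hsI' : s ∈ Icc q.1 r.1 := Ico_subset_Icc_self hsI
      obtain ⟨hsd, hsb, hsn⟩ := hTmem _ hs
      have h1 : ‖stCoord q₀ (F s) - Yq‖ < ρ / 2 := by
        refine lt_of_le_of_lt hsn (lt_of_le_of_lt ?_ ht)
        have := htime s hsI'
        exact mul_le_mul_of_nonneg_left (sub_le_sub_right this _) hC0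
      have h2 : stCoord (n := n) q₀ (F s) ∈ Metric.ball z₀ ρ := by
        rw [Metric.mem_ball]
        calc dist (stCoord (n := n) q₀ (F s)) z₀ ≤ dist (stCoord (n := n) q₀ (F s)) Yq + dist Yq z₀ :=
              dist_triangle _ _ _
          _ < ρ / 2 + ρ / 2 := by rw [dist_eq_norm]; exact add_lt_add_of_lt_of_le h1 hqb
          _ = ρ := by ring
      have hev : ∀ᶠ s' in 𝓝[Icc q.1 r.1] s, F s' ∈ chartDomain (n := n) q₀ ∧
          stCoord (n := n) q₀ (F s') ∈ Metric.ball z₀ ρ := by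
        have e2 : ∀ᶠ s' in 𝓝[Icc q.1 r.1] s, F s' ∈ chartDomain (n := n) q₀ :=
          (hFc s hsI').tendsto ((isOpen_chartDomain _).mem_nhds hsd)
        have e3 : ∀ᶠ s' in 𝓝[Icc q.1 r.1] s, stCoord (n := n) q₀ (F s') ∈ Metric.ball z₀ ρ :=
          ((((continuousOn_stCoord _).continuousAt ((isOpen_chartDomain _).mem_nhds hsd)).tendsto).comp
            (hFc s hsI').tendsto) (Metric.isOpen_ball.mem_nhds h2)
        exact e2.and e3
      obtain ⟨δ, hδ, hball⟩ := Metric.mem_nhdsWithin_iff.1 hev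
      have hmin : s < min (s + δ) r.1 := lt_min (by linarith) hsI.2
      filter_upwards [Ioo_mem_nhdsGT hmin] with s' hs'
      have hs'1 : s' < s + δ := hs'.2.trans_le (min_le_left _ _)
      have hs'2 : s' < r.1 := hs'.2.trans_le (min_le_right _ _)
      have hsub : ∀ σ ∈ Icc s s', σ ∈ Icc q.1 r.1 ∧ F σ ∈ chartDomain (n := n) q₀ ∧
          stCoord (n := n) q₀ (F σ) ∈ Metric.ball z₀ ρ := by
        intro σ hσ
        have hσI : σ ∈ Icc q.1 r.1 := ⟨hsI.1.trans hσ.1, hσ.2.trans hs'2.le⟩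
        refine ⟨hσI, hball ⟨?_, hσI⟩⟩
        rw [Metric.mem_ball, Real.dist_eq, abs_lt]
        constructor <;> linarith [hσ.1, hσ.2]
      have hpos : ∀ σ ∈ Icc s s', 0 < σ := fun σ hσ => hq0.trans_le (hsub σ hσ).1.1
      have hder : ∀ σ ∈ Icc s s', HasDerivAt (fun σ => stCoord (n := n) q₀ (F σ))
          (fderivWithin ℝ (inCoord (n := n) q₀ y) upper (σ, x + c * σ) (1, c)) σ := fun σ hσ =>
        hasDerivAt_line (Y := inCoord (n := n) q₀ y) (hpos σ hσ) ((contDiffWithinAt_inCoord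
          (h.smooth _ (hm σ (hsub σ hσ).1)) (hsub σ hσ).2.1).differentiableWithinAt (by simp))
      have hbound := image_norm_le_of_norm_deriv_right_le_deriv_boundary' (a := s) (b := s')
        (f := fun σ => stCoord (n := n) q₀ (F σ) - stCoord (n := n) q₀ (F s))
        (f' := fun σ => fderivWithin ℝ (inCoord (n := n) q₀ y) upper (σ, x + c * σ) (1, c))
        (B := fun σ => C * ((F σ).1 - (F s).1))
        (B' := fun σ => C * timePart (vel n y (σ, x + c * σ) (1, c)))
        (fun σ hσ => ((hder σ hσ).sub_const _).continuousAt.continuousWithinAt)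
        (fun σ hσ => ((hder σ (Ico_subset_Icc_self hσ)).sub_const _).hasDerivWithinAt)
        (by simp)
        (fun σ hσ => (((h.hasDerivAt_time (hpos σ hσ) (hm σ (hsub σ hσ).1)).sub_const _).const_mul
          C).continuousAt.continuousWithinAt)
        (fun σ hσ => (((h.hasDerivAt_time (hpos σ (Ico_subset_Icc_self hσ))
          (hm σ (hsub σ (Ico_subset_Icc_self hσ)).1)).sub_const _).const_mul C).hasDerivWithinAt)
        (fun σ hσ => ?_) (right_mem_Icc.2 hs'.1.le)
      · obtain ⟨-, h3, h4⟩ := hsub s' (right_mem_Icc.2 hs'.1.le)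
        refine hmemT _ h3 ⟨Metric.ball_subset_closedBall h4, ?_⟩
        change ‖stCoord q₀ (F s') - Yq‖ ≤ C * ((F s').1 - Yq.1)
        have hsn' : ‖stCoord q₀ (F s) - Yq‖ ≤ C * ((F s).1 - Yq.1) := hsn
        calc ‖stCoord q₀ (F s') - Yq‖
            = ‖(stCoord q₀ (F s') - stCoord q₀ (F s)) + (stCoord q₀ (F s) - Yq)‖ := by
              rw [sub_add_sub_cancel]
          _ ≤ C * ((F s').1 - (F s).1) + C * ((F s).1 - Yq.1) :=
              (norm_add_le _ _).trans (add_le_add hbound hsn')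
          _ = C * ((F s').1 - Yq.1) := by ring
      · obtain ⟨h3, h4, h5⟩ := hsub σ (Ico_subset_Icc_self hσ)
        have hv := h.vel_causal hk (hm σ h3) hc
        have hu := h.subset_upper (hm σ h3)
        have hsm := h.smooth _ (hm σ h3)
        have h6 := hC _ (Metric.ball_subset_closedBall h5)
          (fderivWithin ℝ (inCoord (n := n) q₀ y) upper (σ, x + c * σ) (1, c))
          (by rw [g.lor_vel hu hsm h4] at hv; exact hv.1)
        rw [timePart_vel hu hsm h4] at hv ⊢
        rwa [abs_of_pos hv.2] at h6
  have hfin := hTmem _ (hall (right_mem_Icc.2 hlt.le))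
  simp only [hF, e1] at hfin
  exact ⟨hfin.1, hfin.2.1⟩

/-- Gronwall estimate for the time components of the null derivatives. -/
theorem log_estimate (h : g.IsLocalSolution k Ω y) (hk : g.IsInitialData k) {q₀ : N}
    {K : Set (ℝ × Coord n)} {C : ℝ}
    (hC : ∀ z ∈ K, ∀ U V : ℝ × Coord n, g.metricForm q₀ z U U ≤ 0 → g.metricForm q₀ z V V ≤ 0 →
      |(g.christSharp q₀ (z, U, V)).1| ≤ C * (|U.1| * |V.1|))
    {x s₀ s₁ ε : ℝ} (hε : ε = 1 ∨ ε = -1) (hs₀ : 0 ≤ s₀) (hs : s₀ ≤ s₁)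
    (hm : ∀ s ∈ Icc s₀ s₁, (s, x + -ε * s) ∈ Ω ∧ y (s, x + -ε * s) ∈ chartDomain (n := n) q₀ ∧
      inCoord (n := n) q₀ y (s, x + -ε * s) ∈ K) :
    timePart (vel n y (s₁, x + -ε * s₁) (1, ε)) ≤ timePart (vel n y (s₀, x + -ε * s₀) (1, ε)) *
        Real.exp (C * ((y (s₁, x + -ε * s₁)).1 - (y (s₀, x + -ε * s₀)).1)) ∧
      timePart (vel n y (s₀, x + -ε * s₀) (1, ε)) ≤ timePart (vel n y (s₁, x + -ε * s₁) (1, ε)) *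
        Real.exp (C * ((y (s₁, x + -ε * s₁)).1 - (y (s₀, x + -ε * s₀)).1)) := by
  have hε' : -ε = 1 ∨ -ε = -1 := by rcases hε with rfl | rfl <;> simp
  set α : ℝ → ℝ := fun s => timePart (vel n y (s, x + -ε * s) (1, ε)) with hα
  set τ : ℝ → ℝ := fun s => (y (s, x + -ε * s)).1 with hτ
  have hαc : ContinuousOn α (Icc s₀ s₁) :=
    continuousOn_line (f := fun r => timePart (vel n y r (1, ε))) (fun s hs => hs₀.trans hs.1)
      fun s hs => h.continuousWithinAt_timePart (hm s hs).1 _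
  have hτc : ContinuousOn τ (Icc s₀ s₁) := continuous_fst.comp_continuousOn
    (continuousOn_line (f := y) (fun s hs => hs₀.trans hs.1)
      fun s hs => (h.smooth _ (hm s hs).1).continuousWithinAt)
  -- Along direction (1, -ε) the derivative of time τ is the other time part β. So |α'| ≤ C α β says
  -- that α exp(Cτ) increases and α exp(-Cτ) decreases; the sign δ treats both.
  have hmono : ∀ δ : ℝ, (δ = 1 ∨ δ = -1) →
      MonotoneOn (fun s => δ * (α s * Real.exp (δ * (C * τ s)))) (Icc s₀ s₁) := by
    intro δ hδ
    have hd : ∀ s ∈ Ioo s₀ s₁, ∃ d,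
        HasDerivAt (fun s => δ * (α s * Real.exp (δ * (C * τ s)))) d s ∧ 0 ≤ d := by
      intro s hs
      obtain ⟨h1, h2, h3⟩ := hm s (Ioo_subset_Icc_self hs)
      have hs0 : 0 < s := hs₀.trans_lt hs.1
      obtain ⟨α', h4, h5⟩ := h.exists_hasDerivAt_timePart hk hC hε hs0 h1 h2 h3
      have h6 := h.hasDerivAt_time hs0 h1
      have hα0 := h.timePart_pos hk h1 hε
      have hβ0 := h.timePart_pos hk h1 hε'
      rw [abs_of_pos hα0, abs_of_pos hβ0] at h5
      refine ⟨_, (h4.mul ((h6.const_mul C).const_mul δ).exp).const_mul δ, ?_⟩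
      have hE := Real.exp_pos (δ * (C * (y (s, x + -ε * s)).1))
      have h7 := abs_le.1 h5
      have hδ2 : δ * δ = 1 := by rcases hδ with rfl | rfl <;> norm_num
      have h8 : δ * (α' * Real.exp (δ * (C * (y (s, x + -ε * s)).1)) +
          timePart (vel n y (s, x + -ε * s) (1, ε)) * (Real.exp (δ * (C * (y (s, x + -ε * s)).1)) *
            (δ * (C * timePart (vel n y (s, x + -ε * s) (1, -ε))))))
        = (δ * α' + C * (timePart (vel n y (s, x + -ε * s) (1, ε)) *
            timePart (vel n y (s, x + -ε * s) (1, -ε)))) *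
          Real.exp (δ * (C * (y (s, x + -ε * s)).1)) := by
        linear_combination (timePart (vel n y (s, x + -ε * s) (1, ε)) *
          Real.exp (δ * (C * (y (s, x + -ε * s)).1)) *
            (C * timePart (vel n y (s, x + -ε * s) (1, -ε)))) * hδ2
      refine le_of_le_of_eq (mul_nonneg ?_ hE.le) h8.symm
      rcases hδ with rfl | rfl <;> linarith
    refine monotoneOn_of_deriv_nonneg (convex_Icc _ _) ?_ ?_ ?_
    · exact continuousOn_const.mul (hαc.mul (Real.continuous_exp.comp_continuousOn
        (continuousOn_const.mul (continuousOn_const.mul hτc))))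
    · rw [interior_Icc]
      intro s hs
      obtain ⟨d, h1, -⟩ := hd s hs
      exact h1.differentiableAt.differentiableWithinAt
    · rw [interior_Icc]
      intro s hs
      obtain ⟨d, h1, h2⟩ := hd s hs
      rw [h1.deriv]
      exact h2
  have hE : ∀ a b : ℝ, Real.exp (C * (a - b)) = Real.exp (C * a) * Real.exp (-(C * b)) := by
    intro a b
    rw [← Real.exp_add]; ring_nf
  have h1 := hmono 1 (Or.inl rfl) (left_mem_Icc.2 hs) (right_mem_Icc.2 hs) hs
  have h2 := hmono (-1) (Or.inr rfl) (left_mem_Icc.2 hs) (right_mem_Icc.2 hs) hs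
  simp only [one_mul, neg_mul] at h1 h2
  have hcancel : ∀ a, Real.exp (C * a) * Real.exp (-(C * a)) = 1 := fun a => by
    rw [← Real.exp_add]; simp
  constructor
  · calc α s₁ = α s₁ * Real.exp (-(C * τ s₁)) * Real.exp (C * τ s₁) := by
          linear_combination (-α s₁) * hcancel (τ s₁)
      _ ≤ α s₀ * Real.exp (-(C * τ s₀)) * Real.exp (C * τ s₁) := by
          gcongr ?_ * _; linarith
      _ = α s₀ * Real.exp (C * (τ s₁ - τ s₀)) := by rw [hE]; ring
  · calc α s₀ = α s₀ * Real.exp (C * τ s₀) * Real.exp (-(C * τ s₀)) := by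
          linear_combination (-α s₀) * hcancel (τ s₀)
      _ ≤ α s₁ * Real.exp (C * τ s₁) * Real.exp (-(C * τ s₀)) := by gcongr
      _ = α s₁ * Real.exp (C * (τ s₁ - τ s₀)) := by rw [hE]; ring

/-- In the future of a point whose image is close to the centre of a ball in a chart, the null
derivatives are controlled by their values on the boundary of the future. -/
theorem edge_estimate [T2Space N] (h : g.IsLocalSolution k Ω y) (hk : g.IsInitialData k) {q₀ : N}
    {z₀ : ℝ × Coord n} {ρ C C' : ℝ} (hKr : Metric.closedBall z₀ ρ ⊆ chartRange q₀) (hC0 : 0 ≤ C)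
    (hC : ∀ z ∈ Metric.closedBall z₀ ρ, ∀ V : ℝ × Coord n, g.metricForm q₀ z V V ≤ 0 →
      ‖V‖ ≤ C * |V.1|) (hC'0 : 0 ≤ C')
    (hC' : ∀ z ∈ Metric.closedBall z₀ ρ, ∀ U V : ℝ × Coord n, g.metricForm q₀ z U U ≤ 0 →
      g.metricForm q₀ z V V ≤ 0 → |(g.christSharp q₀ (z, U, V)).1| ≤ C' * (|U.1| * |V.1|))
    {q r : ℝ × ℝ} (hr : r ∈ Ω) (hq : q ∈ pastFrom 0 r) (hq0 : 0 < q.1)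
    (hqd : y q ∈ chartDomain (n := n) q₀) (hqb : dist (inCoord (n := n) q₀ y q) z₀ ≤ ρ / 2)
    (ht : C * ((y r).1 - (y q).1) < ρ / 2) {ε u : ℝ} (hε : ε = 1 ∨ ε = -1)
    (hu : u = ((r.1 - q.1) + ε * (r.2 - q.2)) / 2) :
    timePart (vel n y r (1, ε)) ≤ timePart (vel n y (q.1 + u, q.2 + ε * u) (1, ε)) *
        Real.exp (C' * ((y r).1 - (y q).1)) ∧
      timePart (vel n y (q.1 + u, q.2 + ε * u) (1, ε)) ≤ timePart (vel n y r (1, ε)) *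
        Real.exp (C' * ((y r).1 - (y q).1)) := by
  have hε2 : ε * ε = 1 := by rcases hε with rfl | rfl <;> norm_num
  have hab := abs_le.1 hq.2
  have hw : 0 ≤ u ∧ q.1 + u ≤ r.1 := by
    rcases hε with rfl | rfl <;> constructor <;> linarith
  -- The line of direction (1, -ε) through r meets the null ray from q of direction (1, ε) at q +
  -- u(1, ε). Between this point and r it stays in the future of q, so `trapped` keeps its image in
  -- the chart.
  set x := r.2 + ε * r.1 with hx
  have e1 : (r.1, x + -ε * r.1) = r := Prod.ext rfl (by simp only [hx]; ring)
  have e0 : (q.1 + u, x + -ε * (q.1 + u)) = (q.1 + u, q.2 + ε * u) := by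
    refine Prod.ext rfl ?_
    simp only [hx, hu]
    linear_combination (-(r.2 - q.2)) * hε2
  have hmem : ∀ s ∈ Icc (q.1 + u) r.1, (s, x + -ε * s) ∈ pastFrom 0 r ∧
      q ∈ pastFrom 0 (s, x + -ε * s) := by
    intro s hs
    refine ⟨⟨(by linarith [hs.1] : (0 : ℝ) ≤ s), ?_⟩, hq0.le, ?_⟩
    · simp only [hx, abs_le]
      rcases hε with rfl | rfl <;> constructor <;> linarith [hs.1, hs.2]
    · simp only [hx, abs_le]
      rcases hε with rfl | rfl <;> constructor <;> linarith [hs.1, hs.2]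
  have htq : (y q).1 ≤ (y (q.1 + u, q.2 + ε * u)).1 := by
    have h1 := hmem (q.1 + u) ⟨le_rfl, hw.2⟩
    rw [e0] at h1
    exact (h.time_le hk (h.pastFrom_subset hr h1.1) h1.2).1
  have hlog := h.log_estimate hk hC' (x := x) hε (by linarith) hw.2 (fun s hs => by
    obtain ⟨h1, h2⟩ := hmem s hs
    have h3 := h.pastFrom_subset hr h1
    refine ⟨h3, h.trapped hk hKr hC0 hC h3 h2 hq0 hqd hqb (lt_of_le_of_lt ?_ ht)⟩
    have := (h.time_le hk hr h1).1
    gcongr)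
  rw [e1, e0] at hlog
  have hexp : Real.exp (C' * ((y r).1 - (y (q.1 + u, q.2 + ε * u)).1))
      ≤ Real.exp (C' * ((y r).1 - (y q).1)) := by gcongr
  have hr1 := h.timePart_pos hk hr hε
  have hm1 := hmem (q.1 + u) ⟨le_rfl, hw.2⟩
  rw [e0] at hm1
  have he1 := h.timePart_pos hk (h.pastFrom_subset hr hm1.1) hε
  exact ⟨hlog.1.trans (by gcongr), hlog.2.trans (by gcongr)⟩

end IsLocalSolution

end MetricFamily

/-! ### Extension past a missing point -/

namespace MetricFamily

variable {n : ℕ} {N : Type*} [TopologicalSpace N] [ChartedSpace (Coord n) N]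
variable {g : MetricFamily n N}

namespace IsLocalSolution

variable [IsManifold (𝓡 n) ∞ N] {k : ℝ → TangentBundle (stModel n) (ℝ × N)} {Ω : Set (ℝ × ℝ)}
  {y : ℝ × ℝ → ℝ × N}

-- Gluing at positive times. The added set D need not be past-closed itself; only the union has to
-- be.
open Classical in
lemma union (h : g.IsLocalSolution k Ω y) {D : Set (ℝ × ℝ)} {y₂ : ℝ × ℝ → ℝ × N} (hD : IsOpen D)
    (hpos : ∀ r ∈ D, 0 < r.1) (hs : ∀ r ∈ D, SmoothAt n y₂ r) (hw : ∀ r ∈ D, g.WaveMapAt y₂ r)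
    (he : EqOn y y₂ (Ω ∩ D))
    (hp : ∀ r ∈ D, ∀ q ∈ upper, |r.2 - q.2| ≤ r.1 - q.1 → q ∈ Ω ∪ D) :
    ∃ y', g.IsLocalSolution k (Ω ∪ D) y' := by
  set y' : ℝ × ℝ → ℝ × N := fun r => if r ∈ Ω then y r else y₂ r
  have h1 : EqOn y' y Ω := fun r hr => if_pos hr
  have h2 : EqOn y' y₂ D := by
    intro r hr
    by_cases hrΩ : r ∈ Ω
    · exact (if_pos hrΩ).trans (he ⟨hrΩ, hr⟩)
    · exact if_neg hrΩ
  have h3 := h.congr h1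
  refine ⟨y', ?_, ?_, ?_, ?_, ?_⟩
  · obtain ⟨O, hO, hOe⟩ := h.isOpen
    refine ⟨O ∪ D, hO.union hD, ?_⟩
    rw [union_inter_distrib_right, ← hOe, inter_eq_left.2 (show D ⊆ upper from fun r hr => (hpos r hr).le)]
  · rintro r (hr | hr) q hq hqr
    · exact Or.inl (h.past r hr q hq hqr)
    · exact hp r hr q hq hqr
  · rintro r (hr | hr)
    · exact h3.smooth r hr
    · exact smoothAt_congr (hpos r hr).le ((h2.eventuallyEq_of_mem (hD.mem_nhds hr)).filter_mono
        nhdsWithin_le_nhds) (hs r hr)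
  · rintro r (hr | hr) hr0
    · exact h3.wave r hr hr0
    · exact (g.waveMapAt_congr (h2.eventuallyEq_of_mem (hD.mem_nhds hr))).2 (hw r hr)
  · rintro x (hx | hx)
    · exact h3.initial x hx
    · exact absurd (hpos _ hx) (lt_irrefl _)

lemma contDiffAt_inCoord_line (h : g.IsLocalSolution k Ω y) {q₀ : N} {t x : ℝ} (ht : 0 < t)
    (hx : (t, x) ∈ Ω) (hq : y (t, x) ∈ chartDomain (n := n) q₀) :
    ContDiffAt ℝ ∞ (fun x => nullJet (inCoord (n := n) q₀ y) (t, x)) x := by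
  have h1 := (contDiffWithinAt_nullJet ht.le (contDiffWithinAt_inCoord (h.smooth _ hx) hq)).contDiffAt
    (upper_mem_nhds ht)
  have h2 : ContDiffAt ℝ ∞ (fun x : ℝ => (t, x)) x := contDiffAt_const.prodMk contDiffAt_id
  exact ContDiffAt.comp x h1 h2

lemma exists_Icc_subset {I : Set ℝ} (hI : IsOpen I) {a b : ℝ} (hab : a ≤ b) (h : Icc a b ⊆ I) :
    ∃ δ > 0, Icc (a - δ) (b + δ) ⊆ I := by
  obtain ⟨δ₁, hδ₁, h₁⟩ := Metric.isOpen_iff.1 hI a (h (left_mem_Icc.2 hab))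
  obtain ⟨δ₂, hδ₂, h₂⟩ := Metric.isOpen_iff.1 hI b (h (right_mem_Icc.2 hab))
  refine ⟨min (δ₁ / 2) (δ₂ / 2), by positivity, fun x hx => ?_⟩
  have m1 := min_le_left (δ₁ / 2) (δ₂ / 2)
  have m2 := min_le_right (δ₁ / 2) (δ₂ / 2)
  rcases lt_or_ge x a with hxa | hxa
  · refine h₁ ?_
    rw [Metric.mem_ball, Real.dist_eq, abs_lt]
    constructor <;> linarith [hx.1]
  rcases lt_or_ge b x with hxb | hxb
  · refine h₂ ?_
    rw [Metric.mem_ball, Real.dist_eq, abs_lt]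
    constructor <;> linarith [hx.2]
  exact h ⟨hxa, hxb⟩

/-- If time is bounded on a vertical segment whose endpoint is missing from the domain, then the
solution extends to a neighbourhood of the endpoint. -/
theorem exists_extension [T2Space N]
    (hslice : ∀ τ : ℝ, g.IsCauchyHypersurface {p : ℝ × N | p.1 = τ})
    (h : g.IsLocalSolution k Ω y) (hk : g.IsInitialData k) {T x₁ B : ℝ} (hT : 0 < T)
    (hΩ : ∀ r ∈ pastFrom 0 (T, x₁), r ≠ (T, x₁) → r ∈ Ω)
    (hB : ∀ s ∈ Ico 0 T, (y (s, x₁)).1 ≤ B) :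
    ∃ Ω' y', g.IsLocalSolution k Ω' y' ∧ (T, x₁) ∈ Ω' := by
  have hvert : ∀ s ∈ Ico 0 T, (s, x₁) ∈ Ω := by
    intro s hs
    refine hΩ _ ⟨hs.1, by simpa using hs.2.le⟩ fun he => ?_
    rw [Prod.mk.injEq] at he
    exact hs.2.ne he.1
  obtain ⟨z, hz⟩ := h.exists_tendsto_vertical hslice hk hT hvert hB
  set q₀ := z.2
  have hzd : z ∈ chartDomain (n := n) q₀ := mem_chartDomain_self z
  set z₀ := stCoord (n := n) q₀ z
  obtain ⟨ρ', hρ', hball⟩ := Metric.isOpen_iff.1 (isOpen_chartRange q₀) z₀ (stCoord_mem hzd)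
  -- The estimates hold in the ball of radius ρ. The ball of radius 2ρ, still in the range of the
  -- chart, leaves room for data on a slightly longer interval.
  set ρ := ρ' / 3 with hρdef
  have hρ : 0 < ρ := by positivity
  have hKr2 : Metric.closedBall z₀ (2 * ρ) ⊆ chartRange q₀ :=
    (Metric.closedBall_subset_ball (by rw [hρdef]; linarith)).trans hball
  have hKr : Metric.closedBall z₀ ρ ⊆ chartRange q₀ :=
    (Metric.closedBall_subset_closedBall (by linarith)).trans hKr2
  obtain ⟨C, hC1, hC⟩ := g.exists_norm_le_of_causal (isCompact_closedBall z₀ ρ) hKr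
  obtain ⟨C', hC'0, hC'⟩ := g.exists_christSharp_le (isCompact_closedBall z₀ ρ) hKr
  have hC0 : 0 ≤ C := by linarith
  -- time is bounded by its limit
  have hzt : Tendsto (fun s => (y (s, x₁)).1) (𝓝[<] T) (𝓝 z.1) := (continuous_fst.tendsto z).comp hz
  have hvle : ∀ s ∈ Ico 0 T, (y (s, x₁)).1 ≤ z.1 := by
    intro s hs
    refine ge_of_tendsto hzt ?_
    filter_upwards [Ioo_mem_nhdsLT hs.2] with s' hs'
    refine (h.time_le hk (hvert s' ⟨hs.1.trans hs'.1.le, hs'.2⟩) ⟨hs.1, ?_⟩).1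
    simp only [sub_self, abs_zero]
    linarith [hs'.1]
  have htle : ∀ r ∈ pastFrom 0 (T, x₁), r ≠ (T, x₁) → 0 < r.1 → (y r).1 ≤ z.1 := by
    intro r hr hne hr0
    have hrT : r.1 ≤ T := by have := (abs_nonneg _).trans hr.2; simp only at this; linarith
    have hrΩ := hΩ r hr hne
    have hlim : Tendsto (fun σ : ℝ => (r.1 - σ, r.2)) (𝓝[>] 0) (𝓝 r) := by
      have : Tendsto (fun σ : ℝ => (r.1 - σ, r.2)) (𝓝 0) (𝓝 (r.1 - 0, r.2)) :=
        Continuous.tendsto (by fun_prop) 0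
      rw [sub_zero] at this
      exact this.mono_left nhdsWithin_le_nhds
    have hcy : Tendsto (fun σ : ℝ => (y (r.1 - σ, r.2)).1) (𝓝[>] 0) (𝓝 (y r).1) :=
      (continuous_fst.tendsto _).comp
        ((((h.smooth r hrΩ).contMDiffAt (upper_mem_nhds hr0)).continuousAt.tendsto).comp hlim)
    refine le_of_tendsto hcy ?_
    filter_upwards [Ioo_mem_nhdsGT hr0] with σ hσ
    have hs : T - σ ∈ Ico 0 T := ⟨by linarith [hσ.2], by linarith [hσ.1]⟩
    refine (h.time_le hk (hvert _ hs) ⟨by simp only; linarith [hσ.2], ?_⟩).1.trans (hvle _ hs)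
    have := hr.2
    simp only at this ⊢
    linarith
  -- a point on the vertical segment, close to the limit
  have hq : ∀ᶠ s in 𝓝[<] T, y (s, x₁) ∈ chartDomain (n := n) q₀ ∧
      dist (inCoord (n := n) q₀ y (s, x₁)) z₀ < ρ / 2 ∧ C * (z.1 - (y (s, x₁)).1) < ρ / 2 := by
    have e1 : ∀ᶠ s in 𝓝[<] T, y (s, x₁) ∈ chartDomain (n := n) q₀ :=
      hz ((isOpen_chartDomain q₀).mem_nhds hzd)
    have e2 : ∀ᶠ s in 𝓝[<] T, inCoord (n := n) q₀ y (s, x₁) ∈ Metric.ball z₀ (ρ / 2) :=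
      ((((continuousOn_stCoord q₀).continuousAt ((isOpen_chartDomain q₀).mem_nhds hzd)).tendsto).comp
        hz) (Metric.ball_mem_nhds _ (by positivity))
    have e3 : ∀ᶠ s in 𝓝[<] T, C * (z.1 - (y (s, x₁)).1) < ρ / 2 := by
      have : Tendsto (fun s => C * (z.1 - (y (s, x₁)).1)) (𝓝[<] T) (𝓝 (C * (z.1 - z.1))) :=
        (hzt.const_sub z.1).const_mul C
      rw [sub_self, mul_zero] at this
      exact this.eventually_lt_const (by positivity)
    exact e1.and (e2.and e3)
  obtain ⟨t₀, ⟨hqd, hqb, hqt⟩, ht₀, ht₀T⟩ := (hq.and (Ioo_mem_nhdsLT hT)).exists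
  set q : ℝ × ℝ := (t₀, x₁) with hqdef
  have hqΩ : q ∈ Ω := hvert t₀ ⟨ht₀.le, ht₀T⟩
  -- bounds on the future of `q`
  have hedge : ∀ ε : ℝ, (ε = 1 ∨ ε = -1) → ∃ M, ∀ u ∈ Icc 0 ((T - t₀) / 2),
      timePart (vel n y (t₀ + u, x₁ + ε * u) (1, ε)) ≤ M := by
    intro ε hε
    have hm : ∀ u ∈ Icc 0 ((T - t₀) / 2), (t₀ + u, x₁ + ε * u) ∈ Ω := by
      intro u hu
      refine hΩ _ ⟨by simp only; linarith [hu.1], ?_⟩ fun he => ?_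
      · simp only [abs_le]
        rcases hε with rfl | rfl <;> constructor <;> linarith [hu.1, hu.2]
      · rw [Prod.mk.injEq] at he
        linarith [he.1, hu.2]
    have hc : ContinuousOn (fun u => timePart (vel n y (t₀ + u, x₁ + ε * u) (1, ε)))
        (Icc 0 ((T - t₀) / 2)) := fun u hu =>
      ContinuousWithinAt.comp (t := upper) (f := fun u : ℝ => (t₀ + u, x₁ + ε * u))
        (h.continuousWithinAt_timePart (hm u hu) (1, ε))
        (Continuous.continuousWithinAt (by fun_prop)) fun u' hu' => h.subset_upper (hm u' hu')
    obtain ⟨M, hM⟩ := isCompact_Icc.exists_bound_of_continuousOn hc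
    exact ⟨M, fun u hu => (le_abs_self _).trans (hM u hu)⟩
  obtain ⟨M₁, hM₁⟩ := hedge 1 (Or.inl rfl)
  obtain ⟨M₂, hM₂⟩ := hedge (-1) (Or.inr rfl)
  -- The null edges from q stop at height (T + t₀)/2, below the missing point, so they are compact
  -- in Ω and bounded by M₁ and M₂. The exponential is the loss in `edge_estimate`, finite because
  -- time is at most z.1.
  set M := max M₁ M₂ * Real.exp (C' * (z.1 - (y q).1)) with hMdef
  have hM0 : 0 ≤ max M₁ M₂ := by
    refine le_trans ?_ (le_max_left M₁ M₂)
    have h0 := hM₁ 0 ⟨le_rfl, by linarith⟩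
    have e : (t₀ + 0, x₁ + 1 * 0) = q := by simp [hqdef]
    rw [e] at h0
    exact (h.timePart_pos hk hqΩ (Or.inl rfl)).le.trans h0
  have hregion : ∀ r ∈ pastFrom 0 (T, x₁), r ≠ (T, x₁) → q ∈ pastFrom 0 r →
      y r ∈ chartDomain (n := n) q₀ ∧ inCoord (n := n) q₀ y r ∈ Metric.closedBall z₀ ρ ∧
      ∀ ε : ℝ, (ε = 1 ∨ ε = -1) →
        ‖fderivWithin ℝ (inCoord (n := n) q₀ y) upper r (1, ε)‖ ≤ C * M := by
    intro r hr hne hqr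
    have hrΩ := hΩ r hr hne
    have hr0 : 0 < r.1 := by
      have := (abs_nonneg _).trans hqr.2
      simp only [hqdef] at this; linarith
    have ht := htle r hr hne hr0
    have ht' : C * ((y r).1 - (y q).1) < ρ / 2 := lt_of_le_of_lt (by gcongr) hqt
    obtain ⟨h1, h2⟩ := h.trapped hk hKr hC0 hC hrΩ hqr ht₀ hqd hqb.le ht'
    refine ⟨h1, h2, fun ε hε => ?_⟩
    have h3 := (h.edge_estimate hk hKr hC0 hC hC'0 hC' hrΩ hqr ht₀ hqd hqb.le ht' hε rfl).1
    set u := ((r.1 - q.1) + ε * (r.2 - q.2)) / 2 with hu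
    have huI : u ∈ Icc 0 ((T - t₀) / 2) := by
      have a1 := abs_le.1 hqr.2
      have a2 := abs_le.1 hr.2
      simp only [hqdef] at a1 hu
      simp only at a2
      rcases hε with rfl | rfl <;> constructor <;> linarith
    have h4 : timePart (vel n y (q.1 + u, q.2 + ε * u) (1, ε)) ≤ max M₁ M₂ := by
      rcases hε with rfl | rfl
      · exact (hM₁ u huI).trans (le_max_left _ _)
      · exact (hM₂ u huI).trans (le_max_right _ _)
    have h5 : timePart (vel n y r (1, ε)) ≤ M := by
      refine h3.trans ?_
      rw [hMdef]
      gcongr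
    have hu' := h.subset_upper hrΩ
    have hsm := h.smooth r hrΩ
    have h6 := hC _ h2 (fderivWithin ℝ (inCoord (n := n) q₀ y) upper r (1, ε))
      (h.metricForm_null hk hrΩ hε h1).le
    rw [← timePart_vel hu' hsm h1, abs_of_pos (h.timePart_pos hk hrΩ hε)] at h6
    exact h6.trans (by gcongr)
  -- solve from a line close to the endpoint
  obtain ⟨η₀, hη₀, hex⟩ := g.exists_chartWave (q₀ := q₀) (isCompact_closedBall z₀ (2 * ρ))
    (isCompact_closedBall (0 : ℝ × Coord n) (C * M + 1))
    (isCompact_closedBall (0 : ℝ × Coord n) (C * M + 1)) hKr2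
  -- The radius η₀ depends only on ρ and C M, so the initial line may be placed at distance η < η₀
  -- below the missing point. The bound (T - t₀)/2 puts its segment over [x₁ - η, x₁ + η] in the
  -- future of q, where the estimates hold.
  set η := min (η₀ / 2) ((T - t₀) / 2) with hη
  have hη1 : η ≤ η₀ / 2 := min_le_left _ _
  have hη2 : η ≤ (T - t₀) / 2 := min_le_right _ _
  have hηpos : 0 < η := lt_min (by positivity) (by linarith)
  set t₂ := T - η with ht₂
  have ht₂0 : 0 < t₂ := by linarith
  set Y := inCoord (n := n) q₀ y with hY
  set I : Set ℝ := {x | (t₂, x) ∈ Ω ∧ y (t₂, x) ∈ chartDomain (n := n) q₀ ∧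
    Y (t₂, x) ∈ Metric.ball z₀ (2 * ρ) ∧
    fderivWithin ℝ Y upper (t₂, x) (1, 1) ∈ Metric.ball (0 : ℝ × Coord n) (C * M + 1) ∧
    fderivWithin ℝ Y upper (t₂, x) (1, -1) ∈ Metric.ball (0 : ℝ × Coord n) (C * M + 1)} with hI
  have hjet : ∀ x ∈ I, ContDiffAt ℝ ∞ (fun x => nullJet Y (t₂, x)) x := fun x hx =>
    h.contDiffAt_inCoord_line ht₂0 hx.1 hx.2.1
  have hIo : IsOpen I := by
    rw [isOpen_iff_mem_nhds]
    intro x hx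
    have hc := (hjet x hx).continuousAt
    have hl : Tendsto (fun x : ℝ => (t₂, x)) (𝓝 x) (𝓝 (t₂, x)) := Continuous.tendsto (by fun_prop) x
    have e1 : ∀ᶠ x in 𝓝 x, (t₂, x) ∈ Ω := hl (h.mem_nhds hx.1 ht₂0)
    have e2 : ∀ᶠ x in 𝓝 x, y (t₂, x) ∈ chartDomain (n := n) q₀ :=
      ((((h.smooth _ hx.1).contMDiffAt (upper_mem_nhds ht₂0)).continuousAt.tendsto).comp hl)
        ((isOpen_chartDomain q₀).mem_nhds hx.2.1)
    have e3 : ∀ᶠ x in 𝓝 x, Y (t₂, x) ∈ Metric.ball z₀ (2 * ρ) :=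
      hc.fst (Metric.isOpen_ball.mem_nhds hx.2.2.1)
    have e4 : ∀ᶠ x in 𝓝 x, fderivWithin ℝ Y upper (t₂, x) (1, 1) ∈
        Metric.ball (0 : ℝ × Coord n) (C * M + 1) :=
      hc.snd.fst (Metric.isOpen_ball.mem_nhds hx.2.2.2.1)
    have e5 : ∀ᶠ x in 𝓝 x, fderivWithin ℝ Y upper (t₂, x) (1, -1) ∈
        Metric.ball (0 : ℝ × Coord n) (C * M + 1) :=
      hc.snd.snd (Metric.isOpen_ball.mem_nhds hx.2.2.2.2)
    exact e1.and (e2.and (e3.and (e4.and e5)))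
  have hIcc : Icc (x₁ - η) (x₁ + η) ⊆ I := by
    intro x hx
    have hne : (t₂, x) ≠ (T, x₁) := fun he => by
      rw [Prod.mk.injEq] at he; linarith [he.1]
    have hxp : (t₂, x) ∈ pastFrom 0 (T, x₁) := by
      refine ⟨ht₂0.le, ?_⟩
      simp only [abs_le]
      constructor <;> linarith [hx.1, hx.2]
    have hqp : q ∈ pastFrom 0 (t₂, x) := by
      refine ⟨ht₀.le, ?_⟩
      simp only [abs_le, hqdef]
      constructor <;> linarith [hx.1, hx.2]
    obtain ⟨h1, h2, h3⟩ := hregion _ hxp hne hqp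
    refine ⟨hΩ _ hxp hne, h1, Metric.closedBall_subset_ball (by linarith) h2, ?_, ?_⟩
    · rw [mem_ball_zero_iff]; linarith [h3 1 (Or.inl rfl)]
    · rw [mem_ball_zero_iff]; linarith [h3 (-1) (Or.inr rfl)]
  obtain ⟨δ, hδ, hδI⟩ := exists_Icc_subset hIo (by linarith) hIcc
  -- The diamond around (t₂, x₁) has to be strictly larger than η to contain the missing point,
  -- which lies at height exactly η above its centre.
  set η' := min (η + δ) η₀ with hη'
  have hη'1 : η < η' := lt_min (by linarith) (by linarith)
  have hI' : Icc (x₁ - η') (x₁ + η') ⊆ I := by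
    have : η' ≤ η + δ := min_le_left _ _
    exact (Icc_subset_Icc (by linarith) (by linarith)).trans hδI
  obtain ⟨Y₂, hY₂, hY₂w, hY₂0⟩ := hex t₂ x₁ η' (min_le_right _ _) I hIo hI'
    (fun x => Y (t₂, x)) (fun x => fderivWithin ℝ Y upper (t₂, x) (1, 1))
    (fun x => fderivWithin ℝ Y upper (t₂, x) (1, -1))
    (fun x hx => ((hjet x hx).fst).contDiffWithinAt)
    (fun x hx => ((hjet x hx).snd.fst).contDiffWithinAt)
    (fun x hx => ((hjet x hx).snd.snd).contDiffWithinAt)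
    (fun x hx => ⟨Metric.ball_subset_closedBall (hI' hx).2.2.1,
      Metric.ball_subset_closedBall (hI' hx).2.2.2.1, Metric.ball_subset_closedBall (hI' hx).2.2.2.2⟩)
    (fun x hx => by
      have hxI := hI' (Ioo_subset_Icc_self hx)
      refine (hasDerivAt_horizontal ht₂0.le ((contDiffWithinAt_inCoord (h.smooth _ hxI.1)
        hxI.2.1).differentiableWithinAt (by simp))).congr_deriv ?_
      have : ((0 : ℝ), (1 : ℝ)) = (1 / 2 : ℝ) • ((1, 1) - (1, -1)) := by ext <;> norm_num
      rw [this, map_smul, map_sub])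
  have hr2 := fun p hp => (hY₂w p hp).1
  have hbase : ∀ x, |x - x₁| < η' → x ∈ I := fun x hx => hI' (by
    rw [abs_lt] at hx; constructor <;> linarith)
  have hdia : ∀ r ∈ diamond t₂ x₁ η', ∀ r', t₂ ≤ r'.1 → |r.2 - r'.2| ≤ r.1 - r'.1 →
      r' ∈ diamond t₂ x₁ η' := by
    intro r hr r' hr' hrr'
    simp only [diamond, mem_ofPred_eq] at hr ⊢
    have a0 := (abs_nonneg _).trans hrr'
    rw [abs_of_nonneg (by linarith)] at hr ⊢
    have := abs_sub_le r'.2 r.2 x₁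
    rw [abs_sub_comm r.2] at hrr'
    linarith
  set D := diamond t₂ x₁ η' ∩ {r | t₂ < r.1} with hDdef
  have hDo : IsOpen D := (isOpen_diamond _ _ _).inter (isOpen_lt continuous_const continuous_fst)
  have hDpos : ∀ r ∈ D, 0 < r.1 := fun r hr => ht₂0.trans hr.2
  have hsm2 : ∀ r ∈ diamond t₂ x₁ η', SmoothAt n (stPoint (n := n) q₀ ∘ Y₂) r := fun r hr =>
    (smoothAt_of_diamond hY₂ hr2 hr).contMDiffWithinAt
  have hwm2 : ∀ r ∈ diamond t₂ x₁ η', g.WaveMapAt (stPoint (n := n) q₀ ∘ Y₂) r := fun r hr =>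
    g.waveMapAt_of_diamond hY₂ hr2 (fun p hp => (hY₂w p hp).2) hr
  have hglue : EqOn y (stPoint (n := n) q₀ ∘ Y₂) (Ω ∩ D) := by
    rintro r ⟨hrΩ, hrD⟩
    have hsub : ∀ r' ∈ pastFrom t₂ r, r' ∈ Ω ∧ r' ∈ diamond t₂ x₁ η' := fun r' hr' =>
      ⟨h.past r hrΩ r' (ht₂0.le.trans hr'.1) hr'.2, hdia r hrD.1 r' hr'.1 hr'.2⟩
    refine (g.jetEq_of_base (τ := t₂) (q := r) ht₂0.le (fun r' hr' => h.smooth _ (hsub r' hr').1)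
      (fun r' hr' => hsm2 r' (hsub r' hr').2)
      (fun r' hr' hlt => h.wave _ (hsub r' hr').1 (ht₂0.trans hlt))
      (fun r' hr' _ => hwm2 r' (hsub r' hr').2) (fun r' hr' he => ?_) r
      (self_mem_pastFrom hrD.2.le)).eq
    obtain ⟨hr'Ω, hr'D⟩ := hsub r' hr'
    obtain ⟨t', x'⟩ := r'
    obtain rfl : t' = t₂ := he
    have hx' : |x' - x₁| < η' := by simpa [diamond] using hr'D
    have hxI := hbase x' hx'
    obtain ⟨f1, f2, f3⟩ := hY₂0 x' hx'
    refine jetEq_of_nullJet_eq (q₀ := q₀) ht₂0.le (h.smooth _ hr'Ω) (hsm2 _ hr'D) hxI.2.1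
      (stPoint_mem (hr2 _ hr'D)) ?_
    have he2 : inCoord (n := n) q₀ (stPoint q₀ ∘ Y₂) =ᶠ[𝓝 (t₂, x')] Y₂ :=
      (inCoord_diamond hr2).eventuallyEq_of_mem ((isOpen_diamond _ _ _).mem_nhds hr'D)
    have hf : fderivWithin ℝ (inCoord (n := n) q₀ (stPoint q₀ ∘ Y₂)) upper (t₂, x')
        = fderiv ℝ Y₂ (t₂, x') := by
      rw [fderivWithin_of_mem_nhds (upper_mem_nhds ht₂0), he2.fderiv_eq]
    simp only [nullJet, hf, he2.eq_of_nhds, f1, f2, f3]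
    rfl
  have hpast : ∀ r ∈ D, ∀ q' ∈ upper, |r.2 - q'.2| ≤ r.1 - q'.1 → q' ∈ Ω ∪ D := by
    intro r hr q' hq' hrq'
    rcases lt_or_ge t₂ q'.1 with hlt | hge
    · exact Or.inr ⟨hdia r hr.1 q' hlt.le hrq', hlt⟩
    · left
      have hrt : t₂ < r.1 := hr.2
      obtain ⟨x, c, hc, e0, e1, hline⟩ := exists_line (q := q') (r := r) ⟨hq', hrq'⟩ (by linarith)
      have hm := hline t₂ ⟨hge, hrt.le⟩
      have hd := hdia r hr.1 (t₂, x + c * t₂) le_rfl hm.2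
      have hxI := hbase (x + c * t₂) (by simpa [diamond] using hd)
      refine h.past _ hxI.1 q' hq' ?_
      have : q'.2 = x + c * q'.1 := (congrArg Prod.snd e0).symm
      simp only [this]
      have e : x + c * t₂ - (x + c * q'.1) = c * (t₂ - q'.1) := by ring
      rw [e, abs_mul, abs_of_nonneg (by linarith : 0 ≤ t₂ - q'.1)]
      exact mul_le_of_le_one_left (by linarith) hc
  obtain ⟨y', hy'⟩ := h.union (y₂ := stPoint (n := n) q₀ ∘ Y₂) hDo hDpos
    (fun r hr => hsm2 r hr.1) (fun r hr => hwm2 r hr.1) hglue hpast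
  refine ⟨_, y', hy', Or.inr ⟨?_, ?_⟩⟩
  · simp only [diamond, mem_ofPred_eq, sub_self, abs_zero, add_zero]
    rw [abs_of_nonneg (by linarith)]
    linarith
  · simp only [mem_ofPred_eq]; linarith

end IsLocalSolution

end MetricFamily

/-! ### Blow-up of time at the boundary; periodicity; infinite rays -/

namespace MetricFamily

variable {n : ℕ} {N : Type*} [TopologicalSpace N] [ChartedSpace (Coord n) N]
variable {g : MetricFamily n N}

lemma frontier_off_axis {Ω : Set (ℝ × ℝ)} (hΩ : ∃ O : Set (ℝ × ℝ), IsOpen O ∧ Ω = O ∩ upper)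
    {p : ℝ × ℝ} (hp : p ∈ frontier Ω) (hp0 : p.1 ≠ 0) : 0 < p.1 ∧ p ∉ Ω := by
  obtain ⟨O, hO, rfl⟩ := hΩ
  have h1 : p ∈ upper := closure_minimal inter_subset_right isClosed_upper hp.1
  have h2 : 0 < p.1 := lt_of_le_of_ne h1 (Ne.symm hp0)
  refine ⟨h2, fun hpΩ => hp.2 (mem_interior_iff_mem_nhds.2 ?_)⟩
  exact inter_mem (hO.mem_nhds hpΩ.1) (upper_mem_nhds h2)

section

variable [IsManifold (𝓡 n) ∞ N] {k : ℝ → TangentBundle (stModel n) (ℝ × N)}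

/-- Time tends to infinity at the boundary of the maximal domain. -/
theorem timeBlowsUp_max [T2Space N]
    (hslice : ∀ τ : ℝ, g.IsCauchyHypersurface {p : ℝ × N | p.1 = τ}) (hk : g.IsInitialData k) :
    TimeBlowsUp (g.maxDomain k) (g.maxSolution k) := by
  have h := isLocalSolution_max (g := g) (k := k)
  set Ω := g.maxDomain k
  set y := g.maxSolution k
  intro p hp hp0
  obtain ⟨hp1, hpΩ⟩ := frontier_off_axis h.isOpen hp hp0
  rw [tendsto_atTop]
  by_contra! hcon
  obtain ⟨B, hB⟩ := hcon
  have hfreq : ∃ᶠ q in 𝓝 p, q ∈ Ω ∧ (y q).1 < B := by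
    rw [frequently_nhdsWithin_iff] at hB
    exact hB.mono fun q hq => ⟨hq.2, hq.1⟩
  -- A point in the chronological past of p is also in the past of some nearby q with time below B,
  -- because the chronological relation is open.
  have hchron : ∀ r ∈ upper, |p.2 - r.2| < p.1 - r.1 → r ∈ Ω ∧ (y r).1 ≤ B := by
    intro r hr hpr
    have hopen : IsOpen {q : ℝ × ℝ | |q.2 - r.2| < q.1 - r.1} :=
      isOpen_lt (by fun_prop) (by fun_prop)
    obtain ⟨q, ⟨hqΩ, hqB⟩, hqr⟩ := (hfreq.and_eventually (hopen.mem_nhds hpr)).exists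
    have hrq : r ∈ pastFrom 0 q := ⟨hr, le_of_lt hqr⟩
    exact ⟨h.pastFrom_subset hqΩ hrq, (h.time_le hk hqΩ hrq).1.trans hqB.le⟩
  obtain ⟨O, hO, hOΩ⟩ := h.isOpen
  have hpO : p ∉ O := fun hpO => hpΩ (hOΩ ▸ ⟨hpO, hp1.le⟩)
  -- A lowest missing point in the past of p: its own past is in Ω except for the point itself, and
  -- the open vertical segment below it lies in the chronological past of p, where time is at most
  -- B.
  obtain ⟨p', ⟨hp'1, hp'2⟩, hmin⟩ := ((isCompact_pastFrom 0 p).diff hO).exists_isMinOn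
    ⟨p, self_mem_pastFrom hp1.le, hpO⟩ continuous_fst.continuousOn
  have hT : 0 < p'.1 := by
    rcases eq_or_lt_of_le hp'1.1 with h0 | h0
    · have h1 := g.axis_mem_maxDomain hk.smooth p'.2
      rw [show ((0 : ℝ), p'.2) = p' from Prod.ext h0 rfl] at h1
      change p' ∈ Ω at h1
      rw [hOΩ] at h1
      exact absurd h1.1 hp'2
    · exact h0
  obtain ⟨Ω', y', h', hmem⟩ := h.exists_extension hslice hk (T := p'.1) (x₁ := p'.2) (B := B) hT
    (fun r hr hne => by
      have hle : r.1 ≤ p'.1 := by have := (abs_nonneg _).trans hr.2; simp only at this; linarith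
      rcases hle.eq_or_lt with he | hlt
      · have h2 := hr.2
        simp only at h2
        rw [he, sub_self, abs_nonpos_iff, sub_eq_zero] at h2
        exact absurd (Prod.ext he h2.symm) hne
      · have hrp : r ∈ pastFrom 0 p := pastFrom_trans hp'1 hr hr.1
        rw [hOΩ]
        refine ⟨?_, hr.1⟩
        by_contra hrO
        exact absurd (hmin ⟨hrp, hrO⟩) (not_le.2 hlt))
    (fun s hs => (hchron (s, p'.2) hs.1 (by
      have := hp'1.2
      simp only
      linarith [hs.2])).2)
  have h2 : p' ∈ Ω := h'.subset_maxDomain hmem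
  rw [hOΩ] at h2
  exact hp'2 h2.1

end

/-! ### Translations in the plane -/

section Shift

variable [IsManifold (𝓡 n) ∞ N] {k : ℝ → TangentBundle (stModel n) (ℝ × N)} {Ω : Set (ℝ × ℝ)}
  {y : ℝ × ℝ → ℝ × N}

lemma contMDiff_shift (c : ℝ) :
    ContMDiff 𝓘(ℝ, ℝ × ℝ) 𝓘(ℝ, ℝ × ℝ) ∞ fun r : ℝ × ℝ => r + (0, c) :=
  (contDiff_id.add contDiff_const).contMDiff

lemma shift_mem_upper {r : ℝ × ℝ} {c : ℝ} (hr : r ∈ upper) : r + (0, c) ∈ upper := by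
  simpa [mem_upper] using hr

lemma SmoothAt.shift {c : ℝ} {r : ℝ × ℝ} (h : SmoothAt n y (r + (0, c))) :
    SmoothAt n (fun r => y (r + (0, c))) r :=
  ContMDiffWithinAt.comp r h ((contMDiff_shift c).contMDiffAt.contMDiffWithinAt)
    fun _ hr => shift_mem_upper hr

lemma dirDeriv_shift {c : ℝ} {r : ℝ × ℝ} (hr : r ∈ upper) (h : SmoothAt n y (r + (0, c)))
    (d : ℝ × ℝ) : dirDeriv n (fun r => y (r + (0, c))) r d = dirDeriv n y (r + (0, c)) d := by
  have h1 : MDifferentiableWithinAt 𝓘(ℝ, ℝ × ℝ) (stModel n) y upper (r + (0, c)) :=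
    h.mdifferentiableWithinAt (by simp)
  have h2 : MDifferentiableWithinAt 𝓘(ℝ, ℝ × ℝ) 𝓘(ℝ, ℝ × ℝ) (fun r : ℝ × ℝ => r + (0, c)) upper r :=
    ((contMDiff_shift c).mdifferentiableAt (by simp)).mdifferentiableWithinAt
  have h3 := mfderivWithin_comp (I' := 𝓘(ℝ, ℝ × ℝ)) r h1 h2
    (show upper ⊆ (fun r : ℝ × ℝ => r + (0, c)) ⁻¹' upper from fun _ hr => shift_mem_upper hr)
    (uniqueDiffOn_upper r hr).uniqueMDiffWithinAt
  have h4 : mfderivWithin 𝓘(ℝ, ℝ × ℝ) 𝓘(ℝ, ℝ × ℝ) (fun r : ℝ × ℝ => r + (0, c)) upper r d = d := by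
    rw [mfderivWithin_eq_fderivWithin, fderivWithin_add_const,
      fderivWithin_fun_id (uniqueDiffOn_upper r hr)]
    rfl
  refine congrArg (Bundle.TotalSpace.mk (F := ℝ × Coord n) (y (r + (0, c)))) ?_
  refine (congrArg (fun T : (ℝ × ℝ) →L[ℝ] (ℝ × Coord n) => T d) h3).trans ?_
  exact congrArg (mfderivWithin 𝓘(ℝ, ℝ × ℝ) (stModel n) y upper (r + (0, c))) h4

lemma waveMapAt_shift {c : ℝ} {r : ℝ × ℝ} (h : g.WaveMapAt y (r + (0, c))) :
    g.WaveMapAt (fun r => y (r + (0, c))) r := by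
  have e : inCoord (n := n) (y (r + (0, c))).2 (fun r => y (r + (0, c)))
      = fun p => inCoord (n := n) (y (r + (0, c))).2 y (p + (0, c)) := rfl
  have e2 : ∀ d : ℝ × ℝ,
      fderiv ℝ (fun p => fderiv ℝ (inCoord (n := n) (y (r + (0, c))).2 y) (p + (0, c)) d) r
      = fderiv ℝ (fun p => fderiv ℝ (inCoord (n := n) (y (r + (0, c))).2 y) p d) (r + (0, c)) :=
    fun d => fderiv_comp_add_right (f := fun p =>
      fderiv ℝ (inCoord (n := n) (y (r + (0, c))).2 y) p d) (0, c)
  unfold WaveMapAt at h ⊢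
  simp only at h ⊢
  rw [e]
  simp only [fderiv_comp_add_right]
  rw [e2, e2]
  exact h

lemma IsLocalSolution.shift (h : g.IsLocalSolution k Ω y) {c : ℝ} (hc : ∀ x, k (x + c) = k x) :
    g.IsLocalSolution k ((fun r => r + (0, c)) ⁻¹' Ω) (fun r => y (r + (0, c))) where
  isOpen := by
    obtain ⟨O, hO, rfl⟩ := h.isOpen
    refine ⟨(fun r => r + (0, c)) ⁻¹' O, hO.preimage (by fun_prop), ?_⟩
    rw [preimage_inter]
    congr 1
    ext r
    simp [mem_upper]
  past := by
    intro p hp q hq hpq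
    exact h.past _ hp _ (shift_mem_upper hq) (by simpa using hpq)
  smooth r hr := (h.smooth _ hr).shift
  wave r hr hr0 := waveMapAt_shift (h.wave _ hr (by simpa using hr0))
  initial x hx := by
    rw [dirDeriv_shift (le_refl (0 : ℝ)) (h.smooth _ hx)]
    have e : ((0 : ℝ), x) + (0, c) = (0, x + c) := by simp
    have hx' : ((0 : ℝ), x) + (0, c) ∈ Ω := hx
    rw [e] at hx' ⊢
    rw [h.initial _ hx', hc]

lemma mem_maxDomain_shift [T2Space N] {c : ℝ} (hc : ∀ x, k (x + c) = k x) {r : ℝ × ℝ}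
    (hr : r + (0, c) ∈ g.maxDomain k) : r ∈ g.maxDomain k :=
  ((isLocalSolution_max (g := g) (k := k)).shift hc).subset_maxDomain hr

lemma mem_maxDomain_shift_iff [T2Space N] {c : ℝ} (hc : ∀ x, k (x + c) = k x) {r : ℝ × ℝ} :
    r + (0, c) ∈ g.maxDomain k ↔ r ∈ g.maxDomain k := by
  refine ⟨mem_maxDomain_shift hc, fun hr => ?_⟩
  have hc' : ∀ x, k (x + -c) = k x := fun x => by rw [← hc (x + -c)]; ring_nf
  refine mem_maxDomain_shift hc' ?_
  rw [show r + (0, c) + (0, -c) = r by ext <;> simp]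
  exact hr

lemma maxSolution_shift [T2Space N] {c : ℝ} (hc : ∀ x, k (x + c) = k x) {r : ℝ × ℝ}
    (hr : r ∈ g.maxDomain k) (d : ℝ × ℝ) :
    dirDeriv n (g.maxSolution k) (r + (0, c)) d = dirDeriv n (g.maxSolution k) r d := by
  have h := isLocalSolution_max (g := g) (k := k)
  have hr' := (mem_maxDomain_shift_iff hc).2 hr
  rw [← dirDeriv_shift (h.subset_upper hr) (h.smooth _ hr')]
  exact (h.shift hc).jetEq h hr' hr d

end Shift

/-! ### Unboundedness of time along infinite vertical rays -/

namespace IsLocalSolution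

variable [IsManifold (𝓡 n) ∞ N] {k : ℝ → TangentBundle (stModel n) (ℝ × N)} {Ω : Set (ℝ × ℝ)}
  {y : ℝ × ℝ → ℝ × N}

/-- If time were bounded on the ray, then, every point of the half plane being in the past of a
point of the ray, Ω would be the half plane and time would be at most that of the limit z
everywhere. For q high on the ray the whole future of q is trapped near z, where the null
derivatives are comparable with their values on the edges. Periodicity reduces the edge to a compact
piece, which bounds the time part of the (1,1)-derivative from below on the entire null ray. Time
then grows linearly there and exceeds its bound. -/
theorem exists_time_gt [T2Space N]
    (hslice : ∀ τ : ℝ, g.IsCauchyHypersurface {p : ℝ × N | p.1 = τ})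
    (h : g.IsLocalSolution k Ω y) (hk : g.IsInitialData k) {c : ℝ} (hc : 0 < c)
    (hper : ∀ r ∈ Ω, timePart (vel n y (r + (0, 2 * c)) (1, 1)) = timePart (vel n y r (1, 1)))
    {x₁ : ℝ} (hray : ∀ s ≥ 0, (s, x₁) ∈ Ω) (B : ℝ) : ∃ s ≥ 0, B < (y (s, x₁)).1 := by
  by_contra! hB
  obtain ⟨z, hz⟩ := h.exists_tendsto_comp hslice hk (x := x₁) (B := B) (φ := id) (φ' := fun _ => 1)
    contDiff_id (fun s => hasDerivAt_id s) (fun _ => one_pos) rfl hray hB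
  simp only [id] at hz
  have hall : ∀ r ∈ upper, ∃ s ≥ 0, ∀ s' ≥ s, r ∈ pastFrom 0 (s', x₁) := fun r hr =>
    ⟨r.1 + |x₁ - r.2|, add_nonneg hr (abs_nonneg _), fun s' hs' => ⟨hr, by simp only; linarith⟩⟩
  have hΩ : ∀ r ∈ upper, r ∈ Ω := fun r hr => by
    obtain ⟨s, hs, h1⟩ := hall r hr
    exact h.pastFrom_subset (hray s hs) (h1 s le_rfl)
  have hzt : Tendsto (fun s => (y (s, x₁)).1) atTop (𝓝 z.1) := (continuous_fst.tendsto z).comp hz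
  have htle : ∀ r ∈ upper, (y r).1 ≤ z.1 := by
    intro r hr
    obtain ⟨s, hs, h1⟩ := hall r hr
    refine ge_of_tendsto hzt ?_
    filter_upwards [eventually_ge_atTop s] with s' hs'
    exact (h.time_le hk (hray s' (hs.trans hs')) (h1 s' hs')).1
  set q₀ := z.2
  have hzd : z ∈ chartDomain (n := n) q₀ := mem_chartDomain_self z
  set z₀ := stCoord (n := n) q₀ z
  obtain ⟨ρ', hρ', hball⟩ := Metric.isOpen_iff.1 (isOpen_chartRange q₀) z₀ (stCoord_mem hzd)
  set ρ := ρ' / 2 with hρdef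
  have hρ : 0 < ρ := by positivity
  have hKr : Metric.closedBall z₀ ρ ⊆ chartRange q₀ :=
    (Metric.closedBall_subset_ball (by rw [hρdef]; linarith)).trans hball
  obtain ⟨C, hC1, hC⟩ := g.exists_norm_le_of_causal (isCompact_closedBall z₀ ρ) hKr
  obtain ⟨C', hC'0, hC'⟩ := g.exists_christSharp_le (isCompact_closedBall z₀ ρ) hKr
  have hC0 : 0 ≤ C := by linarith
  have hq : ∀ᶠ s in atTop, y (s, x₁) ∈ chartDomain (n := n) q₀ ∧
      dist (inCoord (n := n) q₀ y (s, x₁)) z₀ < ρ / 2 ∧ C * (z.1 - (y (s, x₁)).1) < ρ / 2 := by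
    have e1 : ∀ᶠ s in atTop, y (s, x₁) ∈ chartDomain (n := n) q₀ :=
      hz ((isOpen_chartDomain q₀).mem_nhds hzd)
    have e2 : ∀ᶠ s in atTop, inCoord (n := n) q₀ y (s, x₁) ∈ Metric.ball z₀ (ρ / 2) :=
      ((((continuousOn_stCoord q₀).continuousAt ((isOpen_chartDomain q₀).mem_nhds hzd)).tendsto).comp
        hz) (Metric.ball_mem_nhds _ (by positivity))
    have e3 : ∀ᶠ s in atTop, C * (z.1 - (y (s, x₁)).1) < ρ / 2 := by
      have : Tendsto (fun s => C * (z.1 - (y (s, x₁)).1)) atTop (𝓝 (C * (z.1 - z.1))) :=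
        (hzt.const_sub z.1).const_mul C
      rw [sub_self, mul_zero] at this
      exact this.eventually_lt_const (by positivity)
    exact e1.and (e2.and e3)
  obtain ⟨t₀, ⟨hqd, hqb, hqt⟩, ht₀⟩ := (hq.and (eventually_gt_atTop 0)).exists
  set q : ℝ × ℝ := (t₀, x₁) with hqdef
  set a : ℝ → ℝ := fun u => timePart (vel n y (t₀ + u, x₁ + u) (1, 1)) with ha
  have hedge : ∀ u ≥ 0, (t₀ + u, x₁ + u) ∈ Ω := fun u hu => hΩ _ (by
    change (0 : ℝ) ≤ t₀ + u; linarith)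
  have hac : ContinuousOn a (Icc 0 c) := fun u hu =>
    ContinuousWithinAt.comp (t := upper) (f := fun u : ℝ => (t₀ + u, x₁ + u))
      (h.continuousWithinAt_timePart (hedge u hu.1) (1, 1))
      (Continuous.continuousWithinAt (by fun_prop)) fun u' hu' => h.subset_upper (hedge u' hu'.1)
  obtain ⟨m, hm0, hm⟩ := isCompact_Icc.exists_forall_le' hac
    (fun u hu => h.timePart_pos hk (hedge u hu.1) (Or.inl rfl))
  set E := Real.exp (C' * (z.1 - (y q).1)) with hE
  have hE0 : 0 < E := Real.exp_pos _
  have hperN : ∀ (j : ℕ) (r : ℝ × ℝ), r ∈ upper →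
      timePart (vel n y (r + (0, 2 * c * j)) (1, 1)) = timePart (vel n y r (1, 1)) := by
    intro j
    induction j with
    | zero => intro r _; rw [show r + (0, 2 * c * ((0 : ℕ) : ℝ)) = r by ext <;> simp]
    | succ j ih =>
      intro r hr
      have e : r + (0, 2 * c * ((j + 1 : ℕ) : ℝ)) = r + (0, 2 * c * j) + (0, 2 * c) := by
        rw [add_assoc]; congr 1; simp; ring
      rw [e, hper _ (hΩ _ (shift_mem_upper hr)), ih r hr]
  -- Shifting q + u(1,1) by j periods of length 2c gives a point r in the future of q with the same
  -- time part. The line of direction (1,-1) through r meets the edge at parameter u - cj, and j is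
  -- chosen so that this lies in [0, c], where the minimum m is available.
  have hlow : ∀ u ≥ 0, m / E ≤ a u := by
    intro u hu
    set j := ⌊u / c⌋₊ with hj
    have hj1 : c * j ≤ u := by
      have := Nat.floor_le (div_nonneg hu hc.le)
      rw [le_div_iff₀ hc] at this
      linarith
    have hj2 : u - c * j ≤ c := by
      have := (Nat.lt_floor_add_one (u / c)).le
      rw [div_le_iff₀ hc] at this
      linarith
    have hj0 : 0 ≤ c * j := by positivity
    set r : ℝ × ℝ := (t₀ + u, x₁ + u - 2 * c * j) with hr
    have hru : r ∈ upper := by change (0 : ℝ) ≤ t₀ + u; linarith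
    have hrp : r + (0, 2 * c * j) = (t₀ + u, x₁ + u) := by simp [hr]
    have hqr : q ∈ pastFrom 0 r := by
      refine ⟨ht₀.le, ?_⟩
      simp only [hr, hqdef, abs_le]
      constructor <;> linarith
    have h1 := hperN j r hru
    rw [hrp] at h1
    have ht' : C * ((y r).1 - (y q).1) < ρ / 2 :=
      lt_of_le_of_lt (by gcongr; exact htle r hru) hqt
    have h2 := (h.edge_estimate hk hKr hC0 hC hC'0 hC' (hΩ r hru) hqr ht₀ hqd hqb.le ht'
      (u := u - c * j) (ε := 1) (Or.inl rfl) (by simp only [hr, hqdef]; ring)).2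
    rw [one_mul] at h2
    have h3 : m ≤ a (u - c * j) := hm _ ⟨by linarith, hj2⟩
    have h4 : timePart (vel n y r (1, 1)) = a u := h1.symm
    have h5 : a (u - c * j) ≤ timePart (vel n y r (1, 1)) * Real.exp (C' * ((y r).1 - (y q).1)) := h2
    have h6 : 0 < timePart (vel n y r (1, 1)) := h.timePart_pos hk (hΩ r hru) (Or.inl rfl)
    rw [div_le_iff₀ hE0, ← h4]
    have h7 : Real.exp (C' * ((y r).1 - (y q).1)) ≤ E := by
      rw [hE]
      gcongr
      exact htle r hru
    exact h3.trans (h5.trans (by gcongr))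
  have hα : 0 < m / E := div_pos hm0 hE0
  set L := (z.1 - (y q).1) / (m / E) + 1 with hL
  have hqz : (y q).1 ≤ z.1 := htle q ht₀.le
  have hL0 : 0 < L := by
    have := div_nonneg (sub_nonneg.2 hqz) hα.le
    linarith
  have hline : ∀ s ∈ Icc t₀ (t₀ + L), (s, x₁ - t₀ + 1 * s) ∈ Ω := fun s hs => hΩ _ (ht₀.le.trans hs.1)
  have hgrow := Convex.mul_sub_le_image_sub_of_le_deriv (convex_Icc t₀ (t₀ + L))
    (f := fun s => (y (s, x₁ - t₀ + 1 * s)).1) (C := m / E)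
    (continuous_fst.comp_continuousOn (continuousOn_line (f := y) (fun s hs => ht₀.le.trans hs.1)
      fun s hs => (h.smooth _ (hline s hs)).continuousWithinAt))
    (fun s hs => by
      rw [interior_Icc] at hs
      exact (h.hasDerivAt_time (ht₀.trans hs.1)
        (hline s (Ioo_subset_Icc_self hs))).differentiableAt.differentiableWithinAt)
    (fun s hs => by
      rw [interior_Icc] at hs
      rw [(h.hasDerivAt_time (ht₀.trans hs.1) (hline s (Ioo_subset_Icc_self hs))).deriv]
      have h1 := hlow (s - t₀) (by linarith [hs.1])
      simp only [ha] at h1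
      have e : (t₀ + (s - t₀), x₁ + (s - t₀)) = (s, x₁ - t₀ + 1 * s) := by
        ext <;> simp <;> ring
      rwa [e] at h1)
    t₀ (left_mem_Icc.2 (by linarith)) (t₀ + L) (right_mem_Icc.2 (by linarith)) (by linarith)
  have e0 : (t₀, x₁ - t₀ + 1 * t₀) = q := by simp [hqdef]
  simp only [e0] at hgrow
  have h1 := htle (t₀ + L, x₁ - t₀ + 1 * (t₀ + L)) (by change (0 : ℝ) ≤ t₀ + L; linarith)
  have h2 : m / E * (t₀ + L - t₀) = z.1 - (y q).1 + m / E := by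
    rw [add_sub_cancel_left, hL]; field_simp
  linarith

end IsLocalSolution

end MetricFamily

/-! ### First variation of area -/

namespace MetricFamily

variable {n : ℕ} {N : Type*} [TopologicalSpace N] [ChartedSpace (Coord n) N]
variable {g : MetricFamily n N}

section Form

variable {A : Type} [NormedAddCommGroup A] [NormedSpace ℝ A]

/-- The coefficients of the metric pulled back along `Ψ`. -/
def form (g : MetricFamily n N) (Ψ : A → ℝ × N) (P a b : A) : ℝ :=
  g.lor (Ψ P) (mfderiv 𝓘(ℝ, A) (stModel n) Ψ P a) (mfderiv 𝓘(ℝ, A) (stModel n) Ψ P b)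

lemma pullback_eq_form (y : ℝ × ℝ → ℝ × N) (p a b : ℝ × ℝ) : g.pullback y p a b = g.form y p a b :=
  rfl

variable [IsManifold (𝓡 n) ∞ N] {Ψ : A → ℝ × N} {V : Set A} {P : A} {q₀ : N}

lemma form_eq (hV : IsOpen V) (hΨ : ContMDiffOn 𝓘(ℝ, A) (stModel n) ∞ Ψ V) (hP : P ∈ V)
    (hq : Ψ P ∈ chartDomain (n := n) q₀) (a b : A) :
    g.form Ψ P a b = g.metricForm q₀ ((stCoord (n := n) q₀ ∘ Ψ) P)
      (fderiv ℝ (stCoord (n := n) q₀ ∘ Ψ) P a) (fderiv ℝ (stCoord (n := n) q₀ ∘ Ψ) P b) := by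
  have hd : MDifferentiableAt 𝓘(ℝ, A) (stModel n) Ψ P :=
    (hΨ.contMDiffAt (hV.mem_nhds hP)).mdifferentiableAt (by simp)
  rw [fderiv_stCoord_comp hd hq, fderiv_stCoord_comp hd hq, metricForm_apply, form,
    g.lor_eq_coordMetric hq]
  rfl

lemma form_eventuallyEq (hV : IsOpen V) (hΨ : ContMDiffOn 𝓘(ℝ, A) (stModel n) ∞ Ψ V) (hP : P ∈ V)
    (hq : Ψ P ∈ chartDomain (n := n) q₀) (a b : A) :
    (fun P => g.form Ψ P a b) =ᶠ[𝓝 P] fun P => g.metricForm q₀ ((stCoord (n := n) q₀ ∘ Ψ) P)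
      (fderiv ℝ (stCoord (n := n) q₀ ∘ Ψ) P a) (fderiv ℝ (stCoord (n := n) q₀ ∘ Ψ) P b) := by
  have hc := (hΨ.contMDiffAt (hV.mem_nhds hP)).continuousAt
  filter_upwards [hV.mem_nhds hP, hc.preimage_mem_nhds ((isOpen_chartDomain q₀).mem_nhds hq)]
    with P' h1 h2
  exact form_eq hV hΨ h1 h2 a b

lemma contDiffAt_stCoord_comp (hV : IsOpen V) (hΨ : ContMDiffOn 𝓘(ℝ, A) (stModel n) ∞ Ψ V)
    (hP : P ∈ V) (hq : Ψ P ∈ chartDomain (n := n) q₀) :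
    ContDiffAt ℝ ∞ (stCoord (n := n) q₀ ∘ Ψ) P :=
  contMDiffAt_iff_contDiffAt.1 (((contMDiffOn_stCoord (n := n) q₀).contMDiffAt
    ((isOpen_chartDomain q₀).mem_nhds hq)).comp P (hΨ.contMDiffAt (hV.mem_nhds hP)))

lemma contDiffAt_form (hV : IsOpen V) (hΨ : ContMDiffOn 𝓘(ℝ, A) (stModel n) ∞ Ψ V) (hP : P ∈ V)
    (a b : A) : ContDiffAt ℝ ∞ (fun P => g.form Ψ P a b) P := by
  have hq := mem_chartDomain_self (n := n) (Ψ P)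
  have hZ := contDiffAt_stCoord_comp hV hΨ hP hq
  have hZ' : ContDiffAt ℝ ∞ (fderiv ℝ (stCoord (n := n) (Ψ P).2 ∘ Ψ)) P :=
    hZ.fderiv_right (by simp)
  have hG0 : ContDiffAt ℝ ∞ (g.metricForm (Ψ P).2) ((stCoord (n := n) (Ψ P).2 ∘ Ψ) P) :=
    (g.contDiffOn_metricForm _).contDiffAt ((isOpen_chartRange _).mem_nhds (stCoord_mem hq))
  have hG := ContDiffAt.comp (g := g.metricForm (Ψ P).2) (f := stCoord (n := n) (Ψ P).2 ∘ Ψ) P hG0 hZ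
  exact ((hG.clm_apply (hZ'.clm_apply contDiffAt_const)).clm_apply
    (hZ'.clm_apply contDiffAt_const)).congr_of_eventuallyEq (form_eventuallyEq hV hΨ hP hq a b)

lemma hasFDerivAt_fderiv_apply {F : Type} [NormedAddCommGroup F] [NormedSpace ℝ F] {Z : A → F}
    (hZ : ContDiffAt ℝ 2 Z P) (b : A) :
    HasFDerivAt (fun P => fderiv ℝ Z P b) ((fderiv ℝ (fderiv ℝ Z) P).flip b) P := by
  have hZ' : DifferentiableAt ℝ (fderiv ℝ Z) P :=
    (hZ.fderiv_right (m := 1) (by norm_num)).differentiableAt (by simp)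
  simpa using hZ'.hasFDerivAt.clm_apply (hasFDerivAt_const b P)

/-- First variation of the energy density. -/
lemma fderiv_form (hV : IsOpen V) (hΨ : ContMDiffOn 𝓘(ℝ, A) (stModel n) ∞ Ψ V) (hP : P ∈ V)
    (hq : Ψ P ∈ chartDomain (n := n) q₀) (a b : A) :
    fderiv ℝ (fun P => g.form Ψ P b b) P a / 2 = fderiv ℝ (fun P => g.form Ψ P a b) P b
      - acceleration (g.metricForm q₀) (stCoord (n := n) q₀ ∘ Ψ) P b
        (fderiv ℝ (stCoord (n := n) q₀ ∘ Ψ) P a) := by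
  set Z := stCoord (n := n) q₀ ∘ Ψ with hZdef
  have hZ : ContDiffAt ℝ 2 Z P :=
    (contDiffAt_stCoord_comp hV hΨ hP hq).of_le (mod_cast le_top : ((2 : ℕ∞) : WithTop ℕ∞) ≤ ∞)
  have hz : Z P ∈ chartRange (n := n) q₀ := stCoord_mem hq
  have hZ1 : HasFDerivAt Z (fderiv ℝ Z P) P := (hZ.differentiableAt (by simp)).hasFDerivAt
  have hG := (g.differentiableAt_metricForm hz).hasFDerivAt.comp P hZ1
  have hd := fun b => hasFDerivAt_fderiv_apply hZ b
  have e1 := ((hG.clm_apply (hd b)).clm_apply (hd b)).congr_of_eventuallyEq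
    (form_eventuallyEq hV hΨ hP hq b b)
  have e2 := ((hG.clm_apply (hd a)).clm_apply (hd b)).congr_of_eventuallyEq
    (form_eventuallyEq hV hΨ hP hq a b)
  have hs : fderiv ℝ (fderiv ℝ Z) P a b = fderiv ℝ (fderiv ℝ Z) P b a :=
    (hZ.isSymmSndFDerivAt (by simp)).eq a b
  have hDG : ∀ U V W : ℝ × Coord n, fderiv ℝ (g.metricForm q₀) (Z P) U V W
      = fderiv ℝ (g.metricForm q₀) (Z P) U W V := by
    intro U V W
    rw [← g.fderiv_coordMetric hz, ← g.fderiv_coordMetric hz]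
    congr 2
    funext z'
    rw [← metricForm_apply, metricForm_symm, metricForm_apply]
  rw [e1.fderiv, e2.fderiv, acceleration, christForm_apply, (hd b).fderiv]
  simp only [add_apply, ContinuousLinearMap.comp_apply, ContinuousLinearMap.flip_apply,
    Function.comp]
  rw [hs, hDG _ (fderiv ℝ Z P a) (fderiv ℝ Z P b), g.metricForm_symm q₀ _ (fderiv ℝ Z P b)
    (fderiv ℝ (fderiv ℝ Z) P b a), g.metricForm_symm q₀ _ (fderiv ℝ Z P a)]
  ring

end Form

/-- The integral of a derivative of a compactly supported function vanishes. -/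
lemma integral_fderiv_eq_zero {f : ℝ × ℝ → ℝ} (hf : ContDiff ℝ 1 f) (hc : HasCompactSupport f)
    (v : ℝ × ℝ) : ∫ p, fderiv ℝ f p v = 0 := by
  have hd : Continuous fun p => fderiv ℝ f p v := (hf.continuous_fderiv (by simp)).clm_apply
    continuous_const
  have hdc : HasCompactSupport fun p => fderiv ℝ f p v := by
    refine (hc.fderiv (𝕜 := ℝ)).mono fun p hp => ?_
    intro h0
    exact hp (by simp [h0])
  have h := integral_bilinear_hasLineDerivAt_right_eq_neg_left_of_integrable
    (μ := (volume : Measure (ℝ × ℝ))) (B := ContinuousLinearMap.mul ℝ ℝ) (v := v)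
    (f := fun _ => (1 : ℝ)) (f' := fun _ => 0) (g := f) (g' := fun p => fderiv ℝ f p v)
    (by simp) (by simpa using hd.integrable_of_hasCompactSupport hdc)
    (by simpa using hf.continuous.integrable_of_hasCompactSupport hc)
    (fun x _ => by simpa [HasLineDerivAt] using hasDerivAt_const (0 : ℝ) (1 : ℝ))
    (fun x _ => ((hf.differentiable (by simp)) x).hasFDerivAt.hasLineDerivAt v)
  simpa using h

section Critical

variable [IsManifold (𝓡 n) ∞ N]

/-- A conformal wave map is critical for the area. -/
theorem isAreaCriticalOn_of_wave {y : ℝ × ℝ → ℝ × N} {U : Set (ℝ × ℝ)} (hU : IsOpen U)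
    (hy : ContMDiffOn 𝓘(ℝ, ℝ × ℝ) (stModel n) ∞ y U) (hw : ∀ p ∈ U, g.WaveMapAt y p)
    (hc : ∀ p ∈ U, g.pullback y p (0, 1) (0, 1) = -g.pullback y p (1, 0) (1, 0) ∧
      0 < g.pullback y p (0, 1) (0, 1) ∧ g.pullback y p (1, 0) (0, 1) = 0) :
    g.IsAreaCriticalOn y U := by
  intro K hK hKU Y hY hY0 hYK
  -- The variation parameter becomes a third coordinate, so that derivatives in s and in the plane
  -- are treated by the same calculus.
  set Ψ : ℝ × (ℝ × ℝ) → ℝ × N := fun q => Y q.1 q.2 with hΨ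
  set V : Set (ℝ × (ℝ × ℝ)) := univ ×ˢ U with hV
  have hVo : IsOpen V := isOpen_univ.prod hU
  have hpull : ∀ s, ∀ p ∈ U, ∀ a b, g.pullback (Y s) p a b = g.form Ψ (s, p) (0, a) (0, b) := by
    intro s p hp a b
    have h1 : MDifferentiableAt 𝓘(ℝ, ℝ × (ℝ × ℝ)) (stModel n) Ψ (s, p) :=
      (hY.contMDiffAt (hVo.mem_nhds ⟨mem_univ _, hp⟩)).mdifferentiableAt (by simp)
    have h2 : HasFDerivAt (fun p : ℝ × ℝ => (s, p)) (ContinuousLinearMap.inr ℝ ℝ (ℝ × ℝ)) p :=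
      hasFDerivAt_prodMk_right s p
    have h3 := mfderiv_comp (I' := 𝓘(ℝ, ℝ × (ℝ × ℝ))) p h1 h2.differentiableAt.mdifferentiableAt
    have h4 : ∀ a, mfderiv 𝓘(ℝ, ℝ × ℝ) (stModel n) (Y s) p a
        = mfderiv 𝓘(ℝ, ℝ × (ℝ × ℝ)) (stModel n) Ψ (s, p) (0, a) := by
      intro a
      refine (congrArg (fun T : (ℝ × ℝ) →L[ℝ] (ℝ × Coord n) => T a) h3).trans ?_
      refine congrArg (mfderiv 𝓘(ℝ, ℝ × (ℝ × ℝ)) (stModel n) Ψ (s, p)) ?_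
      rw [mfderiv_eq_fderiv, h2.fderiv]
      rfl
    exact congrArg₂ (fun V W : ℝ × Coord n => g.lor (Y s p) V W) (h4 a) (h4 b)
  have hY0' : ∀ p ∈ U, Y 0 =ᶠ[𝓝 p] y := fun p hp => by
    filter_upwards [hU.mem_nhds hp] with p' hp'
    exact hY0 p' hp'
  have hpull0 : ∀ p ∈ U, ∀ a b, g.form Ψ (0, p) (0, a) (0, b) = g.pullback y p a b := by
    intro p hp a b
    rw [← hpull 0 p hp]
    have hq : y p ∈ chartDomain (n := n) (y p).2 := mem_chartDomain_self _
    have hYU : ContMDiffOn 𝓘(ℝ, ℝ × ℝ) (stModel n) ∞ (Y 0) U := hy.congr hY0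
    have hq' : Y 0 p ∈ chartDomain (n := n) (y p).2 := by rw [hY0 p hp]; exact hq
    have he : stCoord (n := n) (y p).2 ∘ Y 0 =ᶠ[𝓝 p] stCoord (n := n) (y p).2 ∘ y :=
      (hY0' p hp).fun_comp _
    rw [pullback_eq_form, pullback_eq_form, form_eq hU hYU hp hq', form_eq hU hy hp hq,
      he.fderiv_eq, he.eq_of_nhds]
  have hcd : ∀ a b : ℝ × (ℝ × ℝ), ∀ P ∈ V, ContDiffAt ℝ ∞ (fun P => g.form Ψ P a b) P :=
    fun a b P hP => contDiffAt_form hVo hY hP a b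
  set et : ℝ × (ℝ × ℝ) := (0, (1, 0)) with het
  set ex : ℝ × (ℝ × ℝ) := (0, (0, 1)) with hex
  set es : ℝ × (ℝ × ℝ) := (1, 0) with hes
  set F : ℝ × (ℝ × ℝ) → ℝ := fun P => g.form Ψ P et ex ^ 2 - g.form Ψ P et et * g.form Ψ P ex ex
    with hF
  have hFd : ∀ P ∈ V, ContDiffAt ℝ ∞ F P := fun P hP =>
    ((hcd et ex P hP).pow 2).sub ((hcd et et P hP).mul (hcd ex ex P hP))
  have hdet : ∀ s, ∀ p ∈ U, -(g.pullbackDet (Y s) p) = F (s, p) := by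
    intro s p hp
    rw [pullbackDet, hpull s p hp, hpull s p hp, hpull s p hp]
    simp only [hF]
    ring
  have hF0 : ∀ p ∈ U, F (0, p) = g.pullback y p (0, 1) (0, 1) ^ 2 := by
    intro p hp
    obtain ⟨h1, h2, h3⟩ := hc p hp
    simp only [hF, het, hex]
    rw [hpull0 p hp, hpull0 p hp, hpull0 p hp, h3, h1]
    ring
  -- the derivative of the integrand
  have hpos : ∀ᶠ s in 𝓝 (0 : ℝ), ∀ p ∈ K, 0 < F (s, p) := by
    refine hK.eventually_forall_of_forall_eventually fun p hp => ?_
    have h1 : 0 < F (0, p) := by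
      rw [hF0 p (hKU hp)]
      exact pow_pos (hc p (hKU hp)).2.1 2
    exact (hFd (0, p) ⟨mem_univ _, hKU hp⟩).continuousAt.eventually_const_lt h1
  obtain ⟨δ, hδ, hball⟩ := Metric.eventually_nhds_iff.1 hpos
  have hFpos : ∀ s ∈ Metric.closedBall (0 : ℝ) (δ / 2), ∀ p ∈ K, 0 < F (s, p) := fun s hs p hp =>
    hball (lt_of_le_of_lt hs (by linarith)) p hp
  set h' : ℝ → ℝ × ℝ → ℝ := fun s p => fderiv ℝ F (s, p) es / (2 * Real.sqrt (F (s, p))) with hh'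
  have hh'c : ContinuousOn (fun P : ℝ × (ℝ × ℝ) => h' P.1 P.2) (Metric.closedBall 0 (δ / 2) ×ˢ K) := by
    intro P hP
    have hPV : P ∈ V := ⟨mem_univ _, hKU hP.2⟩
    have h1 : ContinuousAt (fun P => fderiv ℝ F P es) P :=
      (((hFd P hPV).fderiv_right (m := 0) (by simp)).clm_apply contDiffAt_const).continuousAt
    have h2 : ContinuousAt (fun P => 2 * Real.sqrt (F P)) P :=
      (Real.continuous_sqrt.continuousAt.comp (hFd P hPV).continuousAt).const_mul 2
    have h3 : 2 * Real.sqrt (F P) ≠ 0 := by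
      have := Real.sqrt_pos.2 (hFpos P.1 hP.1 P.2 hP.2)
      exact (mul_pos two_pos this).ne'
    exact (h1.div h2 h3).continuousWithinAt
  obtain ⟨B, hB⟩ := ((isCompact_closedBall (0 : ℝ) (δ / 2)).prod hK).exists_bound_of_continuousOn hh'c
  have hFs : ∀ s, ∀ p ∈ U, HasDerivAt (fun s => F (s, p)) (fderiv ℝ F (s, p) es) s := by
    intro s p hp
    have h1 : HasDerivAt (fun s : ℝ => (s, p)) es s := (hasDerivAt_id s).prodMk (hasDerivAt_const s p)
    exact ((hFd (s, p) ⟨mem_univ _, hp⟩).differentiableAt (by simp)).hasFDerivAt.comp_hasDerivAt s h1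
  have hmeasK := hK.measurableSet
  have hFc : ∀ s, ContinuousOn (fun p => Real.sqrt (F (s, p))) K := fun s p hp =>
    (Real.continuous_sqrt.continuousAt.comp (f := fun p => F (s, p))
      ((hFd (s, p) ⟨mem_univ _, hKU hp⟩).continuousAt.comp (f := fun p : ℝ × ℝ => (s, p))
        (Continuous.continuousAt (by fun_prop)))).continuousWithinAt
  have hint := hasDerivAt_integral_of_dominated_loc_of_deriv_le (μ := volume.restrict K)
    (F := fun s p => Real.sqrt (F (s, p))) (F' := h') (x₀ := (0 : ℝ)) (bound := fun _ => B)
    (s := Metric.ball (0 : ℝ) (δ / 2))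
    (Metric.ball_mem_nhds _ (by positivity))
    (Eventually.of_forall fun s => (hFc s).aestronglyMeasurable hmeasK)
    ((hFc 0).integrableOn_compact hK)
    (by
      refine ContinuousOn.aestronglyMeasurable ?_ hmeasK
      exact hh'c.comp (f := fun p : ℝ × ℝ => ((0 : ℝ), p)) (by fun_prop) fun p hp =>
        ⟨Metric.mem_closedBall_self (by positivity), hp⟩)
    (by
      filter_upwards [ae_restrict_mem hmeasK] with p hp s hs
      exact hB (s, p) ⟨Metric.ball_subset_closedBall hs, hp⟩)
    (by
      have : IsFiniteMeasure (volume.restrict K : Measure (ℝ × ℝ)) :=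
        ⟨by rw [Measure.restrict_apply_univ]; exact hK.measure_lt_top⟩
      exact integrable_const B)
    (by
      filter_upwards [ae_restrict_mem hmeasK] with p hp s hs
      exact (hFs s p (hKU hp)).sqrt (hFpos s (Metric.ball_subset_closedBall hs) p hp).ne')
  have harea : (fun s => g.area (Y s) K) = fun s => ∫ p in K, Real.sqrt (F (s, p)) := by
    funext s
    refine setIntegral_congr_fun hmeasK fun p hp => ?_
    simp only [hdet s p (hKU hp)]
  rw [harea]
  refine hint.2.congr_deriv ?_
  -- the derivative is a divergence
  set α : ℝ × (ℝ × ℝ) → ℝ × ℝ → ℝ := fun b => U.indicator fun p => g.form Ψ (0, p) es b with hα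
  have hin : ∀ p : ℝ × ℝ, HasFDerivAt (fun p : ℝ × ℝ => ((0 : ℝ), p))
      (ContinuousLinearMap.inr ℝ ℝ (ℝ × ℝ)) p := fun p => hasFDerivAt_prodMk_right 0 p
  have hαU : ∀ b, ∀ p ∈ U, α b =ᶠ[𝓝 p] fun p => g.form Ψ (0, p) es b := fun b p hp => by
    filter_upwards [hU.mem_nhds hp] with p' hp'
    exact indicator_of_mem hp' _
  -- Off K the variation is constant in s, so the variation field vanishes.
  have hαK : ∀ b, ∀ p ∉ K, α b p = 0 := by
    intro b p hp
    by_cases hpU : p ∈ U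
    · have hd : MDifferentiableAt 𝓘(ℝ, ℝ × (ℝ × ℝ)) (stModel n) Ψ (0, p) :=
        (hY.contMDiffAt (hVo.mem_nhds ⟨mem_univ _, hpU⟩)).mdifferentiableAt (by simp)
      have hq : Ψ (0, p) ∈ chartDomain (n := n) (y p).2 := by
        simp only [hΨ, hY0 p hpU]; exact mem_chartDomain_self _
      have hZ := (contDiffAt_stCoord_comp hVo hY (P := (0, p)) ⟨mem_univ _, hpU⟩ hq).differentiableAt
        (by simp)
      have h1 : HasDerivAt (fun s : ℝ => (s, p)) es 0 := (hasDerivAt_id _).prodMk (hasDerivAt_const _ p)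
      have h2 := hZ.hasFDerivAt.comp_hasDerivAt (0 : ℝ) h1
      have h3 : (stCoord (n := n) (y p).2 ∘ Ψ) ∘ (fun s : ℝ => (s, p))
          = fun _ => stCoord (n := n) (y p).2 (y p) := by
        funext s
        simp only [Function.comp, hΨ, hYK s p ⟨hpU, hp⟩]
      rw [h3] at h2
      have h4 := h2.unique (hasDerivAt_const _ _)
      simp only [hα, indicator_of_mem hpU]
      rw [form_eq hVo hY (P := (0, p)) ⟨mem_univ _, hpU⟩ hq, h4, map_zero]
      rfl
    · exact indicator_of_notMem hpU _
  have hαK' : ∀ b, ∀ p ∉ K, α b =ᶠ[𝓝 p] fun _ => 0 := fun b p hp => by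
    filter_upwards [hK.isClosed.isOpen_compl.mem_nhds hp] with p' hp'
    exact hαK b p' hp'
  have hαd : ∀ b, ContDiff ℝ 1 (α b) := by
    intro b
    rw [contDiff_iff_contDiffAt]
    intro p
    by_cases hpK : p ∈ K
    · have h1 := ((hcd es b (0, p) ⟨mem_univ _, hKU hpK⟩).comp p
        (f := fun p : ℝ × ℝ => ((0 : ℝ), p)) (contDiffAt_const.prodMk contDiffAt_id)).of_le
        (m := 1) (by simp)
      exact h1.congr_of_eventuallyEq (hαU b p (hKU hpK))
    · exact contDiffAt_const.congr_of_eventuallyEq (hαK' b p hpK)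
  have hαc : ∀ b, HasCompactSupport (α b) := fun b => HasCompactSupport.intro hK (hαK b)
  have hαf : ∀ b, ∀ p ∈ U, ∀ v, fderiv ℝ (α b) p v
      = fderiv ℝ (fun P => g.form Ψ P es b) (0, p) (0, v) := by
    intro b p hp v
    have h1 := ((hcd es b (0, p) ⟨mem_univ _, hp⟩).differentiableAt (by simp)).hasFDerivAt.comp p
      (hin p)
    have h2 := h1.congr_of_eventuallyEq (hαU b p hp)
    rw [h2.fderiv]
    rfl
  -- At s = 0 the square root of F is the conformal factor, and the derivative of the area density
  -- is half the s-derivative of ⟨∂ₓy, ∂ₓy⟩ - ⟨∂ₜy, ∂ₜy⟩. By `fderiv_form` this is a divergence up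
  -- to the two accelerations paired with the variation field, which cancel by the wave equation.
  have hdiv : ∀ p ∈ K, h' 0 p = fderiv ℝ (α ex) p (0, 1) - fderiv ℝ (α et) p (1, 0) := by
    intro p hpK
    have hp := hKU hpK
    have hPV : ((0 : ℝ), p) ∈ V := ⟨mem_univ _, hp⟩
    obtain ⟨c1, c2, c3⟩ := hc p hp
    set lam := g.pullback y p (0, 1) (0, 1) with hlam
    have hq : Ψ (0, p) ∈ chartDomain (n := n) (y p).2 := by
      simp only [hΨ, hY0 p hp]; exact mem_chartDomain_self _
    have d1 := ((hcd et ex _ hPV).differentiableAt (by simp)).hasFDerivAt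
    have d2 := ((hcd et et _ hPV).differentiableAt (by simp)).hasFDerivAt
    have d3 := ((hcd ex ex _ hPV).differentiableAt (by simp)).hasFDerivAt
    have f1 : g.form Ψ (0, p) et ex = 0 := (hpull0 p hp _ _).trans c3
    have f2 : g.form Ψ (0, p) et et = -lam := (hpull0 p hp _ _).trans (by linarith)
    have f3 : g.form Ψ (0, p) ex ex = lam := hpull0 p hp _ _
    have dF : fderiv ℝ F (0, p) es = lam * (fderiv ℝ (fun P => g.form Ψ P ex ex) (0, p) es
        - fderiv ℝ (fun P => g.form Ψ P et et) (0, p) es) := by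
      have h1 := (d1.pow 2).sub (d2.mul d3)
      have h2 : fderiv ℝ F (0, p) = _ := h1.fderiv
      rw [h2]
      simp only [sub_apply, add_apply, smul_apply, smul_eq_mul, f1, f2, f3]
      ring
    have hv1 := fderiv_form (g := g) hVo hY hPV hq es ex
    have hv2 := fderiv_form (g := g) hVo hY hPV hq es et
    have hyq : y p ∈ chartDomain (n := n) (y p).2 := mem_chartDomain_self _
    have hZ : ∀ p' ∈ U, y p' ∈ chartDomain (n := n) (y p).2 → ∀ v,
        fderiv ℝ (stCoord (n := n) (y p).2 ∘ Ψ) (0, p') (0, v)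
        = fderiv ℝ (inCoord (n := n) (y p).2 y) p' v := by
      intro p' hp' hq' v
      have hq'' : Ψ (0, p') ∈ chartDomain (n := n) (y p).2 := by
        simp only [hΨ, hY0 p' hp']; exact hq'
      have h1 := ((contDiffAt_stCoord_comp hVo hY (P := (0, p')) ⟨mem_univ _, hp'⟩
        hq'').differentiableAt (by simp)).hasFDerivAt.comp p' (hin p')
      have h2 : inCoord (n := n) (y p).2 y =ᶠ[𝓝 p']
          (stCoord (n := n) (y p).2 ∘ Ψ) ∘ fun p : ℝ × ℝ => ((0 : ℝ), p) :=
        (hY0' p' hp').symm.fun_comp (stCoord (n := n) (y p).2)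
      rw [(h1.congr_of_eventuallyEq h2).fderiv]
      rfl
    have hacc : ∀ v W, acceleration (g.metricForm (y p).2) (stCoord (n := n) (y p).2 ∘ Ψ) (0, p)
        (0, v) W = acceleration (g.metricForm (y p).2) (inCoord (n := n) (y p).2 y) p v W := by
      intro v W
      have hz : (stCoord (n := n) (y p).2 ∘ Ψ) (0, p) = inCoord (n := n) (y p).2 y p := by
        simp only [Function.comp, hΨ, hY0 p hp]; rfl
      have hZ2 : ContDiffAt ℝ 2 (stCoord (n := n) (y p).2 ∘ Ψ) (0, p) :=
        (contDiffAt_stCoord_comp hVo hY hPV hq).of_le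
          (mod_cast le_top : ((2 : ℕ∞) : WithTop ℕ∞) ≤ ∞)
      have h1 := (hasFDerivAt_fderiv_apply hZ2 (0, v)).comp p (hin p)
      have h2 : (fun p' => fderiv ℝ (inCoord (n := n) (y p).2 y) p' v) =ᶠ[𝓝 p]
          (fun P => fderiv ℝ (stCoord (n := n) (y p).2 ∘ Ψ) P (0, v)) ∘
            fun p : ℝ × ℝ => ((0 : ℝ), p) := by
        have hcy := (hy.contMDiffAt (hU.mem_nhds hp)).continuousAt
        filter_upwards [hU.mem_nhds hp, hcy.preimage_mem_nhds
          ((isOpen_chartDomain _).mem_nhds hyq)] with p' h3 h4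
        exact (hZ p' h3 h4 v).symm
      have h3 := (h1.congr_of_eventuallyEq h2).fderiv
      unfold acceleration
      rw [hz, hZ p hp hyq, h3, (hasFDerivAt_fderiv_apply hZ2 (0, v)).fderiv]
      rfl
    have hyc := contDiffAt_inCoord (hy.contMDiffAt (hU.mem_nhds hp)) hyq
    have hwave := (g.chartWave_iff_acceleration
      (hyc.of_le (mod_cast le_top : ((2 : ℕ∞) : WithTop ℕ∞) ≤ ∞)) (stCoord_mem hyq)).1
      ((g.waveMapAt_iff_chartWave (hy.contMDiffAt (hU.mem_nhds hp)) hyq).1 (hw p hp))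
    rw [hacc] at hv1 hv2
    rw [hwave] at hv2
    have hsq : Real.sqrt (F (0, p)) = lam := by
      rw [hF0 p hp, Real.sqrt_sq c2.le]
    simp only [hh']
    rw [dF, hsq, hαf ex p hp, hαf et p hp]
    have : lam ≠ 0 := c2.ne'
    field_simp
    linarith
  have hzero : ∀ b v, ∀ p ∉ K, fderiv ℝ (α b) p v = 0 := by
    intro b v p hp
    rw [(hαK' b p hp).fderiv_eq]
    simp
  have hI : ∀ b v, Integrable fun p => fderiv ℝ (α b) p v := by
    intro b v
    refine Continuous.integrable_of_hasCompactSupport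
      (((hαd b).continuous_fderiv (by simp)).clm_apply continuous_const) ?_
    exact HasCompactSupport.intro hK (hzero b v)
  rw [setIntegral_congr_fun hmeasK hdiv, setIntegral_eq_integral_of_forall_compl_eq_zero
    fun p hp => by rw [hzero _ _ p hp, hzero _ _ p hp, sub_zero], integral_sub (hI _ _) (hI _ _),
    integral_fderiv_eq_zero (hαd _) (hαc _), integral_fderiv_eq_zero (hαd _) (hαc _), sub_zero]

end Critical

end MetricFamily

/-! ### From local solutions to solutions and back; rigidity of domains with blow-up -/

namespace MetricFamily

variable {n : ℕ} {N : Type*} [TopologicalSpace N] [ChartedSpace (Coord n) N]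
variable {g : MetricFamily n N}

lemma mem_closure_inter_upper {O : Set (ℝ × ℝ)} {p : ℝ × ℝ} (hp : p ∈ closure O) (hp0 : 0 < p.1) :
    p ∈ closure (O ∩ upper) :=
  mem_closure_iff_frequently.2
    ((mem_closure_iff_frequently.1 hp).and_eventually (upper_mem_nhds hp0))

lemma pullback_eq_vel {y : ℝ × ℝ → ℝ × N} {r : ℝ × ℝ} (hr : 0 < r.1) (a b : ℝ × ℝ) :
    g.pullback y r a b = g.lor (y r) (vel n y r a) (vel n y r b) := by
  unfold pullback vel
  rw [mfderivWithin_of_mem_nhds (upper_mem_nhds hr)]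

section ToSolution

variable [IsManifold (𝓡 n) ∞ N] {k : ℝ → TangentBundle (stModel n) (ℝ × N)} {Ω : Set (ℝ × ℝ)}
  {y : ℝ × ℝ → ℝ × N}

namespace IsLocalSolution

/-- With P and Q null, ∂ₜy = (P + Q)/2 and ∂ₓy = (P - Q)/2 have squares ±⟨P,Q⟩/2 and are orthogonal,
and ⟨P,Q⟩ ≤ 0. -/
lemma conformal (h : g.IsLocalSolution k Ω y) (hk : g.IsInitialData k) {r : ℝ × ℝ} (hr : r ∈ Ω)
    (hr0 : 0 < r.1) :
    g.pullback y r (0, 1) (0, 1) = -g.pullback y r (1, 0) (1, 0) ∧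
      0 ≤ g.pullback y r (0, 1) (0, 1) ∧ g.pullback y r (1, 0) (0, 1) = 0 := by
  have hP := h.lor_null hk hr (Or.inl rfl)
  have hQ := h.lor_null hk hr (Or.inr rfl)
  have hPQ := g.lor_nonpos_of_null hP hQ (h.timePart_pos hk hr (Or.inl rfl))
    (h.timePart_pos hk hr (Or.inr rfl))
  have hQP := g.lor_symm (vel n y r (1, -1)) (vel n y r (1, 1))
  have et : vel n y r (1, 0) = (1 / 2 : ℝ) • vel n y r (1, 1) + (1 / 2 : ℝ) • vel n y r (1, -1) := by
    rw [← vel_smul, ← vel_smul, ← vel_add]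
    congr 1
    ext <;> norm_num
  have ex : vel n y r (0, 1) = (1 / 2 : ℝ) • vel n y r (1, 1)
      + (-1 / 2 : ℝ) • vel n y r (1, -1) := by
    rw [← vel_smul, ← vel_smul, ← vel_add]
    congr 1
    ext <;> norm_num
  rw [pullback_eq_vel hr0, pullback_eq_vel hr0, pullback_eq_vel hr0, et, ex]
  simp only [lor_add_left, lor_add_right, lor_smul_left, lor_smul_right, hP, hQ, hQP]
  refine ⟨by ring, by linarith, by ring⟩

lemma contMDiffOn (h : g.IsLocalSolution k Ω y) :
    ContMDiffOn 𝓘(ℝ, ℝ × ℝ) (stModel n) ∞ y Ω := fun r hr =>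
  ContMDiffWithinAt.mono (h.smooth r hr) h.subset_upper

lemma isConnected (h : g.IsLocalSolution k Ω y) (ha : ∀ x : ℝ, ((0 : ℝ), x) ∈ Ω) :
    IsConnected Ω := by
  refine ⟨⟨(0, 0), ha 0⟩, isPreconnected_of_forall (0, 0) fun p hp => ?_⟩
  refine ⟨range (fun x : ℝ => ((0 : ℝ), x)) ∪ (fun s : ℝ => (s, p.2)) '' Icc 0 p.1, ?_,
    Or.inl ⟨0, rfl⟩, Or.inr ⟨p.1, ⟨h.subset_upper hp, le_rfl⟩, rfl⟩, ?_⟩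
  · rintro q (⟨x, rfl⟩ | ⟨s, hs, rfl⟩)
    · exact ha x
    · refine h.past p hp _ hs.1 ?_
      simpa using hs.2
  · refine IsPreconnected.union ((0 : ℝ), p.2) ⟨p.2, rfl⟩
      ⟨0, ⟨le_rfl, h.subset_upper hp⟩, rfl⟩ (isPreconnected_range (by fun_prop))
      (isPreconnected_Icc.image _ (by fun_prop))

/-- Conformality and criticality are consequences of the wave equation and the data. For the latter,
the Lorentzian points form an open set on which the conformal factor is positive. -/
theorem isSolution (h : g.IsLocalSolution k Ω y) (hk : g.IsInitialData k)
    (ha : ∀ x : ℝ, ((0 : ℝ), x) ∈ Ω) : g.IsSolution k Ω y where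
  isOpen := h.isOpen
  connected := h.isConnected ha
  axis := ha
  initial x := h.initial x (ha x)
  minimal :=
    { smooth := h.contMDiffOn
      wave := h.wave
      conformal := fun r hr hr0 => h.conformal hk hr hr0
      critical := by
        have hW : IsOpen (Ω ∩ {p | 0 < p.1}) := isOpen_iff_mem_nhds.2 fun p hp =>
          inter_mem (h.mem_nhds hp.1 hp.2) ((isOpen_lt continuous_const continuous_fst).mem_nhds hp.2)
        have hyW := h.contMDiffOn.mono (inter_subset_left (t := {p : ℝ × ℝ | 0 < p.1}))
        have hc : ContinuousOn (g.pullbackDet y) (Ω ∩ {p | 0 < p.1}) := fun p hp =>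
          (((contDiffAt_form hW hyW hp (1, 0) (1, 0)).mul
            (contDiffAt_form hW hyW hp (0, 1) (0, 1))).sub
            ((contDiffAt_form hW hyW hp (1, 0) (0, 1)).pow 2)).continuousAt.continuousWithinAt
        have hU : IsOpen {p | p ∈ Ω ∧ 0 < p.1 ∧ g.pullbackDet y p < 0} := by
          convert hc.isOpen_inter_preimage hW (isOpen_Iio (a := (0 : ℝ))) using 1
          ext p
          exact ⟨fun h => ⟨⟨h.1, h.2.1⟩, h.2.2⟩, fun h => ⟨h.1.1, h.1.2, h.2⟩⟩
        refine isAreaCriticalOn_of_wave hU (h.contMDiffOn.mono fun p hp => hp.1)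
          (fun p hp => h.wave p hp.1 hp.2.1) fun p hp => ?_
        obtain ⟨h1, h2, h3⟩ := h.conformal hk hp.1 hp.2.1
        refine ⟨h1, lt_of_le_of_ne h2 fun h0 => ?_, h3⟩
        have := hp.2.2
        rw [pullbackDet, ← h0, h3] at this
        norm_num at this }

end IsLocalSolution

lemma IsSolution.subset_upper (h : g.IsSolution k Ω y) : Ω ⊆ upper := by
  obtain ⟨O, _, rfl⟩ := h.isOpen
  exact inter_subset_right

lemma IsSolution.isLocalSolution (h : g.IsSolution k Ω y) {Ω' : Set (ℝ × ℝ)} (hs : Ω' ⊆ Ω)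
    (ho : ∃ O : Set (ℝ × ℝ), IsOpen O ∧ Ω' = O ∩ upper) (hp : PastClosed Ω') :
    g.IsLocalSolution k Ω' y where
  isOpen := ho
  past := hp
  smooth r hr := by
    obtain ⟨O, hO, he⟩ := h.isOpen
    exact (h.minimal.smooth r (hs hr)).mono_of_mem_nhdsWithin (upper_mem_of_open hO he (hs hr))
  wave r hr := h.minimal.wave r (hs hr)
  initial x _ := h.initial x

lemma IsSolution.continuousOn_time (h : g.IsSolution k Ω y) :
    ContinuousOn (fun r => (y r).1) Ω :=
  continuous_fst.comp_continuousOn h.minimal.smooth.continuousOn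

end ToSolution

/-- A solution whose time component blows up has no proper extension. -/
lemma eq_of_timeBlowsUp {Ω₁ Ω₂ : Set (ℝ × ℝ)} {y₁ y₂ : ℝ × ℝ → ℝ × N}
    (ho : ∃ O : Set (ℝ × ℝ), IsOpen O ∧ Ω₁ = O ∩ upper) (ha : ∀ x : ℝ, ((0 : ℝ), x) ∈ Ω₁)
    (hb : TimeBlowsUp Ω₁ y₁) (hΩ : Ω₁ ⊆ Ω₂) (hu : Ω₂ ⊆ upper) (hconn : IsPreconnected Ω₂)
    (hc : ContinuousOn (fun r => (y₂ r).1) Ω₂) (he : EqOn y₂ y₁ Ω₁) : Ω₁ = Ω₂ := by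
  obtain ⟨O, hO, rfl⟩ := ho
  refine subset_antisymm hΩ fun p hp => ⟨?_, hu hp⟩
  -- The smaller domain is relatively closed in the larger: at a boundary point inside Ω₂, time
  -- would tend both to +∞ and to a finite value.
  refine hconn.subset_of_closure_inter_subset hO ⟨(0, 0), hΩ (ha 0), (ha 0).1⟩ ?_ hp
  rintro q ⟨hq, hq₂⟩
  by_contra hqO
  have hq0 : q.1 ≠ 0 := by
    intro h0
    have : ((0 : ℝ), q.2) ∈ O := (ha q.2).1
    rw [← h0] at this
    exact hqO this
  have hpos : 0 < q.1 := lt_of_le_of_ne (hu hq₂) hq0.symm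
  have hcl : q ∈ closure (O ∩ upper) :=
    mem_closure_inter_upper hq hpos
  have hfr : q ∈ frontier (O ∩ upper) := ⟨hcl, fun h => hqO (interior_subset h).1⟩
  have : (𝓝[O ∩ upper] q).NeBot := mem_closure_iff_nhdsWithin_neBot.1 hcl
  have h1 := hb q hfr hq0
  have h2 : Tendsto (fun r => (y₂ r).1) (𝓝[O ∩ upper] q) (𝓝 (y₂ q).1) :=
    (hc q hq₂).mono_left (nhdsWithin_mono q hΩ)
  have h3 : Tendsto (fun r => (y₂ r).1) (𝓝[O ∩ upper] q) atTop := by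
    refine h1.congr' ?_
    filter_upwards [self_mem_nhdsWithin] with r hr
    rw [he hr]
  exact not_tendsto_nhds_of_tendsto_atTop h3 _ h2

section PastInterior

/-- The points whose causal past is contained in `Ω`. -/
def pastInterior (Ω : Set (ℝ × ℝ)) : Set (ℝ × ℝ) := {p | p ∈ upper ∧ pastFrom 0 p ⊆ Ω}

lemma pastInterior_subset (Ω : Set (ℝ × ℝ)) : pastInterior Ω ⊆ Ω := fun _ hp =>
  hp.2 (self_mem_pastFrom hp.1)

lemma pastClosed_pastInterior (Ω : Set (ℝ × ℝ)) : PastClosed (pastInterior Ω) :=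
  fun _ hp _ hq hq' => ⟨hq, fun _ hr => hp.2 (pastFrom_trans ⟨hq, hq'⟩ hr hr.1)⟩

/-- The past of p is the image of a fixed compact rectangle under a map that depends continuously on
p, so containment in an open set is an open condition. -/
lemma isOpen_pastInterior {Ω : Set (ℝ × ℝ)} (ho : ∃ O : Set (ℝ × ℝ), IsOpen O ∧ Ω = O ∩ upper) :
    ∃ O : Set (ℝ × ℝ), IsOpen O ∧ pastInterior Ω = O ∩ upper := by
  obtain ⟨O, hO, rfl⟩ := ho
  let Φ : (ℝ × ℝ) × (ℝ × ℝ) → ℝ × ℝ := fun q =>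
    (q.2.1 * q.1.1, q.1.2 + q.2.2 * ((1 - q.2.1) * q.1.1))
  have hΦ : Continuous Φ := by fun_prop
  have hK : IsCompact (Icc (0 : ℝ) 1 ×ˢ Icc (-1 : ℝ) 1) := isCompact_Icc.prod isCompact_Icc
  refine ⟨{p | ∀ q ∈ Icc (0 : ℝ) 1 ×ˢ Icc (-1 : ℝ) 1, Φ (p, q) ∈ O}, ?_, ?_⟩
  · refine isOpen_iff_mem_nhds.2 fun p hp => ?_
    exact hK.eventually_forall_of_forall_eventually fun q hq =>
      hΦ.continuousAt.preimage_mem_nhds (hO.mem_nhds (hp q hq))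
  · ext p
    constructor
    · rintro ⟨hp, hpO⟩
      have hp' : 0 ≤ p.1 := hp
      refine ⟨fun q hq => (hpO ?_).1, hp⟩
      obtain ⟨⟨a, b⟩, c, d⟩ := hq
      have h1 : 0 ≤ (1 - q.1) * p.1 := mul_nonneg (by linarith) hp'
      refine ⟨mul_nonneg a hp', ?_⟩
      have e : p.2 - (Φ (p, q)).2 = -(q.2 * ((1 - q.1) * p.1)) := by simp only [Φ]; ring
      have e' : p.1 - (Φ (p, q)).1 = (1 - q.1) * p.1 := by simp only [Φ]; ring
      rw [e, e', abs_neg, abs_mul, abs_of_nonneg h1]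
      exact mul_le_of_le_one_left h1 (abs_le.2 ⟨c, d⟩)
    · rintro ⟨hpO, hp⟩
      refine ⟨hp, fun r hr => ⟨?_, hr.1⟩⟩
      have hr0 : 0 ≤ r.1 := hr.1
      have hr1 : |p.2 - r.2| ≤ p.1 - r.1 := hr.2
      have hle : r.1 ≤ p.1 := by linarith [abs_nonneg (p.2 - r.2)]
      rcases hle.eq_or_lt with heq | hlt
      · have h2 : p.2 = r.2 := by
          rw [heq, sub_self] at hr1
          linarith [abs_eq_zero.1 (le_antisymm hr1 (abs_nonneg _))]
        have := hpO (1, 0) ⟨⟨zero_le_one, le_rfl⟩, by norm_num, by norm_num⟩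
        convert this using 1
        ext
        · simp [Φ, heq]
        · simp [Φ, h2]
      · have hpp : 0 < p.1 := hr0.trans_lt hlt
        have hd : 0 < p.1 - r.1 := sub_pos.2 hlt
        have := hpO (r.1 / p.1, (r.2 - p.2) / (p.1 - r.1)) ⟨⟨by positivity, by
          rw [div_le_one hpp]; exact hle⟩, abs_le.1 (by
          rw [abs_div, abs_of_pos hd, div_le_one hd, abs_sub_comm]; exact hr1)⟩
        convert this using 1
        ext
        · simp only [Φ]; field_simp
        · simp only [Φ]; field_simp; ring

variable [IsManifold (𝓡 n) ∞ N] {k : ℝ → TangentBundle (stModel n) (ℝ × N)} {Ω : Set (ℝ × ℝ)}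
  {y : ℝ × ℝ → ℝ × N}

/-- On the past interior the solution is a local solution, so time is monotone there. The past
interior is also relatively closed in Ω: at a limit point p in Ω, time is bounded on the
chronological past of p, so a point of the causal past missing from Ω would be a boundary point
approached with bounded time, against blow-up. Connectedness of Ω finishes the proof. -/
theorem IsSolution.pastClosed (h : g.IsSolution k Ω y) (hk : g.IsInitialData k)
    (hb : TimeBlowsUp Ω y) : PastClosed Ω := by
  obtain ⟨O, hO, hOe⟩ := isOpen_pastInterior h.isOpen
  have hL := h.isLocalSolution (pastInterior_subset Ω) ⟨O, hO, hOe⟩ (pastClosed_pastInterior Ω)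
  have ha : ∀ p ∈ upper, p.1 = 0 → p ∈ pastInterior Ω := by
    intro p hp hp0
    refine ⟨hp, fun r hr => ?_⟩
    have hr0 : 0 ≤ r.1 := hr.1
    have hr1 : |p.2 - r.2| ≤ p.1 - r.1 := hr.2
    have e : r.1 = 0 := by linarith [abs_nonneg (p.2 - r.2)]
    have := h.axis r.2
    rwa [← e] at this
  suffices hsub : Ω ⊆ O by
    have : Ω = pastInterior Ω :=
      subset_antisymm (fun p hp => hOe ▸ ⟨hsub hp, h.subset_upper hp⟩) (pastInterior_subset Ω)
    rw [this]
    exact pastClosed_pastInterior Ω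
  have hax : ((0 : ℝ), (0 : ℝ)) ∈ O := (hOe ▸ ha (0, 0) (le_refl (0 : ℝ)) rfl : _ ∈ O ∩ upper).1
  refine h.connected.isPreconnected.subset_of_closure_inter_subset hO ⟨(0, 0), h.axis 0, hax⟩ ?_
  rintro p ⟨hp, hpΩ⟩
  suffices hpi : p ∈ pastInterior Ω from (hOe ▸ hpi : _ ∈ O ∩ upper).1
  have hpu : 0 ≤ p.1 := h.subset_upper hpΩ
  rcases hpu.eq_or_lt with h0 | hpos
  · exact ha p hpu h0.symm
  refine ⟨hpu, fun r hr => ?_⟩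
  by_contra hrΩ
  set B := (y p).1 + 1 with hB
  set I : Set (ℝ × ℝ) := {q | 0 ≤ q.1 ∧ |p.2 - q.2| < p.1 - q.1} with hI
  have hcl : p ∈ closure (pastInterior Ω) := by
    rw [hOe]
    exact mem_closure_inter_upper hp hpos
  have hIb : ∀ q ∈ I, q ∈ Ω ∧ (y q).1 ≤ B := by
    intro q hq
    have : (𝓝[pastInterior Ω] p).NeBot := mem_closure_iff_nhdsWithin_neBot.1 hcl
    have h1 : ∀ᶠ p' in 𝓝[pastInterior Ω] p, (y p').1 < B :=
      ((h.continuousOn_time p hpΩ).mono (pastInterior_subset Ω)).eventually_lt_const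
        (lt_add_one _)
    have h2 : ∀ᶠ p' in 𝓝[pastInterior Ω] p, |p'.2 - q.2| - (p'.1 - q.1) < 0 := by
      have hcont : Continuous fun p' : ℝ × ℝ => |p'.2 - q.2| - (p'.1 - q.1) := by fun_prop
      exact mem_nhdsWithin_of_mem_nhds
        (hcont.continuousAt.eventually_lt_const (by linarith [hq.2]))
    obtain ⟨p', ⟨h3, h4⟩, h5⟩ := ((h1.and h2).and self_mem_nhdsWithin).exists
    have hqp : q ∈ pastFrom 0 p' := ⟨hq.1, by linarith⟩
    exact ⟨h5.2 hqp, (hL.time_le hk h5 hqp).1.trans h3.le⟩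
  have hr0 : 0 ≤ r.1 := hr.1
  have hr1 : |p.2 - r.2| ≤ p.1 - r.1 := hr.2
  have hrne : r.1 ≠ 0 := fun e => hrΩ (by
    have := h.axis r.2
    rwa [← e] at this)
  have hrI : r ∈ closure I := by
    -- approach `r` along the segment to `(0, p.2)`
    have hlim : Tendsto (fun s : ℝ => ((1 - s) * r.1, (1 - s) * r.2 + s * p.2)) (𝓝[Ioo 0 1] 0) (𝓝 r) := by
      have hcont : Continuous fun s : ℝ => ((1 - s) * r.1, (1 - s) * r.2 + s * p.2) := by fun_prop
      have := hcont.tendsto 0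
      simp only [sub_zero, one_mul, zero_mul, add_zero] at this
      exact this.mono_left nhdsWithin_le_nhds
    have : (𝓝[Ioo (0 : ℝ) 1] 0).NeBot := by
      rw [← mem_closure_iff_nhdsWithin_neBot, closure_Ioo zero_ne_one]
      exact ⟨le_rfl, zero_le_one⟩
    refine mem_closure_of_tendsto hlim ?_
    filter_upwards [self_mem_nhdsWithin] with s hs
    have hs1 : 0 < 1 - s := by linarith [hs.2]
    refine ⟨mul_nonneg hs1.le hr0, ?_⟩
    have e : p.2 - ((1 - s) * r.2 + s * p.2) = (1 - s) * (p.2 - r.2) := by ring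
    simp only [e, abs_mul, abs_of_pos hs1]
    have := mul_le_mul_of_nonneg_left hr1 hs1.le
    have h6 : 0 < s * p.1 := mul_pos hs.1 hpos
    nlinarith
  have hfr : r ∈ frontier Ω :=
    ⟨closure_mono (fun q hq => (hIb q hq).1) hrI, fun hi => hrΩ (interior_subset hi)⟩
  have hne : (𝓝[I] r).NeBot := mem_closure_iff_nhdsWithin_neBot.1 hrI
  have h1 : ∀ᶠ q in 𝓝[I] r, B < (y q).1 :=
    ((hb r hfr hrne).mono_left (nhdsWithin_mono r fun q hq => (hIb q hq).1)).eventually_gt_atTop B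
  obtain ⟨q, hq, hqI⟩ := (h1.and self_mem_nhdsWithin).exists
  exact absurd (hIb q hqI).2 (not_le.2 hq)

end PastInterior

end MetricFamily

/-! ### Level sets as graphs, and periodization of functions -/

namespace MetricFamily

section Level

/-- Level sets of a function increasing in the first variable are locally smooth graphs. -/
lemma exists_level_function {T : ℝ × ℝ → ℝ} {W : Set (ℝ × ℝ)} (hW : IsOpen W)
    (hT : ContDiffOn ℝ ∞ T W) (hd : ∀ q ∈ W, 0 < fderiv ℝ T q (1, 0)) {p : ℝ × ℝ} (hp : p ∈ W) :
    ∃ V ∈ 𝓝 p.2, ∃ φ : ℝ → ℝ, ContDiffOn ℝ ∞ φ V ∧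
      ∀ x ∈ V, (φ x, x) ∈ W ∧ T (φ x, x) = T p := by
  -- A local diffeomorphism, since T has nonzero derivative in the first variable; its inverse along
  -- the line of first coordinate T p parametrizes the level set by x.
  set Θ : ℝ × ℝ → ℝ × ℝ := fun q => (T q, q.2) with hΘ
  have hTa : ∀ q ∈ W, ContDiffAt ℝ ∞ T q := fun q hq => hT.contDiffAt (hW.mem_nhds hq)
  have hΘa : ∀ q ∈ W, ContDiffAt ℝ ∞ Θ q := fun q hq => (hTa q hq).prodMk contDiffAt_snd
  have he : ∀ q ∈ W, ∃ e : (ℝ × ℝ) ≃L[ℝ] (ℝ × ℝ), HasFDerivAt Θ (e : (ℝ × ℝ) →L[ℝ] ℝ × ℝ) q := by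
    intro q hq
    set L : (ℝ × ℝ) →L[ℝ] ℝ × ℝ := (fderiv ℝ T q).prod (ContinuousLinearMap.snd ℝ ℝ ℝ)
    have hL : HasFDerivAt Θ L q :=
      ((hTa q hq).differentiableAt (by simp)).hasFDerivAt.prodMk hasFDerivAt_snd
    have hinj : Function.Injective (L : (ℝ × ℝ) →ₗ[ℝ] ℝ × ℝ) := by
      rw [← LinearMap.ker_eq_bot, LinearMap.ker_eq_bot']
      rintro ⟨a, b⟩ hab
      have hb : b = 0 := congrArg Prod.snd hab
      have ha : fderiv ℝ T q (a, b) = 0 := congrArg Prod.fst hab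
      have e : ((a, b) : ℝ × ℝ) = a • (1, 0) := by ext <;> simp [hb]
      rw [e, map_smul, smul_eq_mul, mul_eq_zero] at ha
      simp [hb, ha.resolve_right (hd q hq).ne']
    refine ⟨(LinearEquiv.ofInjectiveEndo _ hinj).toContinuousLinearEquiv, ?_⟩
    convert hL using 1
    exact ContinuousLinearMap.ext fun _ => rfl
  obtain ⟨e, hep⟩ := he p hp
  have hne : (∞ : WithTop ℕ∞) ≠ 0 := by simp
  set R := (hΘa p hp).toOpenPartialHomeomorph Θ hep hne with hR
  have hRc : (R : ℝ × ℝ → ℝ × ℝ) = Θ := rfl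
  have hps : p ∈ R.source := (hΘa p hp).mem_toOpenPartialHomeomorph_source hep hne
  have hsymm : R.symm (T p, p.2) = p := R.left_inv hps
  set D : Set (ℝ × ℝ) := R.target ∩ R.symm ⁻¹' W
  have hD : IsOpen D := R.isOpen_inter_preimage_symm hW
  have hpD : ((T p, p.2) : ℝ × ℝ) ∈ D := ⟨R.map_source hps, by rw [mem_preimage, hsymm]; exact hp⟩
  have hc : ContDiff ℝ ∞ fun x : ℝ => (T p, x) := by fun_prop
  refine ⟨(fun x : ℝ => (T p, x)) ⁻¹' D,
    hc.continuous.continuousAt.preimage_mem_nhds (hD.mem_nhds hpD),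
    fun x => (R.symm (T p, x)).1, fun x hx => ?_, fun x hx => ?_⟩
  · obtain ⟨e', he'⟩ := he _ hx.2
    have h1 : ContDiffAt ℝ ∞ R.symm (T p, x) := R.contDiffAt_symm hx.1 he' (hΘa _ hx.2)
    exact (contDiffAt_fst.comp x (h1.comp x (f := fun x : ℝ => (T p, x))
      hc.contDiffAt)).contDiffWithinAt
  · have h1 : Θ (R.symm (T p, x)) = (T p, x) := R.right_inv hx.1
    have h2 : ((R.symm (T p, x)).1, x) = R.symm (T p, x) := by
      ext
      · rfl
      · exact (congrArg Prod.snd h1).symm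
    rw [h2]
    exact ⟨hx.2, congrArg Prod.fst h1⟩

lemma strictMonoOn_of_fderiv_pos {T : ℝ × ℝ → ℝ} {W : Set (ℝ × ℝ)} (hW : IsOpen W)
    (hc : Convex ℝ W) (hT : ContDiffOn ℝ ∞ T W) (hd : ∀ q ∈ W, 0 < fderiv ℝ T q (1, 0))
    {a b x : ℝ} (ha : (a, x) ∈ W) (hb : (b, x) ∈ W) (hab : a < b) : T (a, x) < T (b, x) := by
  have hI : ∀ s ∈ Icc a b, (s, x) ∈ W := by
    intro s hs
    refine hc.segment_subset ha hb ?_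
    rw [segment_eq_image]
    have hba : 0 < b - a := sub_pos.2 hab
    refine ⟨(s - a) / (b - a), ⟨div_nonneg (by linarith [hs.1]) hba.le, ?_⟩, ?_⟩
    · rw [div_le_one hba]; linarith [hs.2]
    · ext
      · simp only [Prod.smul_mk, Prod.mk_add_mk, smul_eq_mul]; field_simp; ring
      · simp only [Prod.smul_mk, Prod.mk_add_mk, smul_eq_mul]; ring
  have hder : ∀ s ∈ Icc a b, HasDerivAt (fun s => T (s, x)) (fderiv ℝ T (s, x) (1, 0)) s := by
    intro s hs
    have h1 : HasDerivAt (fun s : ℝ => (s, x)) ((1 : ℝ), (0 : ℝ)) s :=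
      (hasDerivAt_id s).prodMk (hasDerivAt_const s x)
    exact ((hT.contDiffAt (hW.mem_nhds (hI s hs))).differentiableAt
      (by simp)).hasFDerivAt.comp_hasDerivAt s h1
  refine strictMonoOn_of_deriv_pos (convex_Icc a b)
    (fun s hs => (hder s hs).continuousAt.continuousWithinAt) (fun s hs => ?_)
    (left_mem_Icc.2 hab.le) (right_mem_Icc.2 hab.le) hab
  have hs' := interior_subset hs
  rw [(hder s hs').deriv]
  exact hd _ (hI s hs')

end Level

section Periodize

open Real

/-- `F` on the period beginning at `-a`, continued periodically. -/
def floorShift (F : ℝ → ℝ) (a x : ℝ) : ℝ := F (x - 2 * π * ⌊(x + a) / (2 * π)⌋)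

lemma floorShift_periodic (F : ℝ → ℝ) (a : ℝ) : Function.Periodic (floorShift F a) (2 * π) := by
  intro x
  have h : (x + 2 * π + a) / (2 * π) = (x + a) / (2 * π) + 1 := by
    field_simp [Real.pi_ne_zero]
    ring
  simp only [floorShift, h, Int.floor_add_one]
  push_cast
  congr 1
  ring

/-- Away from the jumps of the floor the function is locally a translate of F. -/
lemma contDiffAt_floorShift {F : ℝ → ℝ} (hF : ContDiff ℝ ∞ F) {a x : ℝ}
    (hx : ∀ m : ℤ, x + a ≠ m * (2 * π)) : ContDiffAt ℝ ∞ (floorShift F a) x := by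
  set m := ⌊(x + a) / (2 * π)⌋ with hm
  have h1 : (m : ℝ) < (x + a) / (2 * π) := by
    refine lt_of_le_of_ne (Int.floor_le _) fun h => hx m ?_
    rw [h]
    field_simp [Real.pi_ne_zero]
  have h2 : (x + a) / (2 * π) < m + 1 := Int.lt_floor_add_one _
  have hc : ContinuousAt (fun x => (x + a) / (2 * π)) x := by fun_prop
  have he : floorShift F a =ᶠ[𝓝 x] fun x => F (x - 2 * π * m) := by
    filter_upwards [hc.eventually_const_lt h1, hc.eventually_lt_const h2] with s h3 h4
    have : ⌊(s + a) / (2 * π)⌋ = m := Int.floor_eq_iff.2 ⟨h3.le, h4⟩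
    simp only [floorShift, this]
  refine ContDiffAt.congr_of_eventuallyEq ?_ he
  exact (hF.comp (by fun_prop : ContDiff ℝ ∞ fun x : ℝ => x - 2 * π * m)).contDiffAt

/-- A smooth function that is periodic over part of the line can be changed into a periodic one. -/
lemma exists_periodic {F : ℝ → ℝ} (hF : ContDiff ℝ ∞ F) :
    ∃ f : ℝ → ℝ, ContDiff ℝ ∞ f ∧ Function.Periodic f (2 * π) ∧
      ∀ x v, (∀ m : ℤ, F (x - 2 * π * m) = v) → f x = v := by
  -- A periodic weight that vanishes near the multiples of 2π, where `floorShift F 0` may jump, and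
  -- equals 1 near the odd multiples of π, where `floorShift F π` may jump. Both functions take the
  -- value v wherever all translates of F do, so the weighted mean does too.
  set θ : ℝ → ℝ := fun x => Real.smoothTransition (1 / 2 - cos x) with hθ
  have hθs : ContDiff ℝ ∞ θ := Real.smoothTransition.contDiff.comp (by fun_prop)
  refine ⟨fun x => θ x * floorShift F 0 x + (1 - θ x) * floorShift F π x, ?_, ?_, ?_⟩
  · rw [contDiff_iff_contDiffAt]
    intro x
    have hF0 : cos x ≠ 1 → ContDiffAt ℝ ∞ (floorShift F 0) x := fun h =>
      contDiffAt_floorShift hF fun m hm => h (by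
        rw [add_zero] at hm
        rw [hm, Real.cos_int_mul_two_pi])
    have hFπ : cos x ≠ -1 → ContDiffAt ℝ ∞ (floorShift F π) x := fun h =>
      contDiffAt_floorShift hF fun m hm => h (by
        rw [eq_sub_of_add_eq hm, Real.cos_int_mul_two_pi_sub_pi])
    have hcos : ContinuousAt cos x := Real.continuous_cos.continuousAt
    by_cases h1 : cos x = 1
    · have he : (fun x => θ x * floorShift F 0 x + (1 - θ x) * floorShift F π x)
          =ᶠ[𝓝 x] floorShift F π := by
        filter_upwards [hcos.eventually_const_lt (by rw [h1]; norm_num : (1 / 2 : ℝ) < cos x)] with s hs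
        have : θ s = 0 := Real.smoothTransition.zero_of_nonpos (by linarith)
        rw [this]; ring
      exact (hFπ (by rw [h1]; norm_num)).congr_of_eventuallyEq he
    by_cases h2 : cos x = -1
    · have he : (fun x => θ x * floorShift F 0 x + (1 - θ x) * floorShift F π x)
          =ᶠ[𝓝 x] floorShift F 0 := by
        filter_upwards [hcos.eventually_lt_const (by rw [h2]; norm_num : cos x < (-1 / 2 : ℝ))] with s hs
        have : θ s = 1 := Real.smoothTransition.one_of_one_le (by linarith)
        rw [this]; ring
      exact (hF0 h1).congr_of_eventuallyEq he
    exact (hθs.contDiffAt.mul (hF0 h1)).add ((contDiffAt_const.sub hθs.contDiffAt).mul (hFπ h2))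
  · intro x
    have h1 : θ (x + 2 * π) = θ x := by simp only [hθ, Real.cos_add_two_pi]
    simp only [h1, floorShift_periodic F 0 x, floorShift_periodic F π x]
  · intro x v h
    simp only [floorShift, h]
    ring

end Periodize

end MetricFamily

/-! ### Time slices as periodic graphs -/

namespace MetricFamily

variable {n : ℕ} {N : Type*} [TopologicalSpace N] [ChartedSpace (Coord n) N]
variable {g : MetricFamily n N} [IsManifold (𝓡 n) ∞ N] {k : ℝ → TangentBundle (stModel n) (ℝ × N)}

namespace IsLocalSolution

variable {Ω : Set (ℝ × ℝ)} {y : ℝ × ℝ → ℝ × N}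

lemma time_lt (h : g.IsLocalSolution k Ω y) (hk : g.IsInitialData k) {s t x : ℝ} (hs : 0 ≤ s)
    (hst : s < t) (ht : (t, x) ∈ Ω) : (y (s, x)).1 < (y (t, x)).1 :=
  (h.time_le hk ht (q := (s, x)) ⟨hs, by simpa using hst.le⟩).2 hst

lemma time_injective (h : g.IsLocalSolution k Ω y) (hk : g.IsInitialData k) {s t x : ℝ}
    (hs : (s, x) ∈ Ω) (ht : (t, x) ∈ Ω) (he : (y (s, x)).1 = (y (t, x)).1) : s = t := by
  rcases lt_trichotomy s t with h1 | h1 | h1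
  · exact absurd he (h.time_lt hk (h.subset_upper hs) h1 ht).ne
  · exact h1
  · exact absurd he (h.time_lt hk (h.subset_upper ht) h1 hs).ne'

lemma vertical_mem (h : g.IsLocalSolution k Ω y) {s t x : ℝ} (hs : 0 ≤ s) (hst : s ≤ t)
    (ht : (t, x) ∈ Ω) : (s, x) ∈ Ω :=
  h.past (t, x) ht (s, x) hs (by simpa using hst)

lemma continuousOn_vertical (h : g.IsLocalSolution k Ω y) {t x : ℝ} (ht : (t, x) ∈ Ω) :
    ContinuousOn (fun s => (y (s, x)).1) (Icc 0 t) := by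
  have h1 : ContinuousOn (fun r => (y r).1) Ω :=
    continuous_fst.comp_continuousOn h.contMDiffOn.continuousOn
  exact h1.comp (f := fun s : ℝ => (s, x)) (by fun_prop) fun s hs => h.vertical_mem hs.1 hs.2 ht

end IsLocalSolution

variable [T2Space N]

section Level

lemma timePart_vel_shift (hk : g.IsInitialData k) {r : ℝ × ℝ} (hr : r ∈ g.maxDomain k) :
    timePart (vel n (g.maxSolution k) (r + (0, 2 * Real.pi)) (1, 1))
      = timePart (vel n (g.maxSolution k) r (1, 1)) :=
  congrArg (fun V : TangentBundle (stModel n) (ℝ × N) => timePart V.snd)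
    (maxSolution_shift (fun x => hk.periodic x) hr (1, 1))

/-- Along every vertical ray, the time component of the maximal solution takes arbitrarily large
values. -/
lemma exists_time_gt_max (hslice : ∀ τ : ℝ, g.IsCauchyHypersurface {p : ℝ × N | p.1 = τ})
    (hk : g.IsInitialData k) (x B : ℝ) :
    ∃ t ≥ 0, (t, x) ∈ g.maxDomain k ∧ B < (g.maxSolution k (t, x)).1 := by
  have L : g.IsLocalSolution k (g.maxDomain k) (g.maxSolution k) := isLocalSolution_max
  by_cases hray : ∀ s ≥ 0, (s, x) ∈ g.maxDomain k
  · obtain ⟨s, hs, hB⟩ := L.exists_time_gt hslice hk Real.pi_pos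
      (fun r hr => timePart_vel_shift hk hr) hray B
    exact ⟨s, hs, hray s hs, hB⟩
  -- Otherwise the ray leaves the domain at a first height T; the point there is on the boundary,
  -- and time blows up on approaching it.
  obtain ⟨O, hO, hOe⟩ := L.isOpen
  push Not at hray
  obtain ⟨s₀, hs₀, hs₀'⟩ := hray
  have hmem : ∀ s, 0 ≤ s → ((s, x) ∈ g.maxDomain k ↔ (s, x) ∈ O) := fun s hs => by
    rw [hOe]; exact ⟨fun h => h.1, fun h => ⟨h, hs⟩⟩
  set S : Set ℝ := {s | 0 ≤ s ∧ (s, x) ∉ O} with hS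
  have hSc : IsClosed S := isClosed_Ici.inter
    (hO.isClosed_compl.preimage (f := fun s : ℝ => (s, x)) (by fun_prop))
  have hSne : S.Nonempty := ⟨s₀, hs₀, fun h => hs₀' ((hmem s₀ hs₀).2 h)⟩
  have hSb : BddBelow S := ⟨0, fun s hs => hs.1⟩
  set T := sInf S with hT
  have hTS : T ∈ S := hSc.csInf_mem hSne hSb
  have hlt : ∀ s, 0 ≤ s → s < T → (s, x) ∈ g.maxDomain k := by
    intro s hs hsT
    by_contra hc
    exact absurd (csInf_le hSb ⟨hs, fun h => hc ((hmem s hs).2 h)⟩) (not_le.2 hsT)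
  have hT0 : 0 < T := by
    refine lt_of_le_of_ne hTS.1 fun h0 => hTS.2 ?_
    rw [← h0]
    exact (hmem 0 le_rfl).1 (axis_mem_maxDomain g hk.smooth x)
  have hlim : Tendsto (fun s : ℝ => (s, x)) (𝓝[Ico 0 T] T) (𝓝[g.maxDomain k] (T, x)) := by
    refine tendsto_nhdsWithin_iff.2 ⟨?_, ?_⟩
    · exact (Continuous.tendsto (by fun_prop) T).mono_left nhdsWithin_le_nhds
    · filter_upwards [self_mem_nhdsWithin] with s hs
      exact hlt s hs.1 hs.2
  have hne : (𝓝[Ico 0 T] T).NeBot := by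
    rw [← mem_closure_iff_nhdsWithin_neBot, closure_Ico hT0.ne]
    exact ⟨hT0.le, le_rfl⟩
  have hnm : (T, x) ∉ g.maxDomain k := fun h => hTS.2 ((hmem T hTS.1).1 h)
  have hfr : (T, x) ∈ frontier (g.maxDomain k) := by
    refine ⟨?_, fun h => hnm (interior_subset h)⟩
    exact mem_closure_iff_nhdsWithin_neBot.2 (hlim.neBot)
  have h1 := ((timeBlowsUp_max hslice hk (T, x) hfr hT0.ne').comp hlim).eventually_gt_atTop B
  obtain ⟨s, hs, hsI⟩ := (h1.and self_mem_nhdsWithin).exists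
  exact ⟨s, hsI.1, hlt s hsI.1 hsI.2, hs⟩

lemma maxSolution_axis (hk : g.IsInitialData k) (x : ℝ) :
    g.maxSolution k (0, x) = (k x).proj :=
  isLocalSolution_max.proj_eq (axis_mem_maxDomain g hk.smooth x)

lemma exists_time_eq (hslice : ∀ τ : ℝ, g.IsCauchyHypersurface {p : ℝ × N | p.1 = τ})
    (hk : g.IsInitialData k) {x x₀ : ℝ} (hx : (k x).proj.1 ≤ x₀) :
    ∃ t, (t, x) ∈ g.maxDomain k ∧ (g.maxSolution k (t, x)).1 = x₀ := by
  have L : g.IsLocalSolution k (g.maxDomain k) (g.maxSolution k) := isLocalSolution_max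
  obtain ⟨t, ht, htm, hB⟩ := exists_time_gt_max hslice hk x x₀
  have h0 : (g.maxSolution k (0, x)).1 ≤ x₀ := by rw [maxSolution_axis hk]; exact hx
  obtain ⟨s, hs, hse⟩ := intermediate_value_Icc ht (L.continuousOn_vertical htm) ⟨h0, hB.le⟩
  exact ⟨s, L.vertical_mem hs.1 hs.2 htm, hse⟩

/-- Near every point the time component extends smoothly across the axis. -/
lemma exists_time_extension (hk : g.IsInitialData k) {r : ℝ × ℝ} (hr : r ∈ g.maxDomain k) :
    ∃ W : Set (ℝ × ℝ), IsOpen W ∧ r ∈ W ∧ W ∩ upper ⊆ g.maxDomain k ∧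
      ∃ T : ℝ × ℝ → ℝ, ContDiffOn ℝ ∞ T W ∧
        EqOn (fun r => (g.maxSolution k r).1) T (W ∩ upper) := by
  have L : g.IsLocalSolution k (g.maxDomain k) (g.maxSolution k) := isLocalSolution_max
  have hr0 : 0 ≤ r.1 := L.subset_upper hr
  rcases hr0.eq_or_lt with h0 | hpos
  · obtain ⟨η, hη, Y, hY, -, hYs⟩ := exists_isLocalSolution_axis g hk.smooth r.2
    refine ⟨diamond 0 r.2 η, isOpen_diamond _ _ _, ?_, hYs.subset_maxDomain, fun p => (Y p).1,
      contDiff_fst.comp_contDiffOn hY, fun p hp => ?_⟩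
    · change |r.1 - 0| + |r.2 - r.2| < η
      rw [← h0]
      simpa using hη
    · exact congrArg Prod.fst (hYs.eqOn_maxSolution hp)
  · refine ⟨interior (g.maxDomain k), isOpen_interior,
      mem_interior_iff_mem_nhds.2 (L.mem_nhds hr hpos),
      inter_subset_left.trans interior_subset, fun r => (g.maxSolution k r).1, ?_, fun _ _ => rfl⟩
    have h1 := L.contMDiffOn.mono (interior_subset (s := g.maxDomain k))
    exact contMDiffOn_iff_contDiffOn.1 (contMDiff_fst.comp_contMDiffOn h1)

/-- Derivatives within the half plane are unique even on the axis, so the extension inherits the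
positive t-derivative of time. -/
lemma fderiv_extension_pos (hk : g.IsInitialData k) {r : ℝ × ℝ} (hr : r ∈ g.maxDomain k)
    {W : Set (ℝ × ℝ)} {T : ℝ × ℝ → ℝ} (hW : IsOpen W) (hrW : r ∈ W) (hT : ContDiffOn ℝ ∞ T W)
    (he : EqOn (fun r => (g.maxSolution k r).1) T (W ∩ upper)) : 0 < fderiv ℝ T r (1, 0) := by
  have L : g.IsLocalSolution k (g.maxDomain k) (g.maxSolution k) := isLocalSolution_max
  have hru : r ∈ upper := L.subset_upper hr
  have hq : g.maxSolution k r ∈ chartDomain (n := n) (g.maxSolution k r).2 := mem_chartDomain_self _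
  have hpos := (L.vel_causal hk hr (c := 0) (by simp)).2
  rw [timePart_vel hru (L.smooth r hr) hq] at hpos
  set Z := inCoord (n := n) (g.maxSolution k r).2 (g.maxSolution k) with hZ
  have hd : DifferentiableWithinAt ℝ Z upper r :=
    (contDiffWithinAt_inCoord (L.smooth r hr) hq).differentiableWithinAt (by simp)
  have hTd : HasFDerivAt T (fderiv ℝ T r) r :=
    ((hT.contDiffAt (hW.mem_nhds hrW)).differentiableAt (by simp)).hasFDerivAt
  have hev : (fun r => (Z r).1) =ᶠ[𝓝[upper] r] T := by
    have : W ∩ upper ∈ 𝓝[upper] r := inter_mem (mem_nhdsWithin_of_mem_nhds (hW.mem_nhds hrW))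
      self_mem_nhdsWithin
    filter_upwards [this] with p hp
    exact he hp
  have h1 : HasFDerivWithinAt (fun r => (Z r).1)
      ((ContinuousLinearMap.fst ℝ ℝ (Coord n)).comp (fderivWithin ℝ Z upper r)) upper r :=
    hasFDerivAt_fst.comp_hasFDerivWithinAt r hd.hasFDerivWithinAt
  have h2 := hTd.hasFDerivWithinAt (s := upper).congr_of_eventuallyEq hev (hev.self_of_nhdsWithin hru)
  have h3 := (uniqueDiffOn_upper r hru).eq h1 h2
  rw [← h3]
  exact hpos

/-- The level curve of the extended time function may dip below the axis. It does so only where k₀⁰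
> x₀: on a convex ball on which the extension T increases in t, φ s < 0 implies x₀ = T (φ s, s) < T
(0, s) = k₀⁰(s). -/
lemma exists_local_level (hk : g.IsInitialData k) {t x x₀ : ℝ} (hr : (t, x) ∈ g.maxDomain k)
    (hx : (g.maxSolution k (t, x)).1 = x₀) :
    ∃ V ∈ 𝓝 x, ∃ φ : ℝ → ℝ, ContDiffOn ℝ ∞ φ V ∧ ∀ s ∈ V, (k s).proj.1 ≤ x₀ →
      (φ s, s) ∈ g.maxDomain k ∧ (g.maxSolution k (φ s, s)).1 = x₀ := by
  have L : g.IsLocalSolution k (g.maxDomain k) (g.maxSolution k) := isLocalSolution_max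
  have hru : (t, x) ∈ upper := L.subset_upper hr
  obtain ⟨W, hW, hrW, hWΩ, T, hT, he⟩ := exists_time_extension hk hr
  have hpos := fderiv_extension_pos hk hr hW hrW hT he
  have hcont : ContinuousAt (fun p => fderiv ℝ T p (1, 0)) (t, x) :=
    (((hT.contDiffAt (hW.mem_nhds hrW)).fderiv_right (m := 0) (by simp)).clm_apply
      contDiffAt_const).continuousAt
  obtain ⟨ε, hε, hball⟩ := Metric.eventually_nhds_iff_ball.1
    ((hcont.eventually_const_lt hpos).and (hW.mem_nhds hrW))
  set B := Metric.ball ((t, x) : ℝ × ℝ) ε with hB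
  have hBo : IsOpen B := Metric.isOpen_ball
  have hBW : B ⊆ W := fun p hp => (hball p hp).2
  have hBd : ∀ p ∈ B, 0 < fderiv ℝ T p (1, 0) := fun p hp => (hball p hp).1
  have hBT := hT.mono hBW
  have hBm : ((t, x) : ℝ × ℝ) ∈ B := Metric.mem_ball_self hε
  obtain ⟨V, hV, φ, hφ, hφV⟩ := exists_level_function hBo hBT hBd hBm
  have hTx : T (t, x) = x₀ := (he ⟨hrW, hru⟩).symm.trans hx
  have hBV : ∀ᶠ s in 𝓝 x, (t, s) ∈ B :=
    (Continuous.continuousAt (f := fun s : ℝ => (t, s)) (by fun_prop)).preimage_mem_nhds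
      (hBo.mem_nhds hBm)
  refine ⟨V ∩ {s | (t, s) ∈ B}, inter_mem hV hBV, φ, hφ.mono inter_subset_left, fun s hs hks => ?_⟩
  obtain ⟨h1, h2⟩ := hφV s hs.1
  have hφ0 : 0 ≤ φ s := by
    by_contra hneg
    push Not at hneg
    have h0B : ((0 : ℝ), s) ∈ B := by
      have h3 : dist (φ s, s) (t, x) < ε := h1
      have h4 : dist (t, s) (t, x) < ε := hs.2
      have ht0 : 0 ≤ t := hru
      rw [Prod.dist_eq, max_lt_iff, Real.dist_eq] at h3
      change dist ((0 : ℝ), s) (t, x) < ε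
      rw [Prod.dist_eq, max_lt_iff, Real.dist_eq]
      refine ⟨?_, h3.2⟩
      have := (abs_lt.1 h3.1).1
      rw [abs_lt]
      constructor <;> linarith
    have h5 := strictMonoOn_of_fderiv_pos hBo (convex_ball _ _) hBT hBd h1 h0B hneg
    have h6 : T (0, s) = (k s).proj.1 := by
      rw [← maxSolution_axis hk s]
      exact (he ⟨hBW h0B, le_refl (0 : ℝ)⟩).symm
    rw [h2, hTx, h6] at h5
    exact absurd hks (not_le.2 h5)
  have hmem : (φ s, s) ∈ W ∩ upper := ⟨hBW h1, hφ0⟩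
  exact ⟨hWΩ hmem, (he hmem).trans (h2.trans hTx)⟩

/-- The time slices pull back to graphs of smooth periodic functions. -/
theorem exists_periodic_level (hslice : ∀ τ : ℝ, g.IsCauchyHypersurface {p : ℝ × N | p.1 = τ})
    (hk : g.IsInitialData k) (x₀ : ℝ) :
    ∃ f : ℝ → ℝ, ContDiff ℝ ∞ f ∧ Function.Periodic f (2 * Real.pi) ∧
      ∀ t x : ℝ, ((t, x) ∈ g.maxDomain k ∧ (g.maxSolution k (t, x)).1 = x₀) ↔
        ((k x).proj.1 ≤ x₀ ∧ t = f x) := by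
  have L : g.IsLocalSolution k (g.maxDomain k) (g.maxSolution k) := isLocalSolution_max
  set A : Set ℝ := {x | (k x).proj.1 ≤ x₀} with hA
  have hAc : IsClosed A := isClosed_le hk.contDiff_time.continuous continuous_const
  -- Over A the admissible heights are a single point, elsewhere the whole line. These sets are
  -- convex and have local smooth selections, also at the boundary of A, so a partition of unity
  -- yields a global smooth selection F.
  set lev : ℝ → Set ℝ := fun x => {t | x ∈ A → (t, x) ∈ g.maxDomain k ∧
    (g.maxSolution k (t, x)).1 = x₀} with hlev
  have hconv : ∀ x, Convex ℝ (lev x) := by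
    intro x
    by_cases hx : x ∈ A
    · have hsub : (lev x).Subsingleton := fun s hs t ht =>
        L.time_injective hk (hs hx).1 (ht hx).1 ((hs hx).2.trans (ht hx).2.symm)
      exact hsub.convex
    · have : lev x = univ := eq_univ_of_forall fun t h => absurd h hx
      rw [this]
      exact convex_univ
  have hloc : ∀ x : ℝ, ∃ U ∈ 𝓝 x, ∃ φ : ℝ → ℝ, ContMDiffOn 𝓘(ℝ, ℝ) 𝓘(ℝ, ℝ) ∞ φ U ∧
      ∀ s ∈ U, φ s ∈ lev s := by
    intro x
    by_cases hx : x ∈ A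
    · obtain ⟨t, ht, hte⟩ := exists_time_eq hslice hk hx
      obtain ⟨V, hV, φ, hφ, hφV⟩ := exists_local_level hk ht hte
      exact ⟨V, hV, φ, contMDiffOn_iff_contDiffOn.2 hφ, fun s hs hsA => hφV s hs hsA⟩
    · exact ⟨Aᶜ, hAc.isOpen_compl.mem_nhds hx, fun _ => 0, contMDiffOn_const,
        fun s hs hsA => absurd hsA hs⟩
  obtain ⟨F, hF⟩ := exists_contMDiffMap_forall_mem_convex_of_local 𝓘(ℝ, ℝ) (n := (⊤ : ℕ∞)) hconv hloc
  obtain ⟨f, hf, hfp, hfe⟩ := exists_periodic (contMDiff_iff_contDiff.1 F.contMDiff)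
  -- Over A the level height is unique and invariant under the period, so periodizing F leaves it
  -- unchanged there.
  have hmain : ∀ x ∈ A, ∀ t, (t, x) ∈ g.maxDomain k → (g.maxSolution k (t, x)).1 = x₀ → f x = t := by
    intro x hx t ht hte
    refine hfe x t fun m => ?_
    have hc : ∀ x, k (x + -(2 * Real.pi * m)) = k x := by
      intro x
      have := (hk.periodic.int_mul (-m)) x
      rw [← this]
      congr 1
      push_cast
      ring
    have e : ((t, x - 2 * Real.pi * m) : ℝ × ℝ) = (t, x) + (0, -(2 * Real.pi * m)) := by
      ext <;> simp [sub_eq_add_neg]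
    have hA' : x - 2 * Real.pi * m ∈ A := by
      change (k (x - 2 * Real.pi * m)).proj.1 ≤ x₀
      rw [sub_eq_add_neg, hc]
      exact hx
    have h1 := hF _ hA'
    have h2 : (t, x - 2 * Real.pi * m) ∈ g.maxDomain k := by
      rw [e]; exact (mem_maxDomain_shift_iff hc).2 ht
    have h3 : g.maxSolution k (t, x - 2 * Real.pi * m) = g.maxSolution k (t, x) := by
      rw [e]
      exact congrArg Bundle.TotalSpace.proj (maxSolution_shift hc ht (1, 1))
    exact L.time_injective hk h1.1 h2 (h1.2.trans (by rw [h3, hte]))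
  refine ⟨f, hf, hfp, fun t x => ⟨fun ⟨ht, hte⟩ => ?_, fun ⟨hx, hte⟩ => ?_⟩⟩
  · have hx : x ∈ A := by
      have := (L.time_le hk ht (q := (0, x)) ⟨le_rfl, by
        have h0 : 0 ≤ t := L.subset_upper ht
        simpa using h0⟩).1
      rw [maxSolution_axis hk, hte] at this
      exact this
    exact ⟨hx, (hmain x hx t ht hte).symm⟩
  · obtain ⟨s, hs, hse⟩ := exists_time_eq hslice hk hx
    rw [hte, hmain x hx s hs hse]
    exact ⟨hs, hse⟩

end Level

end MetricFamily

end

/-! ### The main theorem -/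

theorem theorem7 {n : ℕ} {N : Type*} [TopologicalSpace N] [T2Space N] [SecondCountableTopology N]
    [ChartedSpace (Coord n) N] [IsManifold (𝓡 n) ∞ N]
    (g : MetricFamily n N) (hg : g.IsGloballyHyperbolic)
    (hslice : ∀ τ : ℝ, g.IsCauchyHypersurface {p : ℝ × N | p.1 = τ})
    (k : ℝ → TangentBundle (stModel n) (ℝ × N)) (hk : g.IsInitialData k) :
    ∃ (Ω : Set (ℝ × ℝ)) (y : ℝ × ℝ → ℝ × N),
      -- existence of a periodic solution with blow-up of the time component at the boundary
      (g.IsSolution k Ω y ∧ MetricFamily.TimeBlowsUp Ω y ∧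
        ∀ t x : ℝ, ((t, x + 2 * Real.pi) ∈ Ω ↔ (t, x) ∈ Ω) ∧
          ((t, x) ∈ Ω → y (t, x + 2 * Real.pi) = y (t, x))) ∧
      -- uniqueness
      (∀ (Ω' : Set (ℝ × ℝ)) (y' : ℝ × ℝ → ℝ × N), g.IsSolution k Ω' y' →
        MetricFamily.TimeBlowsUp Ω' y' → Ω' = Ω ∧ EqOn y' y Ω') ∧
      -- maximality: `y` has no proper extension, and `Ω` is the largest past-closed domain
      (∀ (Ω' : Set (ℝ × ℝ)) (y' : ℝ × ℝ → ℝ × N), g.IsSolution k Ω' y' →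
        Ω ⊆ Ω' → EqOn y' y Ω → Ω' = Ω) ∧
      (MetricFamily.PastClosed Ω ∧
        ∀ (Ω' : Set (ℝ × ℝ)) (y' : ℝ × ℝ → ℝ × N), g.IsSolution k Ω' y' →
          MetricFamily.PastClosed Ω' → Ω' ⊆ Ω ∧ EqOn y' y Ω') ∧
      -- time slices pull back to smooth periodic graphs
      (∀ x₀ : ℝ, ∃ f : ℝ → ℝ, ContDiff ℝ ∞ f ∧ Function.Periodic f (2 * Real.pi) ∧
        ∀ t x : ℝ, ((t, x) ∈ Ω ∧ (y (t, x)).1 = x₀) ↔ ((k x).proj.1 ≤ x₀ ∧ t = f x)) := by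
  have L : g.IsLocalSolution k (g.maxDomain k) (g.maxSolution k) :=
    MetricFamily.isLocalSolution_max
  have hax := MetricFamily.axis_mem_maxDomain g hk.smooth
  have hsol := L.isSolution hk hax
  have hblow := MetricFamily.timeBlowsUp_max hslice hk
  have hpast : ∀ (Ω' : Set (ℝ × ℝ)) (y' : ℝ × ℝ → ℝ × N), g.IsSolution k Ω' y' →
      MetricFamily.PastClosed Ω' → Ω' ⊆ g.maxDomain k ∧ EqOn y' (g.maxSolution k) Ω' := by
    intro Ω' y' h' hp
    have L' := h'.isLocalSolution subset_rfl h'.isOpen hp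
    exact ⟨L'.subset_maxDomain, L'.eqOn_maxSolution.symm⟩
  refine ⟨g.maxDomain k, g.maxSolution k, ⟨hsol, hblow, fun t x => ?_⟩, fun Ω' y' h' hb => ?_,
    fun Ω' y' h' hs he => ?_, ⟨L.past, hpast⟩, MetricFamily.exists_periodic_level hslice hk⟩
  · have e : ((t, x + 2 * Real.pi) : ℝ × ℝ) = (t, x) + (0, 2 * Real.pi) := by ext <;> simp
    rw [e]
    exact ⟨MetricFamily.mem_maxDomain_shift_iff hk.periodic, fun hr =>
      congrArg Bundle.TotalSpace.proj (MetricFamily.maxSolution_shift hk.periodic hr (1, 1))⟩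
  -- Blow-up makes Ω' past-closed, hence contained in the maximal domain; blow-up of y' then
  -- excludes that the maximal domain is larger.
  · obtain ⟨hs, he⟩ := hpast Ω' y' h' (h'.pastClosed hk hb)
    exact ⟨MetricFamily.eq_of_timeBlowsUp h'.isOpen h'.axis hb hs L.subset_upper
      hsol.connected.isPreconnected hsol.continuousOn_time he.symm, he⟩
  -- The same rigidity with the roles exchanged: here the maximal solution is the one whose time
  -- blows up.
  · exact (MetricFamily.eq_of_timeBlowsUp L.isOpen hax hblow hs h'.subset_upper
      h'.connected.isPreconnected h'.continuousOn_time he).symm
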